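/- Let $\mathcal U$ be an ultrafilter on a complete Boolean algebra $\mathcal B$; $\mathcal B_+$ denotes the set of nonzero elements, $[X]^n$ and $[X]^{<\aleph_0}$ the sets of $n$-element and of finite subsets of $X$, and $c$ *decides* $a$ if $c\le a$ or $c\le\neg a$. **Definitions.** A $\lambda$-*distribution* is a map $\mathbf A:[\lambda]^{<\aleph_0}\to\mathcal B_+$ with $\mathbf A(\emptyset)=1$ and $\mathbf A(s)\ge \mathbf A(t)$ for $s\subseteq t$. It is *in* $\mathcal U$ if all its values are in $\mathcal U$; it is *multiplicative* if $\mathbf A(s)=\bigwedge_{\alpha\in s}\mathbf A(\{\alpha\})$ for all $s$; $\mathbf B$ *refines* $\mathbf A$ if $\mathbf B(s)\le\mathbf A(s)$ for all $s$. Let $\Delta(FDP)$ be the family of finite subsets of $(\omega\setminus\{0\})\times\omega$ of the form $\{m\}\times u$ with $|u|\le m$. A $\lambda$-distribution $\mathbf A$ is a $(\lambda,\Delta(FDP))$-*distribution* if for every finite $s\subseteq\lambda$ and every $c\in\mathcal B_+$ deciding all $\mathbf A(t)$, $t\subseteq s$, there is $f:s\to(\omega\setminus\{0\})\times\omega$ with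 $c\le\mathbf A(t)\iff f[t]\in\Delta(FDP)$ for all $t\subseteq s$. Let $\lambda_{\mathcal U}(\Delta(FDP))$ be the least $\lambda$ for which some $(\lambda,\Delta(FDP))$-distribution in $\mathcal U$ has no multiplicative refinement in $\mathcal U$ (and $\infty$ if there is none). $\mathcal U$ is $\lambda$-*OK* if every $\lambda$-distribution $\mathbf A$ in $\mathcal U$ such that $\mathbf A(s)=\mathbf A(t)$ whenever $|s|=|t|$ has a multiplicative refinement in $\mathcal U$. $\mathcal U$ is $\aleph_1$-*incomplete* if some countable subset of $\mathcal U$ has its meet outside $\mathcal U$. An element of the Boolean ultrapower $(\omega,<)^{\mathcal B}$ is a function $\mathbf n:\omega\to\mathcal B$ with pairwise disjoint values and supremum $1$; $\|\mathbf n\ge k\|=\bigvee_{m\ge k}\mathbf n(m)$; $\mathbf n$ is $\mathcal U$-*nonstandard* if $\mathbf n(k)\notin\mathcal U$ for all $k<\omega$. $\mathcal U$ is $\lambda$-*flexible* if it is $\aleph_1$-incomplete and for every $\mathcal U$-nonstandard $\mathbf n$ there is a multiplicative $\lambda$-distribution $\mathbf B$ in $\mathcal U$ with $\mathbf B(s)\le\|\mathbf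 n\ge |s|\|$ for all $s$. A family $(\mathbf a_\alpha:\alpha<\lambda)$ from $\mathcal B$ is $\lambda$-*regular* if its finite meets are nonzero, its infinite meets are $0$, and the set of $c\in\mathcal B_+$ deciding every $\mathbf a_\alpha$ is dense in $\mathcal B_+$; $\mathcal U$ is $\lambda$-*regular* if it contains such a family. For a countable language $\mathcal L$, a $\mathcal B$-*valued structure* is a set $\mathbf M$ with a map $\varphi\mapsto\|\varphi\|\in\mathcal B$ on $\mathcal L$-formulas with parameters in $\mathbf M$ such that valid formulas have value $1$, $\|\neg\varphi\|=\neg\|\varphi\|$, $\|\varphi\wedge\psi\|=\|\varphi\|\wedge\|\psi\|$, $\|\exists x\varphi(x)\|=\bigvee_{a\in\mathbf M}\|\varphi(a)\|$, and $\|a=b\|<1$ for $a\ne b$. It is *full* if these suprema are attained; elementary embeddings are the maps preserving $\|\cdot\|$. It is $\lambda^+$-*saturated* if whenever $\mathbf M_0\preceq\mathbf M$, $\mathbf M_0\preceq\mathbf M_1$ and $|\mathbf M_0|,|\mathbf M_1|\le\lambda$, the inclusion of $\mathbf M_0$ extends to an elementary embedding $\mathbf M_1\to\mathbf M$. The specialization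 $\mathbf M/\mathcal U$ of a full $\mathbf M$ is the $\mathcal L$-structure on $\mathbf M/\{(a,b):\|a=b\|\in\mathcal U\}$ in which $\varphi([\bar a])$ holds iff $\|\varphi(\bar a)\|\in\mathcal U$. $\mathcal U$ $\lambda^+$-*saturates* a theory $T$ if there is a full $\lambda^+$-saturated $\mathcal B$-valued model $\mathbf M$ of $T$ (all sentences of $T$ have value $1$) such that $\mathbf M/\mathcal U$ is $\lambda^+$-saturated in the usual sense. $T_{rg}$ is the theory of the random graph. $T_{nlow}$ is the model completion of the following theory in the language with unary relations $P,Q,U_n,P_n,Q_n^0,Q_n^1$, binary relations $R,E$ and $n$-ary functions $F_n$ ($1\le n<\omega$): the universe is the disjoint union of the infinite sets $P$ and $Q$; $E$ is an equivalence relation; $R\subseteq P\times Q$ and $R\subseteq E$; the $U_n$ are pairwise distinct $E$-classes; $P_n=U_n\cap P$; $U_n\cap Q$ is the disjoint union of $Q_n^0$ and $Q_n^1$; $a\mapsto u_a:=\{b\in Q_n^0:R(a,b)\}$ is a bijection from $P_n$ onto $[Q_n^0]^n$; if $b_0,\dots,b_{n-1}$ are distinct elements of $Q_n^0$ then $F_n(b_0,\dots,b_{n-1})$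 is the $a\in P_n$ with $u_a=\{b_0,\dots,b_{n-1}\}$, and otherwise $F_n(b_0,\dots,b_{n-1})=b_0$. **Theorem.** 1. $\lambda_{\mathcal U}(\Delta(FDP))$ is the least $\lambda$ such that $\mathcal U$ is not $\lambda$-OK ($\infty$ if there is none). 2. If $\mathcal U$ is $\aleph_1$-incomplete, then $\lambda_{\mathcal U}(\Delta(FDP))$ is also the least $\lambda$ such that $\mathcal U$ is not $\lambda$-flexible. 3. Let $\mathbf n\in(\omega,<)^{\mathcal B}$ be $\mathcal U$-nonstandard and let $\mathbf B$ be a multiplicative $\lambda$-distribution in $\mathcal U$. Then the following are equivalent: (A) $\mathbf B(s)\le\|\mathbf n\ge |s|\|$ for every $s\in[\lambda]^{<\aleph_0}$; (B) $(\mathbf B(\{\alpha\}):\alpha<\lambda)$ is $\lambda$-regular, and for every $c\in\mathcal B_+$ deciding every $\mathbf B(s)$ (equivalently: in (B) one may only ask that $c$ decide every $\mathbf B(\{\alpha\})$), if $k=|\{\alpha<\lambda:c\le\mathbf B(\{\alpha\})\}|$, then $c\le\|\mathbf n\ge k\|$. In particular, if $\mathcal U$ is $\lambda$-flexible then $\mathcal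 U$ is $\lambda$-regular. 4. For every infinite cardinal $\lambda$: $\mathcal U$ $\lambda^+$-saturates $T_{nlow}$ if and only if $\mathcal U$ $\lambda^+$-saturates $T_{rg}$ and $\mathcal U$ is $\lambda$-OK. -/

import Mathlib

open FirstOrder

universe u

/-! ### Ultrafilters and distributions on complete Boolean algebras -/

section Distributions

variable {B : Type u} [CompleteBooleanAlgebra B]

/-- A filter on a Boolean algebra is an ultrafilter if it is proper and contains `b` or its
complement for every `b`. -/
def IsUltrafilterOn (U : Order.PFilter B) : Prop :=
  ⊥ ∉ U ∧ ∀ b : B, b ∈ U ∨ bᶜ ∈ U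

/-- Some countable family of members of `U` has its meet outside of `U`. -/
def IsAleph1Incomplete (U : Order.PFilter B) : Prop :=
  ∃ c : ℕ → B, (∀ n, c n ∈ U) ∧ (⨅ n, c n) ∉ U

/-- `c` decides `a` if `c` lies below `a` or below its complement. -/
def BADecides (c a : B) : Prop := c ≤ a ∨ c ≤ aᶜ

variable (B) in
/-- A `J`-distribution in `B`: a decreasing map from the finite subsets of `J` to the nonzero
elements of `B`, sending the empty set to `⊤`. -/
structure BADistribution (J : Type u) where
  toFun : Finset J → B
  ne_bot' : ∀ s, toFun s ≠ ⊥
  map_empty' : toFun ∅ = ⊤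
  anti' : ∀ s t, s ⊆ t → toFun t ≤ toFun s

namespace BADistribution

variable {J : Type u}

instance : CoeFun (BADistribution B J) (fun _ => Finset J → B) := ⟨BADistribution.toFun⟩

/-- All the values of the distribution belong to `U`. -/
def IsIn (A : BADistribution B J) (U : Order.PFilter B) : Prop := ∀ s, A s ∈ U

/-- `A'.Refines A`: the distribution `A'` refines `A`. -/
def Refines (A' A : BADistribution B J) : Prop := ∀ s, A' s ≤ A s

def IsMultiplicative (A : BADistribution B J) : Prop := ∀ s, A s = ⨅ i ∈ s, A {i}

/-- `A`, a distribution in `U`, has a multiplicative refinement in `U`. -/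
def HasMultRefinement (A : BADistribution B J) (U : Order.PFilter B) : Prop :=
  ∃ A' : BADistribution B J, A'.IsIn U ∧ A'.IsMultiplicative ∧ A'.Refines A

end BADistribution

/-- A pattern on `I`: a family of finite subsets of `I` closed under subsets. -/
structure Pattern (I : Type*) where
  sets : Set (Finset I)
  down : ∀ s t, s ⊆ t → t ∈ sets → s ∈ sets

/-- The pattern `Δ(FDP)` on `(ω ∖ {0}) × ω`: the sets `{m} × u` with `u` a set of at most `m`
natural numbers. -/
def patternFDP : Pattern (ℕ+ × ℕ) where
  sets := {s | ∃ (m : ℕ+) (u : Finset ℕ), u.card ≤ m ∧ s = {m} ×ˢ u}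
  down := by
    rintro s t hst ⟨m, u, hu, rfl⟩
    refine ⟨m, s.image Prod.snd, ?_, ?_⟩
    · refine le_trans (Finset.card_le_card ?_) hu
      intro n hn
      obtain ⟨p, hp, rfl⟩ := Finset.mem_image.1 hn
      exact (Finset.mem_product.1 (hst hp)).2
    · ext ⟨a, n⟩
      simp only [Finset.mem_product, Finset.mem_singleton, Finset.mem_image, Prod.exists,
        exists_eq_right]
      constructor
      · intro h
        exact ⟨Finset.mem_singleton.1 (Finset.mem_product.1 (hst h)).1, a, h⟩
      · rintro ⟨rfl, b, hb⟩
        have hb' : b = a := Finset.mem_singleton.1 (Finset.mem_product.1 (hst hb)).1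
        exact hb' ▸ hb

open Classical in
/-- `A` is a `(J, Δ)`-distribution: for all finite `s ⊆ J` and nonzero `c` deciding `A t` for every
`t ⊆ s` there is `f : s → I` such that `c ≤ A t ↔ f[t] ∈ Δ` for all `t ⊆ s`.
(Subsets of `s` are given as `t : Finset s`.) -/
def IsPatternDistribution {I : Type*} {J : Type u} (Δ : Pattern I) (A : BADistribution B J) :
    Prop :=
  ∀ (s : Finset J) (c : B), c ≠ ⊥ →
    (∀ t : Finset s, BADecides c (A (t.map (Function.Embedding.subtype _)))) →
    ∃ f : s → I, ∀ t : Finset s,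
      c ≤ A (t.map (Function.Embedding.subtype _)) ↔ t.image f ∈ Δ.sets

/-- The least cardinal with property `p`, which is `⊤` (playing the role of `∞`) if there is
none. -/
noncomputable def leastCardinal (p : Cardinal.{u} → Prop) : WithTop Cardinal.{u} :=
  sInf ((fun κ : Cardinal.{u} => (κ : WithTop Cardinal.{u})) '' {κ | p κ})

/-- `λ_U(Δ)`: the least `κ` such that some `(κ, Δ)`-distribution in `U` has no multiplicative
refinement in `U`. (The type `κ.out` is an index set of cardinality `κ`.) -/
noncomputable def patternInvariant {I : Type*} (U : Order.PFilter B) (Δ : Pattern I) :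
    WithTop Cardinal.{u} :=
  leastCardinal fun κ => ∃ A : BADistribution B κ.out,
    IsPatternDistribution Δ A ∧ A.IsIn U ∧ ¬ A.HasMultRefinement U

/-- `U` is `κ`-OK. -/
def IsOK (U : Order.PFilter B) (κ : Cardinal.{u}) : Prop :=
  ∀ A : BADistribution B κ.out, A.IsIn U → (∀ s t, s.card = t.card → A s = A t) →
    A.HasMultRefinement U

variable (B) in
/-- An element of the Boolean ultrapower `X^B`: a partition of `B` indexed by `X`; its value at `x`
is the Boolean value of "the element equals `x`". -/
structure BooleanUltrapower (X : Type*) where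
  toFun : X → B
  disjoint' : ∀ x y, x ≠ y → toFun x ⊓ toFun y = ⊥
  iSup' : (⨆ x, toFun x) = ⊤

namespace BooleanUltrapower

/-- The Boolean value of `n ≥ k`, for `n` in the Boolean ultrapower of `(ω, <)` and `k < ω`. -/
def geValue (n : BooleanUltrapower B ℕ) (k : ℕ) : B := ⨆ m, ⨆ (_ : k ≤ m), n.toFun m

/-- The class of `n` in the quotient of the Boolean ultrapower of `(ω, <)` by `U` is different
from every standard natural number. -/
def IsNonstandard (n : BooleanUltrapower B ℕ) (U : Order.PFilter B) : Prop :=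
  ∀ k, n.toFun k ∉ U

end BooleanUltrapower

/-- `U` is `κ`-flexible. -/
def IsFlexible (U : Order.PFilter B) (κ : Cardinal.{u}) : Prop :=
  IsAleph1Incomplete U ∧ ∀ n : BooleanUltrapower B ℕ, n.IsNonstandard U →
    ∃ A : BADistribution B κ.out, A.IsIn U ∧ A.IsMultiplicative ∧
      ∀ s, A s ≤ n.geValue s.card

/-- A regular family: finite meets are nonzero, infinite meets are zero, and the nonzero elements
deciding every member of the family are dense. -/
def IsRegularFamily {J : Type u} (a : J → B) : Prop :=
  (∀ s : Finset J, (⨅ i ∈ s, a i) ≠ ⊥) ∧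
  (∀ Z : Set J, Z.Infinite → (⨅ i ∈ Z, a i) = ⊥) ∧
  (∀ b : B, b ≠ ⊥ → ∃ c : B, c ≠ ⊥ ∧ c ≤ b ∧ ∀ i, BADecides c (a i))

/-- `U` contains a `κ`-regular family. -/
def IsRegularFilter (U : Order.PFilter B) (κ : Cardinal.{u}) : Prop :=
  ∃ a : κ.out → B, (∀ i, a i ∈ U) ∧ IsRegularFamily a

end Distributions

/-! ### Boolean-valued structures -/

namespace FirstOrder.Language

/-- The substitution instance `φ(a)` of a formula `φ(x)` with parameters in `M`. -/
def BoundedFormula.instAt {L : FirstOrder.Language.{0, 0}} {M : Type u} (φ : L.BoundedFormula M 1) (a : M) :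
    L.Formula M :=
  Formula.relabel (Sum.elim id fun _ => a) φ.toFormula

/-- The formula `a = b` with parameters `a, b`. -/
def paramEq (L : FirstOrder.Language.{0, 0}) {M : Type u} (a b : M) : L.Formula M :=
  Term.equal (Term.var a) (Term.var b)

end FirstOrder.Language

open FirstOrder.Language

/-- A `B`-valued `L`-structure with domain `M`. Formulas with parameters from `M` are formulas whose
free variables are labelled by elements of `M`. -/
structure BVStructure (L : FirstOrder.Language.{0, 0}) (B : Type u) [CompleteBooleanAlgebra B]
    (M : Type u) where
  val : L.Formula M → B
  val_valid : ∀ φ : L.Formula M, (∅ : L.Theory) ⊨ᵇ φ → val φ = ⊤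
  val_not : ∀ φ : L.Formula M, val φ.not = (val φ)ᶜ
  val_inf : ∀ φ ψ : L.Formula M, val (φ ⊓ ψ) = val φ ⊓ val ψ
  val_ex : ∀ φ : L.BoundedFormula M 1, val φ.ex = ⨆ a, val (φ.instAt a)
  val_eq : ∀ a b : M, a ≠ b → val (L.paramEq a b) ≠ ⊤

namespace BVStructure

variable {L : FirstOrder.Language.{0, 0}} {B : Type u} [CompleteBooleanAlgebra B] {M N : Type u}

/-- The suprema computing the values of existential formulas are attained. -/
def IsFull (S : BVStructure L B M) : Prop :=
  ∀ φ : L.BoundedFormula M 1, ∃ a, S.val φ.ex = S.val (φ.instAt a)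

/-- Every sentence of `T` has value `⊤`. -/
def IsModelOf (S : BVStructure L B M) (T : L.Theory) : Prop :=
  ∀ σ ∈ T, S.val (Formula.relabel Empty.elim σ) = ⊤

/-- Elementary embeddings (automatically injective) of `B`-valued structures. -/
def IsElementary (S : BVStructure L B M) (S' : BVStructure L B N) (f : M → N) : Prop :=
  ∀ φ : L.Formula M, S'.val (φ.relabel f) = S.val φ

/-- `κ⁺`-saturation of a `B`-valued structure: if `M₀` is an elementary substructure of it,
`M₁` is an elementary extension of `M₀`, and both have cardinality at most `κ`, then the inclusion
of `M₀` extends to an elementary embedding of `M₁`. -/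
def IsSuccSaturated (S : BVStructure L B M) (κ : Cardinal.{u}) : Prop :=
  ∀ (M₀ M₁ : Type u) (S₀ : BVStructure L B M₀) (S₁ : BVStructure L B M₁),
    Cardinal.mk M₀ ≤ κ → Cardinal.mk M₁ ≤ κ →
    ∀ (f : M₀ → M) (g : M₀ → M₁), IsElementary S₀ S f → IsElementary S₀ S₁ g →
      ∃ h : M₁ → M, IsElementary S₁ S h ∧ h ∘ g = f

theorem val_mono (S : BVStructure L B M) {φ ψ : L.Formula M}
    (h : (∅ : L.Theory) ⊨ᵇ φ.imp ψ) : S.val φ ≤ S.val ψ := by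
  have h1 : S.val (φ ⊓ ψ.not).not = ⊤ := by
    apply S.val_valid
    intro N v xs
    have := h N v xs
    simp only [BoundedFormula.realize_imp] at this
    simp only [BoundedFormula.realize_not, BoundedFormula.realize_inf, not_and, not_not]
    exact this
  rw [S.val_not, S.val_inf, S.val_not, compl_eq_top] at h1
  simpa using (disjoint_iff.2 h1).le_compl_right

theorem val_eq_trans (S : BVStructure L B M) (a b c : M) :
    S.val (L.paramEq a b) ⊓ S.val (L.paramEq b c) ≤ S.val (L.paramEq a c) := by
  rw [← S.val_inf]
  apply S.val_mono
  intro N v xs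
  simp only [BoundedFormula.realize_imp, BoundedFormula.realize_inf, paramEq, Term.equal,
    BoundedFormula.realize_bdEqual, Term.realize_relabel, Term.realize_var]
  rintro ⟨h1, h2⟩
  exact h1.trans h2

/-- The relation `‖a = b‖ ∈ U`. -/
def setoid (S : BVStructure L B M) (U : Order.PFilter B) : Setoid M where
  r a b := S.val (L.paramEq a b) ∈ U
  iseqv := {
    refl := fun a => by
      have : S.val (L.paramEq a a) = ⊤ := S.val_valid _ fun N v xs => by
        simp [paramEq, Term.equal]
      rw [this]
      exact U.top_mem
    symm := fun {a b} h => by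
      refine U.mem_of_le (S.val_mono ?_) h
      intro N v xs
      simp only [BoundedFormula.realize_imp, paramEq, Term.equal,
        BoundedFormula.realize_bdEqual, Term.realize_relabel, Term.realize_var]
      exact fun h => h.symm
    trans := fun {a b c} h1 h2 =>
      U.mem_of_le (S.val_eq_trans a b c) (Order.PFilter.inf_mem h1 h2) }

/-- The domain of the specialization `M/U`. -/
def Specialization (S : BVStructure L B M) (U : Order.PFilter B) : Type u :=
  Quotient (S.setoid U)

/-- The atomic formula `F(x₁, …, xₙ) = b` with parameters. -/
def funEq {n : ℕ} (F : L.Functions n) (x : Fin n → M) (b : M) : L.Formula M :=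
  Term.equal (Term.func F fun i => Term.var (x i)) (Term.var b)

/-- The atomic formula `R(x₁, …, xₙ)` with parameters. -/
def relAt {n : ℕ} (R : L.Relations n) (x : Fin n → M) : L.Formula M :=
  R.formula fun i => Term.var (x i)

theorem exists_funEq (S : BVStructure L B M) (hS : S.IsFull) {n : ℕ} (F : L.Functions n)
    (x : Fin n → M) : ∃ b, S.val (funEq F x b) = ⊤ := by
  let φ : L.BoundedFormula M 1 :=
    BoundedFormula.equal (Term.func F fun i => Term.var (Sum.inl (x i))) (Term.var (Sum.inr 0))
  obtain ⟨b, hb⟩ := hS φ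
  refine ⟨b, ?_⟩
  have h1 : S.val φ.ex = ⊤ := by
    apply S.val_valid
    intro N v xs
    rw [BoundedFormula.realize_ex]
    refine ⟨Structure.funMap F fun i => v (x i), ?_⟩
    simp only [φ, BoundedFormula.Realize, Term.realize_func, Term.realize_var, Sum.elim_inl,
      Sum.elim_inr]
    rfl
  have h2 : S.val (φ.instAt b) ≤ S.val (funEq F x b) := by
    apply S.val_mono
    intro N v xs
    rw [BoundedFormula.realize_imp]
    intro h
    have h' : (φ.instAt b).Realize v := by
      rw [Formula.Realize, Subsingleton.elim (default : Fin 0 → N) xs]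
      exact h
    rw [BoundedFormula.instAt, Formula.realize_relabel, BoundedFormula.realize_toFormula] at h'
    simp only [φ, BoundedFormula.Realize, Term.realize_func, Term.realize_var, Sum.elim_inl,
      Sum.elim_inr, Function.comp] at h'
    simpa [funEq, Term.equal] using h'
  rw [← hb, h1] at h2
  exact top_le_iff.1 h2

/-- The `L`-structure on the specialization `M/U` of a full `B`-valued structure: `R([a])` holds if
`‖R(a)‖ ∈ U`, and `F([a]) = [b]` for some `b` with `‖F(a) = b‖ = ⊤` (the class of `b` does not
depend on any choice). -/
@[reducible] noncomputable def specStructure (S : BVStructure L B M) (hS : S.IsFull) (U : Order.PFilter B) :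
    L.Structure (S.Specialization U) where
  funMap F x := Quotient.mk (S.setoid U)
    (Classical.choose (S.exists_funEq hS F fun i => Quotient.out (x i)))
  RelMap R x := S.val (relAt R fun i => Quotient.out (x i)) ∈ U

end BVStructure

/-- `μ`-saturation of an ordinary structure `N`: every finitely satisfiable set of formulas in
one variable with parameters from a set of cardinality less than `μ` is realized. -/
def IsCardSaturated (L : FirstOrder.Language.{0, 0}) (N : Type u) [L.Structure N] (μ : Cardinal.{u}) : Prop :=
  ∀ A : Set N, Cardinal.mk A < μ → ∀ p : Set (L.BoundedFormula A 1),
    (∀ s : Finset (L.BoundedFormula A 1), (s : Set (L.BoundedFormula A 1)) ⊆ p →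
      ∃ b : N, ∀ φ ∈ s, φ.Realize (fun a => (a : N)) fun _ => b) →
    ∃ b : N, ∀ φ ∈ p, φ.Realize (fun a => (a : N)) fun _ => b

/-- `U` `κ⁺`-saturates `T`: there is a `κ⁺`-saturated full `B`-valued model of `T` whose
specialization at `U` is `κ⁺`-saturated. -/
def SuccSaturates {L : FirstOrder.Language.{0, 0}} {B : Type u} [CompleteBooleanAlgebra B]
    (U : Order.PFilter B) (κ : Cardinal.{u}) (T : L.Theory) : Prop :=
  ∃ (M : Type u) (S : BVStructure L B M) (hS : S.IsFull), S.IsModelOf T ∧ S.IsSuccSaturated κ ∧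
    @IsCardSaturated L (S.Specialization U) (S.specStructure hS U) (Order.succ κ)

/-! ### The theory of the random graph -/

/-- The extension property characterizing the random graph. -/
def SimpleGraph.HasExtensionProperty {V : Type} (G : SimpleGraph V) : Prop :=
  ∀ X Y : Finset V, Disjoint X Y →
    ∃ z, z ∉ X ∧ z ∉ Y ∧ (∀ a ∈ X, G.Adj z a) ∧ ∀ b ∈ Y, ¬ G.Adj z b

/-- `T_rg`: the sentences true in all graphs with the extension property. -/
def randomGraphTheory : FirstOrder.Language.graph.Theory :=
  {σ | ∀ (V : Type) (G : SimpleGraph V), G.HasExtensionProperty →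
    @Sentence.Realize FirstOrder.Language.graph V G.structure σ}

/-! ### The theory `T_nlow` -/

/-- The function symbols of the language of `T_nlow`. -/
inductive NlowFun : ℕ → Type
  | F (n : ℕ+) : NlowFun n

/-- The relation symbols of the language of `T_nlow`; `Qn n false` and `Qn n true` are the symbols
`Q_n^0` and `Q_n^1`. -/
inductive NlowRel : ℕ → Type
  | P : NlowRel 1
  | Q : NlowRel 1
  | U (n : ℕ+) : NlowRel 1
  | Pn (n : ℕ+) : NlowRel 1
  | Qn (n : ℕ+) (i : Bool) : NlowRel 1
  | R : NlowRel 2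
  | E : NlowRel 2

/-- The language of `T_nlow`. -/
def nlowLanguage : FirstOrder.Language.{0, 0} := ⟨NlowFun, NlowRel⟩

namespace Nlow

variable {M : Type} [nlowLanguage.Structure M]

def P (x : M) : Prop := Structure.RelMap (L := nlowLanguage) NlowRel.P ![x]
def Q (x : M) : Prop := Structure.RelMap (L := nlowLanguage) NlowRel.Q ![x]
def U (n : ℕ+) (x : M) : Prop := Structure.RelMap (L := nlowLanguage) (NlowRel.U n) ![x]
def Pn (n : ℕ+) (x : M) : Prop := Structure.RelMap (L := nlowLanguage) (NlowRel.Pn n) ![x]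
def Qn (n : ℕ+) (i : Bool) (x : M) : Prop :=
  Structure.RelMap (L := nlowLanguage) (NlowRel.Qn n i) ![x]
def R (x y : M) : Prop := Structure.RelMap (L := nlowLanguage) NlowRel.R ![x, y]
def E (x y : M) : Prop := Structure.RelMap (L := nlowLanguage) NlowRel.E ![x, y]
def F (n : ℕ+) (b : Fin n → M) : M := Structure.funMap (L := nlowLanguage) (NlowFun.F n) b

/-- The set `u_a` (at level `n`). -/
def nbrs (n : ℕ+) (a : M) : Set M := {b | Qn n false b ∧ R a b}

/-- The axioms whose model completion is `T_nlow`; each clause is a first-order axiom or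
axiom scheme. -/
structure IsBaseModel (M : Type) [nlowLanguage.Structure M] : Prop where
  P_or_Q : ∀ x : M, Xor (P x) (Q x)
  infinite_P : {x : M | P x}.Infinite
  infinite_Q : {x : M | Q x}.Infinite
  equivalence_E : Equivalence (E : M → M → Prop)
  R_sub : ∀ a b : M, R a b → P a ∧ Q b ∧ E a b
  U_class : ∀ n, ∃ c : M, ∀ x : M, U n x ↔ E c x
  U_distinct : ∀ m n, m ≠ n → ∀ x : M, ¬ (U m x ∧ U n x)
  Pn_iff : ∀ n (x : M), Pn n x ↔ U n x ∧ P x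
  Qn_iff : ∀ n (x : M), (U n x ∧ Q x) ↔ (Qn n false x ∨ Qn n true x)
  Qn_disjoint : ∀ n (x : M), ¬ (Qn n false x ∧ Qn n true x)
  /-- Every `u_a` has exactly `n` elements and `a ↦ u_a` is a bijection from `P_n` onto the
  `n`-element subsets of `Q_n^0`. -/
  nbrs_bij : ∀ n, Set.BijOn (nbrs n) {a : M | Pn n a}
    {s : Set M | s.encard = ((n : ℕ) : ℕ∞) ∧ ∀ b ∈ s, Qn n false b}
  F_good : ∀ (n : ℕ+) (b : Fin n → M), Function.Injective b → (∀ i, Qn n false (b i)) →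
    Pn n (F n b) ∧ nbrs n (F n b) = Set.range b
  F_bad : ∀ (n : ℕ+) (b : Fin n → M), ¬ (Function.Injective b ∧ ∀ i, Qn n false (b i)) →
    F n b = b ⟨0, n.pos⟩

end Nlow

/-- `M` is an existentially closed member of the class `K` of `L`-structures. -/
def IsExistentiallyClosedIn (L : FirstOrder.Language.{0, 0}) (K : ∀ (M : Type) [L.Structure M], Prop)
    (M : Type) [L.Structure M] : Prop :=
  K M ∧ ∀ (N : Type) [L.Structure N], K N → ∀ f : M ↪[L] N,
    ∀ (n : ℕ) (φ : L.BoundedFormula M n), φ.IsQF →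
      (∃ y : Fin n → N, φ.Realize (fun a => f a) y) → ∃ x : Fin n → M, φ.Realize id x

/-- The theory of the existentially closed members of an elementary class `K`. When the theory of
`K` has a model completion, this is it (up to logical equivalence). -/
def modelCompletionOf (L : FirstOrder.Language.{0, 0}) (K : ∀ (M : Type) [L.Structure M], Prop) : L.Theory :=
  {σ | ∀ (M : Type) [L.Structure M], IsExistentiallyClosedIn L K M → M ⊨ σ}

/-- `T_nlow`. -/
def nlowTheory : nlowLanguage.Theory :=
  modelCompletionOf nlowLanguage fun M _ => Nlow.IsBaseModel M

/-! ### Ultrafilters on Boolean algebras -/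

section UltrafilterBasics

variable {B : Type u} [CompleteBooleanAlgebra B] {U : Order.PFilter B}

namespace IsUltrafilterOn

/-! Below an element deciding enough values, a `(λ, Δ(FDP))`-distribution is the preimage of the
pattern under a map `f`: a finite set of indices is accepted iff `f` has a constant first coordinate
`m` on it and takes at most `m` values there.

OK implies refinement. Fix an index `i₀` and keep only the part where `A {i₀, i}` holds; there `f i`
has the same first coordinate `m` as `f i₀`. The decreasing sequence `A.level i₀ k` says that every
coherent set of at most `k` indices is accepted. If all levels lie in `U`, an OK refinement of this
sequence, met with the `A {i₀, i}`, refines `A`. Otherwise, at the first level outside `U`, one has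
`m = k - 1` below an element of `U`, and there are `k` coherent indices with distinct values. A
maximal finite `t` extending to such a `k`-set modulo `U` behaves like an independent set in a
matroid: by exchange, below suitable elements of `U` every index has its value in `f[t]`, a set of
at most `m` values (`exists_refinement_of_level_notMem`). Conversely, a distribution depending only
on cardinality is an FDP-distribution once its value at singletons is `⊤`
(`isPatternDistribution_ofCard`).

Flexibility concerns the sequences `‖n ≥ k‖`. These are decreasing in `U`, and by
`ℵ₁`-incompleteness every decreasing sequence in `U` dominates one of them. For the regularity
statement, at most `m` members of the family can hold together below `n = m`, which gives both the
vanishing of infinite meets and a dense set of deciding elements.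

Saturation of both theories is compared with `SeparatesColourings`. Full saturated Boolean-valued
models exist (`exists_full_isSuccSaturated`), and in them a small type is realized with prescribed
lower bounds `d k` for its formulas as soon as, for every ultrafilter `W`, finitely many formulas
with `d k ∈ W` are satisfiable in `M/W` (`exists_realization`). The problem is thus to find `d k ∈
U` excluding the conflicts which occur only at other ultrafilters. For the random graph the only
conflict is that a positive and a negative parameter become equal, and `SeparatesColourings`
excludes exactly this. For `T_nlow` there is one more: a point of `P` in a class outside all `U_n`
is wanted with many neighbours, but at `W` the class may be `U_n`, where a point of `P` has only `n`
neighbours in `Q_n^0`. OK bounds the number of requested neighbours by the level. Conversely, given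
a decreasing sequence in `U`, one takes distinct elements `b i` of one class which is `U_n`, with `b
i ∈ Q_n^0`, where the sequence drops just after `n`; a common neighbour `x` in the specialization
gives the family `‖R(x, b i)‖` required by OK.

Saturation itself is proved by back and forth: specializations are random graphs for sets of size
`κ`, respectively rich in the sense of `IsRich`, and partial isomorphisms between two such
structures extend. Richness is derived from its finite form `IsFinRich`, which models of `T_nlow`
inherit from explicit one-point extensions of base models. -/

theorem compl_mem_iff (hU : IsUltrafilterOn U) {b : B} : bᶜ ∈ U ↔ b ∉ U := by
  constructor
  · intro h1 h2
    exact hU.1 (by simpa using Order.PFilter.inf_mem h2 h1)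
  · intro h
    exact (hU.2 b).resolve_left h

theorem ne_bot (hU : IsUltrafilterOn U) {b : B} (hb : b ∈ U) : b ≠ ⊥ := by
  rintro rfl
  exact hU.1 hb

theorem sup_mem_iff (hU : IsUltrafilterOn U) {a b : B} : a ⊔ b ∈ U ↔ a ∈ U ∨ b ∈ U := by
  rw [← not_iff_not, ← hU.compl_mem_iff, compl_sup, Order.PFilter.inf_mem_iff, hU.compl_mem_iff,
    hU.compl_mem_iff, not_or]

end IsUltrafilterOn

theorem Order.PFilter.finset_iInf_mem {J : Type*} {a : J → B} {s : Finset J}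
    (h : ∀ i ∈ s, a i ∈ U) : (⨅ i ∈ s, a i) ∈ U := by
  classical
  induction s using Finset.induction_on with
  | empty => simp
  | insert i s hi ih =>
    rw [Finset.iInf_insert]
    exact Order.PFilter.inf_mem (h i (by simp)) (ih fun j hj => h j (by simp [hj]))

theorem Order.PFilter.finset_iInf_mem_iff {J : Type*} {a : J → B} {s : Finset J} :
    (⨅ i ∈ s, a i) ∈ U ↔ ∀ i ∈ s, a i ∈ U :=
  ⟨fun h i hi => Order.PFilter.mem_of_le (iInf₂_le i hi) h, Order.PFilter.finset_iInf_mem⟩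

/-- Every nonzero element belongs to an ultrafilter. -/
theorem exists_isUltrafilterOn_mem {c : B} (hc : c ≠ ⊥) :
    ∃ W : Order.PFilter B, IsUltrafilterOn W ∧ c ∈ W := by
  obtain ⟨I, hI, -, hdisj⟩ := DistribLattice.prime_ideal_of_disjoint_filter_ideal
    (F := Order.PFilter.principal c) (I := Order.Ideal.principal (⊥ : B)) (by
      rw [Set.disjoint_left]
      intro x hx hx'
      have h1 : c ≤ x := hx
      have h2 : x ≤ ⊥ := hx'
      exact hc (le_bot_iff.1 (h1.trans h2)))
  have hmem : ∀ x : B, x ∈ hI.compl_filter.toPFilter ↔ x ∉ I := fun x => Iff.rfl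
  refine ⟨hI.compl_filter.toPFilter, ⟨?_, ?_⟩, ?_⟩
  · rw [hmem, not_not]
    exact I.bot_mem
  · intro b
    rw [hmem, hmem]
    by_contra! h
    refine hI.toIsProper.ne_univ ?_
    ext x
    simp only [SetLike.mem_coe, Set.mem_univ, iff_true]
    exact I.lower (by simp) (Order.Ideal.sup_mem h.1 h.2 : b ⊔ bᶜ ∈ I)
  · rw [hmem]
    intro h
    exact Set.disjoint_left.1 hdisj (show c ∈ _ from le_refl c) h

/-- The elements are treated one at a time: either the meet with `a i` is nonzero and replaces the
current element, or the current element already lies below the complement. -/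
theorem exists_le_decides (c : B) (hc : c ≠ ⊥) {J : Type*} (s : Finset J) (a : J → B) :
    ∃ c' ≤ c, c' ≠ ⊥ ∧ ∀ i ∈ s, BADecides c' (a i) := by
  classical
  induction s using Finset.induction_on with
  | empty => exact ⟨c, le_rfl, hc, by simp⟩
  | insert i s hi ih =>
    obtain ⟨c', hle, hne, hdec⟩ := ih
    by_cases h : c' ⊓ a i = ⊥
    · refine ⟨c', hle, hne, fun j hj => ?_⟩
      rcases Finset.mem_insert.1 hj with rfl | hj
      · exact Or.inr (disjoint_iff.2 h).le_compl_right
      · exact hdec j hj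
    · refine ⟨c' ⊓ a i, inf_le_left.trans hle, h, fun j hj => ?_⟩
      rcases Finset.mem_insert.1 hj with rfl | hj
      · exact Or.inl inf_le_right
      · exact (hdec j hj).imp inf_le_left.trans inf_le_left.trans

namespace BADistribution

variable {J : Type u}

/-- The multiplicative distribution generated by a family of members of `U`. -/
noncomputable def ofFamily (hU : IsUltrafilterOn U) (d : J → B) (hd : ∀ i, d i ∈ U) :
    BADistribution B J where
  toFun s := ⨅ i ∈ s, d i
  ne_bot' s := hU.ne_bot (Order.PFilter.finset_iInf_mem fun i _ => hd i)
  map_empty' := by simp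
  anti' s t h := biInf_mono h

/-- A multiplicative distribution is the same as its values at singletons. The empty set imposes no
condition because `A ∅ = ⊤`. -/
theorem hasMultRefinement_iff (hU : IsUltrafilterOn U) {A : BADistribution B J} :
    A.HasMultRefinement U ↔
      ∃ d : J → B, (∀ i, d i ∈ U) ∧ ∀ s : Finset J, s.Nonempty → (⨅ i ∈ s, d i) ≤ A s := by
  constructor
  · rintro ⟨A', h1, h2, h3⟩
    exact ⟨fun i => A' {i}, fun i => h1 _, fun s _ => (h2 s).symm.trans_le (h3 s)⟩
  · rintro ⟨d, hd, h⟩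
    refine ⟨ofFamily hU d hd, fun s => Order.PFilter.finset_iInf_mem fun i _ => hd i,
      fun s => by simp [ofFamily], fun s => ?_⟩
    rcases s.eq_empty_or_nonempty with rfl | hs
    · rw [A.map_empty']
      exact le_top
    · exact h s hs

end BADistribution

end UltrafilterBasics

/-! ### The pattern `Δ(FDP)` and OK ultrafilters -/

section FDP

variable {B : Type u} [CompleteBooleanAlgebra B] {U : Order.PFilter B} {J : Type u}

theorem mem_patternFDP_iff {s : Finset (ℕ+ × ℕ)} :
    s ∈ patternFDP.sets ↔ ∃ m : ℕ+, (∀ x ∈ s, x.1 = m) ∧ s.card ≤ m := by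
  classical
  constructor
  · rintro ⟨m, u, hu, rfl⟩
    refine ⟨m, fun x hx => by simpa using (Finset.mem_product.1 hx).1, by simpa using hu⟩
  · rintro ⟨m, hm, hs⟩
    refine ⟨m, s.image Prod.snd, Finset.card_image_le.trans hs, ?_⟩
    ext ⟨a, n⟩
    simp only [Finset.mem_product, Finset.mem_singleton, Finset.mem_image, Prod.exists,
      exists_eq_right]
    constructor
    · intro h
      exact ⟨hm _ h, a, h⟩
    · rintro ⟨rfl, b, hb⟩
      obtain rfl : b = a := hm _ hb
      exact hb

/-- Below any nonzero element, a pattern distribution is locally a preimage of the pattern. -/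
theorem IsPatternDistribution.exists_local {I : Type*} [Nonempty I] [DecidableEq I] {Δ : Pattern I}
    {A : BADistribution B J} (hA : IsPatternDistribution Δ A) (s : Finset J) {c : B} (hc : c ≠ ⊥) :
    ∃ c' ≤ c, c' ≠ ⊥ ∧ ∃ f : J → I, ∀ t ⊆ s,
      (t.image f ∈ Δ.sets → c' ≤ A t) ∧ (t.image f ∉ Δ.sets → c' ≤ (A t)ᶜ) := by
  classical
  obtain ⟨c', hle, hne, hdec⟩ := exists_le_decides c hc s.powerset A
  have hdec' : ∀ t : Finset s, BADecides c' (A (t.map (Function.Embedding.subtype _))) := fun t =>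
    hdec _ (Finset.mem_powerset.2 fun x hx => by
      obtain ⟨y, -, rfl⟩ := Finset.mem_map.1 hx
      exact y.2)
  obtain ⟨f, hf⟩ := hA s c' hne hdec'
  refine ⟨c', hle, hne, fun j => if h : j ∈ s then f ⟨j, h⟩ else Classical.arbitrary I, ?_⟩
  intro t ht
  have h1 : (t.subtype (· ∈ s)).map (Function.Embedding.subtype _) = t := by
    ext x
    simp only [Finset.mem_map, Finset.mem_subtype, Function.Embedding.subtype_apply, Subtype.exists,
      exists_and_left, exists_prop, exists_eq_right_right]
    exact ⟨fun h => h.1, fun h => ⟨h, ht h⟩⟩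
  have h2 : t.image (fun j => if h : j ∈ s then f ⟨j, h⟩ else Classical.arbitrary I) =
      (t.subtype (· ∈ s)).image f := by
    ext x
    simp only [Finset.mem_image, Finset.mem_subtype, Subtype.exists, exists_and_left]
    constructor
    · rintro ⟨a, ha, rfl⟩
      exact ⟨a, ha, ht ha, by rw [dif_pos (ht ha)]⟩
    · rintro ⟨a, ha, h, rfl⟩
      exact ⟨a, ha, by rw [dif_pos h]⟩
  have h4 := hdec' (t.subtype (· ∈ s))
  rw [h1] at h4
  rw [h2, show ∀ t : Finset s, t.image f ∈ Δ.sets ↔ c' ≤ A (t.map (Function.Embedding.subtype _))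
    from fun t => by convert (hf t).symm]
  rw [h1]
  refine ⟨id, fun h => h4.resolve_left h⟩

/-- The value at `k` of the largest level distribution below a pair-coherent distribution: any
at most `k` indices coherent with `i₀` lie in the distribution. -/
noncomputable def BADistribution.fiber (A : BADistribution B J) (i₀ : J) (t : Finset J) : B :=
  open Classical in ⨅ i ∈ t, A {i₀, i}

/-- Under a local map `f` into the pattern, with `m` the first coordinate of `f i₀`, a coherent set
is accepted iff `f` takes at most `m` values on it. Level `k` thus holds when `k ≤ m`, or when there
are too few distinct values to notice that `k > m`. -/
noncomputable def BADistribution.level (A : BADistribution B J) (i₀ : J) (k : ℕ) : B :=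
  ⨅ t : Finset J, ⨅ (_ : t.card ≤ k), (A t ⊔ (A.fiber i₀ t)ᶜ)

/-- The Boolean value of "`t` extends to a set of at most `k` coherent indices outside of `A`". -/
noncomputable def BADistribution.spread (A : BADistribution B J) (i₀ : J) (k : ℕ) (t : Finset J) :
    B :=
  ⨆ t' : Finset J, ⨆ (_ : t ⊆ t' ∧ t'.card ≤ k), ((A t')ᶜ ⊓ A.fiber i₀ t')

-- At the first level outside `U` the local parameter `m` is `k - 1`, and the sets counted by
-- `spread` extend to `k` coherent indices on which `f` is injective. The refinement forces each `f
-- i` into `f[t]` for a fixed maximal `t` of fewer than `k` indices; a set of indices with values in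
-- `f[t]` has at most `m` values and is accepted.
open Classical in
theorem exists_refinement_of_level_notMem (hU : IsUltrafilterOn U) {A : BADistribution B J}
    (hA : IsPatternDistribution patternFDP A) (hAU : A.IsIn U) (i₀ : J) {k : ℕ}
    (hk : A.level i₀ k ∉ U) (hk' : ∀ j < k, A.level i₀ j ∈ U) : A.HasMultRefinement U := by
  rw [BADistribution.hasMultRefinement_iff hU]
  have hempty : A.spread i₀ k ∅ = (A.level i₀ k)ᶜ := by
    simp [BADistribution.spread, BADistribution.level, compl_iInf, compl_sup]
  have hcard : ∀ t : Finset J, A.spread i₀ k t ∈ U → t.card < k := by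
    intro t ht
    by_contra! hlt
    have : A.spread i₀ k t ≤ (A t)ᶜ := by
      refine iSup₂_le ?_
      rintro t' ⟨h1, h2⟩
      obtain rfl : t = t' := Finset.eq_of_subset_of_card_le h1 (h2.trans hlt)
      exact inf_le_left
    exact hU.compl_mem_iff.1 (Order.PFilter.mem_of_le this ht) (hAU t)
  -- Grow `t` from the empty set, whose spread is the complement of level `k`; by `hcard` the growth
  -- stops before `k` elements.
  obtain ⟨t, ht, htmax⟩ : ∃ t : Finset J, A.spread i₀ k t ∈ U ∧
      ∀ i ∉ t, A.spread i₀ k (insert i t) ∉ U := by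
    by_contra! hcon
    have : ∀ j, ∃ t : Finset J, A.spread i₀ k t ∈ U ∧ t.card = j := by
      intro j
      induction j with
      | zero => exact ⟨∅, by rw [hempty, hU.compl_mem_iff]; exact hk, rfl⟩
      | succ j ih =>
        obtain ⟨t, h1, h2⟩ := ih
        obtain ⟨i, hi, h3⟩ := hcon t h1
        exact ⟨insert i t, h3, by rw [Finset.card_insert_of_notMem hi, h2]⟩
    obtain ⟨t, h1, h2⟩ := this k
    exact (hcard t h1).ne h2
  have htk := hcard t ht
  -- The four factors say: `i` is coherent with `i₀`, smaller levels hold, `t` is independent, and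
  -- adding `i` to `t` destroys independence.
  refine ⟨fun i => A {i₀, i} ⊓ A.level i₀ (k - 1) ⊓ A.spread i₀ k t ⊓
    (if i ∈ t then ⊤ else (A.spread i₀ k (insert i t))ᶜ), fun i => ?_, fun s hs => ?_⟩
  · refine Order.PFilter.inf_mem (Order.PFilter.inf_mem (Order.PFilter.inf_mem (hAU _)
      (hk' _ (by omega))) ht) ?_
    split_ifs with hi
    · exact Order.PFilter.top_mem
    · exact hU.compl_mem_iff.2 (htmax i hi)
  by_contra hle
  obtain ⟨c, hc, hcd, hcs⟩ : ∃ c : B, c ≠ ⊥ ∧ (∀ i ∈ s, c ≤ A {i₀, i} ⊓ A.level i₀ (k - 1) ⊓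
      A.spread i₀ k t ⊓ (if i ∈ t then ⊤ else (A.spread i₀ k (insert i t))ᶜ)) ∧ c ≤ (A s)ᶜ := by
    refine ⟨_, ?_, fun i hi => inf_le_left.trans (iInf₂_le i hi), inf_le_right⟩
    rw [← sdiff_eq]
    simpa using hle
  obtain ⟨i₁, hi₁⟩ := hs
  have hcspread : c ≤ A.spread i₀ k t := (hcd i₁ hi₁).trans (inf_le_left.trans inf_le_right)
  obtain ⟨t', ⟨htt', ht'k⟩, hct'⟩ : ∃ t' : Finset J, (t ⊆ t' ∧ t'.card ≤ k) ∧
      c ⊓ ((A t')ᶜ ⊓ A.fiber i₀ t') ≠ ⊥ := by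
    by_contra! hcon
    have : c ⊓ A.spread i₀ k t = ⊥ := by
      simp only [BADistribution.spread, inf_iSup_eq]
      simpa using fun t' h1 h2 => hcon t' ⟨h1, h2⟩
    exact hc (by rwa [inf_eq_left.2 hcspread] at this)
  obtain ⟨c', hc'le, hc', f, hf⟩ := hA.exists_local (insert i₀ (s ∪ t')) hct'
  have hc'c : c' ≤ c := hc'le.trans inf_le_left
  have key : ∀ r ⊆ insert i₀ (s ∪ t'), c' ≤ A r → r.image f ∈ patternFDP.sets := by
    intro r hr h
    by_contra hn
    exact hc' (le_bot_iff.1 ((le_inf h ((hf r hr).2 hn)).trans (by simp)))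
  have key' : ∀ r ⊆ insert i₀ (s ∪ t'), c' ≤ (A r)ᶜ → r.image f ∉ patternFDP.sets := by
    intro r hr h hn
    exact hc' (le_bot_iff.1 ((le_inf ((hf r hr).1 hn) h).trans (by simp)))
  have hfib : ∀ i ∈ s ∪ t', c' ≤ A {i₀, i} := by
    intro i hi
    rcases Finset.mem_union.1 hi with hi | hi
    · exact hc'c.trans ((hcd i hi).trans (inf_le_left.trans (inf_le_left.trans inf_le_left)))
    · exact (hc'le.trans (inf_le_right.trans inf_le_right)).trans (iInf₂_le i hi)
  have hfst : ∀ i ∈ s ∪ t', (f i).1 = (f i₀).1 := by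
    intro i hi
    have := key {i₀, i} (by
      intro x
      simp only [Finset.mem_insert, Finset.mem_singleton]
      rintro (rfl | rfl)
      · exact Or.inl rfl
      · exact Or.inr hi) (hfib i hi)
    obtain ⟨m, hm, -⟩ := mem_patternFDP_iff.1 this
    rw [hm (f i) (by simp), hm (f i₀) (by simp)]
  set m := (f i₀).1 with hm
  have hΔ : ∀ r ⊆ s ∪ t', (r.image f ∈ patternFDP.sets ↔ (r.image f).card ≤ m) := by
    intro r hr
    rw [mem_patternFDP_iff]
    constructor
    · rintro ⟨m', h1, h2⟩
      rcases r.eq_empty_or_nonempty with rfl | ⟨x, hx⟩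
      · simp
      · rw [← h1 (f x) (Finset.mem_image_of_mem f hx), hfst x (hr hx)] at h2
        exact h2
    · intro h
      refine ⟨m, ?_, h⟩
      intro x hx
      obtain ⟨i, hi, rfl⟩ := Finset.mem_image.1 hx
      exact hfst i (hr hi)
  have hsub : ∀ {r : Finset J}, r ⊆ s ∪ t' → r ⊆ insert i₀ (s ∪ t') := fun h =>
    h.trans (Finset.subset_insert _ _)
  have hfiber : ∀ r ⊆ s ∪ t', c' ≤ A.fiber i₀ r := fun r hr => le_iInf₂ fun i hi => hfib i (hr hi)
  have ht'im : (m : ℕ) < (t'.image f).card := by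
    by_contra! h
    exact key' t' (hsub Finset.subset_union_right)
      (hc'le.trans (inf_le_right.trans inf_le_left)) ((hΔ t' Finset.subset_union_right).2 h)
  have hlevel : ∀ r ⊆ t', r.card ≤ k - 1 → (r.image f).card ≤ m := by
    intro r hr hrk
    have hr' : r ⊆ s ∪ t' := hr.trans Finset.subset_union_right
    rw [← hΔ r hr']
    refine key r (hsub hr') ?_
    have h1 : c' ≤ A r ⊔ (A.fiber i₀ r)ᶜ := (hc'c.trans ((hcd i₁ hi₁).trans
      (inf_le_left.trans (inf_le_left.trans inf_le_right)))).trans (iInf₂_le r hrk)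
    calc c' ≤ (A r ⊔ (A.fiber i₀ r)ᶜ) ⊓ A.fiber i₀ r := le_inf h1 (hfiber r hr')
      _ ≤ A r := by rw [inf_sup_right]; simp
  have ht'card : t'.card = k := by
    refine le_antisymm ht'k ?_
    by_contra! h
    exact absurd (hlevel t' subset_rfl (by omega)) (by omega)
  -- If `m + 1 < k`, some `m + 1` elements of `t'` with distinct values would form a rejected set,
  -- against level `k - 1`.
  have hmk : k = m + 1 ∧ (t'.image f).card = k := by
    have h4 : (t'.image f).card ≤ t'.card := Finset.card_image_le
    have h5 : ¬ (m : ℕ) + 1 < k := by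
      intro h5
      obtain ⟨r, hr, hrcard⟩ := Finset.exists_subset_card_eq (s := t'.image f) (n := m + 1) (by omega)
      obtain ⟨q, hq, hqinj, hqim⟩ : ∃ q ⊆ t', Set.InjOn f q ∧ q.image f = r := by
        obtain ⟨q, hq1, hq2, hq3⟩ :=
          Finset.exists_subset_injOn_image_eq_of_surjOn (f := f) (t' : Set J) r (by
            intro y hy
            simpa using hr hy)
        exact ⟨q, by exact_mod_cast hq1, hq2, hq3⟩
      have h6 : q.card = r.card := by rw [← hqim, Finset.card_image_of_injOn hqinj]
      have := hlevel q hq (by omega)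
      rw [hqim, hrcard] at this
      omega
    exact ⟨by omega, by omega⟩
  have hinj : Set.InjOn f t' := Finset.injOn_of_card_image_eq (hmk.2.trans ht'card.symm)
  -- Otherwise `f[s] ⊆ f[t]` has at most `|t| ≤ k - 1 = m` values and `s` would be accepted.
  obtain ⟨i, his, hit⟩ : ∃ i ∈ s, f i ∉ t.image f := by
    by_contra! hcon
    have h1 : (s.image f).card ≤ m := by
      refine (Finset.card_le_card (t := t.image f) ?_).trans
        (Finset.card_image_le.trans (by omega))
      intro x hx
      obtain ⟨i, hi, rfl⟩ := Finset.mem_image.1 hx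
      exact hcon i hi
    exact key' s (hsub Finset.subset_union_left) (hc'c.trans hcs)
      ((hΔ s Finset.subset_union_left).2 h1)
  have hi : i ∉ t := fun h => hit (Finset.mem_image_of_mem f h)
  -- Exchange: `i` replaces the element of `t'` with the same value if there is one, and any element
  -- outside `t` otherwise. The `k` values stay distinct, so the new set is rejected and witnesses
  -- the spread of `insert i t`.
  obtain ⟨x, hxt', hxt, hx⟩ : ∃ x ∈ t', x ∉ t ∧ ∀ z ∈ t'.erase x, f z ≠ f i := by
    by_cases h : ∃ x ∈ t', f x = f i
    · obtain ⟨x, hx, hxi⟩ := h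
      refine ⟨x, hx, fun hxt => hit (hxi ▸ Finset.mem_image_of_mem f hxt), ?_⟩
      intro z hz hzi
      rw [Finset.mem_erase] at hz
      exact hz.1 (hinj hz.2 hx (hzi.trans hxi.symm))
    · push Not at h
      obtain ⟨x, hx1, hx2⟩ : ∃ x ∈ t', x ∉ t := by
        by_contra! hcon
        have := Finset.card_le_card (show t' ⊆ t from hcon)
        omega
      exact ⟨x, hx1, hx2, fun z hz => h z (Finset.mem_of_mem_erase hz)⟩
  have hr : insert i (t'.erase x) ⊆ s ∪ t' := by
    intro y hy
    rcases Finset.mem_insert.1 hy with rfl | hy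
    · exact Finset.mem_union_left _ his
    · exact Finset.mem_union_right _ (Finset.mem_of_mem_erase hy)
  have hrim : ((insert i (t'.erase x)).image f).card = k := by
    rw [Finset.image_insert, Finset.card_insert_of_notMem, Finset.card_image_of_injOn
      (hinj.mono (by simpa using Finset.erase_subset x t')), Finset.card_erase_of_mem hxt', ht'card]
    · omega
    · intro h
      obtain ⟨z, hz, hzi⟩ := Finset.mem_image.1 h
      exact hx z hz hzi
  have hrA : c' ≤ (A (insert i (t'.erase x)))ᶜ := by
    refine (hf _ (hsub hr)).2 ?_
    intro hmem
    rw [hΔ _ hr, hrim] at hmem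
    omega
  have h1 : c' ≤ A.spread i₀ k (insert i t) := by
    refine (le_inf hrA (hfiber _ hr)).trans
      (le_iSup₂_of_le (f := fun t'' (_ : insert i t ⊆ t'' ∧ t''.card ≤ k) =>
        ((A t'')ᶜ ⊓ A.fiber i₀ t'')) (insert i (t'.erase x)) ⟨?_, ?_⟩ le_rfl)
    · refine Finset.insert_subset_insert i fun y hy => Finset.mem_erase.2 ⟨?_, htt' hy⟩
      rintro rfl
      exact hxt hy
    · refine (Finset.card_insert_le _ _).trans ?_
      rw [Finset.card_erase_of_mem hxt', ht'card]
      omega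
  have h2 : c' ≤ (A.spread i₀ k (insert i t))ᶜ := by
    have := hc'c.trans ((hcd i his).trans inf_le_right)
    rwa [if_neg hi] at this
  exact hc' (le_bot_iff.1 ((le_inf h1 h2).trans (by simp)))

theorem BADistribution.level_antitone (A : BADistribution B J) (i₀ : J) :
    Antitone (A.level i₀) := fun _ _ h =>
  le_iInf₂ fun t ht => iInf₂_le t (ht.trans h)

/-- The distribution with `A s = a |s|`. -/
def BADistribution.ofCard (J : Type u) (a : ℕ → B) (h0 : a 0 = ⊤) (hanti : Antitone a)
    (hne : ∀ k, a k ≠ ⊥) : BADistribution B J where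
  toFun s := a s.card
  ne_bot' s := hne _
  map_empty' := by simpa using h0
  anti' s t h := hanti (Finset.card_le_card h)

/-- `U` is OK for families indexed by `J`: every decreasing sequence in `U` bounds the finite
meets of some `J`-indexed family in `U`. -/
def OKFor (U : Order.PFilter B) (J : Type u) : Prop :=
  ∀ a : ℕ → B, Antitone a → (∀ k, a k ∈ U) →
    ∃ d : J → B, (∀ i, d i ∈ U) ∧ ∀ s : Finset J, s.Nonempty → (⨅ i ∈ s, d i) ≤ a s.card

/-- Sequences and distributions depending only on cardinality correspond to each other; the value at
`0` has to be reset to `⊤` for a distribution and plays no role for nonempty sets. -/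
theorem isOK_iff_okFor (hU : IsUltrafilterOn U) {κ : Cardinal.{u}} :
    IsOK U κ ↔ OKFor U κ.out := by
  constructor
  · intro h a ha haU
    let a' : ℕ → B := fun k => if k = 0 then ⊤ else a k
    have hmem : ∀ k, a' k ∈ U := by
      intro k
      simp only [a']
      split_ifs
      · exact Order.PFilter.top_mem
      · exact haU k
    have hanti : Antitone a' := by
      intro i j hij
      simp only [a']
      split_ifs with h1 h2
      · exact le_rfl
      · omega
      · exact le_top
      · exact ha hij
    obtain ⟨d, hd, hds⟩ := (BADistribution.hasMultRefinement_iff hU).1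
      (h (BADistribution.ofCard κ.out a' (by simp [a']) hanti fun k => hU.ne_bot (hmem k))
        (fun s => hmem _) (fun s t hst => by simp [BADistribution.ofCard, hst]))
    refine ⟨d, hd, fun s hs => (hds s hs).trans ?_⟩
    have : s.card ≠ 0 := by simpa using hs.ne_empty
    simp [BADistribution.ofCard, a', this]
  · intro h A hA hAcard
    rw [BADistribution.hasMultRefinement_iff hU]
    let a : ℕ → B := fun k => ⨅ s : Finset κ.out, ⨅ (_ : s.card ≤ k), A s
    have ha : ∀ s : Finset κ.out, a s.card = A s := by
      intro s
      refine le_antisymm (iInf₂_le (f := fun t (_ : t.card ≤ s.card) => A t) s le_rfl) (le_iInf₂ fun t ht => ?_)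
      obtain ⟨t', ht', hcard⟩ := Finset.exists_subset_card_eq ht
      rw [hAcard t t' hcard.symm]
      exact A.anti' _ _ ht'
    obtain ⟨d, hd, hds⟩ := h a (fun i j hij => le_iInf₂ fun t ht => iInf₂_le t (ht.trans hij)) (by
      intro k
      by_cases hk : ∃ s : Finset κ.out, s.card = k
      · obtain ⟨s, rfl⟩ := hk
        rw [ha]
        exact hA s
      -- If no set has `k` elements, the index set is finite and the value at the whole of it bounds
      -- the infimum from below.
      · have hfin : ∃ s : Finset κ.out, ∀ t : Finset κ.out, t ⊆ s := by
          have : Finite κ.out := by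
            by_contra hinf
            rw [not_finite_iff_infinite] at hinf
            exact hk (Infinite.exists_subset_card_eq _ k)
          have := Fintype.ofFinite κ.out
          exact ⟨Finset.univ, fun t => Finset.subset_univ t⟩
        obtain ⟨s, hs⟩ := hfin
        exact Order.PFilter.mem_of_le (le_iInf₂ fun t _ => A.anti' _ _ (hs t)) (hA s))
    exact ⟨d, hd, fun s hs => (hds s hs).trans (ha s).le⟩

/-- Coherence with one fixed index linearizes the problem: if all levels are in `U`, OK applies to
them, and the first level outside `U` is treated by the exchange argument. -/
theorem exists_refinement_of_okFor (hU : IsUltrafilterOn U) (hOK : OKFor U J)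
    {A : BADistribution B J} (hA : IsPatternDistribution patternFDP A) (hAU : A.IsIn U) :
    A.HasMultRefinement U := by
  classical
  rcases isEmpty_or_nonempty J with hJ | ⟨⟨i₀⟩⟩
  · rw [BADistribution.hasMultRefinement_iff hU]
    exact ⟨fun _ => ⊤, fun i => isEmptyElim i, fun s ⟨i, _⟩ => isEmptyElim i⟩
  by_cases hall : ∀ k, A.level i₀ k ∈ U
  · rw [BADistribution.hasMultRefinement_iff hU]
    obtain ⟨d, hd, hds⟩ := hOK _ (A.level_antitone i₀) hall
    refine ⟨fun i => d i ⊓ A {i₀, i}, fun i => Order.PFilter.inf_mem (hd i) (hAU _),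
      fun s hs => ?_⟩
    have h1 : (⨅ i ∈ s, d i ⊓ A {i₀, i}) ≤ A s ⊔ (A.fiber i₀ s)ᶜ :=
      (iInf₂_mono fun i _ => inf_le_left).trans ((hds s hs).trans
        (iInf₂_le (f := fun t (_ : t.card ≤ s.card) => A t ⊔ (A.fiber i₀ t)ᶜ) s le_rfl))
    have h2 : (⨅ i ∈ s, d i ⊓ A {i₀, i}) ≤ A.fiber i₀ s := iInf₂_mono fun i _ => inf_le_right
    refine (le_inf h1 h2).trans ?_
    rw [inf_sup_right]
    simp
  · push Not at hall
    exact exists_refinement_of_level_notMem hU hA hAU i₀ (Nat.find_spec hall)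
      fun j hj => not_not.1 (Nat.find_min hall hj)

/-- Use distinct second coordinates and, as common first coordinate, the last `k` with `c ≤ a k`.
The pattern has no first coordinate `0`, hence the requirement `a 1 = ⊤`. -/
theorem isPatternDistribution_ofCard (a : ℕ → B) (h0 : a 0 = ⊤) (h1 : a 1 = ⊤)
    (hanti : Antitone a) (hne : ∀ k, a k ≠ ⊥) :
    IsPatternDistribution patternFDP (BADistribution.ofCard J a h0 hanti hne) := by
  classical
  intro s c hc hdec
  obtain ⟨e⟩ : Nonempty (s ≃ Fin s.card) := ⟨s.equivFin⟩
  obtain ⟨m, hmle⟩ : ∃ m : ℕ+, ∀ k ≤ s.card, (c ≤ a k ↔ k ≤ m) := by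
    by_cases h : ∃ k, ¬ c ≤ a k
    · have hf := Nat.find_spec h
      have h2 : 2 ≤ Nat.find h := by
        by_contra! hlt
        interval_cases hk : Nat.find h
        · exact hf (by simp [h0])
        · exact hf (by simp [h1])
      refine ⟨⟨Nat.find h - 1, by omega⟩, fun k _ => ?_⟩
      simp only [PNat.mk_coe]
      constructor
      · intro hk
        by_contra! hlt
        exact hf (hk.trans (hanti (by omega)))
      · intro hk
        exact not_not.1 (Nat.find_min h (m := k) (by omega))
    · push Not at h
      -- Nothing is rejected here, so any bound not below `s.card` works; the successor is positive
      -- also for empty `s`.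
      exact ⟨⟨s.card + 1, by omega⟩, fun k hk => ⟨fun _ => by simp; omega, fun _ => h k⟩⟩
  refine ⟨fun i => (m, e i), fun t => ?_⟩
  have hcard : (t.image fun i => (m, ((e i : Fin _) : ℕ))).card = t.card :=
    Finset.card_image_of_injective _ fun i j hij => e.injective (Fin.ext (Prod.ext_iff.1 hij).2)
  have htle : t.card ≤ s.card := by simpa using Finset.card_le_univ t
  have main : c ≤ a t.card ↔ (t.image fun i => (m, ((e i : Fin _) : ℕ))) ∈ patternFDP.sets := by
    rw [mem_patternFDP_iff, hcard, hmle _ htle]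
    constructor
    · intro h
      refine ⟨m, fun x hx => ?_, h⟩
      obtain ⟨i, -, rfl⟩ := Finset.mem_image.1 hx
      rfl
    · rintro ⟨m', h1, h2⟩
      rcases t.eq_empty_or_nonempty with rfl | ⟨x, hx⟩
      · simp
      · rwa [← h1 _ (Finset.mem_image_of_mem _ hx)] at h2
  simp only [BADistribution.ofCard, Finset.card_map]
  convert main

/-- The sequence is raised to `⊤` at `0` and `1` to fit the pattern; meeting every `d i` with `a 1`
restores the bound for singletons. -/
theorem okFor_of_forall_pattern (hU : IsUltrafilterOn U)
    (h : ∀ A : BADistribution B J, IsPatternDistribution patternFDP A → A.IsIn U →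
      A.HasMultRefinement U) : OKFor U J := by
  intro a ha haU
  let a' : ℕ → B := fun k => if k ≤ 1 then ⊤ else a k
  have hmem : ∀ k, a' k ∈ U := by
    intro k
    simp only [a']
    split_ifs
    · exact Order.PFilter.top_mem
    · exact haU k
  have hanti : Antitone a' := by
    intro i j hij
    simp only [a']
    split_ifs with h1 h2
    · exact le_rfl
    · omega
    · exact le_top
    · exact ha hij
  obtain ⟨d, hd, hds⟩ := (BADistribution.hasMultRefinement_iff hU).1
    (h (BADistribution.ofCard J a' (by simp [a']) hanti fun k => hU.ne_bot (hmem k))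
      (isPatternDistribution_ofCard a' _ (by simp [a']) _ _) fun s => hmem _)
  refine ⟨fun i => d i ⊓ a 1, fun i => Order.PFilter.inf_mem (hd i) (haU 1), fun s hs => ?_⟩
  have h1 := (iInf₂_mono fun i _ => inf_le_left : (⨅ i ∈ s, d i ⊓ a 1) ≤ _).trans (hds s hs)
  obtain ⟨i, hi⟩ := hs
  by_cases hcard : s.card ≤ 1
  · exact (iInf₂_le i hi).trans (inf_le_right.trans (ha hcard))
  · simpa [BADistribution.ofCard, a', hcard] using h1

theorem patternInvariant_eq_leastCardinal_not_isOK (hU : IsUltrafilterOn U) :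
    patternInvariant U patternFDP = leastCardinal (fun κ : Cardinal.{u} => ¬ IsOK U κ) := by
  unfold patternInvariant
  congr 1
  funext κ
  rw [isOK_iff_okFor hU, eq_iff_iff]
  constructor
  · rintro ⟨A, h1, h2, h3⟩ hOK
    exact h3 (exists_refinement_of_okFor hU hOK h1 h2)
  · intro h
    by_contra hcon
    push Not at hcon
    exact h (okFor_of_forall_pattern hU hcon)

end FDP

/-! ### Flexible and regular ultrafilters -/

section Flexible

variable {B : Type u} [CompleteBooleanAlgebra B] {U : Order.PFilter B}

namespace BooleanUltrapower

theorem geValue_antitone (n : BooleanUltrapower B ℕ) : Antitone n.geValue := fun _ _ h =>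
  iSup₂_le fun m hm => le_iSup₂_of_le m (h.trans hm) le_rfl

theorem geValue_zero (n : BooleanUltrapower B ℕ) : n.geValue 0 = ⊤ := by
  simpa [geValue] using n.iSup'

theorem geValue_inf_toFun (n : BooleanUltrapower B ℕ) {k m : ℕ} (h : m < k) :
    n.geValue k ⊓ n.toFun m = ⊥ := by
  simp only [geValue, iSup_inf_eq]
  simp only [iSup_eq_bot]
  intro j hj
  exact n.disjoint' _ _ (by omega)

theorem geValue_succ_sup (n : BooleanUltrapower B ℕ) (k : ℕ) :
    n.geValue k = n.toFun k ⊔ n.geValue (k + 1) := by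
  refine le_antisymm (iSup₂_le fun m hm => ?_) (sup_le ?_ (n.geValue_antitone (by omega)))
  · rcases hm.eq_or_lt with rfl | hlt
    · exact le_sup_left
    · exact le_sup_of_le_right (le_iSup₂_of_le (f := fun m (_ : k + 1 ≤ m) => n.toFun m) m hlt le_rfl)
  · exact le_iSup₂_of_le (f := fun m (_ : k ≤ m) => n.toFun m) k le_rfl le_rfl

theorem IsNonstandard.geValue_mem (hU : IsUltrafilterOn U) {n : BooleanUltrapower B ℕ}
    (hn : n.IsNonstandard U) (k : ℕ) : n.geValue k ∈ U := by
  induction k with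
  | zero =>
    rw [geValue_zero]
    exact Order.PFilter.top_mem
  | succ k ih =>
    rw [geValue_succ_sup, hU.sup_mem_iff] at ih
    exact ih.resolve_left (hn k)

/-- The partition of a decreasing sequence with meet `⊥`. -/
noncomputable def ofAntitone (a : ℕ → B) (h0 : a 0 = ⊤) (ha : Antitone a) (hinf : ⨅ k, a k = ⊥) :
    BooleanUltrapower B ℕ where
  toFun k := a k ⊓ (a (k + 1))ᶜ
  disjoint' := by
    have : ∀ x y, x < y → a x ⊓ (a (x + 1))ᶜ ⊓ (a y ⊓ (a (y + 1))ᶜ) = ⊥ := by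
      intro x y hxy
      refine le_bot_iff.1 ((inf_le_inf inf_le_right inf_le_left).trans ?_)
      refine (inf_le_inf_left _ (ha (show x + 1 ≤ y by omega))).trans ?_
      simp
    intro x y hxy
    rcases lt_or_gt_of_ne hxy with h | h
    · exact this x y h
    · rw [inf_comm]
      exact this y x h
  iSup' := by
    -- The complement of the supremum of the differences lies below every `a k`, by induction on
    -- `k`, and hence below their meet `⊥`.
    rw [eq_top_iff, ← compl_le_compl_iff_le, compl_top, ← hinf, compl_iSup]
    refine le_iInf fun k => ?_
    induction k with
    | zero => simp [h0]
    | succ k ih =>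
      have h1 : (⨅ i, (a i ⊓ (a (i + 1))ᶜ)ᶜ) ≤ (a k ⊓ (a (k + 1))ᶜ)ᶜ := iInf_le _ k
      rw [compl_inf, compl_compl] at h1
      refine (le_inf h1 ih).trans ?_
      rw [inf_sup_right]
      simp

theorem ofAntitone_isNonstandard (hU : IsUltrafilterOn U) {a : ℕ → B} (h0 : a 0 = ⊤)
    (ha : Antitone a) (hinf : ⨅ k, a k = ⊥) (haU : ∀ k, a k ∈ U) :
    (ofAntitone a h0 ha hinf).IsNonstandard U := fun k hk =>
  hU.compl_mem_iff.1 (Order.PFilter.inf_mem_iff.1 hk).2 (haU (k + 1))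

theorem geValue_ofAntitone_le {a : ℕ → B} (h0 : a 0 = ⊤)
    (ha : Antitone a) (hinf : ⨅ k, a k = ⊥) (k : ℕ) : (ofAntitone a h0 ha hinf).geValue k ≤ a k :=
  iSup₂_le fun _ hm => inf_le_left.trans (ha hm)

end BooleanUltrapower

/-- Take finite meets of the given countable family, each met with the complement of the full meet;
this complement is in `U` and makes the total meet `⊥`. -/
theorem IsAleph1Incomplete.exists_antitone (hU : IsUltrafilterOn U) (h : IsAleph1Incomplete U) :
    ∃ a : ℕ → B, a 0 = ⊤ ∧ Antitone a ∧ ⨅ k, a k = ⊥ ∧ ∀ k, a k ∈ U := by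
  obtain ⟨c, hc, hinf⟩ := h
  refine ⟨fun k => if k = 0 then ⊤ else (⨅ i ∈ Finset.range k, c i) ⊓ (⨅ i, c i)ᶜ, by simp,
    ?_, ?_, ?_⟩
  · intro i j hij
    dsimp only
    split_ifs with h1 h2
    · exact le_rfl
    · omega
    · exact le_top
    · exact inf_le_inf_right _ (biInf_mono fun x hx => by
        simp only [Finset.mem_range] at hx ⊢; omega)
  · rw [← le_bot_iff]
    have h1 : (⨅ k : ℕ, if k = 0 then ⊤ else (⨅ i ∈ Finset.range k, c i) ⊓ (⨅ i, c i)ᶜ) ≤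
        (⨅ i, c i) ⊓ (⨅ i, c i)ᶜ := by
      refine le_inf (le_iInf fun i => ?_) ?_
      · refine (iInf_le _ (i + 1)).trans ?_
        rw [if_neg (by omega)]
        exact inf_le_left.trans (iInf₂_le i (by simp))
      · refine (iInf_le _ 1).trans ?_
        rw [if_neg (by omega)]
        exact inf_le_right
    simpa using h1
  · intro k
    dsimp only
    split_ifs
    · exact Order.PFilter.top_mem
    · exact Order.PFilter.inf_mem (Order.PFilter.finset_iInf_mem fun i _ => hc i)
        (hU.compl_mem_iff.2 hinf)

/-- A nonstandard `n` yields the decreasing sequence `‖n ≥ k‖` in `U`. Conversely, a decreasing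
sequence in `U` is first shrunk to have meet `⊥`, and its successive differences then define a
nonstandard `n` with `‖n ≥ k‖` below it. -/
theorem isFlexible_iff_isOK (hU : IsUltrafilterOn U) (hinc : IsAleph1Incomplete U)
    {κ : Cardinal.{u}} : IsFlexible U κ ↔ IsOK U κ := by
  rw [isOK_iff_okFor hU]
  constructor
  · rintro ⟨-, hflex⟩ a ha haU
    obtain ⟨a', h0, ha', hinf, ha'U⟩ := hinc.exists_antitone hU
    let b : ℕ → B := fun k => if k = 0 then ⊤ else a k ⊓ a' k
    have hb : Antitone b := by
      intro i j hij
      simp only [b]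
      split_ifs with h1 h2
      · exact le_rfl
      · omega
      · exact le_top
      · exact inf_le_inf (ha hij) (ha' hij)
    have hbinf : ⨅ k, b k = ⊥ := by
      rw [← le_bot_iff, ← hinf]
      refine le_iInf fun k => ?_
      refine (iInf_le _ (k + 1)).trans ?_
      simp only [b, Nat.add_eq_zero_iff, one_ne_zero, and_false, if_false]
      exact inf_le_right.trans (ha' (by omega))
    have hbU : ∀ k, b k ∈ U := by
      intro k
      simp only [b]
      split_ifs
      · exact Order.PFilter.top_mem
      · exact Order.PFilter.inf_mem (haU k) (ha'U k)
    obtain ⟨A, hA1, hA2, hA3⟩ := hflex (.ofAntitone b (by simp [b]) hb hbinf)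
      (BooleanUltrapower.ofAntitone_isNonstandard hU _ _ _ hbU)
    refine ⟨fun i => A {i}, fun i => hA1 _, fun s hs => ?_⟩
    have hs' : s.card ≠ 0 := by simpa using hs.ne_empty
    refine (hA2 s).symm.trans_le ((hA3 s).trans
      ((BooleanUltrapower.geValue_ofAntitone_le _ _ _ _).trans ?_))
    simp only [b, if_neg hs']
    exact inf_le_left
  · intro hOK
    refine ⟨hinc, fun n hn => ?_⟩
    obtain ⟨d, hd, hds⟩ := hOK n.geValue n.geValue_antitone (hn.geValue_mem hU)
    refine ⟨BADistribution.ofFamily hU d hd,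
      fun s => Order.PFilter.finset_iInf_mem fun i _ => hd i,
      fun s => by simp [BADistribution.ofFamily], fun s => ?_⟩
    rcases s.eq_empty_or_nonempty with rfl | hs
    · simp [n.geValue_zero]
    · exact hds s hs

theorem patternInvariant_eq_leastCardinal_not_isFlexible (hU : IsUltrafilterOn U)
    (hinc : IsAleph1Incomplete U) :
    patternInvariant U patternFDP = leastCardinal (fun κ : Cardinal.{u} => ¬ IsFlexible U κ) := by
  rw [patternInvariant_eq_leastCardinal_not_isOK hU]
  congr 1
  funext κ
  rw [isFlexible_iff_isOK hU hinc]

variable {J : Type u}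

/-- Below `n.toFun m` no more than `m` members of the family are compatible. A set of indices that
is maximal with nonzero meet below a given element therefore exists, and its meet decides every
member. -/
theorem isRegularFamily_of_le_geValue (n : BooleanUltrapower B ℕ) {D : BADistribution B J}
    (hmult : D.IsMultiplicative) (h : ∀ s, D s ≤ n.geValue s.card) :
    IsRegularFamily fun i => D {i} := by
  classical
  have hdisj : ∀ (s : Finset J) (m : ℕ), m < s.card → D s ⊓ n.toFun m = ⊥ := fun s m hm =>
    le_bot_iff.1 ((inf_le_inf_right _ (h s)).trans (n.geValue_inf_toFun hm).le)
  have hpart : ∀ b : B, b ≠ ⊥ → ∃ m, b ⊓ n.toFun m ≠ ⊥ := by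
    intro b hb
    by_contra! hcon
    refine hb ?_
    rw [← inf_top_eq b, ← n.iSup', inf_iSup_eq]
    simpa using hcon
  refine ⟨fun s => ?_, fun Z hZ => ?_, fun b hb => ?_⟩
  · rw [← hmult s]
    exact D.ne_bot' s
  · by_contra hne
    obtain ⟨m, hm⟩ := hpart _ hne
    obtain ⟨s, hsZ, hs⟩ := hZ.exists_subset_card_eq (m + 1)
    refine hm (le_bot_iff.1 ?_)
    rw [← hdisj s m (by omega), hmult s]
    exact inf_le_inf_right _ (le_iInf₂ fun i hi => iInf₂_le i (hsZ hi))
  · obtain ⟨m, hm⟩ := hpart b hb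
    obtain ⟨s, hs, hsmax⟩ : ∃ s : Finset J, D s ⊓ (b ⊓ n.toFun m) ≠ ⊥ ∧
        ∀ i ∉ s, D (insert i s) ⊓ (b ⊓ n.toFun m) = ⊥ := by
      by_contra! hcon
      have : ∀ j, ∃ s : Finset J, D s ⊓ (b ⊓ n.toFun m) ≠ ⊥ ∧ s.card = j := by
        intro j
        induction j with
        | zero => exact ⟨∅, by rwa [D.map_empty', top_inf_eq], rfl⟩
        | succ j ih =>
          obtain ⟨t, h1, h2⟩ := ih
          obtain ⟨i, hi, h3⟩ := hcon t h1
          exact ⟨insert i t, h3, by rw [Finset.card_insert_of_notMem hi, h2]⟩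
      obtain ⟨t, h1, h2⟩ := this (m + 1)
      refine h1 (le_bot_iff.1 ?_)
      rw [← hdisj t m (by omega)]
      exact inf_le_inf_left _ inf_le_right
    refine ⟨_, hs, inf_le_right.trans inf_le_left, fun i => ?_⟩
    by_cases hi : i ∈ s
    · exact Or.inl (inf_le_left.trans (D.anti' _ _ (by simpa using hi)))
    · right
      -- By maximality of `s` and multiplicativity, the chosen element is disjoint from `D {i}`.
      have h1 := hsmax i hi
      rw [hmult, Finset.iInf_insert, ← hmult s, inf_assoc] at h1
      exact (disjoint_iff.2 h1).symm.le_compl_right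

theorem regular_tfae (n : BooleanUltrapower B ℕ) (D : BADistribution B J)
    (hmult : D.IsMultiplicative) : List.TFAE [
      ∀ s, D s ≤ n.geValue s.card,
      IsRegularFamily (fun i => D {i}) ∧ ∀ c : B, c ≠ ⊥ → (∀ s, BADecides c (D s)) →
        ∀ s : Finset J, (∀ i, i ∈ s ↔ c ≤ D {i}) → c ≤ n.geValue s.card,
      IsRegularFamily (fun i => D {i}) ∧ ∀ c : B, c ≠ ⊥ → (∀ i, BADecides c (D {i})) →
        ∀ s : Finset J, (∀ i, i ∈ s ↔ c ≤ D {i}) → c ≤ n.geValue s.card] := by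
  classical
  tfae_have 1 → 2 := by
    intro h
    refine ⟨isRegularFamily_of_le_geValue n hmult h, fun c _ _ s hs => ?_⟩
    refine le_trans ?_ (h s)
    rw [hmult s]
    exact le_iInf₂ fun i hi => (hs i).1 hi
  tfae_have 2 → 3 := by
    rintro ⟨hreg, h⟩
    refine ⟨hreg, fun c hc hdec => h c hc fun s => ?_⟩
    rw [hmult s]
    by_cases hall : ∀ i ∈ s, c ≤ D {i}
    · exact Or.inl (le_iInf₂ hall)
    · push Not at hall
      obtain ⟨i, hi, hci⟩ := hall
      exact Or.inr (((hdec i).resolve_left hci).trans (compl_le_compl (iInf₂_le i hi)))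
  tfae_have 3 → 1 := by
    rintro ⟨hreg, h⟩ s
    by_contra hle
    have hne : D s ⊓ (n.geValue s.card)ᶜ ≠ ⊥ := by
      rw [← sdiff_eq]
      simpa using hle
    obtain ⟨c, hc, hcle, hdec⟩ := hreg.2.2 _ hne
    -- An infinite set of members above `c` would have meet `⊥`. The finite set of all members above
    -- `c` contains `s`, so its bound implies the one for `s`.
    have hfin : {i | c ≤ D {i}}.Finite := by
      by_contra hinf
      exact hc (le_bot_iff.1 ((le_iInf₂ fun i (hi : c ≤ D {i}) => hi).trans
        (hreg.2.1 {i | c ≤ D {i}} hinf).le))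
    have h1 := h c hc hdec hfin.toFinset (by simp)
    have h2 : s ⊆ hfin.toFinset := by
      intro i hi
      simp only [Set.Finite.mem_toFinset, Set.mem_ofPred_eq]
      exact (hcle.trans inf_le_left).trans (D.anti' _ _ (by simpa using hi))
    have h3 := h1.trans (n.geValue_antitone (Finset.card_le_card h2))
    exact hc (le_bot_iff.1 ((le_inf h3 (hcle.trans inf_le_right)).trans (by simp)))
  tfae_finish

theorem IsFlexible.isRegularFilter (hU : IsUltrafilterOn U) {κ : Cardinal.{u}}
    (h : IsFlexible U κ) : IsRegularFilter U κ := by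
  obtain ⟨a, h0, ha, hinf, haU⟩ := h.1.exists_antitone hU
  obtain ⟨A, hA1, hA2, hA3⟩ := h.2 _
    (BooleanUltrapower.ofAntitone_isNonstandard hU h0 ha hinf haU)
  exact ⟨fun i => A {i}, fun i => hA1 _, isRegularFamily_of_le_geValue _ hA2 hA3⟩

end Flexible


/-! ### Boolean valuations of formulas and compactness -/

section Formulas

variable {L : FirstOrder.Language.{0, 0}} {X Y : Type u}

/-- Semantic entailment between formulas with the same free variables. -/
def FormulaEntails (φ ψ : L.Formula X) : Prop :=
  ∀ (N : Type u) [L.Structure N] [Nonempty N] (v : X → N), φ.Realize v → ψ.Realize v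

theorem models_empty_iff {φ : L.Formula X} : (∅ : L.Theory) ⊨ᵇ φ ↔
    ∀ (N : Type u) [L.Structure N] [Nonempty N] (v : X → N), φ.Realize v := by
  constructor
  · intro h N _ _ v
    exact h.realize_formula N
  · intro h N v xs
    rw [Subsingleton.elim xs default]
    exact h N v

/-- Only finitely many variables matter, and they can be renamed into any other set of variables
without renaming the rest. This moves formulas to smaller parameter sets. -/
theorem exists_formula_finset {X : Type*} (θ : L.Formula X) :
    ∃ s : Finset X, ∀ {Y : Type*} (g : s → Y), ∃ θ' : L.Formula Y,
      ∀ {N : Type*} [L.Structure N] (v : X → N) (w : Y → N), (∀ x, w (g x) = v x) →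
        (θ'.Realize w ↔ θ.Realize v) := by
  classical
  refine ⟨θ.freeVarFinset, fun g => ⟨θ.restrictFreeVar g, fun v w h => ?_⟩⟩
  exact BoundedFormula.realize_restrictFreeVar v h

theorem exists_finset_realize_congr {X : Type*} (θ : L.Formula X) :
    ∃ s : Finset X, ∀ {N : Type*} [L.Structure N] (v w : X → N), (∀ x ∈ s, v x = w x) →
        (θ.Realize v ↔ θ.Realize w) := by
  classical
  refine ⟨θ.freeVarFinset, fun v w h => ?_⟩
  have h1 : Formula.Realize (θ.restrictFreeVar (fun x : θ.freeVarFinset => x) : L.Formula _) (fun x => v x) ↔ θ.Realize v :=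
    BoundedFormula.realize_restrictFreeVar v fun x => rfl
  have h2 : Formula.Realize (θ.restrictFreeVar (fun x : θ.freeVarFinset => x) : L.Formula _) (fun x => v x) ↔ θ.Realize w :=
    BoundedFormula.realize_restrictFreeVar w fun x => h x x.2
  exact h1.symm.trans h2

/-- Existential quantification over an arbitrary family of variables. -/
theorem exists_formula_exists {X Y : Type*} (χ : L.Formula (X ⊕ Y)) :
    ∃ χ' : L.Formula X, ∀ {N : Type*} [L.Structure N] [Nonempty N] (v : X → N),
      χ'.Realize v ↔ ∃ w : Y → N, χ.Realize (Sum.elim v w) := by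
  classical
  obtain ⟨s, hs⟩ := exists_formula_finset χ
  obtain ⟨χ₁, hχ₁⟩ := hs (Y := X ⊕ s.toRight) fun z => match z with
    | ⟨Sum.inl x, _⟩ => Sum.inl x
    | ⟨Sum.inr y, hy⟩ => Sum.inr ⟨y, Finset.mem_toRight.2 hy⟩
  refine ⟨χ₁.iExs s.toRight, fun {N} _ _ v => ?_⟩
  rw [Formula.realize_iExs]
  constructor
  · rintro ⟨w, hw⟩
    refine ⟨fun y => if h : y ∈ s.toRight then w ⟨y, h⟩ else Classical.arbitrary N, ?_⟩
    refine (hχ₁ _ _ ?_).1 hw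
    rintro ⟨x | y, hy⟩
    · rfl
    · show w _ = dite _ _ _
      rw [dif_pos (Finset.mem_toRight.2 hy)]
  · rintro ⟨w, hw⟩
    refine ⟨fun y => w y, (hχ₁ _ _ ?_).2 hw⟩
    rintro ⟨x | y, hy⟩ <;> rfl

end Formulas

/-- A Boolean valuation of the formulas with free variables in `X`: a homomorphism from the
Lindenbaum algebra to `B`. -/
@[ext]
structure PreVal (L : FirstOrder.Language.{0, 0}) (B : Type u) [CompleteBooleanAlgebra B]
    (X : Type u) where
  val : L.Formula X → B
  val_valid : ∀ φ : L.Formula X, (∅ : L.Theory) ⊨ᵇ φ → val φ = ⊤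
  val_not : ∀ φ : L.Formula X, val φ.not = (val φ)ᶜ
  val_inf : ∀ φ ψ : L.Formula X, val (φ ⊓ ψ) = val φ ⊓ val ψ

namespace PreVal

variable {L : FirstOrder.Language.{0, 0}} {B : Type u} [CompleteBooleanAlgebra B] {X Y Z : Type u}

theorem mono (V : PreVal L B X) {φ ψ : L.Formula X} (h : FormulaEntails φ ψ) :
    V.val φ ≤ V.val ψ := by
  have h1 : V.val (φ ⊓ ψ.not).not = ⊤ := by
    apply V.val_valid
    rw [models_empty_iff]
    intro N _ _ v
    simp only [Formula.realize_not, Formula.realize_inf, not_and, not_not]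
    exact h N v
  rw [V.val_not, V.val_inf, V.val_not, compl_eq_top] at h1
  simpa using (disjoint_iff.2 h1).le_compl_right

theorem congr (V : PreVal L B X) {φ ψ : L.Formula X}
    (h : ∀ (N : Type u) [L.Structure N] [Nonempty N] (v : X → N), φ.Realize v ↔ ψ.Realize v) :
    V.val φ = V.val ψ :=
  le_antisymm (V.mono fun N _ _ v => (h N v).1) (V.mono fun N _ _ v => (h N v).2)

theorem val_top (V : PreVal L B X) : V.val ⊤ = ⊤ :=
  V.val_valid _ (models_empty_iff.2 fun N _ _ v => by simp)

theorem exists_inf (V : PreVal L B X) {ι : Type*} (s : Finset ι) (φ : ι → L.Formula X) :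
    ∃ ψ : L.Formula X, V.val ψ = ⨅ i ∈ s, V.val (φ i) ∧
      ∀ (N : Type u) [L.Structure N] (v : X → N), ψ.Realize v ↔ ∀ i ∈ s, (φ i).Realize v := by
  classical
  induction s using Finset.induction_on with
  | empty => exact ⟨⊤, by simp [V.val_top], by simp⟩
  | insert i s hi ih =>
    obtain ⟨ψ, h1, h2⟩ := ih
    refine ⟨φ i ⊓ ψ, by rw [V.val_inf, h1, Finset.iInf_insert], fun N _ v => ?_⟩
    rw [Formula.realize_inf, h2]
    simp

/-- The negation of an unsatisfiable formula is valid, so such a formula has value `⊥`. -/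
theorem exists_realize (V : PreVal L B X) {φ : L.Formula X} (h : V.val φ ≠ ⊥) :
    ∃ (N : Type u) (_ : L.Structure N) (_ : Nonempty N) (v : X → N), φ.Realize v := by
  by_contra! hcon
  refine h ?_
  rw [← compl_eq_top, ← V.val_not]
  exact V.val_valid _ (models_empty_iff.2 fun N _ _ v => Formula.realize_not.2 (hcon N _ ‹_› v))

theorem exists_realize_finset (V : PreVal L B X) {ι : Type*} {s : Finset ι} {φ : ι → L.Formula X}
    (h : (⨅ i ∈ s, V.val (φ i)) ≠ ⊥) :
    ∃ (N : Type u) (_ : L.Structure N) (_ : Nonempty N) (v : X → N), ∀ i ∈ s, (φ i).Realize v := by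
  obtain ⟨ψ, h1, h2⟩ := V.exists_inf s φ
  obtain ⟨N, i1, i2, v, hv⟩ := V.exists_realize (h1 ▸ h)
  exact ⟨N, i1, i2, v, (h2 N v).1 hv⟩

theorem iInf_le_of_entails (V : PreVal L B X) {ι : Type*} {s : Finset ι} {φ : ι → L.Formula X}
    {ψ : L.Formula X} (h : ∀ (N : Type u) [L.Structure N] [Nonempty N] (v : X → N),
      (∀ i ∈ s, (φ i).Realize v) → ψ.Realize v) : (⨅ i ∈ s, V.val (φ i)) ≤ V.val ψ := by
  obtain ⟨χ, h1, h2⟩ := V.exists_inf s φ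
  rw [← h1]
  exact V.mono fun N _ _ v hv => h N v ((h2 N v).1 hv)

theorem mem_of_entails (V : PreVal L B X) {W : Order.PFilter B} {ι : Type*} {s : Finset ι}
    {φ : ι → L.Formula X} {ψ : L.Formula X} (hmem : ∀ i ∈ s, V.val (φ i) ∈ W)
    (h : ∀ (N : Type u) [L.Structure N] [Nonempty N] (v : X → N),
      (∀ i ∈ s, (φ i).Realize v) → ψ.Realize v) : V.val ψ ∈ W :=
  Order.PFilter.mem_of_le (V.iInf_le_of_entails h) (Order.PFilter.finset_iInf_mem hmem)

/-- The inequality for the negated formula is the reverse inequality. -/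
theorem eq_of_le {V V' : PreVal L B X} (h : ∀ φ, V.val φ ≤ V'.val φ) : V = V' := by
  ext φ
  refine le_antisymm (h φ) ?_
  have := h φ.not
  rwa [V.val_not, V'.val_not, compl_le_compl_iff_le] at this

theorem val_relabel_eq_of_le {V : PreVal L B X} {V' : PreVal L B Y} {f : Z → X} {g : Z → Y}
    (h : ∀ φ : L.Formula Z, V.val (φ.relabel f) ≤ V'.val (φ.relabel g)) (φ : L.Formula Z) :
    V.val (φ.relabel f) = V'.val (φ.relabel g) := by
  refine le_antisymm (h φ) ?_
  have h1 := h φ.not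
  have h2 : V.val (φ.not.relabel f) = (V.val (φ.relabel f))ᶜ := by
    rw [← V.val_not]
    exact V.congr fun N _ _ v => by simp [Formula.realize_relabel]
  have h3 : V'.val (φ.not.relabel g) = (V'.val (φ.relabel g))ᶜ := by
    rw [← V'.val_not]
    exact V'.congr fun N _ _ v => by simp [Formula.realize_relabel]
  rwa [h2, h3, compl_le_compl_iff_le] at h1

/-- Substitution of variables in a valuation. -/
def comap (V : PreVal L B X) (f : Y → X) : PreVal L B Y where
  val φ := V.val (φ.relabel f)
  val_valid φ h := V.val_valid _ (models_empty_iff.2 fun N _ _ v => by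
    rw [Formula.realize_relabel]
    exact models_empty_iff.1 h N _)
  val_not φ := by
    rw [← V.val_not]
    exact V.congr fun N _ _ v => by simp [Formula.realize_relabel]
  val_inf φ ψ := by
    rw [← V.val_inf]
    exact V.congr fun N _ _ v => by simp [Formula.realize_relabel]

@[simp]
theorem comap_val (V : PreVal L B X) (f : Y → X) (φ : L.Formula Y) :
    (V.comap f).val φ = V.val (φ.relabel f) := rfl

theorem val_relabel_relabel (V : PreVal L B X) (f : Y → X) (g : Z → Y) (φ : L.Formula Z) :
    V.val ((φ.relabel g).relabel f) = V.val (φ.relabel (f ∘ g)) :=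
  V.congr fun N _ _ v => by simp [Formula.realize_relabel, Function.comp_assoc]

theorem comap_comap (V : PreVal L B X) (f : Y → X) (g : Z → Y) :
    (V.comap f).comap g = V.comap (f ∘ g) := by
  ext φ
  exact V.val_relabel_relabel f g φ

/-- Replacing variables by variables with the same value does not change the value. -/
theorem val_relabel_eq (V : PreVal L B X) {f g : Y → X}
    (h : ∀ y, V.val (L.paramEq (f y) (g y)) = ⊤) (φ : L.Formula Y) :
    V.val (φ.relabel f) = V.val (φ.relabel g) := by
  refine val_relabel_eq_of_le (fun φ => ?_) φ
  -- The formula and the finitely many equations between its relevant variables entail the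
  -- relabelled formula, and all the equations have value `⊤`.
  obtain ⟨s, hs⟩ := exists_finset_realize_congr φ
  have h1 := V.iInf_le_of_entails (s := Finset.insertNone s)
    (φ := fun o : Option Y => o.elim (φ.relabel f) fun y => L.paramEq (f y) (g y)) (ψ := φ.relabel g) (by
      intro N _ _ v hv
      have h0 := hv none (by simp)
      simp only [Option.elim, Formula.realize_relabel] at h0 ⊢
      refine (hs _ _ fun y hy => ?_).1 h0
      have := hv (some y) (by simpa using hy)
      simpa [paramEq] using this)
  refine le_trans (le_iInf₂ fun o ho => ?_) h1
  rcases o with _ | y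
  · exact le_rfl
  · exact le_top.trans (h y).ge

/-- A multiplicative, consistent lower bound for valuations. -/
structure IsBFilter (G : L.Formula X → B) : Prop where
  mono : ∀ φ ψ, FormulaEntails φ ψ → G φ ≤ G ψ
  top : G ⊤ = ⊤
  bot : G ⊥ = ⊥
  inf : ∀ φ ψ, G φ ⊓ G ψ ≤ G (φ ⊓ ψ)

theorem IsBFilter.iSup {c : Set (L.Formula X → B)} (hc : ∀ G ∈ c, IsBFilter G)
    (hchain : IsChain (· ≤ ·) c) (hne : c.Nonempty) :
    IsBFilter fun φ => ⨆ G ∈ c, G φ where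
  mono φ ψ h := iSup₂_mono fun G hG => (hc G hG).mono φ ψ h
  top := by
    obtain ⟨G, hG⟩ := hne
    exact top_le_iff.1 ((hc G hG).top.symm.trans_le (le_iSup₂_of_le (f := fun G _ => G ⊤) G hG le_rfl))
  bot := le_bot_iff.1 (iSup₂_le fun G hG => (hc G hG).bot.le)
  inf φ ψ := by
    simp only [iSup_inf_eq, inf_iSup_eq]
    refine iSup₂_le fun G' hG' => iSup₂_le fun G hG => ?_
    rcases hchain.total hG hG' with h | h
    · exact (inf_le_inf_right _ (h _)).trans (((hc G' hG').inf φ ψ).trans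
        (le_iSup₂_of_le (f := fun G _ => G (φ ⊓ ψ)) G' hG' le_rfl))
    · exact (inf_le_inf_left _ (h _)).trans (((hc G hG).inf φ ψ).trans
        (le_iSup₂_of_le (f := fun G _ => G (φ ⊓ ψ)) G hG le_rfl))

/-- The element `(G χ.not)ᶜ` is the largest part on which `χ` is not refuted. There `χ` is added as
an axiom, and nothing changes elsewhere. -/
theorem IsBFilter.adjoin {G : L.Formula X → B} (hG : IsBFilter G) (χ : L.Formula X) :
    IsBFilter fun φ => G φ ⊔ ((G χ.not)ᶜ ⊓ G (χ.imp φ)) where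
  mono φ ψ h := sup_le_sup (hG.mono _ _ h) (inf_le_inf_left _ (hG.mono _ _ fun N _ _ v => by
    simp only [Formula.realize_imp]
    exact fun h1 h2 => h N v (h1 h2)))
  top := by simp [hG.top]
  bot := by
    rw [hG.bot, bot_sup_eq, ← le_bot_iff]
    refine (inf_le_inf_left _ (hG.mono _ χ.not fun N _ _ v => ?_)).trans (by simp)
    simp
  inf φ ψ := by
    rw [inf_sup_left, inf_sup_right, inf_sup_right]
    have himp : ∀ θ : L.Formula X, G θ ≤ G (χ.imp θ) := fun θ => hG.mono _ _ fun N _ _ v => by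
      simp only [Formula.realize_imp]
      exact fun h _ => h
    have hinf : G (χ.imp φ) ⊓ G (χ.imp ψ) ≤ G (χ.imp (φ ⊓ ψ)) :=
      (hG.inf _ _).trans (hG.mono _ _ fun N _ _ v => by
        simp only [Formula.realize_imp, Formula.realize_inf]
        exact fun h h' => ⟨h.1 h', h.2 h'⟩)
    refine sup_le (sup_le ((hG.inf _ _).trans le_sup_left) ?_) (sup_le ?_ ?_)
    · refine le_sup_of_le_right (le_inf (inf_le_left.trans inf_le_left) (le_trans ?_ hinf))
      exact inf_le_inf inf_le_right (himp ψ)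
    · refine le_sup_of_le_right (le_inf (inf_le_right.trans inf_le_left) (le_trans ?_ hinf))
      exact inf_le_inf (himp φ) inf_le_right
    · refine le_sup_of_le_right (le_inf (inf_le_right.trans inf_le_left) (le_trans ?_ hinf))
      exact inf_le_inf inf_le_right inf_le_right

/-- This is the ultrafilter lemma with values in `B`: a maximal multiplicative lower bound commutes
with negation. -/
theorem IsBFilter.exists_preVal {G : L.Formula X → B} (hG : IsBFilter G) :
    ∃ V : PreVal L B X, ∀ φ, G φ ≤ V.val φ := by
  obtain ⟨H, hGH, hH⟩ := zorn_le_nonempty₀ {G : L.Formula X → B | IsBFilter G}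
    (fun c hc hchain y hy => ⟨_, IsBFilter.iSup hc hchain ⟨y, hy⟩, fun z hz φ =>
      le_iSup₂_of_le (f := fun G _ => G φ) z hz le_rfl⟩) G hG
  have hHf : IsBFilter H := hH.1
  have hnot : ∀ φ, H φ.not = (H φ)ᶜ := by
    intro φ
    refine le_antisymm ?_ ?_
    · refine (disjoint_iff.2 (le_bot_iff.1 ((hHf.inf _ _).trans ?_))).le_compl_right
      rw [← hHf.bot]
      exact hHf.mono _ _ fun N _ _ v => by simp
    -- Maximality against adjoining `φ` gives `(H φ.not)ᶜ ≤ H φ`, as `φ.imp φ` has value `⊤`.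
    · have h1 := hH.2 (hHf.adjoin φ) (fun ψ => le_sup_left) φ
      have h2 : H (φ.imp φ) = ⊤ := by
        rw [← top_le_iff, ← hHf.top]
        exact hHf.mono _ _ fun N _ _ v => by simp
      simp only [h2, inf_top_eq] at h1
      rw [compl_le_iff_compl_le]
      exact le_sup_right.trans h1
  refine ⟨⟨H, fun φ hφ => ?_, hnot, fun φ ψ => le_antisymm (le_inf ?_ ?_) (hHf.inf φ ψ)⟩, hGH⟩
  · rw [← top_le_iff, ← hHf.top]
    exact hHf.mono _ _ fun N _ _ v _ => models_empty_iff.1 hφ N v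
  · exact hHf.mono _ _ fun N _ _ v h => (Formula.realize_inf.1 h).1
  · exact hHf.mono _ _ fun N _ _ v h => (Formula.realize_inf.1 h).2

/-- Compactness for Boolean valuations. -/
theorem exists_of_finitely_satisfiable {ι : Type*} (φ : ι → L.Formula X) (b : ι → B)
    (h : ∀ s : Finset ι, (⨅ i ∈ s, b i) ≠ ⊥ →
      ∃ (N : Type u) (_ : L.Structure N) (_ : Nonempty N) (v : X → N), ∀ i ∈ s, (φ i).Realize v) :
    ∃ V : PreVal L B X, ∀ i, b i ≤ V.val (φ i) := by
  classical
  -- The generated filter: a formula receives the join of the meets of all finite sets of conditions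
  -- which entail it. The hypothesis makes the value of `⊥` vanish.
  let G : L.Formula X → B := fun ψ => ⨆ s : {s : Finset ι // ∀ (N : Type u) [L.Structure N]
    [Nonempty N] (v : X → N), (∀ i ∈ s, (φ i).Realize v) → ψ.Realize v}, ⨅ i ∈ s.1, b i
  have hG : IsBFilter G := by
    refine ⟨fun ψ χ h => ?_, ?_, ?_, fun ψ χ => ?_⟩
    · refine iSup_le fun s => ?_
      exact le_iSup_of_le ⟨s.1, fun N _ _ v hv => h N v (s.2 N v hv)⟩ le_rfl
    · rw [← top_le_iff]
      exact le_iSup_of_le ⟨∅, fun N _ _ v _ => by simp⟩ (by simp)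
    · rw [← le_bot_iff]
      refine iSup_le fun s => ?_
      by_contra hne
      obtain ⟨N, i1, i2, v, hv⟩ := h s.1 (by simpa using hne)
      exact Formula.realize_bot.1 (s.2 N v hv)
    · simp only [G, iSup_inf_eq, inf_iSup_eq]
      refine iSup_le fun s => iSup_le fun t => ?_
      refine le_iSup_of_le ⟨s.1 ∪ t.1, fun N _ _ v hv => Formula.realize_inf.2
        ⟨t.2 N v fun i hi => hv i (by simp [hi]), s.2 N v fun i hi => hv i (by simp [hi])⟩⟩ ?_
      rw [Finset.iInf_union, inf_comm]
  obtain ⟨V, hV⟩ := hG.exists_preVal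
  refine ⟨V, fun i => le_trans ?_ (hV _)⟩
  exact le_iSup_of_le (f := fun s : {s : Finset ι // _} => ⨅ i ∈ s.1, b i)
    ⟨{i}, fun N _ _ v hv => hv i (by simp)⟩ (by simp)

end PreVal

/-- The valuation underlying a Boolean-valued structure. -/
def BVStructure.toPreVal {L : FirstOrder.Language.{0, 0}} {B : Type u} [CompleteBooleanAlgebra B]
    {M : Type u} (S : BVStructure L B M) : PreVal L B M :=
  ⟨S.val, S.val_valid, S.val_not, S.val_inf⟩

@[simp]
theorem BVStructure.toPreVal_val {L : FirstOrder.Language.{0, 0}} {B : Type u}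
    [CompleteBooleanAlgebra B] {M : Type u} (S : BVStructure L B M) (φ : L.Formula M) :
    S.toPreVal.val φ = S.val φ := rfl


/-! ### Existence of full saturated Boolean-valued structures -/

namespace PreVal

variable {L : FirstOrder.Language.{0, 0}} {B : Type u} [CompleteBooleanAlgebra B] {X Y : Type u}

/-- A valuation extends to new variables realizing a given formula as much as possible. -/
theorem exists_extend (V : PreVal L B X) (χ : L.Formula (X ⊕ Y)) {χ' : L.Formula X}
    (hχ : ∀ {N : Type u} [L.Structure N] [Nonempty N] (v : X → N),
      χ'.Realize v ↔ ∃ w : Y → N, χ.Realize (Sum.elim v w)) :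
    ∃ V' : PreVal L B (X ⊕ Y), V'.comap Sum.inl = V ∧ V.val χ' ≤ V'.val χ := by
  obtain ⟨V', hV'⟩ := exists_of_finitely_satisfiable (X := X ⊕ Y) (ι := Option (L.Formula X))
    (fun o => o.elim χ fun θ => θ.relabel Sum.inl) (fun o => o.elim (V.val χ') fun θ => V.val θ) (by
      intro s hs
      obtain ⟨N, i1, i2, v, hv⟩ := V.exists_realize_finset (s := s)
        (φ := fun o => o.elim χ' id) (by
          convert hs using 4 with o ho
          cases o <;> rfl)
      by_cases hnone : none ∈ s
      · obtain ⟨w, hw⟩ := (hχ v).1 (hv none hnone)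
        refine ⟨N, i1, i2, Sum.elim v w, fun o ho => ?_⟩
        rcases o with _ | θ
        · exact hw
        · simpa [Formula.realize_relabel] using hv (some θ) ho
      · refine ⟨N, i1, i2, Sum.elim v fun _ => Classical.arbitrary N, fun o ho => ?_⟩
        rcases o with _ | θ
        · exact absurd ho hnone
        · simpa [Formula.realize_relabel] using hv (some θ) ho)
  exact ⟨V', (eq_of_le fun θ => hV' (some θ)).symm, hV' none⟩

end PreVal

/-- Hereditary names: a name is a base name or one of the new elements of an extension, described by
a valuation, of a family of names. -/
inductive BVName (L : FirstOrder.Language.{0, 0}) (B : Type u) [CompleteBooleanAlgebra B]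
    (K X : Type u) : Type u
  | base : X → BVName L B K X
  | new : PreVal L B (K ⊕ K) → (K → BVName L B K X) → K → BVName L B K X

namespace BVName

variable {L : FirstOrder.Language.{0, 0}} {B : Type u} [CompleteBooleanAlgebra B] {K X : Type u}

/-- The old and new elements of an extension. -/
def out (c : PreVal L B (K ⊕ K)) (args : K → BVName L B K X) : K ⊕ K → BVName L B K X :=
  Sum.elim args (new c args)

/-- The valuations agree on the formulas with variables in `D`. -/
def AgreeOn (D : Set (BVName L B K X)) (V V' : PreVal L B (BVName L B K X)) : Prop :=
  ∀ θ : L.Formula D, V.val (θ.relabel (↑)) = V'.val (θ.relabel (↑))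

theorem AgreeOn.comap_eq {D : Set (BVName L B K X)} {V V' : PreVal L B (BVName L B K X)}
    (h : AgreeOn D V V') {Y : Type u} (f : Y → BVName L B K X) (hf : ∀ y, f y ∈ D) :
    V.comap f = V'.comap f := by
  ext φ
  have := h (φ.relabel fun y => ⟨f y, hf y⟩)
  rwa [V.val_relabel_relabel, V'.val_relabel_relabel] at this

theorem AgreeOn.mono {D D' : Set (BVName L B K X)} {V V' : PreVal L B (BVName L B K X)}
    (h : AgreeOn D V V') (hD : D' ⊆ D) : AgreeOn D' V V' := fun θ =>
  congrArg (fun W => W.val θ) (h.comap_eq (fun x : D' => (x : BVName L B K X)) fun x => hD x.2)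

/-- The new elements realize the type they were added for. -/
def IsRealizing (V : PreVal L B (BVName L B K X)) (c : PreVal L B (K ⊕ K))
    (args : K → BVName L B K X) : Prop :=
  V.comap args = c.comap Sum.inl → V.comap (out c args) = c

variable (L B K X) in
/-- A partially constructed saturated structure. -/
structure Stage (q : PreVal L B X) where
  dom : Set (BVName L B K X)
  val : PreVal L B (BVName L B K X)
  base_mem : ∀ x, base x ∈ dom
  base_val : val.comap base = q
  closed : ∀ c args j, new c args j ∈ dom → (∀ k, args k ∈ dom) ∧ (∀ k, new c args k ∈ dom) ∧
    IsRealizing val c args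

variable {q : PreVal L B X}

namespace Stage

def Le (S S' : Stage L B K X q) : Prop := S.dom ⊆ S'.dom ∧ AgreeOn S.dom S.val S'.val

theorem Le.trans {S S' S'' : Stage L B K X q} (h : S.Le S') (h' : S'.Le S'') : S.Le S'' :=
  ⟨h.1.trans h'.1, fun θ => (h.2 θ).trans ((h'.2.mono h.1) θ)⟩

theorem Le.refl (S : Stage L B K X q) : S.Le S := ⟨subset_rfl, fun _ => rfl⟩

theorem out_mem (S : Stage L B K X q) {c : PreVal L B (K ⊕ K)} {args : K → BVName L B K X} {j : K}
    (h : new c args j ∈ S.dom) (y : K ⊕ K) : out c args y ∈ S.dom := by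
  rcases y with k | k
  · exact (S.closed c args j h).1 k
  · exact (S.closed c args j h).2.1 k

theorem exists_initial (q : PreVal L B X) : Nonempty (Stage L B K X q) := by
  obtain ⟨V, hV⟩ := PreVal.exists_of_finitely_satisfiable (B := B) (X := BVName L B K X)
    (fun θ : L.Formula X => θ.relabel base) q.val (by
      intro s hs
      obtain ⟨N, i1, i2, v, hv⟩ := q.exists_realize_finset hs
      refine ⟨N, i1, i2, fun n => match n with
        | base x => v x
        | new _ _ _ => Classical.arbitrary N, fun θ hθ => ?_⟩
      rw [Formula.realize_relabel]
      exact hv θ hθ)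
  refine ⟨⟨Set.range base, V, fun x => ⟨x, rfl⟩, (PreVal.eq_of_le hV).symm, ?_⟩⟩
  rintro c args j ⟨x, hx⟩
  cases hx

/-- The valuations of a chain agree only on the smaller domains, so they have no union as total
valuations. Compactness provides a common extension, since finitely many conditions live in one
member of the chain. -/
theorem exists_upper_bound {c : Set (Stage L B K X q)} (hc : IsChain Le c) (hne : c.Nonempty) :
    ∃ S : Stage L B K X q, ∀ S' ∈ c, S'.Le S := by
  classical
  have hmax : ∀ s : Finset c, s.Nonempty → ∃ m : c, ∀ S ∈ s, S.1.Le m.1 := by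
    intro s hs
    induction hs using Finset.Nonempty.cons_induction with
    | singleton a => exact ⟨a, by simp [Le.refl]⟩
    | cons a s ha hs ih =>
      obtain ⟨m, hm⟩ := ih
      by_cases ham : a = m
      · subst ham
        refine ⟨a, fun S hS => ?_⟩
        rcases Finset.mem_cons.1 hS with rfl | hS
        · exact Le.refl _
        · exact hm S hS
      · rcases hc a.2 m.2 (fun h => ham (Subtype.ext h)) with h | h
        · refine ⟨m, fun S hS => ?_⟩
          rcases Finset.mem_cons.1 hS with rfl | hS
          · exact h
          · exact hm S hS
        · refine ⟨a, fun S hS => ?_⟩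
          rcases Finset.mem_cons.1 hS with rfl | hS
          · exact Le.refl _
          · exact (hm S hS).trans h
  obtain ⟨S₀, hS₀⟩ := hne
  obtain ⟨V, hV⟩ := PreVal.exists_of_finitely_satisfiable (B := B) (X := BVName L B K X)
    (ι := Σ S : c, L.Formula S.1.dom) (fun p => p.2.relabel (↑))
    (fun p => p.1.1.val.val (p.2.relabel (↑))) (by
      intro s hs
      obtain ⟨m, hm⟩ := hmax (insert ⟨S₀, hS₀⟩ (s.image Sigma.fst)) (by simp)
      refine m.1.val.exists_realize_finset (s := s) (φ := fun p => p.2.relabel (↑)) ?_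
      convert hs using 4 with p hp
      exact ((hm p.1 (Finset.mem_insert_of_mem (Finset.mem_image_of_mem _ hp))).2 p.2).symm)
  have hagree : ∀ S ∈ c, AgreeOn S.dom S.val V := fun S hS θ => by
    have h1 : S.val.comap (↑) = V.comap ((↑) : S.dom → _) :=
      PreVal.eq_of_le fun θ => hV ⟨⟨S, hS⟩, θ⟩
    exact congrArg (fun W => W.val θ) h1
  refine ⟨⟨⋃ S ∈ c, S.dom, V, fun x => Set.mem_biUnion hS₀ (S₀.base_mem x), ?_, ?_⟩,
    fun S hS => ⟨Set.subset_biUnion_of_mem hS, hagree S hS⟩⟩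
  · rw [← (hagree S₀ hS₀).comap_eq _ S₀.base_mem, S₀.base_val]
  · intro e args j hj
    obtain ⟨S, hS, hjS⟩ := Set.mem_iUnion₂.1 hj
    obtain ⟨h1, h2, h3⟩ := S.closed e args j hjS
    refine ⟨fun k => Set.mem_biUnion hS (h1 k), fun k => Set.mem_biUnion hS (h2 k), ?_⟩
    rw [IsRealizing, ← (hagree S hS).comap_eq _ h1, ← (hagree S hS).comap_eq _ (S.out_mem hjS)]
    exact h3

/-- Amalgamation of the valuation on the domain with `c` along `args`. A finite part `χ` of `c` has
value at most that of its existential closure over the old variables, and the two valuations agree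
on the latter by the matching hypothesis; if they do not match there is nothing to realize. -/
theorem exists_val_extend (S : Stage L B K X q) {c : PreVal L B (K ⊕ K)}
    {args : K → BVName L B K X} (hargs : ∀ k, args k ∈ S.dom)
    (hnew : ∀ k, new c args k ∉ S.dom) :
    ∃ V : PreVal L B (BVName L B K X), AgreeOn S.dom S.val V ∧ IsRealizing V c args := by
  classical
  by_cases hc : S.val.comap args = c.comap Sum.inl
  swap
  · exact ⟨S.val, fun _ => rfl, fun h => absurd h hc⟩
  obtain ⟨V, hV⟩ := PreVal.exists_of_finitely_satisfiable (B := B) (X := BVName L B K X)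
    (ι := L.Formula S.dom ⊕ L.Formula (K ⊕ K))
    (Sum.elim (fun θ => θ.relabel (↑)) fun θ => θ.relabel (out c args))
    (Sum.elim (fun θ => S.val.val (θ.relabel (↑))) c.val) (by
      intro s hs
      obtain ⟨χ, hχ1, hχ2⟩ := c.exists_inf s.toRight id
      obtain ⟨χ', hχ'⟩ := exists_formula_exists χ
      obtain ⟨N, i1, i2, v, hv⟩ := S.val.exists_realize_finset
        (s := Finset.insertNone s.toLeft)
        (φ := fun o => o.elim (χ'.relabel args) fun θ => θ.relabel (↑)) (by
          intro hbot
          refine hs (le_bot_iff.1 ((le_iInf₂ fun o ho => ?_).trans hbot.le))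
          rcases o with _ | θ
          · have h1 : S.val.val (χ'.relabel args) = c.val (χ'.relabel Sum.inl) :=
              congrArg (fun W => W.val χ') hc
            simp only [Option.elim]
            rw [h1]
            have h2 : c.val χ ≤ c.val (χ'.relabel Sum.inl) := c.mono fun N _ _ v hv => by
              rw [Formula.realize_relabel, hχ']
              exact ⟨v ∘ Sum.inr, by rwa [Sum.elim_comp_inl_inr]⟩
            refine le_trans ?_ h2
            rw [hχ1]
            exact le_iInf₂ fun θ hθ => iInf₂_le (Sum.inr θ : _ ⊕ _) (Finset.mem_toRight.1 hθ)
          · exact iInf₂_le (Sum.inl θ : _ ⊕ _) (by simpa using ho))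
      have h0 := hv none (by simp)
      simp only [Option.elim, Formula.realize_relabel, hχ'] at h0
      obtain ⟨w, hw⟩ := h0
      -- The new names are outside the domain, so their interpretation can be overwritten by the
      -- witnesses.
      obtain ⟨v', hv'1, hv'2⟩ : ∃ v' : BVName L B K X → N, (∀ n ∈ S.dom, v' n = v n) ∧
          ∀ k, v' (new c args k) = w k := by
        refine ⟨fun n => if h : ∃ j, n = new c args j then w h.choose else v n, ?_, fun k => ?_⟩
        · intro n hn
          refine dif_neg ?_
          rintro ⟨j, rfl⟩
          exact hnew j hn
        · have hk : ∃ j, new c args k = new c args j := ⟨k, rfl⟩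
          refine (dif_pos hk).trans ?_
          exact congrArg w (new.inj hk.choose_spec).2.2.symm
      refine ⟨N, i1, i2, v', ?_⟩
      rintro (θ | θ) hθ
      · have := hv (some θ) (by simpa using hθ)
        simp only [Option.elim, Formula.realize_relabel, Sum.elim_inl] at this ⊢
        rwa [show v' ∘ ((↑) : S.dom → _) = v ∘ (↑) from funext fun x => hv'1 _ x.2]
      · have := (hχ2 N _).1 hw θ (Finset.mem_toRight.2 hθ)
        simp only [Formula.realize_relabel, Sum.elim_inr, id] at this ⊢
        rwa [show v' ∘ out c args = Sum.elim (v ∘ args) w by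
          funext x
          rcases x with k | k
          · exact hv'1 _ (hargs k)
          · exact hv'2 k])
  refine ⟨V, fun θ => ?_, fun _ => ?_⟩
  · have h1 : S.val.comap (↑) = V.comap ((↑) : S.dom → _) :=
      PreVal.eq_of_le fun θ => hV (Sum.inl θ)
    exact congrArg (fun W => W.val θ) h1
  · exact (PreVal.eq_of_le fun θ => hV (Sum.inr θ)).symm

theorem exists_extend (S : Stage L B K X q) {c : PreVal L B (K ⊕ K)}
    {args : K → BVName L B K X} (hargs : ∀ k, args k ∈ S.dom)
    (hnew : ∀ k, new c args k ∉ S.dom) :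
    ∃ S' : Stage L B K X q, S.Le S' ∧ ∀ k, new c args k ∈ S'.dom := by
  obtain ⟨V, hV, hVc⟩ := S.exists_val_extend hargs hnew
  refine ⟨⟨S.dom ∪ Set.range (new c args), V, fun x => Or.inl (S.base_mem x), ?_, ?_⟩,
    ⟨Set.subset_union_left, hV⟩, fun k => Or.inr ⟨k, rfl⟩⟩
  · rw [← hV.comap_eq _ S.base_mem, S.base_val]
  · rintro e args' j (hj | ⟨k, hk⟩)
    · obtain ⟨h1, h2, h3⟩ := S.closed e args' j hj
      refine ⟨fun k => Or.inl (h1 k), fun k => Or.inl (h2 k), ?_⟩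
      rw [IsRealizing, ← hV.comap_eq _ h1, ← hV.comap_eq _ (S.out_mem hj)]
      exact h3
    · simp only [new.injEq] at hk
      obtain ⟨rfl, rfl, rfl⟩ := hk
      exact ⟨fun k => Or.inl (hargs k), fun k => Or.inr ⟨k, rfl⟩, hVc⟩

end Stage

/-- There is a valuation on all names extending `q` and realizing all extensions. -/
theorem exists_val [Nonempty K] (q : PreVal L B X) : ∃ V : PreVal L B (BVName L B K X),
    V.comap base = q ∧ ∀ c args, IsRealizing V c args := by
  obtain ⟨k₀⟩ := ‹Nonempty K›
  obtain ⟨S, hS⟩ := exists_maximal_of_chains_bounded (r := Stage.Le (L := L) (K := K) (q := q))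
    (fun c hc => by
      rcases c.eq_empty_or_nonempty with rfl | hne
      · obtain ⟨S⟩ := Stage.exists_initial (K := K) q
        exact ⟨S, by simp⟩
      · exact Stage.exists_upper_bound hc hne) Stage.Le.trans
  -- By induction on names: once the arguments are in the domain, the new names must be, since
  -- otherwise the maximal stage could be extended.
  have hall : ∀ n, n ∈ S.dom := by
    intro n
    induction n with
    | base x => exact S.base_mem x
    | new c args j ih =>
      by_contra hj
      obtain ⟨S', h1, h2⟩ := S.exists_extend (c := c) (args := args) ih
        (fun k hk => hj ((S.closed c args k hk).2.1 j))
      exact hj ((hS S' h1).1 (h2 j))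
  exact ⟨S.val, S.base_val, fun c args => (S.closed c args k₀ (hall _)).2.2⟩

theorem realize_ex_iff {Y N : Type*} [L.Structure N] (χ : L.BoundedFormula Y 1) (v : Y → N) :
    Formula.Realize χ.ex v ↔ ∃ a, χ.toFormula.Realize (Sum.elim v fun _ => a) := by
  rw [Formula.Realize, BoundedFormula.realize_ex]
  refine exists_congr fun a => ?_
  rw [BoundedFormula.realize_toFormula]
  simp only [Sum.elim_comp_inl, Sum.elim_comp_inr]
  refine iff_of_eq (congrArg _ (funext fun i => ?_))
  rw [show i = Fin.last 0 from Fin.ext (by omega), Fin.snoc_last]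

/-- The finitely many parameters are packed into one `K`-tuple `args`, padded by a base name. An
extension of its valuation realizing the formula as much as possible is a valuation on `K ⊕ K`,
hence one of those for which new names were provided. -/
theorem exists_witness [Infinite K] [Nonempty X] {V : PreVal L B (BVName L B K X)}
    (hV : ∀ c args, IsRealizing V c args) {Y : Type u} (χ : L.BoundedFormula Y 1)
    (f : Y → BVName L B K X) :
    ∃ n, V.val (Formula.relabel f χ.ex) ≤ V.val (χ.toFormula.relabel (Sum.elim f fun _ => n)) := by
  classical
  obtain ⟨s, hs⟩ := exists_formula_finset χ.toFormula
  obtain ⟨e⟩ : Nonempty (s.toLeft ↪ K) :=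
    ⟨(s.toLeft.equivFin.toEmbedding.trans Fin.valEmbedding).trans (Infinite.natEmbedding K)⟩
  obtain ⟨k₀⟩ : Nonempty K := inferInstance
  obtain ⟨θ, hθ⟩ := hs (Y := K ⊕ K) fun z => match z with
    | ⟨Sum.inl y, hy⟩ => Sum.inl (e ⟨y, Finset.mem_toLeft.2 hy⟩)
    | ⟨Sum.inr _, _⟩ => Sum.inr k₀
  obtain ⟨x₀⟩ := ‹Nonempty X›
  let args : K → BVName L B K X := Function.extend e (fun y => f y) fun _ => base x₀
  have hargs : ∀ y, args (e y) = f y := fun y => e.injective.extend_apply _ _ _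
  obtain ⟨θ', hθ'⟩ := exists_formula_exists θ
  obtain ⟨c, hc, hcθ⟩ := (V.comap args).exists_extend θ hθ'
  have hVc : V.comap (out c args) = c := hV c args hc.symm
  refine ⟨new c args k₀, ?_⟩
  calc V.val (Formula.relabel f χ.ex) ≤ V.val (θ'.relabel args) := V.mono fun N _ _ v h => by
        rw [Formula.realize_relabel] at h ⊢
        obtain ⟨a, ha⟩ := (realize_ex_iff χ _).1 h
        refine (hθ' _).2 ⟨fun _ => a, (hθ (Sum.elim (v ∘ f) fun _ => a) _ ?_).2 ha⟩
        rintro ⟨y | i, hy⟩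
        · exact congrArg v (hargs _)
        · rfl
    _ ≤ c.val θ := hcθ
    _ = V.val (θ.relabel (out c args)) := (congrArg (fun W => W.val θ) hVc).symm
    _ ≤ _ := V.mono fun N _ _ v h => by
        rw [Formula.realize_relabel] at h ⊢
        refine (hθ _ _ ?_).1 h
        rintro ⟨y | i, hy⟩
        · exact congrArg v (hargs _)
        · rfl

/-- Names with the same value are identified. -/
def setoid (V : PreVal L B (BVName L B K X)) : Setoid (BVName L B K X) where
  r a b := V.val (L.paramEq a b) = ⊤
  iseqv := {
    refl := fun a => V.val_valid _ (models_empty_iff.2 fun N _ _ v => by simp [paramEq])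
    symm := fun {a b} h => top_le_iff.1 (h.symm.trans_le (V.mono fun N _ _ v => by
      simpa [paramEq] using Eq.symm))
    trans := fun {a b c} h1 h2 => by
      have := V.iInf_le_of_entails (s := Finset.univ)
        (φ := ![L.paramEq a b, L.paramEq b c]) (ψ := L.paramEq a c) (fun N _ _ v h => by
          have h1 := h 0 (by simp)
          have h2 := h 1 (by simp)
          simp only [paramEq, Matrix.cons_val_zero, Matrix.cons_val_one, Formula.realize_equal,
            Term.realize_var] at h1 h2 ⊢
          exact h1.trans h2)
      rw [← top_le_iff]
      refine le_trans (le_iInf₂ fun i _ => ?_) this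
      fin_cases i
      · exact h1.ge
      · exact h2.ge }

theorem val_relabel_out (V : PreVal L B (BVName L B K X)) {Y : Type u}
    (f : Y → BVName L B K X) (φ : L.Formula Y) :
    V.val (φ.relabel fun y => (Quotient.mk (setoid V) (f y)).out) = V.val (φ.relabel f) :=
  V.val_relabel_eq (fun y => Quotient.exact ((Quotient.mk (setoid V) (f y)).out_eq)) φ

/-- The structure on the names modulo equality. -/
noncomputable def structure' [Infinite K] [Nonempty X] (V : PreVal L B (BVName L B K X))
    (hV : ∀ c args, IsRealizing V c args) : BVStructure L B (Quotient (setoid V)) where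
  val φ := V.val (φ.relabel Quotient.out)
  val_valid φ h := (V.comap Quotient.out).val_valid φ h
  val_not φ := (V.comap Quotient.out).val_not φ
  val_inf φ ψ := (V.comap Quotient.out).val_inf φ ψ
  val_ex φ := by
    refine le_antisymm ?_ (iSup_le fun a => (V.comap Quotient.out).mono fun N _ _ v h => ?_)
    · obtain ⟨n, hn⟩ := exists_witness hV φ Quotient.out
      refine hn.trans (le_iSup_of_le (Quotient.mk _ n) ?_)
      rw [BoundedFormula.instAt, V.val_relabel_relabel]
      refine (V.val_relabel_eq (fun y => ?_) _).le
      rcases y with y | i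
      · exact (setoid V).refl _
      · exact Quotient.exact ((Quotient.mk (setoid V) n).out_eq).symm
    · rw [BoundedFormula.instAt, Formula.realize_relabel] at h
      refine (realize_ex_iff φ v).2 ⟨v a, ?_⟩
      convert h using 1
      funext x
      rcases x with x | i <;> rfl
  val_eq a b hab h := hab (by
    rw [← a.out_eq, ← b.out_eq]
    refine Quotient.sound ?_
    show V.val _ = ⊤
    rw [← h]
    exact V.congr fun N _ _ v => by simp [paramEq, Formula.realize_relabel])

/-- Take the names modulo equality of value `⊤`, with `K` of size `κ`. Structures of size at most
`κ` are enumerated by `K`, so an extension of a small substructure is coded by one valuation on `K ⊕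
K`, which the new names realize. -/
theorem exists_full_isSuccSaturated {κ : Cardinal.{u}} (hκ : Cardinal.aleph0 ≤ κ) [Nontrivial B]
    [Nonempty X] (q : PreVal L B X) :
    ∃ (M : Type u) (S : BVStructure L B M), S.IsFull ∧ S.IsSuccSaturated κ ∧
      ∃ i : X → M, ∀ φ, S.val (φ.relabel i) = q.val φ := by
  have hinf : Infinite κ.out := by rwa [Cardinal.infinite_iff, Cardinal.mk_out]
  obtain ⟨V, hVq, hV⟩ := exists_val (K := κ.out) q
  refine ⟨_, structure' V hV, fun φ => ?_, ?_, fun x => Quotient.mk _ (base x), fun φ => ?_⟩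
  · obtain ⟨n, hn⟩ := exists_witness hV φ Quotient.out
    refine ⟨Quotient.mk _ n, le_antisymm (hn.trans ?_) ?_⟩
    · simp only [structure']
      rw [BoundedFormula.instAt, V.val_relabel_relabel]
      refine (V.val_relabel_eq (fun y => ?_) _).le
      rcases y with y | i
      · exact (setoid V).refl _
      · exact Quotient.exact ((Quotient.mk (setoid V) n).out_eq).symm
    · rw [(structure' V hV).val_ex]
      exact le_iSup (fun a => (structure' V hV).val (φ.instAt a)) _
  · intro M₀ M₁ S₀ S₁ h₀ h₁ f g hf hg
    have hne : ∀ {M : Type u} (S : BVStructure L B M), Nonempty M := by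
      intro M S
      by_contra hM
      rw [not_nonempty_iff] at hM
      have h1 := S.val_ex ⊤
      rw [iSup_of_empty] at h1
      have h2 : S.val (BoundedFormula.ex ⊤ : L.BoundedFormula M 0) = ⊤ :=
        S.val_valid _ (models_empty_iff.2 fun N _ _ v => by
          rw [Formula.Realize, BoundedFormula.realize_ex]
          exact ⟨Classical.arbitrary N, by simp⟩)
      exact bot_ne_top (h1.symm.trans h2)
    have hsurj : ∀ {M : Type u}, Nonempty M → Cardinal.mk M ≤ κ →
        ∃ p : κ.out → M, Function.Surjective p := by
      intro M hM h
      rw [← Cardinal.mk_out κ] at h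
      obtain ⟨e⟩ := h
      exact ⟨Function.invFun e, Function.invFun_surjective e.injective⟩
    obtain ⟨p₀, hp₀⟩ := hsurj (hne S₀) h₀
    obtain ⟨p₁, hp₁⟩ := hsurj (hne S₁) h₁
    let args : κ.out → BVName L B κ.out X := fun k => (f (p₀ k)).out
    let c : PreVal L B (κ.out ⊕ κ.out) := S₁.toPreVal.comap (Sum.elim (g ∘ p₀) p₁)
    have hc : V.comap args = c.comap Sum.inl := by
      ext φ
      have h1 : V.val (φ.relabel args) = (structure' V hV).val ((φ.relabel p₀).relabel f) := by
        simp only [structure']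
        rw [V.val_relabel_relabel, V.val_relabel_relabel]
        rfl
      rw [PreVal.comap_comap, Sum.elim_comp_inl, PreVal.comap_val, PreVal.comap_val, h1,
        hf (φ.relabel p₀), ← hg (φ.relabel p₀)]
      exact S₁.toPreVal.val_relabel_relabel g p₀ φ
    have hout : ∀ φ : L.Formula (κ.out ⊕ κ.out), V.val (φ.relabel (out c args)) = c.val φ :=
      fun φ => congrArg (fun W => W.val φ) (hV c args hc)
    have hsec : ∀ m, p₁ (Function.surjInv hp₁ m) = m := Function.surjInv_eq hp₁
    refine ⟨fun m => Quotient.mk _ (new c args (Function.surjInv hp₁ m)), fun φ => ?_, ?_⟩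
    · simp only [structure']
      rw [V.val_relabel_relabel]
      have h1 := val_relabel_out V (fun m : M₁ => new c args (Function.surjInv hp₁ m)) φ
      refine h1.trans ?_
      have h2 := hout (φ.relabel (Sum.inr ∘ Function.surjInv hp₁))
      rw [V.val_relabel_relabel] at h2
      refine h2.trans ?_
      simp only [c, PreVal.comap_val]
      rw [S₁.toPreVal.val_relabel_relabel]
      refine S₁.toPreVal.congr fun N _ _ v => ?_
      rw [Formula.realize_relabel]
      exact iff_of_eq (congrArg φ.Realize (funext fun m => congrArg v (hsec m)))
    -- An old element also has a name among the new ones; the equation between its two names has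
    -- value `⊤` in `c`.
    · funext m
      obtain ⟨k, rfl⟩ := hp₀ m
      rw [← (f (p₀ k)).out_eq]
      refine Quotient.sound ?_
      show V.val _ = ⊤
      have h2 := hout (L.paramEq (Sum.inr (Function.surjInv hp₁ (g (p₀ k)))) (Sum.inl k))
      have h3 : V.val (L.paramEq (new c args (Function.surjInv hp₁ (g (p₀ k)))) (args k)) =
          V.val ((L.paramEq (Sum.inr (Function.surjInv hp₁ (g (p₀ k)))) (Sum.inl k)).relabel
            (out c args)) :=
        V.congr fun N _ _ v => by simp [paramEq, Formula.realize_relabel, out]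
      refine h3.trans (h2.trans ?_)
      simp only [c, PreVal.comap_val]
      exact S₁.val_valid _ (models_empty_iff.2 fun N _ _ v => by
        simp [paramEq, Formula.realize_relabel, hsec])
  · simp only [structure']
    rw [V.val_relabel_relabel]
    refine (val_relabel_out V base φ).trans ?_
    exact congrArg (fun W => W.val φ) hVq

end BVName


/-! ### Specializations of full Boolean-valued structures -/

section Specialization

variable {L : FirstOrder.Language.{0, 0}} {B : Type u} [CompleteBooleanAlgebra B] {M : Type u}

/-- A formula with one distinguished free variable, as a bounded formula. -/
def FirstOrder.Language.Formula.toBoundedOne {X : Type*} (χ : L.Formula (X ⊕ Unit)) :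
    L.BoundedFormula X 1 :=
  BoundedFormula.relabel (n := 1) (k := 0) (Sum.map id fun _ => 0) χ

theorem FirstOrder.Language.Formula.realize_toBoundedOne {X : Type*} (χ : L.Formula (X ⊕ Unit))
    {N : Type*} [L.Structure N] (v : X → N) (xs : Fin 1 → N) :
    χ.toBoundedOne.Realize v xs ↔ χ.Realize (Sum.elim v fun _ => xs 0) := by
  refine (BoundedFormula.realize_relabel (φ := χ) (g := Sum.map id fun _ => (0 : Fin 1))).trans ?_
  rw [Formula.Realize]
  refine iff_of_eq (congrArg₂ _ ?_ (Subsingleton.elim _ _))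
  funext x
  rcases x with x | x <;> rfl

theorem PreVal.val_eq_bot {X : Type u} (V : PreVal L B X) {φ : L.Formula X}
    (h : ∀ (N : Type u) [L.Structure N] [Nonempty N] (v : X → N), ¬ φ.Realize v) :
    V.val φ = ⊥ := by
  rw [← compl_eq_top, ← V.val_not]
  exact V.val_valid _ (models_empty_iff.2 fun N _ _ v => Formula.realize_not.2 (h N v))

/-- The specialization `M/W` as a first-order structure. -/
def SpecModel (S : BVStructure L B M) (_hS : S.IsFull) (W : Order.PFilter B) : Type u :=
  S.Specialization W

theorem BVStructure.IsFull.nonempty {S : BVStructure L B M} (hS : S.IsFull) : Nonempty M :=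
  ⟨(hS ⊤).choose⟩

theorem BVStructure.realize_instAt (φ : L.BoundedFormula M 1) (a : M) {N : Type*} [L.Structure N]
    (v : M → N) : (φ.instAt a).Realize v ↔ φ.Realize v (fun _ => v a) := by
  rw [BoundedFormula.instAt, Formula.realize_relabel, BoundedFormula.realize_toFormula]
  rfl

namespace SpecModel

variable {S : BVStructure L B M} {hS : S.IsFull} {W : Order.PFilter B}

noncomputable instance : L.Structure (SpecModel S hS W) := S.specStructure hS W

variable (S hS W) in
def mk (a : M) : SpecModel S hS W := Quotient.mk (S.setoid W) a

theorem mk_surjective : Function.Surjective (mk S hS W) := Quotient.mk_surjective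

instance : Nonempty (SpecModel S hS W) := hS.nonempty.map (mk S hS W)

theorem mk_eq_mk {a b : M} : mk S hS W a = mk S hS W b ↔ S.val (L.paramEq a b) ∈ W :=
  Quotient.eq (r := S.setoid W)

noncomputable def out (x : SpecModel S hS W) : M := Quotient.out (s := S.setoid W) x

theorem mk_out (x : SpecModel S hS W) : mk S hS W x.out = x :=
  Quotient.out_eq (s := S.setoid W) x

theorem relMap_iff {n : ℕ} (R : L.Relations n) (x : Fin n → SpecModel S hS W) :
    Structure.RelMap R x ↔ S.val (BVStructure.relAt R fun i => (x i).out) ∈ W := Iff.rfl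

theorem exists_funMap {n : ℕ} (F : L.Functions n) (x : Fin n → SpecModel S hS W) :
    ∃ b, S.val (BVStructure.funEq F (fun i => (x i).out) b) = ⊤ ∧
      Structure.funMap F x = mk S hS W b :=
  ⟨_, Classical.choose_spec (S.exists_funEq hS F fun i => (x i).out), rfl⟩

/-- Function values in the specialization are defined through chosen representatives; the equations
between representatives hold modulo `W`, and congruence transports them through the term. -/
theorem exists_term_eq (t : L.Term M) :
    ∃ m, S.val (Term.equal t (Term.var m)) ∈ W ∧ t.realize (mk S hS W) = mk S hS W m := by
  induction t with
  | var m =>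
    refine ⟨m, ?_, rfl⟩
    rw [S.val_valid _ (models_empty_iff.2 fun N _ _ v => by simp)]
    exact W.top_mem
  | @func n F ts ih =>
    choose m h1 h2 using ih
    obtain ⟨b, hb, hb'⟩ := exists_funMap (W := W) (hS := hS) F fun i => mk S hS W (m i)
    refine ⟨b, ?_, ?_⟩
    · refine S.toPreVal.mem_of_entails (ι := (Fin n ⊕ Fin n) ⊕ Unit) (s := Finset.univ)
        (φ := fun i => match i with
          | Sum.inl (Sum.inl i) => Term.equal (ts i) (Term.var (m i))
          | Sum.inl (Sum.inr i) => L.paramEq ((mk S hS W (m i)).out) (m i)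
          | Sum.inr _ => BVStructure.funEq F (fun i => (mk S hS W (m i)).out) b) ?_ ?_
      · rintro ((i | i) | i) _
        · exact h1 i
        · exact mk_eq_mk.1 (mk_out _)
        · simp only [BVStructure.toPreVal_val]
          rw [hb]
          exact W.top_mem
      · intro N _ _ v hv
        have e1 : ∀ i, (ts i).realize v = v (m i) := fun i => by
          simpa using hv (Sum.inl (Sum.inl i)) (Finset.mem_univ _)
        have e2 : ∀ i, v ((mk S hS W (m i)).out) = v (m i) := fun i => by
          simpa [paramEq] using hv (Sum.inl (Sum.inr i)) (Finset.mem_univ _)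
        have e3 := hv (Sum.inr ()) (Finset.mem_univ _)
        simp only [BVStructure.funEq, Formula.realize_equal, Term.realize_func,
          Term.realize_var, e2] at e3
        simp only [Formula.realize_equal, Term.realize_func, e1, Term.realize_var, e3]
    · rw [Term.realize_func, ← hb']
      exact congrArg _ (funext h2)

/-- Substitution of elements of `M` for all the variables of a bounded formula. -/
def inst {n : ℕ} (φ : L.BoundedFormula M n) (xs : Fin n → M) : L.Formula M :=
  φ.toFormula.relabel (Sum.elim id xs)

theorem realize_inst {n : ℕ} (φ : L.BoundedFormula M n) (xs : Fin n → M) {N : Type*}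
    [L.Structure N] (v : M → N) : (inst φ xs).Realize v ↔ φ.Realize v (v ∘ xs) := by
  rw [inst, Formula.realize_relabel, BoundedFormula.realize_toFormula]
  rfl

/-- The induction behind Łoś's theorem. In the quantifier step fullness provides one `a` at which
the value of `∃ x, ¬ φ` is attained, so the value of the universal formula is that of a single
instance. -/
theorem realize_boundedFormula_iff (hW : IsUltrafilterOn W) {n : ℕ} (φ : L.BoundedFormula M n)
    (xs : Fin n → M) :
    φ.Realize (mk S hS W) (mk S hS W ∘ xs) ↔ S.val (inst φ xs) ∈ W := by
  induction φ with
  | falsum =>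
    have : S.val (inst (BoundedFormula.falsum) xs) = ⊥ := S.toPreVal.val_eq_bot fun N _ _ v h => by
      exact (realize_inst _ _ _).1 h
    rw [this]
    exact ⟨False.elim, fun h => hW.1 h⟩
  | equal t₁ t₂ =>
    obtain ⟨m₁, h1, h1'⟩ := exists_term_eq (S := S) (hS := hS) (W := W) (t₁.relabel (Sum.elim id xs))
    obtain ⟨m₂, h2, h2'⟩ := exists_term_eq (S := S) (hS := hS) (W := W) (t₂.relabel (Sum.elim id xs))
    have e : ∀ {N : Type u} [L.Structure N] (v : M → N) (t : L.Term (M ⊕ Fin _)),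
        (t.relabel (Sum.elim id xs)).realize v = t.realize (Sum.elim v (v ∘ xs)) := by
      intro N _ v t
      rw [Term.realize_relabel]
      congr 1
      funext x
      rcases x with x | x <;> rfl
    rw [e] at h1' h2'
    rw [BoundedFormula.Realize, h1', h2', mk_eq_mk]
    constructor
    · intro h3
      refine S.toPreVal.mem_of_entails (s := Finset.univ) (φ := ![(t₁.relabel (Sum.elim id xs)).equal (Term.var m₁),
          (t₂.relabel (Sum.elim id xs)).equal (Term.var m₂), L.paramEq m₁ m₂])
        (fun i _ => by fin_cases i; exacts [h1, h2, h3]) fun N _ _ v hv => ?_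
      have g1 := hv 0 (Finset.mem_univ _)
      have g2 := hv 1 (Finset.mem_univ _)
      have g3 := hv 2 (Finset.mem_univ _)
      simp only [Matrix.cons_val, Formula.realize_equal, Term.realize_var, paramEq, e] at g1 g2 g3
      rw [realize_inst, BoundedFormula.Realize, g1, g2, g3]
    · intro h3
      refine S.toPreVal.mem_of_entails (s := Finset.univ) (φ := ![(t₁.relabel (Sum.elim id xs)).equal (Term.var m₁),
          (t₂.relabel (Sum.elim id xs)).equal (Term.var m₂), inst (BoundedFormula.equal t₁ t₂) xs])
        (fun i _ => by fin_cases i; exacts [h1, h2, h3]) fun N _ _ v hv => ?_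
      have g1 := hv 0 (Finset.mem_univ _)
      have g2 := hv 1 (Finset.mem_univ _)
      have g3 := hv 2 (Finset.mem_univ _)
      simp only [Matrix.cons_val, Formula.realize_equal, Term.realize_var, e, realize_inst,
        BoundedFormula.Realize] at g1 g2 g3
      simp only [paramEq, Formula.realize_equal, Term.realize_var]
      rw [← g1, ← g2, g3]
  | @rel n k R ts =>
    have e : ∀ {N : Type u} [L.Structure N] (v : M → N) (t : L.Term (M ⊕ Fin _)),
        (t.relabel (Sum.elim id xs)).realize v = t.realize (Sum.elim v (v ∘ xs)) := by
      intro N _ v t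
      rw [Term.realize_relabel]
      congr 1
      funext x
      rcases x with x | x <;> rfl
    choose m h1 h1' using fun i => exists_term_eq (S := S) (hS := hS) (W := W) ((ts i).relabel (Sum.elim id xs))
    simp only [e] at h1'
    rw [BoundedFormula.Realize]
    simp only [h1', relMap_iff]
    have h2 : ∀ i, S.val (L.paramEq ((mk S hS W (m i)).out) (m i)) ∈ W := fun i =>
      mk_eq_mk.1 (mk_out _)
    constructor
    · intro h3
      refine S.toPreVal.mem_of_entails (ι := (Fin k ⊕ Fin k) ⊕ Unit) (s := Finset.univ)
        (φ := Sum.elim (Sum.elim (fun i => ((ts i).relabel (Sum.elim id xs)).equal (Term.var (m i)))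
          (fun i => L.paramEq ((mk S hS W (m i)).out) (m i))) fun _ => BVStructure.relAt R fun i => (mk S hS W (m i)).out) ?_ ?_
      · rintro ((i | i) | i) _
        exacts [h1 i, h2 i, h3]
      intro N _ _ v hv
      have g1 := fun i => hv (Sum.inl (Sum.inl i)) (Finset.mem_univ _)
      have g2 := fun i => hv (Sum.inl (Sum.inr i)) (Finset.mem_univ _)
      have g3 := hv (Sum.inr ()) (Finset.mem_univ _)
      simp only [Sum.elim_inl, Sum.elim_inr, Formula.realize_equal, Term.realize_var, paramEq, e,
        BVStructure.relAt, Formula.realize_rel] at g1 g2 g3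
      rw [realize_inst, BoundedFormula.Realize]
      simpa only [g1, g2] using g3
    · intro h3
      refine S.toPreVal.mem_of_entails (ι := (Fin k ⊕ Fin k) ⊕ Unit) (s := Finset.univ)
        (φ := Sum.elim (Sum.elim (fun i => ((ts i).relabel (Sum.elim id xs)).equal (Term.var (m i)))
          (fun i => L.paramEq ((mk S hS W (m i)).out) (m i))) fun _ => inst (BoundedFormula.rel R ts) xs) ?_ ?_
      · rintro ((i | i) | i) _
        exacts [h1 i, h2 i, h3]
      intro N _ _ v hv
      have g1 := fun i => hv (Sum.inl (Sum.inl i)) (Finset.mem_univ _)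
      have g2 := fun i => hv (Sum.inl (Sum.inr i)) (Finset.mem_univ _)
      have g3 := hv (Sum.inr ()) (Finset.mem_univ _)
      simp only [Sum.elim_inl, Sum.elim_inr, Formula.realize_equal, Term.realize_var, paramEq, e,
        realize_inst, BoundedFormula.Realize] at g1 g2 g3
      rw [BVStructure.relAt, Formula.realize_rel]
      simpa only [g1, g2, Term.realize_var] using g3
  | imp φ ψ ih1 ih2 =>
    have : S.val (inst (φ.imp ψ) xs) = (S.val (inst φ xs) ⊓ (S.val (inst ψ xs))ᶜ)ᶜ := by
      rw [← S.val_not, ← S.val_inf, ← S.val_not]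
      refine S.toPreVal.congr fun N _ _ v => ?_
      rw [realize_inst, BoundedFormula.realize_imp, Formula.realize_not, Formula.realize_inf,
        Formula.realize_not, realize_inst, realize_inst]
      tauto
    rw [this, hW.compl_mem_iff, BoundedFormula.realize_imp, ih1, ih2]
    constructor
    · rintro h1 h2
      exact hW.compl_mem_iff.1 (W.mem_of_le inf_le_right h2) (h1 (W.mem_of_le inf_le_left h2))
    · intro h h1
      by_contra h2
      exact h (Order.PFilter.inf_mem h1 (hW.compl_mem_iff.2 h2))
  | @all n φ ih =>
    let χ : L.Formula (M ⊕ Unit) := φ.toFormula.relabel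
      (Sum.elim Sum.inl (Fin.snoc (fun i => Sum.inl (xs i)) (Sum.inr ()) : Fin (n + 1) → M ⊕ Unit))
    have hχ : ∀ {N : Type u} [L.Structure N] (v : M → N) (a : N),
        χ.Realize (Sum.elim v fun _ => a) ↔ φ.Realize v (Fin.snoc (v ∘ xs) a) := by
      intro N _ v a
      simp only [χ]
      rw [Formula.realize_relabel, BoundedFormula.realize_toFormula]
      refine iff_of_eq (congrArg₂ _ rfl ?_)
      funext i
      refine Fin.lastCases ?_ (fun i => ?_) i <;> simp
    obtain ⟨a, ha⟩ := hS χ.not.toBoundedOne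
    have e1 : S.val (χ.not.toBoundedOne.ex) = (S.val (inst φ.all xs))ᶜ := by
      rw [← S.val_not]
      refine S.toPreVal.congr fun N _ _ v => ?_
      rw [Formula.Realize, BoundedFormula.realize_ex, Formula.realize_not, realize_inst,
        BoundedFormula.realize_all]
      push Not
      refine exists_congr fun b => ?_
      rw [Formula.realize_toBoundedOne, Formula.realize_not]
      exact not_congr (hχ v b)
    have e2 : S.val (χ.not.toBoundedOne.instAt a) = (S.val (inst φ (Fin.snoc xs a)))ᶜ := by
      rw [← S.val_not]
      refine S.toPreVal.congr fun N _ _ v => ?_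
      rw [BVStructure.realize_instAt, Formula.realize_toBoundedOne, Formula.realize_not,
        Formula.realize_not, hχ, realize_inst, Fin.comp_snoc]
    rw [e1, e2] at ha
    rw [compl_injective ha, ← ih, BoundedFormula.realize_all]
    constructor
    · intro h
      rw [Fin.comp_snoc]
      exact h _
    · intro h b
      obtain ⟨b, rfl⟩ := mk_surjective b
      rw [← Fin.comp_snoc, ih]
      rw [ih, ← compl_injective ha] at h
      refine W.mem_of_le (S.toPreVal.mono fun N _ _ v => ?_) h
      rw [realize_inst, realize_inst, BoundedFormula.realize_all, Fin.comp_snoc]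
      exact fun h => h _

/-- Łoś's theorem for specializations. -/
theorem realize_iff (hW : IsUltrafilterOn W) (φ : L.Formula M) :
    φ.Realize (mk S hS W) ↔ S.val φ ∈ W := by
  have h := realize_boundedFormula_iff (S := S) (hS := hS) hW φ default
  rw [Formula.Realize, Subsingleton.elim default (mk S hS W ∘ default), h]
  refine iff_of_eq (congrArg (· ∈ W) (S.toPreVal.congr fun N _ _ v => ?_))
  rw [realize_inst, Formula.Realize, Subsingleton.elim default (v ∘ default)]

theorem realize_relabel_iff (hW : IsUltrafilterOn W) {X : Type*} (φ : L.Formula X) (v : X → M) :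
    φ.Realize (fun x => mk S hS W (v x)) ↔ S.val (φ.relabel v) ∈ W := by
  rw [← realize_iff (hS := hS) hW, Formula.realize_relabel]
  rfl

theorem model_of_isModelOf (hW : IsUltrafilterOn W) {T : L.Theory} (hT : S.IsModelOf T) :
    SpecModel S hS W ⊨ T := by
  refine ⟨fun σ hσ => ?_⟩
  have h := realize_relabel_iff (S := S) (hS := hS) hW σ Empty.elim
  rw [hT σ hσ] at h
  rw [Sentence.Realize]
  have h2 := h.2 W.top_mem
  rwa [Subsingleton.elim default fun x => mk S hS W (Empty.elim x)]

end SpecModel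

end Specialization


/-! ### Elementary substructures, realization of types and extensions -/

section LowenheimSkolem

variable {L : FirstOrder.Language.{0, 0}} {B : Type u} [CompleteBooleanAlgebra B] {M X : Type u}

open Cardinal

theorem FirstOrder.Language.BoundedFormula.realize_ex_one {X N : Type*} [L.Structure N]
    (φ : L.BoundedFormula X 1) (v : X → N) :
    Formula.Realize φ.ex v ↔ ∃ a, φ.Realize v fun _ => a := by
  rw [Formula.Realize, BoundedFormula.realize_ex]
  refine exists_congr fun a => iff_of_eq (congrArg _ ?_)
  funext i
  rw [show i = Fin.last 0 from Fin.eq_zero i, Fin.snoc_last]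

/-- A Boolean valuation with witnesses in which distinct variables are not identified is a full
Boolean-valued structure. -/
def PreVal.toBVStructure (V : PreVal L B X)
    (hfull : ∀ φ : L.BoundedFormula X 1, ∃ a, V.val φ.ex = V.val (φ.instAt a))
    (heq : ∀ a b : X, a ≠ b → V.val (L.paramEq a b) ≠ ⊤) : BVStructure L B X where
  val := V.val
  val_valid := V.val_valid
  val_not := V.val_not
  val_inf := V.val_inf
  val_ex φ := by
    refine le_antisymm ?_ (iSup_le fun a => V.mono fun N _ _ v h => ?_)
    · obtain ⟨a, ha⟩ := hfull φ
      rw [ha]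
      exact le_iSup (fun a => V.val (φ.instAt a)) a
    · rw [BVStructure.realize_instAt] at h
      exact (BoundedFormula.realize_ex_one _ _).2 ⟨v a, h⟩
  val_eq := heq

theorem mk_formula_le (hL : L.card ≤ ℵ₀) {κ : Cardinal.{u}} (hκ : ℵ₀ ≤ κ) (hX : #X ≤ κ) :
    #(L.Formula X) ≤ κ := by
  have h1 : #(L.Formula X) ≤ #(Σ n, L.BoundedFormula X n) :=
    mk_le_of_injective (f := fun φ => ⟨0, φ⟩) fun a b h => by simpa using h
  refine h1.trans (BoundedFormula.card_le.trans ?_)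
  refine max_le hκ ?_
  refine Cardinal.add_le_of_le hκ (by simpa using hX) ?_
  have : Cardinal.lift.{u} L.card ≤ Cardinal.lift.{u} ℵ₀ := Cardinal.lift_le.2 hL
  refine le_trans ?_ hκ
  simpa using this

theorem BVStructure.IsFull.exists_witness {S : BVStructure L B M} (hS : S.IsFull)
    (χ : L.Formula (M ⊕ Unit)) :
    ∃ a, S.val χ.toBoundedOne.ex = S.val (χ.relabel (Sum.elim id fun _ => a)) := by
  obtain ⟨a, ha⟩ := hS χ.toBoundedOne
  refine ⟨a, ha.trans (S.toPreVal.congr fun N _ _ v => ?_)⟩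
  rw [BVStructure.realize_instAt, Formula.realize_toBoundedOne, Formula.realize_relabel]
  refine iff_of_eq (congrArg _ ?_)
  funext x
  rcases x with x | x <;> rfl

/-- Close under chosen witnesses `ω` times. A formula over the union has its finitely many
parameters in one stage, so its witness lies in the next one. -/
theorem BVStructure.exists_closed (S : BVStructure L B M) (hS : S.IsFull) (hL : L.card ≤ ℵ₀)
    {κ : Cardinal.{u}} (hκ : ℵ₀ ≤ κ) (A : Set M) (hA : #A ≤ κ) :
    ∃ D : Set M, A ⊆ D ∧ #D ≤ κ ∧ ∀ χ : L.Formula (D ⊕ Unit), ∃ a : D,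
      S.val (χ.relabel (Sum.map ((↑) : D → M) id)).toBoundedOne.ex =
        S.val (χ.relabel (Sum.elim (↑) fun _ => (a : M))) := by
  choose w hw using hS.exists_witness
  let step : Set M → Set M := fun C => C ∪ Set.range
    fun χ : L.Formula (C ⊕ Unit) => w (χ.relabel (Sum.map Subtype.val id))
  obtain ⟨D, hD0, hD⟩ : ∃ D : ℕ → Set M, D 0 = A ∧ ∀ n, D (n + 1) = step (D n) :=
    ⟨fun n => Nat.rec A (fun _ => step) n, rfl, fun n => rfl⟩
  have hmono : Monotone D := monotone_nat_of_le_succ fun n => by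
    rw [hD]
    exact Set.subset_union_left
  have hcard : ∀ n, #(D n) ≤ κ := by
    intro n
    induction n with
    | zero => rwa [hD0]
    | succ n ih =>
      rw [hD]
      refine (mk_union_le _ _).trans (add_le_of_le hκ ih (mk_range_le.trans ?_))
      refine mk_formula_le hL hκ ?_
      rw [mk_sum]
      refine add_le_of_le hκ (by simpa using ih) ?_
      simpa using one_le_aleph0.trans hκ
  refine ⟨⋃ n, D n, hD0 ▸ Set.subset_iUnion D 0, ?_, fun χ => ?_⟩
  · refine (mk_iUnion_le_sum_mk (f := fun n : ULift.{u} ℕ => D n.down) |>.trans' ?_).trans ?_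
    · refine mk_le_mk_of_subset (Set.iUnion_subset fun n => ?_)
      exact Set.subset_iUnion (fun n : ULift.{u} ℕ => D n.down) ⟨n⟩
    · refine (sum_le_sum _ (fun _ => κ) fun n => hcard _).trans ?_
      simp only [sum_const, mk_uLift, mk_nat, lift_aleph0, lift_id]
      exact mul_le_of_le hκ hκ le_rfl
  · obtain ⟨s, hs⟩ := exists_formula_finset χ
    obtain ⟨n, hn⟩ : ∃ n, ∀ x : (⋃ n, D n : Set M), Sum.inl x ∈ s → (x : M) ∈ D n := by
      choose k hk using fun x : (⋃ n, D n : Set M) => Set.mem_iUnion.1 x.2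
      refine ⟨s.sup (Sum.elim k fun _ => 0), fun x hx => hmono ?_ (hk x)⟩
      exact Finset.le_sup (f := Sum.elim k fun _ => 0) hx
    obtain ⟨χ', hχ'⟩ := hs (Y := D n ⊕ Unit) fun x => match x with
      | ⟨Sum.inl x, hx⟩ => Sum.inl ⟨x, hn x hx⟩
      | ⟨Sum.inr y, _⟩ => Sum.inr y
    refine ⟨⟨w (χ'.relabel (Sum.map Subtype.val id)), Set.mem_iUnion.2 ⟨n + 1, ?_⟩⟩, ?_⟩
    · rw [hD]
      exact Or.inr ⟨χ', rfl⟩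
    have e : ∀ {N : Type u} [L.Structure N] (v : M → N) (a : N),
        χ'.Realize (Sum.elim (fun x => v x) fun _ => a) ↔
          χ.Realize (Sum.elim (fun x => v x) fun _ => a) := by
      intro N _ v a
      refine hχ' _ _ ?_
      rintro ⟨x | x, hx⟩ <;> rfl
    have h := hw (χ'.relabel (Sum.map Subtype.val id))
    convert h using 1
    · refine S.toPreVal.congr fun N _ _ v => ?_
      rw [BoundedFormula.realize_ex_one, BoundedFormula.realize_ex_one]
      refine exists_congr fun a => ?_
      rw [Formula.realize_toBoundedOne, Formula.realize_relabel, Formula.realize_toBoundedOne,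
        Formula.realize_relabel, Sum.elim_comp_map, Sum.elim_comp_map]
      exact (e v a).symm
    · refine S.toPreVal.congr fun N _ _ v => ?_
      rw [Formula.realize_relabel, Formula.realize_relabel, Formula.realize_relabel]
      convert (e v (v (w (χ'.relabel (Sum.map Subtype.val id))))).symm using 2
      · funext x
        rcases x with x | x <;> rfl
      · funext x
        rcases x with x | x <;> rfl

/-- The downward Löwenheim–Skolem theorem for full Boolean-valued structures. -/
theorem BVStructure.exists_elementary_substructure (S : BVStructure L B M) (hS : S.IsFull)
    (hL : L.card ≤ ℵ₀) {κ : Cardinal.{u}} (hκ : ℵ₀ ≤ κ) (A : Set M) (hA : #A ≤ κ) :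
    ∃ D : Set M, A ⊆ D ∧ #D ≤ κ ∧ ∃ S₀ : BVStructure L B D, S₀.IsFull ∧
      BVStructure.IsElementary S₀ S (↑) := by
  obtain ⟨D, hAD, hD, h⟩ := S.exists_closed hS hL hκ A hA
  have hfull : ∀ φ : L.BoundedFormula D 1, ∃ a,
      (S.toPreVal.comap (↑)).val φ.ex = (S.toPreVal.comap ((↑) : D → M)).val (φ.instAt a) := by
    intro φ
    let χ : L.Formula (D ⊕ Unit) := φ.toFormula.relabel (Sum.map id fun _ => ())
    have hχ : ∀ {N : Type u} [L.Structure N] (v : D → N) (a : N),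
        χ.Realize (Sum.elim v fun _ => a) ↔ φ.Realize v fun _ => a := by
      intro N _ v a
      simp only [χ]
      rw [Formula.realize_relabel, BoundedFormula.realize_toFormula]
      exact Iff.rfl
    obtain ⟨a, ha⟩ := h χ
    refine ⟨a, ?_⟩
    simp only [PreVal.comap_val]
    convert ha using 1
    · refine S.toPreVal.congr fun N _ _ v => ?_
      rw [Formula.realize_relabel, BoundedFormula.realize_ex_one, BoundedFormula.realize_ex_one]
      refine exists_congr fun b => ?_
      rw [Formula.realize_toBoundedOne, Formula.realize_relabel, Sum.elim_comp_map]
      exact (hχ _ _).symm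
    · refine S.toPreVal.congr fun N _ _ v => ?_
      rw [Formula.realize_relabel, BVStructure.realize_instAt, Formula.realize_relabel]
      refine (hχ _ _).symm.trans ?_
      refine iff_of_eq (congrArg _ ?_)
      funext x
      rcases x with x | x <;> rfl
  refine ⟨D, hAD, hD, (S.toPreVal.comap ((↑) : D → M)).toBVStructure hfull ?_, hfull, fun φ => rfl⟩
  intro a b hab hval
  refine S.val_eq a b (fun h => hab (Subtype.ext h)) ?_
  rw [← hval, PreVal.comap_val]
  exact S.toPreVal.congr fun N _ _ v => by simp [paramEq, Formula.realize_relabel]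

end LowenheimSkolem

/-! ### Realization of Boolean-valued types in saturated structures -/

section Realization

variable {L : FirstOrder.Language.{0, 0}} {B : Type u} [CompleteBooleanAlgebra B] {M : Type u}

open Cardinal

/-- A partial Boolean type is realized in a saturated structure if it is finitely realized in the
specializations. -/
theorem BVStructure.exists_realization [Nontrivial B] (S : BVStructure L B M) (hS : S.IsFull)
    (hL : L.card ≤ ℵ₀) {κ : Cardinal.{u}} (hκ : ℵ₀ ≤ κ) (hsat : S.IsSuccSaturated κ)
    {J K : Type u} (hJ : #J ≤ κ) (hK : #K ≤ κ) (φ : K → L.Formula (M ⊕ J)) (d : K → B)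
    (h : ∀ W : Order.PFilter B, IsUltrafilterOn W → ∀ s : Finset K, (∀ k ∈ s, d k ∈ W) →
      ∃ j : J → SpecModel S hS W, ∀ k ∈ s, (φ k).Realize (Sum.elim (SpecModel.mk S hS W) j)) :
    ∃ b : J → M, ∀ k, d k ≤ S.val ((φ k).relabel (Sum.elim id b)) := by
  classical
  choose fv hfv using fun k => exists_formula_finset (φ k)
  obtain ⟨D, hAD, hD, S₀, hS₀, hel⟩ := S.exists_elementary_substructure hS hL hκ
    (⋃ k, {m | Sum.inl m ∈ fv k}) (by
      refine (mk_iUnion_le_sum_mk).trans ((sum_le_sum _ (fun _ => κ) fun k => ?_).trans ?_)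
      · refine le_trans ?_ hκ
        refine Cardinal.mk_le_aleph0_iff.2 (Set.Countable.to_subtype ?_)
        exact ((fv k).finite_toSet.preimage Sum.inl_injective.injOn).countable
      · simp only [sum_const, lift_id]
        exact mul_le_of_le hκ hK le_rfl)
  have hmem : ∀ k m, Sum.inl m ∈ fv k → m ∈ D := fun k m hm => hAD (Set.mem_iUnion.2 ⟨k, hm⟩)
  choose φ' hφ' using fun k => hfv k (Y := D ⊕ J) fun x => match x with
    | ⟨Sum.inl x, hx⟩ => Sum.inl ⟨x, hmem k x hx⟩
    | ⟨Sum.inr y, _⟩ => Sum.inr y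
  have e : ∀ k {N : Type u} [L.Structure N] (v : M → N) (w : J → N),
      (φ' k).Realize (Sum.elim (fun x => v x) w) ↔ (φ k).Realize (Sum.elim v w) := by
    intro k N _ v w
    refine hφ' k _ _ ?_
    rintro ⟨x | x, hx⟩ <;> rfl
  -- Consistency of the type with the diagram of `D`: a nonzero finite meet of bounds lies in an
  -- ultrafilter `W`, and the specialization at `W` is the model.
  obtain ⟨V, hV⟩ := PreVal.exists_of_finitely_satisfiable (B := B) (X := D ⊕ J)
    (ι := L.Formula D ⊕ K) (Sum.elim (fun θ => θ.relabel Sum.inl) φ') (Sum.elim S₀.val d) (by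
      intro s hs
      obtain ⟨W, hW, hsW⟩ := exists_isUltrafilterOn_mem hs
      have hsW := fun i hi => W.mem_of_le (iInf₂_le i hi) hsW
      obtain ⟨j, hj⟩ := h W hW s.toRight fun k hk => hsW (Sum.inr k) (Finset.mem_toRight.1 hk)
      refine ⟨SpecModel S hS W, inferInstance, inferInstance,
        Sum.elim (fun x => SpecModel.mk S hS W x) j, ?_⟩
      rintro (θ | k) hi
      · simp only [Sum.elim_inl, Formula.realize_relabel, Sum.elim_comp_inl]
        rw [SpecModel.realize_relabel_iff hW, hel]
        exact hsW _ hi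
      · exact (e k _ j).2 (hj k (Finset.mem_toRight.2 hi)))
  have hV0 : S₀.toPreVal = V.comap Sum.inl := PreVal.eq_of_le fun θ => hV (Sum.inl θ)
  have : Nonempty (D ⊕ J) := hS₀.nonempty.map Sum.inl
  -- Turn the valuation on `D ⊕ J` into a full structure and cut it down to size `κ`; saturation of
  -- `S` then embeds it over `D`.
  obtain ⟨M', S', hS', hsat', i, hi⟩ := BVName.exists_full_isSuccSaturated hκ V
  obtain ⟨D', hAD', hD', S₁, hS₁, hel'⟩ := S'.exists_elementary_substructure hS' hL hκ
    (Set.range i) (mk_range_le.trans (by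
      rw [mk_sum]
      exact add_le_of_le hκ (by simpa using hD) (by simpa using hJ)))
  let i' : D ⊕ J → D' := fun x => ⟨i x, hAD' ⟨x, rfl⟩⟩
  have hi' : ∀ θ : L.Formula (D ⊕ J), S₁.val (θ.relabel i') = V.val θ := fun θ => by
    rw [← hi θ, ← hel' (θ.relabel i')]
    exact S'.toPreVal.val_relabel_relabel _ _ θ
  obtain ⟨f, hf, hf'⟩ := hsat D D' S₀ S₁ hD hD' (↑) (i' ∘ Sum.inl) hel fun θ => by
    have h1 : S₀.val θ = (V.comap Sum.inl).val θ := congrArg (fun q => q.val θ) hV0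
    rw [h1, PreVal.comap_val, ← hi']
    exact (S₁.toPreVal.val_relabel_relabel _ _ θ).symm
  refine ⟨fun j => f (i' (Sum.inr j)), fun k => ?_⟩
  refine (hV (Sum.inr k)).trans (le_of_eq ?_)
  simp only [Sum.elim_inr]
  rw [← hi', ← hf]
  refine S.toPreVal.congr fun N _ _ v => ?_
  rw [Formula.realize_relabel, Formula.realize_relabel, Formula.realize_relabel]
  have h2 : (v ∘ Sum.elim id fun j => f (i' (Sum.inr j))) =
      Sum.elim v fun j => v (f (i' (Sum.inr j))) := by
    funext x
    rcases x with x | x <;> rfl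
  rw [h2, ← e]
  refine iff_of_eq (congrArg _ ?_)
  funext x
  rcases x with x | x
  · exact congrArg v (congrFun hf' x)
  · rfl

/-- Every structure has an elementary extension which realizes a given type and is the
specialization of a full saturated structure. -/
theorem exists_specModel_extension [Nontrivial B] {U : Order.PFilter B} (hU : IsUltrafilterOn U)
    {κ : Cardinal.{u}} (hκ : ℵ₀ ≤ κ) (N : Type u) [L.Structure N] [Nonempty N]
    (Γ : Set (L.Formula (N ⊕ Unit)))
    (hΓ : ∀ s : Finset (L.Formula (N ⊕ Unit)), (s : Set (L.Formula (N ⊕ Unit))) ⊆ Γ →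
      ∃ x : N, ∀ γ ∈ s, γ.Realize (Sum.elim id fun _ => x)) :
    ∃ (M : Type u) (S : BVStructure L B M) (hS : S.IsFull), S.IsSuccSaturated κ ∧
      (∀ T : L.Theory, N ⊨ T → S.IsModelOf T) ∧
      ∃ (j : N → SpecModel S hS U) (x : SpecModel S hS U),
        (∀ θ : L.Formula N, θ.Realize j ↔ θ.Realize id) ∧
        ∀ γ ∈ Γ, γ.Realize (Sum.elim j fun _ => x) := by
  classical
  -- The elementary diagram of `N` and all of `Γ` receive value `⊤`; finite parts are satisfied in
  -- `N` itself.
  obtain ⟨V, hV⟩ := PreVal.exists_of_finitely_satisfiable (B := B) (X := N ⊕ Unit)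
    (ι := {θ : L.Formula N // θ.Realize id} ⊕ Γ)
    (Sum.elim (fun θ => θ.1.relabel Sum.inl) (fun γ => γ.1)) (fun _ => ⊤) (by
      intro s _
      obtain ⟨x, hx⟩ := hΓ (s.toRight.image (↑)) (by
        intro γ hγ
        simp only [Finset.coe_image, Set.mem_image] at hγ
        obtain ⟨γ, _, rfl⟩ := hγ
        exact γ.2)
      refine ⟨N, inferInstance, inferInstance, Sum.elim id fun _ => x, ?_⟩
      rintro (θ | γ) hi
      · simp only [Sum.elim_inl, Formula.realize_relabel, Sum.elim_comp_inl]
        exact θ.2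
      · exact hx _ (Finset.mem_image_of_mem _ (Finset.mem_toRight.2 hi)))
  obtain ⟨M, S, hS, hsat, i, hi⟩ := BVName.exists_full_isSuccSaturated hκ V
  have key : ∀ θ : L.Formula N, θ.Realize id → S.val (θ.relabel (i ∘ Sum.inl)) = ⊤ := by
    intro θ hθ
    rw [← top_le_iff]
    refine (hV (Sum.inl ⟨θ, hθ⟩)).trans (le_of_eq ?_)
    rw [← hi]
    exact S.toPreVal.val_relabel_relabel _ _ θ
  refine ⟨M, S, hS, hsat, ?_, fun n => SpecModel.mk S hS U (i (Sum.inl n)),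
    SpecModel.mk S hS U (i (Sum.inr ())), ?_, ?_⟩
  · intro T hT σ hσ
    have h1 := key (σ.relabel Empty.elim) (by
      rw [Formula.realize_relabel]
      have := hT.realize_of_mem σ hσ
      rwa [Sentence.Realize, Subsingleton.elim (default : Empty → N) (id ∘ Empty.elim)] at this)
    rw [← h1]
    refine S.toPreVal.congr fun N _ _ v => ?_
    rw [Formula.realize_relabel, Formula.realize_relabel, Formula.realize_relabel]
    exact iff_of_eq (congrArg _ (Subsingleton.elim _ _))
  · have h2 : ∀ θ : L.Formula N, θ.Realize id →
        θ.Realize fun n => SpecModel.mk S hS U (i (Sum.inl n)) := by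
      intro θ hθ
      refine (SpecModel.realize_relabel_iff hU θ (i ∘ Sum.inl)).2 ?_
      rw [key θ hθ]
      exact U.top_mem
    intro θ
    refine ⟨fun h => ?_, h2 θ⟩
    by_contra hn
    exact Formula.realize_not.1 (h2 θ.not (Formula.realize_not.2 hn)) h
  · intro γ hγ
    have h3 := (SpecModel.realize_relabel_iff (hS := hS) hU γ i).2 (by
      rw [hi]
      refine U.mem_of_le (hV (Sum.inr ⟨γ, hγ⟩)) U.top_mem)
    convert h3 using 1
    funext x
    rcases x with x | x <;> rfl

end Realization

/-! ### Back-and-forth systems -/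

section BackAndForth

variable {L : FirstOrder.Language.{0, 0}} {N₁ N₂ : Type*} [L.Structure N₁] [L.Structure N₂]

/-- A family of partial isomorphisms, given by their graphs, with the back and forth property
consists of partial elementary maps. -/
theorem realize_iff_of_backForth (Good : Set (N₁ × N₂) → Prop)
    (hinj : ∀ G, Good G → ∀ x ∈ G, ∀ y ∈ G, x.1 = y.1 ↔ x.2 = y.2)
    (hfun : ∀ G, Good G → ∀ {n} (f : L.Functions n) (x : Fin n → N₁ × N₂), (∀ i, x i ∈ G) →
      (Structure.funMap f (fun i => (x i).1), Structure.funMap f (fun i => (x i).2)) ∈ G)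
    (hrel : ∀ G, Good G → ∀ {n} (r : L.Relations n) (x : Fin n → N₁ × N₂), (∀ i, x i ∈ G) →
      (Structure.RelMap r (fun i => (x i).1) ↔ Structure.RelMap r (fun i => (x i).2)))
    (hforth : ∀ G, Good G → ∀ a, ∃ G', Good G' ∧ G ⊆ G' ∧ ∃ b, (a, b) ∈ G')
    (hback : ∀ G, Good G → ∀ b, ∃ G', Good G' ∧ G ⊆ G' ∧ ∃ a, (a, b) ∈ G')
    {X : Type*} {n : ℕ} (φ : L.BoundedFormula X n) (G : Set (N₁ × N₂)) (hG : Good G)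
    (v : X → N₁ × N₂) (hv : ∀ x, v x ∈ G) (xs : Fin n → N₁ × N₂) (hxs : ∀ i, xs i ∈ G) :
    φ.Realize (fun x => (v x).1) (fun i => (xs i).1) ↔
      φ.Realize (fun x => (v x).2) (fun i => (xs i).2) := by
  have hterm : ∀ G, Good G → ∀ {Y : Type _} (t : L.Term Y) (w : Y → N₁ × N₂), (∀ y, w y ∈ G) →
      (t.realize (fun y => (w y).1), t.realize (fun y => (w y).2)) ∈ G := by
    intro G hG Y t w hw
    induction t with
    | var y => exact hw y
    | func f ts ih => exact hfun G hG f (fun i => (_, _)) ih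
  have hterm' : ∀ G, Good G → ∀ {n : ℕ} (t : L.Term (X ⊕ Fin n)) (v : X → N₁ × N₂)
      (xs : Fin n → N₁ × N₂), (∀ x, v x ∈ G) → (∀ i, xs i ∈ G) →
      (t.realize (Sum.elim (fun x => (v x).1) fun i => (xs i).1),
        t.realize (Sum.elim (fun x => (v x).2) fun i => (xs i).2)) ∈ G := by
    intro G hG n t v xs hv hxs
    have := hterm G hG t (Sum.elim v xs) (fun y => by rcases y with y | y; exacts [hv y, hxs y])
    convert this using 3 <;>
    · funext y
      rcases y with y | y <;> rfl
  induction φ generalizing G with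
  | falsum => exact Iff.rfl
  | equal t₁ t₂ => exact hinj G hG _ (hterm' G hG t₁ v xs hv hxs) _ (hterm' G hG t₂ v xs hv hxs)
  | rel R ts => exact hrel G hG R (fun i => (_, _)) fun i => hterm' G hG (ts i) v xs hv hxs
  | imp φ ψ ih1 ih2 =>
    exact imp_congr (ih1 G hG hv xs hxs) (ih2 G hG hv xs hxs)
  | @all n φ ih =>
    have hsnoc : ∀ (G' : Set (N₁ × N₂)), Good G' → G ⊆ G' → ∀ p ∈ G',
        (φ.Realize (fun x => (v x).1) (Fin.snoc (fun i => (xs i).1) p.1) ↔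
          φ.Realize (fun x => (v x).2) (Fin.snoc (fun i => (xs i).2) p.2)) := by
      intro G' hG' hGG' p hp
      have := ih G' hG' (fun x => hGG' (hv x)) (Fin.snoc xs p) (fun i => by
        refine Fin.lastCases ?_ (fun i => ?_) i
        · simpa using hp
        · simpa using hGG' (hxs i))
      convert this using 2
      · exact (Fin.comp_snoc Prod.fst xs p).symm
      · exact (Fin.comp_snoc Prod.snd xs p).symm
    rw [BoundedFormula.realize_all, BoundedFormula.realize_all]
    constructor
    · intro h b
      obtain ⟨G', hG', hGG', a, ha⟩ := hback G hG b
      exact (hsnoc G' hG' hGG' (a, b) ha).1 (h a)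
    · intro h a
      obtain ⟨G', hG', hGG', b, hb⟩ := hforth G hG a
      exact (hsnoc G' hG' hGG' (a, b) hb).2 (h b)

end BackAndForth


/-! ### Transfer of sentences -/

section Transfer

variable {L : FirstOrder.Language.{0, 0}}

/-- The universal closure of a formula. -/
noncomputable def FirstOrder.Language.Formula.allClosure {X : Type*} (θ : L.Formula X) :
    L.Sentence := by
  classical exact θ.not.exClosure.not

theorem FirstOrder.Language.Formula.realize_allClosure {X : Type*} (θ : L.Formula X) {N : Type*}
    [L.Structure N] [Nonempty N] : N ⊨ θ.allClosure ↔ ∀ v : X → N, θ.Realize v := by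
  classical
  rw [Formula.allClosure, Sentence.Realize, Formula.realize_not, ← Sentence.Realize,
    Formula.realize_exClosure]
  push Not
  constructor
  · intro h v
    by_contra hn
    refine h (fun x => v x) ?_
    exact (BoundedFormula.realize_restrictFreeVar (f := id) v fun x => rfl).2
      (Formula.realize_not.2 hn)
  · intro h v hv
    let v' : X → N := fun x => if hx : x ∈ θ.not.freeVarFinset then v ⟨x, hx⟩ else
      Classical.arbitrary N
    refine Formula.realize_not.1 ((BoundedFormula.realize_restrictFreeVar v' fun x => ?_).1 hv)
      (h v')
    show v x = dite _ _ _
    rw [dif_pos x.2]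

theorem exists_injOn_of_infinite {Q N : Type*} (t : Finset Q) {A : Set N} (hA : A.Infinite) :
    ∃ f : Q → N, Set.InjOn f t ∧ ∀ q, f q ∈ A := by
  classical
  obtain ⟨s, hs, hcard⟩ := hA.exists_subset_card_eq t.card
  obtain ⟨a, ha⟩ := hA.nonempty
  let e : t ≃ s := Finset.equivOfCardEq hcard.symm
  refine ⟨fun q => if h : q ∈ t then e ⟨q, h⟩ else a, fun x hx y hy hxy => ?_, fun q => ?_⟩
  · have hx' : x ∈ t := hx
    have hy' : y ∈ t := hy
    simpa [hx', hy'] using hxy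
  · dsimp only
    split_ifs with h
    · exact hs (e ⟨q, h⟩).2
    · exact ha

end Transfer

/-! ### Boolean-valued equivalence relations -/

section BoolEquiv

variable {B : Type u} [CompleteBooleanAlgebra B]

/-- A Boolean-valued equivalence relation. -/
structure IsBoolEquiv {J : Type*} (e : J → J → B) : Prop where
  refl : ∀ i, e i i = ⊤
  symm : ∀ i j, e i j ≤ e j i
  trans : ∀ i j k, e i j ⊓ e j k ≤ e i k

/-- The equivalence relation determined by an ultrafilter. -/
def IsBoolEquiv.setoid {J : Type*} {e : J → J → B} (he : IsBoolEquiv e) (W : Order.PFilter B) :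
    Setoid J where
  r i j := e i j ∈ W
  iseqv := ⟨fun i => by rw [he.refl]; exact W.top_mem, fun h => W.mem_of_le (he.symm _ _) h,
    fun h h' => W.mem_of_le (he.trans _ _ _) (Order.PFilter.inf_mem h h')⟩

theorem PreVal.isBoolEquiv {L : FirstOrder.Language.{0, 0}} {X : Type u} (V : PreVal L B X)
    {J : Type*} (θ : J → J → L.Formula X)
    (h : ∀ (N : Type u) [L.Structure N] [Nonempty N] (v : X → N),
      Equivalence fun i j => (θ i j).Realize v) : IsBoolEquiv fun i j => V.val (θ i j) where
  refl i := V.val_valid _ (models_empty_iff.2 fun N _ _ v => (h N v).refl i)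
  symm i j := V.mono fun N _ _ v => (h N v).symm
  trans i j k := by
    rw [← V.val_inf]
    exact V.mono fun N _ _ v hv =>
      (h N v).trans (Formula.realize_inf.1 hv).1 (Formula.realize_inf.1 hv).2

open Cardinal

/-- Two-colourings of Boolean-valued equivalence relations of size at most `κ` which are consistent
modulo `U` are refined in `U` to everywhere consistent ones. -/
def SeparatesColourings (U : Order.PFilter B) (κ : Cardinal.{u}) : Prop :=
  ∀ (J : Type u), #J ≤ κ → ∀ (e : J → J → B) (ε : J → Prop), IsBoolEquiv e →
    (∀ i j, ε i → ¬ ε j → (e i j)ᶜ ∈ U) →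
    ∃ d : J → B, (∀ i, d i ∈ U) ∧ ∀ i j, ε i → ¬ ε j → d i ⊓ d j ⊓ e i j = ⊥

variable {L : FirstOrder.Language.{0, 0}} {M : Type u}

/-- Realization of a Boolean-valued equivalence relation by equality. -/
theorem BVStructure.exists_eq_val [Nontrivial B] (S : BVStructure L B M) (hS : S.IsFull)
    (hL : L.card ≤ ℵ₀) {κ : Cardinal.{u}} (hκ : ℵ₀ ≤ κ) (hsat : S.IsSuccSaturated κ)
    {J : Type u} (hJ : #J ≤ κ) {e : J → J → B} (he : IsBoolEquiv e) (ψ : L.Formula Unit)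
    (hψ : ∀ W : Order.PFilter B, IsUltrafilterOn W →
      {x : SpecModel S hS W | ψ.Realize fun _ => x}.Infinite) :
    ∃ b : J → M, (∀ i j, S.val (L.paramEq (b i) (b j)) = e i j) ∧
      ∀ i, S.val (ψ.relabel fun _ => b i) = ⊤ := by
  classical
  have hK : #(((J × J) ⊕ (J × J)) ⊕ J) ≤ κ := by
    have : #(J × J) ≤ κ := by
      rw [mk_prod, lift_id]
      exact mul_le_of_le hκ hJ hJ
    simp only [mk_sum, lift_id]
    exact add_le_of_le hκ (add_le_of_le hκ this this) hJ
  obtain ⟨b, hb⟩ := S.exists_realization hS hL hκ hsat hJ hK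
    (Sum.elim (Sum.elim (fun p => L.paramEq (Sum.inr p.1) (Sum.inr p.2))
      (fun p => (L.paramEq (Sum.inr p.1) (Sum.inr p.2)).not)) fun i => ψ.relabel fun _ => Sum.inr i)
    (Sum.elim (Sum.elim (fun p => e p.1 p.2) (fun p => (e p.1 p.2)ᶜ)) fun _ => ⊤) (by
      intro W hW s hs
      let t : Finset (((J × J) ⊕ (J × J)) ⊕ J) → Finset J := fun s => s.biUnion
        (Sum.elim (Sum.elim (fun p => {p.1, p.2}) fun p => {p.1, p.2}) fun i => {i})
      -- At `W`, the relation `e` is an ordinary equivalence relation; the finitely many classes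
      -- involved are sent to distinct points satisfying `ψ`.
      obtain ⟨f, hf, hf'⟩ := exists_injOn_of_infinite ((t s).image (Quotient.mk (he.setoid W)))
        (hψ W hW)
      refine ⟨fun i => f (Quotient.mk _ i), fun k hk => ?_⟩
      have hmem : ∀ i, i ∈ (Sum.elim (Sum.elim (fun p : J × J => {p.1, p.2})
          fun p : J × J => ({p.1, p.2} : Finset J)) fun i => {i}) k → i ∈ t s := fun i hi =>
        Finset.mem_biUnion.2 ⟨k, hk, hi⟩
      have hk' := hs k hk
      rcases k with (⟨i, j⟩ | ⟨i, j⟩) | i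
      · simp only [Sum.elim_inl, paramEq, Formula.realize_equal, Term.realize_var, Sum.elim_inr]
        exact congrArg f (Quotient.sound hk')
      · simp only [Sum.elim_inl, paramEq, Formula.realize_equal, Term.realize_var, Sum.elim_inr,
          Formula.realize_not]
        intro h
        have h2 := hf (Finset.mem_image_of_mem _ (hmem i (by simp)))
          (Finset.mem_image_of_mem _ (hmem j (by simp))) h
        exact hW.compl_mem_iff.1 hk' (Quotient.exact h2)
      · simp only [Sum.elim_inr, Formula.realize_relabel]
        exact hf' _)
  refine ⟨b, fun i j => le_antisymm ?_ ?_, fun i => ?_⟩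
  · have := hb (Sum.inl (Sum.inr (i, j)))
    simp only [Sum.elim_inl, Sum.elim_inr] at this
    have h2 : (e i j)ᶜ ≤ (S.val (L.paramEq (b i) (b j)))ᶜ := by
      rw [← S.val_not]
      refine this.trans (le_of_eq (S.toPreVal.congr fun N _ _ v => ?_))
      rw [Formula.realize_relabel]; simp [paramEq]
    exact compl_le_compl_iff_le.1 h2
  · have := hb (Sum.inl (Sum.inl (i, j)))
    simp only [Sum.elim_inl, Sum.elim_inr] at this
    refine this.trans (le_of_eq (S.toPreVal.congr fun N _ _ v => ?_))
    simp [Formula.realize_relabel, paramEq]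
  · have := hb (Sum.inr i)
    simp only [Sum.elim_inr, top_le_iff] at this
    rw [← this]
    refine S.toPreVal.congr fun N _ _ v => ?_
    simp only [Formula.realize_relabel]
    rfl

theorem IsCardSaturated.exists_realize {N : Type u} [L.Structure N] {κ : Cardinal.{u}}
    (h : IsCardSaturated L N (Order.succ κ)) {J : Type u} (hJ : #J ≤ κ) (v : J → N) {I : Type*}
    (χ : I → L.Formula (J ⊕ Unit))
    (hfin : ∀ s : Finset I, ∃ x, ∀ i ∈ s, (χ i).Realize (Sum.elim v fun _ => x)) :
    ∃ x, ∀ i, (χ i).Realize (Sum.elim v fun _ => x) := by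
  classical
  have e : ∀ i x, ((χ i).relabel (Sum.map (Set.rangeFactorization v) id)).toBoundedOne.Realize
      (fun a : Set.range v => (a : N)) (fun _ => x) ↔ (χ i).Realize (Sum.elim v fun _ => x) := by
    intro i x
    rw [Formula.realize_toBoundedOne, Formula.realize_relabel, Sum.elim_comp_map]
    rfl
  obtain ⟨x, hx⟩ := h (Set.range v) (Order.lt_succ_of_le (mk_range_le.trans hJ))
    (Set.range fun i => ((χ i).relabel (Sum.map (Set.rangeFactorization v) id)).toBoundedOne) (by
      intro s hs
      choose f hf using fun φ : s => hs φ.2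
      obtain ⟨x, hx⟩ := hfin (Finset.univ.image f)
      refine ⟨x, fun φ hφ => ?_⟩
      have h1 := hf ⟨φ, hφ⟩
      dsimp only at h1
      rw [← h1]
      exact (e _ x).2 (hx _ (Finset.mem_image_of_mem _ (Finset.mem_univ _))))
  exact ⟨x, fun i => (e i x).1 (hx _ ⟨i, rfl⟩)⟩

/-- Saturation of the specialization in a formula with the extension property of the random graph
separates colourings. -/
theorem separatesColourings_of_saturated [Nontrivial B] {U : Order.PFilter B}
    (hU : IsUltrafilterOn U) (S : BVStructure L B M)
    (hS : S.IsFull) (hL : L.card ≤ ℵ₀) {κ : Cardinal.{u}} (hκ : ℵ₀ ≤ κ) (hsat : S.IsSuccSaturated κ)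
    (hcard : IsCardSaturated L (SpecModel S hS U) (Order.succ κ)) (ψ : L.Formula Unit)
    (hψ : ∀ W : Order.PFilter B, IsUltrafilterOn W →
      {x : SpecModel S hS W | ψ.Realize fun _ => x}.Infinite)
    (ρ : L.Formula (Unit ⊕ Unit))
    (hρ : ∀ X Y : Finset (SpecModel S hS U), (∀ x ∈ X, ψ.Realize fun _ => x) →
      (∀ x ∈ Y, ψ.Realize fun _ => x) → Disjoint X Y →
      ∃ z, (∀ x ∈ X, ρ.Realize (Sum.elim (fun _ => x) fun _ => z)) ∧
        ∀ x ∈ Y, ¬ ρ.Realize (Sum.elim (fun _ => x) fun _ => z)) :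
    SeparatesColourings U κ := by
  classical
  intro J hJ e ε he hε
  -- The abstract relation `e` becomes equality of elements, so the colouring becomes a type over
  -- `κ` parameters, consistent at `U` by the extension property of `ρ`.
  obtain ⟨b, hb, hbψ⟩ := S.exists_eq_val hS hL hκ hsat hJ he ψ hψ
  have hbψ' : ∀ i, ψ.Realize fun _ => SpecModel.mk S hS U (b i) := fun i => by
    refine (SpecModel.realize_relabel_iff hU ψ fun _ => b i).2 ?_
    rw [hbψ]
    exact U.top_mem
  obtain ⟨x, hx⟩ := hcard.exists_realize hJ (fun i => SpecModel.mk S hS U (b i))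
    (fun i : J => if ε i then ρ.relabel (Sum.map (fun _ => i) id) else
      (ρ.relabel (Sum.map (fun _ => i) id)).not) (by
      intro s
      obtain ⟨z, h1, h2⟩ := hρ ((s.filter ε).image fun i => SpecModel.mk S hS U (b i))
        ((s.filter fun i => ¬ ε i).image fun i => SpecModel.mk S hS U (b i))
        (by simp only [Finset.mem_image]; rintro _ ⟨i, _, rfl⟩; exact hbψ' i)
        (by simp only [Finset.mem_image]; rintro _ ⟨i, _, rfl⟩; exact hbψ' i) (by
          rw [Finset.disjoint_left]
          simp only [Finset.mem_image, Finset.mem_filter]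
          rintro _ ⟨i, ⟨_, hi⟩, rfl⟩ ⟨j, ⟨_, hj⟩, hij⟩
          have := SpecModel.mk_eq_mk.1 hij.symm
          rw [hb] at this
          exact hU.compl_mem_iff.1 (hε i j hi hj) this)
      refine ⟨z, fun i hi => ?_⟩
      split_ifs with hεi
      · rw [Formula.realize_relabel, Sum.elim_comp_map]
        exact h1 _ (Finset.mem_image_of_mem _ (Finset.mem_filter.2 ⟨hi, hεi⟩))
      · rw [Formula.realize_not, Formula.realize_relabel, Sum.elim_comp_map]
        exact h2 _ (Finset.mem_image_of_mem _ (Finset.mem_filter.2 ⟨hi, hεi⟩)))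
  obtain ⟨m, rfl⟩ := SpecModel.mk_surjective x
  let θ : J → L.Formula M := fun i => ρ.relabel (Sum.elim (fun _ => b i) fun _ => m)
  have hθ : ∀ i, ρ.Realize (Sum.elim (fun _ => SpecModel.mk S hS U (b i))
      fun _ => SpecModel.mk S hS U m) ↔ S.val (θ i) ∈ U := fun i => by
    rw [← SpecModel.realize_relabel_iff (hS := hS) hU]
    refine iff_of_eq (congrArg _ ?_)
    funext y
    rcases y with y | y <;> rfl
  -- The value of the formula demanded at `i`; equal elements cannot satisfy both `ρ` and its
  -- negation, so conflicting values are disjoint from `e i j`.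
  refine ⟨fun i => if ε i then S.val (θ i) else (S.val (θ i))ᶜ, fun i => ?_, fun i j hi hj => ?_⟩
  · have := hx i
    dsimp only
    split_ifs at this ⊢
    · rw [Formula.realize_relabel, Sum.elim_comp_map] at this
      exact (hθ i).1 this
    · rw [Formula.realize_not, Formula.realize_relabel, Sum.elim_comp_map] at this
      exact hU.compl_mem_iff.2 fun h => this ((hθ i).2 h)
  · dsimp only
    rw [if_pos hi, if_neg hj, ← hb, ← S.val_not, ← S.val_inf, ← S.val_inf]
    refine S.toPreVal.val_eq_bot fun N _ _ v => ?_
    simp only [Formula.realize_inf, Formula.realize_not, θ, Formula.realize_relabel, paramEq,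
      Formula.realize_equal, Term.realize_var]
    rintro ⟨⟨h1, h2⟩, h3⟩
    refine h2 ?_
    convert h1 using 1
    funext y
    rcases y with y | y
    · exact h3.symm
    · rfl

/-- Saturation of a specialization from back and forth systems between it and its extensions. -/
theorem isCardSaturated_of_backForth [Nontrivial B] {U : Order.PFilter B}
    (hU : IsUltrafilterOn U) (S : BVStructure L B M)
    (hS : S.IsFull) {κ : Cardinal.{u}} (hκ : ℵ₀ ≤ κ)
    (h : ∀ (M' : Type u) (S' : BVStructure L B M') (hS' : S'.IsFull), S'.IsSuccSaturated κ →
      (∀ T : L.Theory, SpecModel S hS U ⊨ T → S'.IsModelOf T) →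
      ∀ j : SpecModel S hS U → SpecModel S' hS' U,
      (∀ θ : L.Formula (SpecModel S hS U), θ.Realize j ↔ θ.Realize id) →
      ∀ A : Set (SpecModel S hS U), #A ≤ κ → ∀ x : SpecModel S' hS' U, ∃ y : SpecModel S hS U,
      ∀ θ : L.Formula (A ⊕ Unit), θ.Realize (Sum.elim (fun a => j a) fun _ => x) ↔
        θ.Realize (Sum.elim (fun a => (a : SpecModel S hS U)) fun _ => y)) :
    IsCardSaturated L (SpecModel S hS U) (Order.succ κ) := by
  classical
  intro A hA p hp
  let q : L.BoundedFormula A 1 → L.Formula (A ⊕ Unit) := fun φ =>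
    φ.toFormula.relabel (Sum.map id fun _ => ())
  have hq : ∀ {N : Type u} [L.Structure N] (φ : L.BoundedFormula A 1) (v : A → N) (x : N),
      (q φ).Realize (Sum.elim v fun _ => x) ↔ φ.Realize v fun _ => x := by
    intro N _ φ v x
    simp only [q]
    rw [Formula.realize_relabel, BoundedFormula.realize_toFormula, Sum.elim_comp_map]
    rfl
  -- The type is realized in an extension which is again the specialization of a saturated
  -- structure; the hypothesis moves the realization back.
  obtain ⟨M', S', hS', hsat', hT, j, x, hj, hx⟩ := exists_specModel_extension hU hκ
    (SpecModel S hS U) ((fun φ => (q φ).relabel (Sum.map (↑) id)) '' p) (by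
      intro s hs
      choose f hf hf' using fun γ : s => hs γ.2
      obtain ⟨x, hx⟩ := hp (Finset.univ.image f) (by
        intro φ hφ
        simp only [Finset.coe_image, Set.mem_image] at hφ
        obtain ⟨γ, _, rfl⟩ := hφ
        exact hf γ)
      refine ⟨x, fun γ hγ => ?_⟩
      have h1 := hf' ⟨γ, hγ⟩
      dsimp only at h1
      rw [← h1, Formula.realize_relabel, Sum.elim_comp_map]
      exact (hq _ _ _).2 (hx _ (Finset.mem_image_of_mem _ (Finset.mem_univ _))))
  obtain ⟨y, hy⟩ := h M' S' hS' hsat' hT j hj A (Order.lt_succ_iff.1 hA) x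
  refine ⟨y, fun φ hφ => ?_⟩
  rw [← hq, ← hy]
  have := hx _ ⟨φ, hφ, rfl⟩
  rw [Formula.realize_relabel, Sum.elim_comp_map] at this
  exact this

end BoolEquiv


/-! ### The random graph -/

section RandomGraph

open Cardinal

theorem realize_of_randomGraphTheory {N : Type*} [Language.graph.Structure N] [Nonempty N]
    (hN : N ⊨ randomGraphTheory) {X : Type*} (θ : Language.graph.Formula X)
    (h : ∀ (V : Type) (G : SimpleGraph V), G.HasExtensionProperty → ∀ v : X → V,
      @Formula.Realize _ V G.structure _ θ v) (v : X → N) : θ.Realize v := by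
  refine (Formula.realize_allClosure θ).1 (hN.realize_of_mem _ ?_) v
  intro V G hG
  let := G.structure
  obtain ⟨z, -⟩ := hG ∅ ∅ (Finset.disjoint_empty_left _)
  have : Nonempty V := ⟨z⟩
  exact (Formula.realize_allClosure θ).2 (h V G hG)

/-- The extension property for sets of size at most `κ`, in a symmetric irreflexive relation. -/
structure IsRandomGraph (N : Type u) (r : N → N → Prop) (κ : Cardinal.{u}) : Prop where
  symm : ∀ a b, r a b → r b a
  irrefl : ∀ a, ¬ r a a
  ext : ∀ (J : Type u) (v : J → N) (ε : J → Prop), #J ≤ κ → (∀ i j, ε i → ¬ ε j → v i ≠ v j) →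
    ∃ z, ∀ i, z ≠ v i ∧ (r z (v i) ↔ ε i)

/-- Adjacency. -/
def graphAdj {N : Type*} [Language.graph.Structure N] (a b : N) : Prop :=
  Structure.RelMap (L := Language.graph) Language.adj ![a, b]

theorem graphAdj_structure {V : Type} (G : SimpleGraph V) (a b : V) :
    @graphAdj V G.structure a b ↔ G.Adj a b := Iff.rfl

/-- The formula `r(s, t)`. -/
noncomputable def graphFormula {X : Type*} (a b : X) : Language.graph.Formula X :=
  Relations.formula₂ (L := Language.graph) Language.adj (Term.var a) (Term.var b)

theorem realize_graphFormula {X N : Type*} [Language.graph.Structure N] (a b : X) (v : X → N) :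
    (graphFormula a b).Realize v ↔ graphAdj (v a) (v b) := by
  rw [graphFormula, Formula.realize_rel₂]
  rfl

open Classical in
/-- The formula saying that `z` is different from `v` and adjacent to it exactly if `p`. -/
noncomputable def graphExtFormula {X : Type*} (z v : X) (p : Prop) : Language.graph.Formula X :=
  (Term.equal (Term.var z) (Term.var v)).not ⊓
    if p then graphFormula z v else (graphFormula z v).not

theorem realize_graphExtFormula {X N : Type*} [Language.graph.Structure N] (z a : X) (p : Prop)
    (v : X → N) :
    (graphExtFormula z a p).Realize v ↔ v z ≠ v a ∧ (graphAdj (v z) (v a) ↔ p) := by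
  rw [graphExtFormula, Formula.realize_inf, Formula.realize_not, Formula.realize_equal]
  refine and_congr Iff.rfl ?_
  split_ifs with h <;> simp [Formula.realize_not, realize_graphFormula, h]

/-- The extension axiom for the finite partial type described by `ε`. -/
noncomputable def graphExtension {J : Type*} [Finite J] (ε : J → Prop) : Language.graph.Formula J :=
  (Formula.iInf fun p : {p : J × J // ε p.1 ∧ ¬ ε p.2} =>
    (Term.equal (Term.var p.1.1) (Term.var p.1.2)).not).imp
      (Formula.iExs Unit (Formula.iInf fun i : J =>
        graphExtFormula (Sum.inr ()) (Sum.inl i) (ε i)))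

theorem realize_graphExtension {J N : Type*} [Finite J] [Language.graph.Structure N] (ε : J → Prop)
    (v : J → N) : (graphExtension ε).Realize v ↔ ((∀ i j, ε i → ¬ ε j → v i ≠ v j) →
      ∃ z, ∀ i, z ≠ v i ∧ (graphAdj z (v i) ↔ ε i)) := by
  simp only [graphExtension, Formula.realize_imp, Formula.realize_iInf, Formula.realize_iExs,
    realize_graphExtFormula, Formula.realize_not, Formula.realize_equal, Term.realize_var,
    Subtype.forall, Prod.forall, Sum.elim_inl, Sum.elim_inr]
  refine imp_congr ⟨fun h i j hi hj => h i j ⟨hi, hj⟩, fun h i j hij => h i j hij.1 hij.2⟩ ?_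
  exact ⟨fun ⟨z, hz⟩ => ⟨z (), hz⟩, fun ⟨z, hz⟩ => ⟨fun _ => z, hz⟩⟩

theorem isRandomGraph_of_model {N : Type u} [Language.graph.Structure N] [Nonempty N]
    (hN : N ⊨ randomGraphTheory) :
    (∀ a b : N, graphAdj a b → graphAdj b a) ∧ (∀ a : N, ¬ graphAdj a a) ∧
    ∀ (J : Type u) [Finite J] (v : J → N) (ε : J → Prop), (∀ i j, ε i → ¬ ε j → v i ≠ v j) →
      ∃ z, ∀ i, z ≠ v i ∧ (graphAdj z (v i) ↔ ε i) := by
  refine ⟨fun a b => ?_, fun a => ?_, fun J _ v ε hv => ?_⟩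
  · have := realize_of_randomGraphTheory hN ((graphFormula (0 : Fin 2) 1).imp (graphFormula 1 0))
      (fun V G hG v => by
        let := G.structure
        simp only [Formula.realize_imp, realize_graphFormula, graphAdj_structure]
        exact fun h => h.symm) ![a, b]
    simpa [Formula.realize_imp, realize_graphFormula] using this
  · have := realize_of_randomGraphTheory hN (graphFormula (0 : Fin 1) 0).not
      (fun V G hG v => by
        let := G.structure
        simp [Formula.realize_not, realize_graphFormula, graphAdj_structure]) ![a]
    simpa [Formula.realize_not, realize_graphFormula] using this
  · classical
    cases nonempty_fintype J
    refine (realize_graphExtension ε v).1 (realize_of_randomGraphTheory hN (graphExtension ε)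
      (fun V G hG v => ?_) v) hv
    let := G.structure
    refine (realize_graphExtension ε v).2 fun hv => ?_
    obtain ⟨z, h1, h2, h3, h4⟩ := hG ((Finset.univ.filter ε).image v)
      ((Finset.univ.filter fun i => ¬ ε i).image v) (by
        rw [Finset.disjoint_left]
        simp only [Finset.mem_image, Finset.mem_filter, Finset.mem_univ, true_and]
        rintro _ ⟨i, hi, rfl⟩ ⟨j, hj, hij⟩
        exact hv i j hi hj hij.symm)
    refine ⟨z, fun i => ?_⟩
    by_cases hi : ε i
    · have hm : v i ∈ (Finset.univ.filter ε).image v :=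
        Finset.mem_image_of_mem v (Finset.mem_filter.2 ⟨Finset.mem_univ _, hi⟩)
      exact ⟨fun h => h1 (h ▸ hm), by simpa [hi, graphAdj_structure] using h3 _ hm⟩
    · have hm : v i ∈ (Finset.univ.filter fun i => ¬ ε i).image v :=
        Finset.mem_image_of_mem v (Finset.mem_filter.2 ⟨Finset.mem_univ _, hi⟩)
      exact ⟨fun h => h2 (h ▸ hm), by simpa [hi, graphAdj_structure] using h4 _ hm⟩

theorem infinite_of_randomGraphTheory {N : Type u} [Language.graph.Structure N] [Nonempty N]
    (hN : N ⊨ randomGraphTheory) : Infinite N := by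
  rw [← not_finite_iff_infinite]
  intro _
  obtain ⟨z, hz⟩ := (isRandomGraph_of_model hN).2.2 N id (fun _ => True) (by simp)
  exact (hz z).1 rfl

theorem card_graph_le : (Language.graph).card ≤ ℵ₀ := by
  have : IsEmpty (Σ n, Language.graph.Functions n) := ⟨fun x => x.2.elim⟩
  have : Countable (Σ n, Language.graph.Relations n) := by
    refine ⟨⟨fun _ => 0, ?_⟩⟩
    rintro ⟨_, ⟨⟩⟩ ⟨_, ⟨⟩⟩ _
    rfl
  have : Countable Language.graph.Symbols :=
    inferInstanceAs (Countable ((Σ n, Language.graph.Functions n) ⊕ (Σ n, Language.graph.Relations n)))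
  exact Cardinal.mk_le_aleph0

/-- The existence of the random graph. -/
theorem exists_hasExtensionProperty : ∃ G : SimpleGraph ℕ, G.HasExtensionProperty := by
  classical
  -- Join two numbers if one is a member of the finite set coded by the other.
  let e : ℕ ≃ Finset ℕ := (Denumerable.eqv (Finset ℕ)).symm
  refine ⟨⟨fun a b => a ≠ b ∧ (a ∈ e b ∨ b ∈ e a), ⟨fun a b h => ⟨h.1.symm, h.2.symm⟩⟩,
    ⟨fun a h => h.1 rfl⟩⟩, fun X Y hXY => ?_⟩
  -- Infinitely many codes contain `X` and miss `Y`, because one irrelevant element may be added.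
  -- Some such code lies outside `X`, `Y` and all the sets coded by members of `Y`.
  have hinf : {z | ∃ n ∉ Y, e z = insert n X}.Infinite := by
    have h1 : {n | n ∉ X ∪ Y}.Infinite := (Finset.finite_toSet (X ∪ Y)).infinite_compl
    refine (h1.image (f := fun n => e.symm (insert n X)) ?_).mono ?_
    · intro m hm n hn hmn
      have h2 : insert m X = insert n X := e.symm.injective hmn
      have h3 : m ∈ insert n X := h2 ▸ Finset.mem_insert_self m X
      exact (Finset.mem_insert.1 h3).resolve_right fun h => hm (Finset.mem_union_left _ h)
    · rintro _ ⟨n, hn, rfl⟩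
      exact ⟨n, fun h => hn (Finset.mem_union_right _ h), by simp⟩
  obtain ⟨z, ⟨n, hn, hz⟩, hz'⟩ := hinf.exists_notMem_finset (X ∪ Y ∪ Y.biUnion e)
  simp only [Finset.mem_union, Finset.mem_biUnion, not_or, not_exists, not_and] at hz'
  refine ⟨z, hz'.1.1, hz'.1.2, fun a ha => ⟨fun h => hz'.1.1 (h ▸ ha), Or.inr ?_⟩, fun b hb h => ?_⟩
  · rw [hz]
    exact Finset.mem_insert_of_mem ha
  · rcases h.2 with h | h
    · exact hz'.2 b hb h
    · rw [hz] at h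
      rcases Finset.mem_insert.1 h with rfl | h
      · exact hn hb
      · exact Finset.disjoint_left.1 hXY h hb

/-- The theories are defined by structures in `Type`, while the Boolean-valued models live in the
universe of `B`. -/
theorem exists_model_of_type_zero {L : FirstOrder.Language.{0, 0}} (V : Type) [L.Structure V]
    [Nonempty V] : ∃ (N : Type u) (_ : L.Structure N) (_ : Nonempty N),
      ∀ T : L.Theory, V ⊨ T → N ⊨ T := by
  let : L.Structure (ULift.{u} V) := Equiv.ulift.symm.inducedStructure
  refine ⟨ULift.{u} V, inferInstance, inferInstance, fun T hT => ?_⟩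
  exact StrongHomClass.theory_model
    (Equiv.inducedStructureEquiv (L := L) (Equiv.ulift.{u, 0} (α := V)).symm)

theorem exists_model_randomGraphTheory : ∃ (N : Type u) (_ : Language.graph.Structure N)
    (_ : Nonempty N), N ⊨ randomGraphTheory := by
  obtain ⟨G, hG⟩ := exists_hasExtensionProperty
  let := G.structure
  obtain ⟨N, i1, i2, h⟩ := exists_model_of_type_zero.{u} (L := Language.graph) ℕ
  exact ⟨N, i1, i2, h _ ⟨fun σ hσ => hσ ℕ G hG⟩⟩

/-! ### Saturation of the random graph and separation of colourings -/

section Saturation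

variable {B : Type u} [CompleteBooleanAlgebra B] {U : Order.PFilter B} {κ : Cardinal.{u}}

theorem IsUltrafilterOn.nontrivial (hU : IsUltrafilterOn U) : Nontrivial B :=
  ⟨⟨⊥, ⊤, fun h => hU.1 (h ▸ U.top_mem)⟩⟩

theorem separatesColourings_of_succSaturates (hU : IsUltrafilterOn U) (hκ : ℵ₀ ≤ κ)
    (h : SuccSaturates U κ randomGraphTheory) : SeparatesColourings U κ := by
  classical
  obtain ⟨M, S, hS, hT, hsat, hcard⟩ := h
  have := hU.nontrivial
  refine separatesColourings_of_saturated hU S hS card_graph_le hκ hsat hcard ⊤ (fun W hW => ?_)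
    (graphFormula (Sum.inr ()) (Sum.inl ())) fun X Y _ _ hXY => ?_
  · have := infinite_of_randomGraphTheory (SpecModel.model_of_isModelOf (hS := hS) hW hT)
    simpa [Set.infinite_univ_iff] using Set.infinite_univ (α := SpecModel S hS W)
  · obtain ⟨z, hz⟩ := (isRandomGraph_of_model (SpecModel.model_of_isModelOf (hS := hS) hU hT)).2.2
      (X ∪ Y : Finset _) (fun i => i.1) (fun i => i.1 ∈ X) fun i j hi hj hij => hj (hij ▸ hi)
    refine ⟨z, fun x hx => ?_, fun x hx => ?_⟩ <;> rw [realize_graphFormula]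
    · exact ((hz ⟨x, Finset.mem_union_left _ hx⟩).2).2 hx
    · exact fun hzx => Finset.disjoint_left.1 hXY
        (((hz ⟨x, Finset.mem_union_right _ hx⟩).2).1 hzx) hx

/-- The separating family `d` serves as the family of lower bounds: at any `W` the indices with `d i
∈ W` are coloured consistently with equality at `W`, so finite extension axioms apply there. -/
theorem isRandomGraph_specModel (hU : IsUltrafilterOn U) (hκ : ℵ₀ ≤ κ)
    (hsep : SeparatesColourings U κ) {M : Type u} (S : BVStructure Language.graph B M)
    (hS : S.IsFull) (hT : S.IsModelOf randomGraphTheory) (hsat : S.IsSuccSaturated κ) :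
    IsRandomGraph (SpecModel S hS U) graphAdj κ := by
  have hnt := hU.nontrivial
  have hmod := fun W (hW : IsUltrafilterOn W) =>
    isRandomGraph_of_model (SpecModel.model_of_isModelOf (hS := hS) hW hT)
  refine ⟨(hmod U hU).1, (hmod U hU).2.1, fun J v ε hJ hv => ?_⟩
  choose b hb using fun i => SpecModel.mk_surjective (v i)
  obtain rfl : (fun i => SpecModel.mk S hS U (b i)) = v := funext hb
  obtain ⟨d, hd, hd'⟩ := hsep J hJ (fun i j => S.val (Language.graph.paramEq (b i) (b j))) ε
    (S.toPreVal.isBoolEquiv _ fun N _ _ v => by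
      simp only [paramEq, Formula.realize_equal, Term.realize_var]
      exact eq_equivalence.comap fun i => v (b i))
    (fun i j hi hj => hU.compl_mem_iff.2 fun h => hv i j hi hj (SpecModel.mk_eq_mk.2 h))
  obtain ⟨m, hm⟩ := S.exists_realization hS card_graph_le hκ hsat (J := PUnit)
    (by simpa using one_le_aleph0.trans hκ) hJ
    (fun i => graphExtFormula (Sum.inr PUnit.unit) (Sum.inl (b i)) (ε i)) d (by
      intro W hW s hs
      obtain ⟨z, hz⟩ := (hmod W hW).2.2 s (fun i => SpecModel.mk S hS W (b i)) (fun i => ε i) (by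
        intro i j hi hj hij
        refine hW.1 ?_
        rw [← hd' i j hi hj]
        exact Order.PFilter.inf_mem (Order.PFilter.inf_mem (hs i i.2) (hs j j.2))
          (SpecModel.mk_eq_mk.1 hij))
      refine ⟨fun _ => z, fun k hk => ?_⟩
      rw [realize_graphExtFormula]
      exact hz ⟨k, hk⟩)
  refine ⟨SpecModel.mk S hS U (m PUnit.unit), fun i => ?_⟩
  have h1 := (SpecModel.realize_iff (hS := hS) hU _).2 (U.mem_of_le (hm i) (hd i))
  rwa [Formula.realize_relabel, realize_graphExtFormula] at h1

/-- The graph of a small partial isomorphism between graphs. -/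
structure IsSmallPartialIso {N₁ N₂ : Type u} (r₁ : N₁ → N₁ → Prop) (r₂ : N₂ → N₂ → Prop)
    (κ : Cardinal.{u}) (G : Set (N₁ × N₂)) : Prop where
  card_le : #G ≤ κ
  eq_iff : ∀ x ∈ G, ∀ y ∈ G, x.1 = y.1 ↔ x.2 = y.2
  rel_iff : ∀ x ∈ G, ∀ y ∈ G, r₁ x.1 y.1 ↔ r₂ x.2 y.2

theorem IsSmallPartialIso.swap {N₁ N₂ : Type u} {r₁ : N₁ → N₁ → Prop} {r₂ : N₂ → N₂ → Prop}
    {G : Set (N₁ × N₂)} (h : IsSmallPartialIso r₁ r₂ κ G) :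
    IsSmallPartialIso r₂ r₁ κ (Prod.swap ⁻¹' G) where
  card_le := by
    refine le_trans (le_of_eq ?_) h.card_le
    rw [← Set.image_swap_eq_preimage_swap]
    exact mk_image_eq Prod.swap_injective
  eq_iff x hx y hy := (h.eq_iff _ hx _ hy).symm
  rel_iff x hx y hy := (h.rel_iff _ hx _ hy).symm

theorem IsSmallPartialIso.exists_extend {N₁ N₂ : Type u} {r₁ : N₁ → N₁ → Prop}
    {r₂ : N₂ → N₂ → Prop} (hκ : ℵ₀ ≤ κ) (h₁ : IsRandomGraph N₁ r₁ κ) (h₂ : IsRandomGraph N₂ r₂ κ)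
    {G : Set (N₁ × N₂)} (h : IsSmallPartialIso r₁ r₂ κ G) (a : N₁) :
    ∃ G', IsSmallPartialIso r₁ r₂ κ G' ∧ G ⊆ G' ∧ ∃ b, (a, b) ∈ G' := by
  by_cases ha : ∃ p ∈ G, p.1 = a
  · obtain ⟨p, hp, rfl⟩ := ha
    exact ⟨G, h, subset_rfl, p.2, hp⟩
  push Not at ha
  obtain ⟨b, hb⟩ := h₂.ext G (fun p => p.1.2) (fun p => r₁ a p.1.1) h.card_le
    (fun p q hp hq hpq => by
      have := (h.eq_iff p.1 p.2 q.1 q.2).2 hpq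
      rw [this] at hp
      exact hq hp)
  refine ⟨insert (a, b) G, ⟨mk_insert_le.trans
    (add_le_of_le hκ h.card_le (one_le_aleph0.trans hκ)), ?_, ?_⟩,
    Set.subset_insert _ _, b, Set.mem_insert _ _⟩
  · rintro x (rfl | hx) y (rfl | hy)
    · simp
    · exact ⟨fun h => absurd h.symm (ha y hy), fun h => absurd h (hb ⟨y, hy⟩).1⟩
    · exact ⟨fun h => absurd h (ha x hx), fun h => absurd h.symm (hb ⟨x, hx⟩).1⟩
    · exact h.eq_iff x hx y hy
  · rintro x (rfl | hx) y (rfl | hy)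
    · exact ⟨fun h => absurd h (h₁.irrefl _), fun h => absurd h (h₂.irrefl _)⟩
    · exact (hb ⟨y, hy⟩).2.symm
    · exact ⟨fun h => h₂.symm _ _ ((hb ⟨x, hx⟩).2.2 (h₁.symm _ _ h)),
        fun h => h₁.symm _ _ ((hb ⟨x, hx⟩).2.1 (h₂.symm _ _ h))⟩
    · exact h.rel_iff x hx y hy

/-- Any saturated full model will do: its specialization and that of any saturated elementary
extension are random graphs for sets of size `κ`, so small partial isomorphisms form a
back-and-forth system. -/
theorem succSaturates_of_separatesColourings (hU : IsUltrafilterOn U) (hκ : ℵ₀ ≤ κ)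
    (hsep : SeparatesColourings U κ) : SuccSaturates U κ randomGraphTheory := by
  have hnt := hU.nontrivial
  obtain ⟨N, i1, i2, hN⟩ := exists_model_randomGraphTheory.{u}
  obtain ⟨M, S, hS, hsat, hT, -⟩ := exists_specModel_extension (L := Language.graph) hU hκ N ∅ (by
    intro s hs
    obtain rfl : s = ∅ := by simpa using hs
    exact ⟨Classical.arbitrary N, by simp⟩)
  refine ⟨M, S, hS, hT _ hN, hsat, ?_⟩
  refine isCardSaturated_of_backForth hU S hS hκ fun M' S' hS' hsat' hT' j hj A hA x => ?_
  have h2 := isRandomGraph_specModel hU hκ hsep S hS (hT _ hN) hsat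
  have h1 := isRandomGraph_specModel hU hκ hsep S' hS'
    (hT' _ (SpecModel.model_of_isModelOf hU (hT _ hN))) hsat'
  have hG : IsSmallPartialIso graphAdj graphAdj κ ((fun a => (j a, a)) '' A) := by
    refine ⟨mk_image_le.trans hA, ?_, ?_⟩
    · rintro _ ⟨a, _, rfl⟩ _ ⟨b, _, rfl⟩
      simpa [paramEq] using hj (Language.graph.paramEq a b)
    · rintro _ ⟨a, _, rfl⟩ _ ⟨b, _, rfl⟩
      simpa [realize_graphFormula] using hj (graphFormula a b)
  obtain ⟨G, hG', hGG', y, hy⟩ := hG.exists_extend hκ h1 h2 x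
  refine ⟨y, fun θ => ?_⟩
  have := realize_iff_of_backForth (L := Language.graph)
    (IsSmallPartialIso (N₁ := SpecModel S' hS' U) (N₂ := SpecModel S hS U) graphAdj graphAdj κ)
    (fun G hG => hG.eq_iff) (fun G hG n f => f.elim) ?_
    (fun G hG a => hG.exists_extend hκ h1 h2 a) ?_ θ G hG'
    (Sum.elim (fun a : A => (j a, (a : SpecModel S hS U))) fun _ => (x, y)) ?_ default
    (fun i => i.elim0)
  · rw [Formula.Realize, Formula.Realize]
    convert this using 2
    · funext y; rcases y with y | y <;> rfl
    · funext y; rcases y with y | y <;> rfl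
  · rintro G hG _ ⟨⟩ x hx
    have := hG.rel_iff _ (hx 0) _ (hx 1)
    simp only [graphAdj] at this
    convert this using 2 <;>
    · funext i; fin_cases i <;> rfl
  · intro G hG b
    obtain ⟨G', h1', h2', a, ha⟩ := hG.swap.exists_extend hκ h2 h1 b
    exact ⟨_, h1'.swap, fun p hp => h2' (by simpa using hp), a, ha⟩
  · rintro (a | _)
    · exact hGG' ⟨a, a.2, rfl⟩
    · exact hy

end Saturation

end RandomGraph


/-! ### Structures in the language of `T_nlow` -/

namespace NlowStr

open Cardinal

section Predicates

variable {M : Type*} [nlowLanguage.Structure M]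

def P (x : M) : Prop := Structure.RelMap (L := nlowLanguage) NlowRel.P ![x]
def Q (x : M) : Prop := Structure.RelMap (L := nlowLanguage) NlowRel.Q ![x]
def U (n : ℕ+) (x : M) : Prop := Structure.RelMap (L := nlowLanguage) (NlowRel.U n) ![x]
def Pn (n : ℕ+) (x : M) : Prop := Structure.RelMap (L := nlowLanguage) (NlowRel.Pn n) ![x]
def Qn (n : ℕ+) (i : Bool) (x : M) : Prop :=
  Structure.RelMap (L := nlowLanguage) (NlowRel.Qn n i) ![x]
def R (x y : M) : Prop := Structure.RelMap (L := nlowLanguage) NlowRel.R ![x, y]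
def E (x y : M) : Prop := Structure.RelMap (L := nlowLanguage) NlowRel.E ![x, y]
def F (n : ℕ+) (b : Fin n → M) : M := Structure.funMap (L := nlowLanguage) (NlowFun.F n) b

/-- The set `u_a` at level `n`. -/
def nb (n : ℕ+) (a : M) : Set M := {b | Qn n false b ∧ R a b}

end Predicates

/-- The axioms of the base theory which are relevant for partial isomorphisms. -/
structure IsNlow (N : Type*) [nlowLanguage.Structure N] : Prop where
  Q_iff : ∀ x : N, Q x ↔ ¬ P x
  E_equiv : Equivalence (E : N → N → Prop)
  R_sub : ∀ a b : N, R a b → P a ∧ Q b ∧ E a b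
  U_nonempty : ∀ n, ∃ x : N, U n x
  U_iff : ∀ n (x y : N), U n x → (U n y ↔ E x y)
  U_inj : ∀ m n (x : N), U m x → U n x → m = n
  Pn_iff : ∀ n (x : N), Pn n x ↔ U n x ∧ P x
  Q0_sub : ∀ n (x : N), Qn n false x → U n x ∧ Q x
  Q1_iff : ∀ n (x : N), Qn n true x ↔ U n x ∧ Q x ∧ ¬ Qn n false x
  gen : ∀ n (a : N), Pn n a → ∃ b : Fin n → N, Function.Injective b ∧ (∀ i, Qn n false (b i)) ∧
    F n b = a
  nb_inj : ∀ n (a a' : N), Pn n a → Pn n a' → nb n a = nb n a' → a = a'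
  F_good : ∀ (n : ℕ+) (b : Fin n → N), Function.Injective b → (∀ i, Qn n false (b i)) →
    Pn n (F n b) ∧ nb n (F n b) = Set.range b
  F_bad : ∀ (n : ℕ+) (b : Fin n → N), ¬ (Function.Injective b ∧ ∀ i, Qn n false (b i)) →
    F n b = b ⟨0, n.pos⟩

namespace IsNlow

variable {N : Type*} [nlowLanguage.Structure N] (h : IsNlow N)

include h

theorem finite_nb {n : ℕ+} {a : N} (ha : Pn n a) : (nb n a).Finite ∧ (nb n a).ncard = n := by
  obtain ⟨b, hb, hb', rfl⟩ := h.gen n a ha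
  rw [(h.F_good n b hb hb').2]
  refine ⟨Set.finite_range b, ?_⟩
  rw [← Set.image_univ, Set.ncard_image_of_injective _ hb, Set.ncard_univ, Nat.card_eq_fintype_card,
    Fintype.card_fin]

theorem nonempty_nb {n : ℕ+} {a : N} (ha : Pn n a) : (nb n a).Nonempty := by
  rw [← Set.ncard_pos (h.finite_nb ha).1, (h.finite_nb ha).2]
  exact n.pos

theorem not_P_of_Q0 {n : ℕ+} {x : N} (hx : Qn n false x) : ¬ P x :=
  (h.Q_iff x).1 (h.Q0_sub n x hx).2

theorem nb_of_R {n : ℕ+} {a x : N} (hx : Qn n false x) (hR : R a x) : Pn n a ∧ x ∈ nb n a := by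
  refine ⟨(h.Pn_iff n a).2 ⟨?_, (h.R_sub a x hR).1⟩, hx, hR⟩
  exact (h.U_iff n x a (h.Q0_sub n x hx).1).2 (h.E_equiv.symm (h.R_sub a x hR).2.2)

theorem E_of_U {n : ℕ+} {x y : N} (hx : U n x) (hy : U n y) : E x y := (h.U_iff n x y hx).1 hy

end IsNlow

/-! ### Good partial isomorphisms between models of the base axioms -/

section PartialIso

variable {N₁ N₂ : Type u} [nlowLanguage.Structure N₁] [nlowLanguage.Structure N₂]

/-- The neighbourhoods of `a` and `a'` correspond to each other under `G`. -/
def Corr (n : ℕ+) (G : Set (N₁ × N₂)) (a : N₁) (a' : N₂) : Prop :=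
  (∀ z ∈ nb n a, ∃ z', z' ∈ nb n a' ∧ (z, z') ∈ G) ∧ ∀ z' ∈ nb n a', ∃ z, z ∈ nb n a ∧ (z, z') ∈ G

theorem Corr.mono {n : ℕ+} {G G' : Set (N₁ × N₂)} {a : N₁} {a' : N₂} (h : Corr n G a a')
    (hG : G ⊆ G') : Corr n G' a a' :=
  ⟨fun z hz => (h.1 z hz).imp fun _ hz' => ⟨hz'.1, hG hz'.2⟩,
    fun z hz => (h.2 z hz).imp fun _ hz' => ⟨hz'.1, hG hz'.2⟩⟩

theorem Corr.swap {n : ℕ+} {G : Set (N₁ × N₂)} {a : N₁} {a' : N₂} (h : Corr n G a a') :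
    Corr n (Prod.swap ⁻¹' G) a' a := ⟨h.2, h.1⟩

/-- Graphs of small partial isomorphisms between closed substructures. -/
structure IsGood (μ : Cardinal.{u}) (G : Set (N₁ × N₂)) : Prop where
  card_lt : #G < μ
  eq_iff : ∀ x ∈ G, ∀ y ∈ G, x.1 = y.1 ↔ x.2 = y.2
  P_iff : ∀ x ∈ G, P x.1 ↔ P x.2
  U_iff : ∀ n, ∀ x ∈ G, U n x.1 ↔ U n x.2
  Q0_iff : ∀ n, ∀ x ∈ G, Qn n false x.1 ↔ Qn n false x.2
  E_iff : ∀ x ∈ G, ∀ y ∈ G, E x.1 y.1 ↔ E x.2 y.2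
  R_iff : ∀ x ∈ G, ∀ y ∈ G, R x.1 y.1 ↔ R x.2 y.2
  corr : ∀ n, ∀ x ∈ G, Pn n x.1 → Corr n G x.1 x.2
  closed : ∀ n a a', Pn n a → Pn n a' → Corr n G a a' → (a, a') ∈ G

variable {μ : Cardinal.{u}} {G : Set (N₁ × N₂)}

theorem IsGood.Pn_iff (hG : IsGood μ G) (h₁ : IsNlow N₁) (h₂ : IsNlow N₂) (n : ℕ+) {x : N₁ × N₂}
    (hx : x ∈ G) : Pn n x.1 ↔ Pn n x.2 := by
  rw [h₁.Pn_iff, h₂.Pn_iff, hG.U_iff n x hx, hG.P_iff x hx]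

theorem IsGood.Q_iff (hG : IsGood μ G) (h₁ : IsNlow N₁) (h₂ : IsNlow N₂) {x : N₁ × N₂}
    (hx : x ∈ G) : Q x.1 ↔ Q x.2 := by
  rw [h₁.Q_iff, h₂.Q_iff, hG.P_iff x hx]

theorem IsGood.swap (hG : IsGood μ G) (h₁ : IsNlow N₁) (h₂ : IsNlow N₂) :
    IsGood μ (Prod.swap ⁻¹' G) where
  card_lt := by
    rw [← Set.image_swap_eq_preimage_swap]
    exact mk_image_le.trans_lt hG.card_lt
  eq_iff x hx y hy := (hG.eq_iff _ hx _ hy).symm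
  P_iff x hx := (hG.P_iff _ hx).symm
  U_iff n x hx := (hG.U_iff n _ hx).symm
  Q0_iff n x hx := (hG.Q0_iff n _ hx).symm
  E_iff x hx y hy := (hG.E_iff _ hx _ hy).symm
  R_iff x hx y hy := (hG.R_iff _ hx _ hy).symm
  corr n x hx hxn := (hG.corr n _ hx ((hG.Pn_iff h₁ h₂ n hx).2 hxn)).swap
  closed n a a' ha ha' h := hG.closed n a' a ha' ha ⟨h.2, h.1⟩

theorem IsGood.relMap_iff (hG : IsGood μ G) (h₁ : IsNlow N₁) (h₂ : IsNlow N₂) {n : ℕ}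
    (r : nlowLanguage.Relations n) (x : Fin n → N₁ × N₂) (hx : ∀ i, x i ∈ G) :
    (Structure.RelMap r (fun i => (x i).1) ↔ Structure.RelMap r (fun i => (x i).2)) := by
  have e1 : ∀ {N : Type u} (f : Fin 1 → N), f = ![f 0] := fun f => by
    funext i; fin_cases i; rfl
  have e2 : ∀ {N : Type u} (f : Fin 2 → N), f = ![f 0, f 1] := fun f => by
    funext i; fin_cases i <;> rfl
  rcases r with _ | _ | n | n | ⟨n, i⟩ | _ | _
  · rw [e1 fun i => (x i).1, e1 fun i => (x i).2]
    exact hG.P_iff _ (hx 0)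
  · rw [e1 fun i => (x i).1, e1 fun i => (x i).2]
    exact hG.Q_iff h₁ h₂ (hx 0)
  · rw [e1 fun i => (x i).1, e1 fun i => (x i).2]
    exact hG.U_iff n _ (hx 0)
  · rw [e1 fun i => (x i).1, e1 fun i => (x i).2]
    exact hG.Pn_iff h₁ h₂ n (hx 0)
  · rw [e1 fun i => (x i).1, e1 fun i => (x i).2]
    cases i
    · exact hG.Q0_iff n _ (hx 0)
    · refine (h₁.Q1_iff n _).trans (Iff.trans ?_ (h₂.Q1_iff n _).symm)
      rw [hG.U_iff n _ (hx 0), hG.Q_iff h₁ h₂ (hx 0), hG.Q0_iff n _ (hx 0)]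
  · rw [e2 fun i => (x i).1, e2 fun i => (x i).2]
    exact hG.R_iff _ (hx 0) _ (hx 1)
  · rw [e2 fun i => (x i).1, e2 fun i => (x i).2]
    exact hG.E_iff _ (hx 0) _ (hx 1)

/-- The field `closed` is made for this: two values of `F_n` at corresponding good tuples have
corresponding neighbourhoods, so they form a pair of `G`. -/
theorem IsGood.funMap_mem (hG : IsGood μ G) (h₁ : IsNlow N₁) (h₂ : IsNlow N₂) {n : ℕ}
    (f : nlowLanguage.Functions n) (x : Fin n → N₁ × N₂) (hx : ∀ i, x i ∈ G) :
    (Structure.funMap f (fun i => (x i).1), Structure.funMap f (fun i => (x i).2)) ∈ G := by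
  rcases f with ⟨n⟩
  have hinj : Function.Injective (fun i => (x i).1) ↔ Function.Injective (fun i => (x i).2) := by
    refine forall_congr' fun i => forall_congr' fun j => imp_congr (hG.eq_iff _ (hx i) _ (hx j)) ?_
    rfl
  have hQ : (∀ i, Qn n false (x i).1) ↔ ∀ i, Qn n false (x i).2 :=
    forall_congr' fun i => hG.Q0_iff n _ (hx i)
  show (F n _, F n _) ∈ G
  by_cases h : Function.Injective (fun i => (x i).1) ∧ ∀ i, Qn n false (x i).1
  · have g1 := h₁.F_good n _ h.1 h.2
    have g2 := h₂.F_good n _ (hinj.1 h.1) (hQ.1 h.2)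
    refine hG.closed n _ _ g1.1 g2.1 ⟨?_, ?_⟩
    · rw [g1.2, g2.2]
      rintro _ ⟨i, rfl⟩
      exact ⟨_, ⟨i, rfl⟩, hx i⟩
    · rw [g1.2, g2.2]
      rintro _ ⟨i, rfl⟩
      exact ⟨_, ⟨i, rfl⟩, hx i⟩
  · rw [h₁.F_bad n _ h, h₂.F_bad n _ (by rwa [← hinj, ← hQ])]
    exact hx _

/-- Adding a pair of elements which are neither in some `Q_n^0` nor in some `P_n`. -/
theorem IsGood.insert (hG : IsGood μ G) (h₁ : IsNlow N₁) (h₂ : IsNlow N₂) (hμ : ℵ₀ ≤ μ) {x : N₁}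
    {y : N₂} (hx : ∀ p ∈ G, p.1 ≠ x) (hy : ∀ p ∈ G, p.2 ≠ y) (hP : P x ↔ P y)
    (hU : ∀ n, U n x ↔ U n y) (hQx : ∀ n, ¬ Qn n false x) (hQy : ∀ n, ¬ Qn n false y)
    (hPx : ∀ n, ¬ Pn n x) (hE : ∀ p ∈ G, E x p.1 ↔ E y p.2)
    (hR : ∀ p ∈ G, (R x p.1 ↔ R y p.2) ∧ (R p.1 x ↔ R p.2 y)) :
    IsGood μ (Insert.insert (x, y) G) where
  card_lt := mk_insert_le.trans_lt (add_lt_of_lt hμ hG.card_lt (one_lt_aleph0.trans_le hμ))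
  eq_iff := by
    rintro p (rfl | hp) q (rfl | hq)
    · simp
    · exact ⟨fun h => absurd h.symm (hx q hq), fun h => absurd h.symm (hy q hq)⟩
    · exact ⟨fun h => absurd h (hx p hp), fun h => absurd h (hy p hp)⟩
    · exact hG.eq_iff p hp q hq
  P_iff := by
    rintro p (rfl | hp)
    exacts [hP, hG.P_iff p hp]
  U_iff n := by
    rintro p (rfl | hp)
    exacts [hU n, hG.U_iff n p hp]
  Q0_iff n := by
    rintro p (rfl | hp)
    · exact ⟨fun h => absurd h (hQx n), fun h => absurd h (hQy n)⟩
    · exact hG.Q0_iff n p hp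
  E_iff := by
    rintro p (rfl | hp) q (rfl | hq)
    · exact ⟨fun _ => h₂.E_equiv.refl _, fun _ => h₁.E_equiv.refl _⟩
    · exact hE q hq
    · exact ⟨fun h => h₂.E_equiv.symm ((hE p hp).1 (h₁.E_equiv.symm h)),
        fun h => h₁.E_equiv.symm ((hE p hp).2 (h₂.E_equiv.symm h))⟩
    · exact hG.E_iff p hp q hq
  R_iff := by
    rintro p (rfl | hp) q (rfl | hq)
    · constructor
      · intro h
        exact absurd (h₁.R_sub _ _ h).1 ((h₁.Q_iff _).1 (h₁.R_sub _ _ h).2.1)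
      · intro h
        exact absurd (h₂.R_sub _ _ h).1 ((h₂.Q_iff _).1 (h₂.R_sub _ _ h).2.1)
    · exact (hR q hq).1
    · exact (hR p hp).2
    · exact hG.R_iff p hp q hq
  corr n := by
    rintro p (rfl | hp) hn
    · exact absurd hn (hPx n)
    · exact (hG.corr n p hp hn).mono (Set.subset_insert _ _)
  closed n a a' ha ha' h := by
    refine Set.mem_insert_of_mem _ (hG.closed n a a' ha ha' ⟨fun z hz => ?_, fun z hz => ?_⟩)
    · obtain ⟨z', h1, h2⟩ := h.1 z hz
      refine ⟨z', h1, h2.resolve_left fun h3 => ?_⟩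
      obtain ⟨rfl, rfl⟩ := Prod.mk.inj h3
      exact hQx n hz.1
    · obtain ⟨z', h1, h2⟩ := h.2 z hz
      refine ⟨z', h1, h2.resolve_left fun h3 => ?_⟩
      obtain ⟨rfl, rfl⟩ := Prod.mk.inj h3
      exact hQy n hz.1

theorem mk_finset_lt (hμ : ℵ₀ ≤ μ) {X : Type u} (hX : #X < μ) : #(Finset X) < μ := by
  cases finite_or_infinite X
  · exact (mk_lt_aleph0_iff.2 inferInstance).trans_le hμ
  · rwa [mk_finset_of_infinite]

/-- A point of `P_n` is determined by its finite neighbourhood, from which the level `n` can also be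
read off because the `U_n` are disjoint. -/
theorem mk_generated_lt {N : Type u} [nlowLanguage.Structure N] (h : IsNlow N) (hμ : ℵ₀ ≤ μ)
    {X : Set N} (hX : #X < μ) : #{a : N | ∃ n, Pn n a ∧ nb n a ⊆ X} < μ := by
  classical
  refine lt_of_le_of_lt ?_ (mk_finset_lt hμ hX)
  have hfin : ∀ a : {a : N | ∃ n, Pn n a ∧ nb n a ⊆ X}, ∃ s : Finset X, ∃ n, Pn n a.1 ∧
      nb n a.1 = (↑) '' (s : Set X) := by
    rintro ⟨a, n, ha, hX⟩
    have hf : {x : X | (x : N) ∈ nb n a}.Finite :=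
      (h.finite_nb ha).1.preimage Subtype.val_injective.injOn
    refine ⟨hf.toFinset, n, ha, ?_⟩
    ext z
    constructor
    · intro hz
      exact ⟨⟨z, hX hz⟩, by simpa using hz, rfl⟩
    · rintro ⟨z, hz, rfl⟩
      simpa using hz
  choose s n hs hs' using hfin
  refine mk_le_of_injective (f := s) fun a b hab => Subtype.ext ?_
  have e : nb (n a) a.1 = nb (n b) b.1 := by rw [hs', hs', hab]
  obtain ⟨z, hz⟩ := h.nonempty_nb (hs a)
  have hz' : z ∈ nb (n b) b.1 := e ▸ hz
  have hn : n a = n b := h.U_inj _ _ z (h.Q0_sub _ _ hz.1).1 (h.Q0_sub _ _ hz'.1).1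
  refine h.nb_inj (n a) _ _ (hs a) (hn ▸ hs b) ?_
  rw [e, hn]

/-- Adding a pair of elements of `Q_n^0`. -/
theorem IsGood.insert_Q0 (hG : IsGood μ G) (h₁ : IsNlow N₁) (h₂ : IsNlow N₂) (hμ : ℵ₀ ≤ μ)
    {x : N₁} {y : N₂} {n : ℕ+} (hx : ∀ p ∈ G, p.1 ≠ x) (hy : ∀ p ∈ G, p.2 ≠ y)
    (hQx : Qn n false x) (hQy : Qn n false y)
    (hR : ∀ a a', Pn n a → Pn n a' → x ∈ nb n a → y ∈ nb n a' →
      Corr n (Insert.insert (x, y) G) a a' → ∀ p ∈ G, Qn n true p.1 → (R a p.1 ↔ R a' p.2)) :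
    ∃ G', IsGood μ G' ∧ G ⊆ G' ∧ (x, y) ∈ G' := by
  set H : Set (N₁ × N₂) := Insert.insert (x, y) G with hH
  have hHeq : ∀ p ∈ H, ∀ q ∈ H, p.1 = q.1 ↔ p.2 = q.2 := by
    rintro p (rfl | hp) q (rfl | hq)
    · simp
    · exact ⟨fun h => absurd h.symm (hx q hq), fun h => absurd h.symm (hy q hq)⟩
    · exact ⟨fun h => absurd h (hx p hp), fun h => absurd h (hy p hp)⟩
    · exact hG.eq_iff p hp q hq
  have hHcorr : ∀ {a a'}, Corr n H a a' → ∀ p ∈ H, p.1 ∈ nb n a ↔ p.2 ∈ nb n a' := by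
    intro a a' h p hp
    constructor
    · intro hz
      obtain ⟨z', hz', hzz'⟩ := h.1 _ hz
      rwa [(hHeq p hp _ hzz').1 rfl]
    · intro hz
      obtain ⟨z', hz', hzz'⟩ := h.2 _ hz
      rwa [(hHeq p hp _ hzz').2 rfl]
  have hxH : (x, y) ∈ H := Set.mem_insert _ _
  -- Adding `x` to `Q_n^0` generates all points of `P_n` whose neighbourhoods contain `x` and
  -- otherwise lie in the old domain; they are matched through their neighbourhoods.
  let New : Set (N₁ × N₂) := {q | Pn n q.1 ∧ Pn n q.2 ∧ x ∈ nb n q.1 ∧ y ∈ nb n q.2 ∧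
    Corr n H q.1 q.2}
  have hold : ∀ m a a', Corr m H a a' → x ∉ nb m a → y ∉ nb m a' → Corr m G a a' := by
    intro m a a' h hxa hya
    refine ⟨fun z hz => ?_, fun z hz => ?_⟩
    · obtain ⟨z', h1, h2⟩ := h.1 z hz
      refine ⟨z', h1, h2.resolve_left fun h3 => ?_⟩
      obtain ⟨rfl, rfl⟩ := Prod.mk.inj h3
      exact hxa hz
    · obtain ⟨z', h1, h2⟩ := h.2 z hz
      refine ⟨z', h1, h2.resolve_left fun h3 => ?_⟩
      obtain ⟨rfl, rfl⟩ := Prod.mk.inj h3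
      exact hya hz
  have hUx := (h₁.Q0_sub n x hQx).1
  have hUy := (h₂.Q0_sub n y hQy).1
  have hPx := h₁.not_P_of_Q0 hQx
  have hPy := h₂.not_P_of_Q0 hQy
  have hNewG : ∀ q ∈ New, ∀ p ∈ G, q.1 ≠ p.1 ∧ q.2 ≠ p.2 := by
    rintro q ⟨hq1, hq2, hqx, hqy, -⟩ p hp
    constructor
    · intro h
      obtain ⟨z', -, hz'⟩ := (hG.corr n p hp (h ▸ hq1)).1 x (h ▸ hqx)
      exact hx _ hz' rfl
    · intro h
      have hp2 : Pn n p.2 := h ▸ hq2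
      obtain ⟨z', -, hz'⟩ := (hG.corr n p hp ((hG.Pn_iff h₁ h₂ n hp).2 hp2)).2 y (h ▸ hqy)
      exact hy _ hz' rfl
  have hNewx : ∀ q ∈ New, q.1 ≠ x ∧ q.2 ≠ y := by
    rintro q ⟨hq1, hq2, -⟩
    exact ⟨fun h => hPx (h ▸ ((h₁.Pn_iff n _).1 hq1).2),
      fun h => hPy (h ▸ ((h₂.Pn_iff n _).1 hq2).2)⟩
  have hNew_eq : ∀ q ∈ New, ∀ r ∈ New, q.1 = r.1 ↔ q.2 = r.2 := by
    rintro q ⟨hq1, hq2, hqx, hqy, hq⟩ r ⟨hr1, hr2, hrx, hry, hr⟩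
    constructor
    · intro h
      refine h₂.nb_inj n _ _ hq2 hr2 (Set.ext fun z => ⟨fun hz => ?_, fun hz => ?_⟩)
      · obtain ⟨w, hw, hwz⟩ := hq.2 z hz
        exact (hHcorr hr _ hwz).1 (h ▸ hw)
      · obtain ⟨w, hw, hwz⟩ := hr.2 z hz
        exact (hHcorr hq _ hwz).1 (h ▸ hw)
    · intro h
      refine h₁.nb_inj n _ _ hq1 hr1 (Set.ext fun z => ⟨fun hz => ?_, fun hz => ?_⟩)
      · obtain ⟨w, hw, hwz⟩ := hq.1 z hz
        exact (hHcorr hr _ hwz).2 (h ▸ hw)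
      · obtain ⟨w, hw, hwz⟩ := hr.1 z hz
        exact (hHcorr hq _ hwz).2 (h ▸ hw)
  have heq : ∀ p ∈ H ∪ New, ∀ q ∈ H ∪ New, p.1 = q.1 ↔ p.2 = q.2 := by
    have hHN : ∀ p ∈ H, ∀ q ∈ New, q.1 ≠ p.1 ∧ q.2 ≠ p.2 := by
      rintro p (rfl | hp) q hq
      exacts [hNewx q hq, hNewG q hq p hp]
    rintro p (hp | hp) q (hq | hq)
    · exact hHeq p hp q hq
    · exact ⟨fun h => absurd h.symm (hHN p hp q hq).1, fun h => absurd h.symm (hHN p hp q hq).2⟩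
    · exact ⟨fun h => absurd h (hHN q hq p hp).1, fun h => absurd h (hHN q hq p hp).2⟩
    · exact hNew_eq p hp q hq
  have hU : ∀ m, ∀ p ∈ H ∪ New, U m p.1 ↔ U m p.2 := by
    have aux : ∀ m (a : N₁) (a' : N₂), U n a → U n a' → (U m a ↔ U m a') := by
      intro m a a' ha ha'
      constructor
      · intro h
        rwa [h₁.U_inj m n a h ha]
      · intro h
        rwa [h₂.U_inj m n a' h ha']
    rintro m p ((rfl | hp) | hp)
    · exact aux m x y hUx hUy
    · exact hG.U_iff m p hp
    · exact aux m _ _ ((h₁.Pn_iff n _).1 hp.1).1 ((h₂.Pn_iff n _).1 hp.2.1).1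
  have hcardH : #H < μ := mk_insert_le.trans_lt
    (add_lt_of_lt hμ hG.card_lt (one_lt_aleph0.trans_le hμ))
  -- elements of the class `U_n`
  have hE : ∀ p ∈ H ∪ New, ∀ q ∈ H ∪ New, U n p.1 → (E p.1 q.1 ↔ E p.2 q.2) := by
    intro p hp q hq hpU
    rw [← h₁.U_iff n _ _ hpU, ← h₂.U_iff n _ _ ((hU n p hp).1 hpU)]
    exact hU n q hq
  have hNewU : ∀ p ∈ H ∪ New, p ∉ G → U n p.1 := by
    rintro p ((rfl | hp) | hp) hpG
    exacts [hUx, absurd hp hpG, ((h₁.Pn_iff n _).1 hp.1).1]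
  refine ⟨H ∪ New, ?_, (Set.subset_insert _ _).trans Set.subset_union_left, Or.inl hxH⟩
  refine ⟨?_, heq, ?_, hU, ?_, ?_, ?_, ?_, ?_⟩
  · refine (mk_union_le _ _).trans_lt (add_lt_of_lt hμ hcardH ?_)
    have h1 : #(Prod.fst '' New) < μ := by
      refine lt_of_le_of_lt (mk_le_mk_of_subset ?_)
        (mk_generated_lt h₁ hμ (X := Prod.fst '' H) (mk_image_le.trans_lt hcardH))
      rintro _ ⟨q, ⟨hq1, -, -, -, hq⟩, rfl⟩
      refine ⟨n, hq1, fun z hz => ?_⟩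
      obtain ⟨z', -, hz'⟩ := hq.1 z hz
      exact ⟨_, hz', rfl⟩
    rwa [mk_image_eq_of_injOn _ _ fun p hp q hq h => Prod.ext h ((hNew_eq p hp q hq).1 h)] at h1
  · rintro p ((rfl | hp) | hp)
    · exact ⟨fun h => absurd h hPx, fun h => absurd h hPy⟩
    · exact hG.P_iff p hp
    · exact ⟨fun _ => ((h₂.Pn_iff n _).1 hp.2.1).2, fun _ => ((h₁.Pn_iff n _).1 hp.1).2⟩
  · rintro m p ((rfl | hp) | hp)
    · constructor
      · intro h
        rwa [h₁.U_inj m n x (h₁.Q0_sub m x h).1 hUx]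
      · intro h
        rwa [h₂.U_inj m n y (h₂.Q0_sub m y h).1 hUy]
    · exact hG.Q0_iff m p hp
    · exact ⟨fun h => absurd ((h₁.Pn_iff n _).1 hp.1).2 (h₁.not_P_of_Q0 h),
        fun h => absurd ((h₂.Pn_iff n _).1 hp.2.1).2 (h₂.not_P_of_Q0 h)⟩
  · intro p hp q hq
    by_cases hpG : p ∈ G
    · by_cases hqG : q ∈ G
      · exact hG.E_iff p hpG q hqG
      · have := hE q hq p hp (hNewU q hq hqG)
        exact ⟨fun h => h₂.E_equiv.symm (this.1 (h₁.E_equiv.symm h)),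
          fun h => h₁.E_equiv.symm (this.2 (h₂.E_equiv.symm h))⟩
    · exact hE p hp q hq (hNewU p hp hpG)
  · -- the relation `R`
    have hP1 : ∀ q ∈ New, ∀ p : N₁, ¬ R p q.1 := fun q hq p h =>
      (h₁.Q_iff _).1 (h₁.R_sub _ _ h).2.1 ((h₁.Pn_iff n _).1 hq.1).2
    have hP2 : ∀ q ∈ New, ∀ p : N₂, ¬ R p q.2 := fun q hq p h =>
      (h₂.Q_iff _).1 (h₂.R_sub _ _ h).2.1 ((h₂.Pn_iff n _).1 hq.2.1).2
    rintro p ((rfl | hp) | hp) q ((rfl | hq) | hq)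
    · exact ⟨fun h => absurd (h₁.R_sub _ _ h).1 hPx, fun h => absurd (h₂.R_sub _ _ h).1 hPy⟩
    · exact ⟨fun h => absurd (h₁.R_sub _ _ h).1 hPx, fun h => absurd (h₂.R_sub _ _ h).1 hPy⟩
    · exact ⟨fun h => absurd (h₁.R_sub _ _ h).1 hPx, fun h => absurd (h₂.R_sub _ _ h).1 hPy⟩
    · constructor
      · intro h
        obtain ⟨h3, h4⟩ := h₁.nb_of_R hQx h
        obtain ⟨z', -, hz'⟩ := (hG.corr n p hp h3).1 x h4
        exact absurd rfl (hx _ hz')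
      · intro h
        obtain ⟨h3, h4⟩ := h₂.nb_of_R hQy h
        obtain ⟨z', -, hz'⟩ := (hG.corr n p hp ((hG.Pn_iff h₁ h₂ n hp).2 h3)).2 y h4
        exact absurd rfl (hy _ hz')
    · exact hG.R_iff p hp q hq
    · exact ⟨fun h => absurd h (hP1 q hq _), fun h => absurd h (hP2 q hq _)⟩
    · exact ⟨fun _ => hp.2.2.2.1.2, fun _ => hp.2.2.1.2⟩
    · have hpU1 := ((h₁.Pn_iff n _).1 hp.1).1
      have hpU2 := ((h₂.Pn_iff n _).1 hp.2.1).1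
      -- For a new point of `P_n`, its relation to `Q_n^0` is fixed by the correspondence and it is
      -- unrelated to other classes; only its relation to `Q_n^1` is free, and there `hR` is used.
      by_cases hqU : U n q.1 ∧ Q q.1
      · by_cases hq0 : Qn n false q.1
        · have h3 := hHcorr hp.2.2.2.2 q (Set.mem_insert_of_mem _ hq)
          have hq0' := (hG.Q0_iff n q hq).1 hq0
          exact ⟨fun h => (h3.1 ⟨hq0, h⟩).2, fun h => (h3.2 ⟨hq0', h⟩).2⟩
        · exact hR p.1 p.2 hp.1 hp.2.1 hp.2.2.1 hp.2.2.2.1 hp.2.2.2.2 q hq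
            ((h₁.Q1_iff n _).2 ⟨hqU.1, hqU.2, hq0⟩)
      · constructor
        · intro h
          obtain ⟨-, h4, h5⟩ := h₁.R_sub _ _ h
          exact absurd ⟨(h₁.U_iff n _ _ hpU1).2 h5, h4⟩ hqU
        · intro h
          obtain ⟨-, h4, h5⟩ := h₂.R_sub _ _ h
          exact absurd ⟨(hG.U_iff n q hq).2 ((h₂.U_iff n _ _ hpU2).2 h5),
            (hG.Q_iff h₁ h₂ hq).2 h4⟩ hqU
    · exact ⟨fun h => absurd h (hP1 q hq _), fun h => absurd h (hP2 q hq _)⟩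
  · rintro m p ((rfl | hp) | hp) hpm
    · exact absurd ((h₁.Pn_iff m _).1 hpm).2 hPx
    · exact (hG.corr m p hp hpm).mono ((Set.subset_insert _ _).trans Set.subset_union_left)
    · rw [h₁.U_inj m n _ ((h₁.Pn_iff m _).1 hpm).1 ((h₁.Pn_iff n _).1 hp.1).1]
      exact hp.2.2.2.2.mono Set.subset_union_left
  · intro m a a' ha ha' h
    have hHm : Corr m H a a' := by
      refine ⟨fun z hz => ?_, fun z hz => ?_⟩
      · obtain ⟨z', hz', hzz'⟩ := h.1 z hz
        refine ⟨z', hz', hzz'.resolve_right fun h3 => ?_⟩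
        exact h₁.not_P_of_Q0 hz.1 ((h₁.Pn_iff n _).1 h3.1).2
      · obtain ⟨z', hz', hzz'⟩ := h.2 z hz
        refine ⟨z', hz', hzz'.resolve_right fun h3 => ?_⟩
        exact h₂.not_P_of_Q0 hz.1 ((h₂.Pn_iff n _).1 h3.2.1).2
    by_cases hm : m = n
    · subst hm
      by_cases hxa : x ∈ nb m a
      · exact Or.inr ⟨ha, ha', hxa, (hHcorr hHm _ hxH).1 hxa, hHm⟩
      · have hya : y ∉ nb m a' := fun h => hxa ((hHcorr hHm _ hxH).2 h)
        exact Or.inl (Set.mem_insert_of_mem _ (hG.closed m a a' ha ha' (hold m a a' hHm hxa hya)))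
    · refine Or.inl (Set.mem_insert_of_mem _ (hG.closed m a a' ha ha' (hold m a a' hHm ?_ ?_)))
      · intro h
        exact hm (h₁.U_inj m n x (h₁.Q0_sub m x h.1).1 hUx)
      · intro h
        exact hm (h₂.U_inj m n y (h₂.Q0_sub m y h.1).1 hUy)

end PartialIso

end NlowStr


/-! ### Rich structures and back and forth for `T_nlow` -/

namespace NlowStr

open Cardinal

/-- The extension properties for sets of parameters of size less than `μ`. -/
structure IsRich (N : Type u) [nlowLanguage.Structure N] (μ : Cardinal.{u}) : Prop where
  exists_Q : ∀ (A : Set N) (ε : N → Prop) (m₀ : N), #A < μ →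
    ∃ y, Q y ∧ E m₀ y ∧ (∀ n, ¬ Qn n false y) ∧ y ∉ A ∧ ∀ p ∈ A, P p → E m₀ p → (R p y ↔ ε p)
  exists_P : ∀ (A : Set N) (ε : N → Prop) (m₀ : N), #A < μ → (∀ n, ¬ U n m₀) →
    ∃ y, P y ∧ E m₀ y ∧ y ∉ A ∧ ∀ q ∈ A, Q q → E m₀ q → (R y q ↔ ε q)
  exists_class : ∀ A : Set N, #A < μ → ∃ m₀, (∀ n, ¬ U n m₀) ∧ ∀ a ∈ A, ¬ E m₀ a
  exists_Q0 : ∀ (n : ℕ+) (A : Set N) (ε : Set N → N → Prop), #A < μ →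
    ∃ y, Qn n false y ∧ y ∉ A ∧ ∀ a, Pn n a → y ∈ nb n a → nb n a ⊆ insert y A →
      ∀ m ∈ A, Qn n true m → (R a m ↔ ε (nb n a \ {y}) m)

theorem IsNlow.U_of_E {N : Type*} [nlowLanguage.Structure N] (h : IsNlow N) {x y : N}
    (hE : E x y) (n : ℕ+) : U n x ↔ U n y :=
  ⟨fun hx => (h.U_iff n x y hx).2 hE, fun hy => (h.U_iff n y x hy).2 (h.E_equiv.symm hE)⟩

/-! ### Extending good partial isomorphisms into rich structures -/

section Extension

variable {N₁ N₂ : Type u} [nlowLanguage.Structure N₁] [nlowLanguage.Structure N₂]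
  {μ : Cardinal.{u}} {G : Set (N₁ × N₂)}

/-- The class of an element is matched in the other structure. -/
theorem IsGood.exists_class (hG : IsGood μ G) (h₁ : IsNlow N₁) (h₂ : IsNlow N₂)
    (hr : IsRich N₂ μ) (x : N₁) :
    ∃ m₀ : N₂, (∀ n, U n x ↔ U n m₀) ∧ ∀ p ∈ G, E x p.1 ↔ E m₀ p.2 := by
  by_cases hx : ∃ n, U n x
  · obtain ⟨n, hn⟩ := hx
    obtain ⟨m₀, hm₀⟩ := h₂.U_nonempty n
    refine ⟨m₀, fun m => ⟨fun h => h₁.U_inj m n x h hn ▸ hm₀, fun h => h₂.U_inj m n _ h hm₀ ▸ hn⟩,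
      fun p hp => ?_⟩
    rw [← h₁.U_iff n _ _ hn, ← h₂.U_iff n _ _ hm₀, hG.U_iff n p hp]
  · by_cases hxG : ∃ p ∈ G, E x p.1
    · obtain ⟨p, hp, hxp⟩ := hxG
      refine ⟨p.2, fun n => ?_, fun q hq => ?_⟩
      · rw [h₁.U_of_E hxp, hG.U_iff n p hp]
      · rw [← hG.E_iff p hp q hq]
        exact ⟨fun h => h₁.E_equiv.trans (h₁.E_equiv.symm hxp) h,
          fun h => h₁.E_equiv.trans hxp h⟩
    · obtain ⟨m₀, h1, h2⟩ := hr.exists_class (Prod.snd '' G) (mk_image_le.trans_lt hG.card_lt)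
      refine ⟨m₀, fun n => ⟨fun h => absurd ⟨n, h⟩ hx, fun h => absurd h (h1 n)⟩, fun p hp => ?_⟩
      exact ⟨fun h => absurd ⟨p, hp, h⟩ hxG, fun h => absurd h (h2 _ ⟨p, hp, rfl⟩)⟩

theorem IsGood.exists_extend_Q (hG : IsGood μ G) (h₁ : IsNlow N₁) (h₂ : IsNlow N₂) (hμ : ℵ₀ ≤ μ)
    (hr : IsRich N₂ μ) {x : N₁} (hx : ∀ p ∈ G, p.1 ≠ x) (hxQ : Q x) (hx0 : ∀ n, ¬ Qn n false x) :
    ∃ G', IsGood μ G' ∧ G ⊆ G' ∧ ∃ y, (x, y) ∈ G' := by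
  obtain ⟨m₀, hU, hE⟩ := hG.exists_class h₁ h₂ hr x
  obtain ⟨y, hyQ, hyE, hy0, hyA, hyR⟩ := hr.exists_Q (Prod.snd '' G)
    -- The adjacency demanded of the new element is that of `x`, transported along `G`.
    (fun p' => ∃ p, (p, p') ∈ G ∧ R p x) m₀ (mk_image_le.trans_lt hG.card_lt)
  have hxP := (h₁.Q_iff x).1 hxQ
  have hyP := (h₂.Q_iff y).1 hyQ
  refine ⟨Insert.insert (x, y) G, hG.insert h₁ h₂ hμ hx (fun p hp h => hyA ⟨p, hp, h⟩)
    ⟨fun h => absurd h hxP, fun h => absurd h hyP⟩ (fun n => (hU n).trans (h₂.U_of_E hyE n)) hx0 hy0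
    (fun n h => hxP ((h₁.Pn_iff n x).1 h).2) (fun p hp => (hE p hp).trans ?_)
    (fun p hp => ⟨⟨fun h => absurd (h₁.R_sub _ _ h).1 hxP, fun h => absurd (h₂.R_sub _ _ h).1 hyP⟩,
      ?_⟩), Set.subset_insert _ _, y, Set.mem_insert _ _⟩
  · exact ⟨fun h => h₂.E_equiv.trans (h₂.E_equiv.symm hyE) h, fun h => h₂.E_equiv.trans hyE h⟩
  · constructor
    · intro h
      obtain ⟨hp1, -, hp2⟩ := h₁.R_sub _ _ h
      exact (hyR p.2 ⟨p, hp, rfl⟩ ((hG.P_iff p hp).1 hp1)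
        ((hE p hp).1 (h₁.E_equiv.symm hp2))).2 ⟨p.1, hp, h⟩
    · intro h
      obtain ⟨hp1, -, hp2⟩ := h₂.R_sub _ _ h
      obtain ⟨q, hq, hqR⟩ := (hyR p.2 ⟨p, hp, rfl⟩ hp1
        (h₂.E_equiv.trans hyE (h₂.E_equiv.symm hp2))).1 h
      rwa [← (hG.eq_iff _ hq p hp).2 rfl]

theorem IsGood.exists_extend_P (hG : IsGood μ G) (h₁ : IsNlow N₁) (h₂ : IsNlow N₂) (hμ : ℵ₀ ≤ μ)
    (hr : IsRich N₂ μ) {x : N₁} (hx : ∀ p ∈ G, p.1 ≠ x) (hxP : P x) (hxU : ∀ n, ¬ U n x) :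
    ∃ G', IsGood μ G' ∧ G ⊆ G' ∧ ∃ y, (x, y) ∈ G' := by
  obtain ⟨m₀, hU, hE⟩ := hG.exists_class h₁ h₂ hr x
  obtain ⟨y, hyP, hyE, hyA, hyR⟩ := hr.exists_P (Prod.snd '' G)
    (fun p' => ∃ p, (p, p') ∈ G ∧ R x p) m₀ (mk_image_le.trans_lt hG.card_lt)
    fun n h => hxU n ((hU n).2 h)
  have hxQ : ∀ z : N₁, ¬ R z x := fun z h => (h₁.Q_iff x).1 (h₁.R_sub _ _ h).2.1 hxP
  have hyQ : ∀ z : N₂, ¬ R z y := fun z h => (h₂.Q_iff y).1 (h₂.R_sub _ _ h).2.1 hyP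
  refine ⟨Insert.insert (x, y) G, hG.insert h₁ h₂ hμ hx (fun p hp h => hyA ⟨p, hp, h⟩)
    ⟨fun _ => hyP, fun _ => hxP⟩ (fun n => (hU n).trans (h₂.U_of_E hyE n))
    (fun n h => h₁.not_P_of_Q0 h hxP) (fun n h => h₂.not_P_of_Q0 h hyP)
    (fun n h => hxU n ((h₁.Pn_iff n x).1 h).1) (fun p hp => (hE p hp).trans ?_)
    (fun p hp => ⟨?_, fun h => absurd h (hxQ _), fun h => absurd h (hyQ _)⟩),
    Set.subset_insert _ _, y, Set.mem_insert _ _⟩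
  · exact ⟨fun h => h₂.E_equiv.trans (h₂.E_equiv.symm hyE) h, fun h => h₂.E_equiv.trans hyE h⟩
  · constructor
    · intro h
      obtain ⟨-, hp1, hp2⟩ := h₁.R_sub _ _ h
      exact (hyR p.2 ⟨p, hp, rfl⟩ ((hG.Q_iff h₁ h₂ hp).1 hp1) ((hE p hp).1 hp2)).2 ⟨p.1, hp, h⟩
    · intro h
      obtain ⟨-, hp1, hp2⟩ := h₂.R_sub _ _ h
      obtain ⟨q, hq, hqR⟩ := (hyR p.2 ⟨p, hp, rfl⟩ hp1 (h₂.E_equiv.trans hyE hp2)).1 h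
      rwa [← (hG.eq_iff _ hq p hp).2 rfl]

theorem IsGood.exists_extend_Q0 (hG : IsGood μ G) (h₁ : IsNlow N₁) (h₂ : IsNlow N₂) (hμ : ℵ₀ ≤ μ)
    (hr : IsRich N₂ μ) {x : N₁} {n : ℕ+} (hxQ : Qn n false x) :
    ∃ G', IsGood μ G' ∧ G ⊆ G' ∧ ∃ y, (x, y) ∈ G' := by
  by_cases hx : ∃ p ∈ G, p.1 = x
  · obtain ⟨p, hp, rfl⟩ := hx
    exact ⟨G, hG, subset_rfl, p.2, hp⟩
  push Not at hx
  -- The demand is read off in the first structure: `S` is the neighbourhood of a new point without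
  -- `y`, and its preimage together with `x` is the neighbourhood of the point `a` to be imitated.
  obtain ⟨y, hyQ, hyA, hyR⟩ := hr.exists_Q0 n (Prod.snd '' G)
    (fun S m' => ∃ a m, Pn n a ∧ (∀ z, z ∈ nb n a ↔ z = x ∨ ∃ z' ∈ S, (z, z') ∈ G) ∧
      (m, m') ∈ G ∧ R a m) (mk_image_le.trans_lt hG.card_lt)
  have hy : ∀ p ∈ G, p.2 ≠ y := fun p hp h => hyA ⟨p, hp, h⟩
  obtain ⟨G', h1, h2, h3⟩ := hG.insert_Q0 h₁ h₂ hμ hx hy hxQ hyQ (by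
    intro a a' ha ha' hxa hya hcorr p hp hpQ
    have hsub : nb n a' ⊆ Insert.insert y (Prod.snd '' G) := by
      intro z hz
      obtain ⟨w, -, hw⟩ := hcorr.2 z hz
      rcases hw with hw | hw
      · exact Or.inl (Prod.mk.inj hw).2
      · exact Or.inr ⟨_, hw, rfl⟩
    have hpQ' : Qn n true p.2 := by
      rw [h₂.Q1_iff, ← hG.U_iff n p hp, ← hG.Q_iff h₁ h₂ hp, ← hG.Q0_iff n p hp]
      exact (h₁.Q1_iff n _).1 hpQ
    rw [hyR a' ha' hya hsub p.2 ⟨p, hp, rfl⟩ hpQ']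
    have hnb : ∀ z, z ∈ nb n a ↔ z = x ∨ ∃ z' ∈ nb n a' \ {y}, (z, z') ∈ G := by
      intro z
      constructor
      · intro hz
        obtain ⟨w, hw, hzw⟩ := hcorr.1 z hz
        rcases hzw with hzw | hzw
        · exact Or.inl (Prod.mk.inj hzw).1
        · exact Or.inr ⟨w, ⟨hw, fun h => hy _ hzw h⟩, hzw⟩
      · rintro (rfl | ⟨z', hz', hzz'⟩)
        · exact hxa
        · obtain ⟨w, hw, hwz⟩ := hcorr.2 z' hz'.1
          rcases hwz with hwz | hwz
          · exact absurd (Prod.mk.inj hwz).2 hz'.2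
          · have : w = z := (hG.eq_iff _ hwz _ hzz').2 rfl
            rwa [← this]
    constructor
    · intro h
      exact ⟨a, p.1, ha, hnb, hp, h⟩
    · rintro ⟨b, m, hb, hb', hm, hR⟩
      have e1 : b = a := h₁.nb_inj n _ _ hb ha (Set.ext fun z => (hb' z).trans (hnb z).symm)
      have e2 : m = p.1 := (hG.eq_iff _ hm p hp).2 rfl
      rwa [← e1, ← e2])
  exact ⟨G', h1, h2, y, h3⟩

theorem IsGood.exists_extend_tuple (hG : IsGood μ G) (h₁ : IsNlow N₁) (h₂ : IsNlow N₂)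
    (hμ : ℵ₀ ≤ μ) (hr : IsRich N₂ μ) {n : ℕ+} {k : ℕ} (b : Fin k → N₁)
    (hb : ∀ i, Qn n false (b i)) :
    ∃ G', IsGood μ G' ∧ G ⊆ G' ∧ ∀ i, ∃ y, (b i, y) ∈ G' := by
  induction k with
  | zero => exact ⟨G, hG, subset_rfl, fun i => i.elim0⟩
  | succ k ih =>
    obtain ⟨G₁, hG₁, hGG₁, h⟩ := ih (fun i => b i.castSucc) fun i => hb _
    obtain ⟨G₂, hG₂, hGG₂, hy⟩ := hG₁.exists_extend_Q0 h₁ h₂ hμ hr (hb (Fin.last k))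
    refine ⟨G₂, hG₂, hGG₁.trans hGG₂, fun i => ?_⟩
    refine Fin.lastCases hy (fun i => ?_) i
    exact (h i).imp fun _ hy => hGG₂ hy

/-- Points of `P_n` are not added directly: their `n` generators in `Q_n^0` are added, and closure
under `F_n` does the rest. Only points outside these sorts need a choice of their own. -/
theorem IsGood.exists_extend (hG : IsGood μ G) (h₁ : IsNlow N₁) (h₂ : IsNlow N₂) (hμ : ℵ₀ ≤ μ)
    (hr : IsRich N₂ μ) (x : N₁) : ∃ G', IsGood μ G' ∧ G ⊆ G' ∧ ∃ y, (x, y) ∈ G' := by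
  by_cases hx : ∃ p ∈ G, p.1 = x
  · obtain ⟨p, hp, rfl⟩ := hx
    exact ⟨G, hG, subset_rfl, p.2, hp⟩
  push Not at hx
  by_cases hxP : P x
  · by_cases hxU : ∃ n, U n x
    · obtain ⟨n, hn⟩ := hxU
      obtain ⟨b, hb, hbQ, rfl⟩ := h₁.gen n x ((h₁.Pn_iff n x).2 ⟨hn, hxP⟩)
      obtain ⟨G', hG', hGG', h⟩ := hG.exists_extend_tuple h₁ h₂ hμ hr b hbQ
      choose y hy using h
      exact ⟨G', hG', hGG', _, hG'.funMap_mem h₁ h₂ (NlowFun.F n) (fun i => (b i, y i)) hy⟩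
    · push Not at hxU
      exact hG.exists_extend_P h₁ h₂ hμ hr hx hxP hxU
  · by_cases hx0 : ∃ n, Qn n false x
    · obtain ⟨n, hn⟩ := hx0
      exact hG.exists_extend_Q0 h₁ h₂ hμ hr hn
    · push Not at hx0
      exact hG.exists_extend_Q h₁ h₂ hμ hr hx ((h₁.Q_iff x).2 hxP) hx0

/-- Good partial isomorphisms between rich structures are elementary. -/
theorem IsGood.realize_iff (hG : IsGood μ G) (h₁ : IsNlow N₁) (h₂ : IsNlow N₂) (hμ : ℵ₀ ≤ μ)
    (hr₁ : IsRich N₁ μ) (hr₂ : IsRich N₂ μ) {X : Type*} (θ : nlowLanguage.Formula X)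
    (v : X → N₁ × N₂) (hv : ∀ x, v x ∈ G) :
    θ.Realize (fun x => (v x).1) ↔ θ.Realize (fun x => (v x).2) := by
  have := realize_iff_of_backForth (L := nlowLanguage) (IsGood (N₁ := N₁) (N₂ := N₂) μ)
    (fun G hG => hG.eq_iff) (fun G hG n f => hG.funMap_mem h₁ h₂ f)
    (fun G hG n r => hG.relMap_iff h₁ h₂ r) (fun G hG a => hG.exists_extend h₁ h₂ hμ hr₂ a)
    (fun G hG b => ?_) θ G hG v hv default (fun i => i.elim0)
  · rw [Formula.Realize, Formula.Realize]
    convert this using 2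
  · obtain ⟨G', h1', h2', a, ha⟩ := (hG.swap h₁ h₂).exists_extend h₂ h₁ hμ hr₁ b
    exact ⟨_, h1'.swap h₂ h₁, fun p hp => h2' (by simpa using hp), a, ha⟩

theorem IsGood.exists_extend_finite (hG : IsGood μ G) (h₁ : IsNlow N₁) (h₂ : IsNlow N₂)
    (hμ : ℵ₀ ≤ μ) (hr : IsRich N₂ μ) {k : ℕ} (b : Fin k → N₁) :
    ∃ G', IsGood μ G' ∧ G ⊆ G' ∧ ∀ i, ∃ y, (b i, y) ∈ G' := by
  induction k with
  | zero => exact ⟨G, hG, subset_rfl, fun i => i.elim0⟩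
  | succ k ih =>
    obtain ⟨G₁, hG₁, hGG₁, h⟩ := ih (fun i => b i.castSucc)
    obtain ⟨G₂, hG₂, hGG₂, hy⟩ := hG₁.exists_extend h₁ h₂ hμ hr (b (Fin.last k))
    refine ⟨G₂, hG₂, hGG₁.trans hGG₂, fun i => ?_⟩
    refine Fin.lastCases hy (fun i => ?_) i
    exact (h i).imp fun _ hy => hGG₂ hy

/-- Good partial isomorphisms preserve quantifier-free formulas. -/
theorem IsGood.realize_iff_of_isQF (hG : IsGood μ G) (h₁ : IsNlow N₁) (h₂ : IsNlow N₂)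
    {X : Type*} {n : ℕ} {φ : nlowLanguage.BoundedFormula X n} (hφ : φ.IsQF) (v : X → N₁ × N₂)
    (xs : Fin n → N₁ × N₂) (hv : ∀ x, v x ∈ G) (hxs : ∀ i, xs i ∈ G) :
    φ.Realize (fun x => (v x).1) (fun i => (xs i).1) ↔
      φ.Realize (fun x => (v x).2) (fun i => (xs i).2) := by
  have hterm : ∀ t : nlowLanguage.Term (X ⊕ Fin n),
      (t.realize (Sum.elim (fun x => (v x).1) fun i => (xs i).1),
        t.realize (Sum.elim (fun x => (v x).2) fun i => (xs i).2)) ∈ G := by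
    intro t
    induction t with
    | var y => rcases y with y | y; exacts [hv y, hxs y]
    | func f ts ih => exact hG.funMap_mem h₁ h₂ f (fun i => (_, _)) ih
  induction hφ with
  | falsum => exact Iff.rfl
  | of_isAtomic h =>
    cases h with
    | equal t₁ t₂ => simpa using hG.eq_iff _ (hterm _) _ (hterm _)
    | rel r ts => exact hG.relMap_iff h₁ h₂ r (fun i => (_, _)) fun i => hterm (ts i)
  | imp _ _ ih1 ih2 => exact imp_congr ih1 ih2

end Extension

/-! ### Closed sets and the graphs of embeddings -/

section Closed

variable {N : Type u} [nlowLanguage.Structure N] {μ : Cardinal.{u}}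

/-- The set is closed under the correspondence between the elements of `P_n` and their
neighbourhoods. -/
structure IsClosedSet (D : Set N) : Prop where
  nb_sub : ∀ n, ∀ a ∈ D, Pn n a → nb n a ⊆ D
  mem : ∀ n a, Pn n a → nb n a ⊆ D → a ∈ D

/-- Two steps suffice: add the neighbours of points of `A`, then all points generated by the result.
Neighbours lie in `Q`, so the second step creates no new generators. -/
theorem IsNlow.exists_isClosedSet (h : IsNlow N) (hμ : ℵ₀ ≤ μ) (A : Set N) (hA : #A < μ) :
    ∃ D : Set N, A ⊆ D ∧ #D < μ ∧ IsClosedSet D := by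
  let A₁ : Set N := A ∪ ⋃ a ∈ A, {z | ∃ n, Pn n a ∧ z ∈ nb n a}
  have hfin : ∀ a : N, {z | ∃ n, Pn n a ∧ z ∈ nb n a}.Finite := by
    intro a
    by_cases ha : ∃ n, Pn n a
    · obtain ⟨n, hn⟩ := ha
      refine (h.finite_nb hn).1.subset ?_
      rintro z ⟨m, hm, hz⟩
      rwa [h.U_inj n m a ((h.Pn_iff n a).1 hn).1 ((h.Pn_iff m a).1 hm).1]
    · refine Set.finite_empty.subset ?_
      rintro z ⟨n, hn, -⟩
      exact ha ⟨n, hn⟩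
  have hA₁ : #A₁ < μ := by
    refine (mk_union_le _ _).trans_lt (add_lt_of_lt hμ hA ?_)
    by_cases hAf : A.Finite
    · exact (lt_aleph0_iff_set_finite.2 (hAf.biUnion fun a _ => hfin a)).trans_le hμ
    · have hAi : ℵ₀ ≤ #A := by
        rw [← not_lt, lt_aleph0_iff_set_finite]
        exact hAf
      refine lt_of_le_of_lt ?_ hA
      rw [Set.biUnion_eq_iUnion]
      refine mk_iUnion_le_sum_mk.trans ((sum_le_sum _ (fun _ => ℵ₀) fun a => ?_).trans ?_)
      · exact (lt_aleph0_iff_set_finite.2 (hfin a)).le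
      · simp only [sum_const, lift_id]
        exact mul_le_of_le hAi le_rfl hAi
  have hQ : ∀ n z a, Pn n a → z ∈ nb n a → z ∈ A₁ ∪ {a : N | ∃ n, Pn n a ∧ nb n a ⊆ A₁} →
      z ∈ A₁ := by
    rintro n z a ha hz (hz' | ⟨m, hm, -⟩)
    · exact hz'
    · exact absurd ((h.Pn_iff m z).1 hm).2 (h.not_P_of_Q0 hz.1)
  refine ⟨A₁ ∪ {a : N | ∃ n, Pn n a ∧ nb n a ⊆ A₁},
    Set.subset_union_left.trans Set.subset_union_left,
    (mk_union_le _ _).trans_lt (add_lt_of_lt hμ hA₁ (mk_generated_lt h hμ hA₁)), ?_, ?_⟩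
  · rintro n a (ha | ⟨m, hm, ha⟩) hn
    · rcases ha with ha | ha
      · refine Set.Subset.trans ?_ (Set.subset_union_left.trans' Set.subset_union_right)
        intro z hz
        exact Set.mem_biUnion ha ⟨n, hn, hz⟩
      · obtain ⟨c, hc, m, hm, hac⟩ := Set.mem_iUnion₂.1 ha
        exact absurd ((h.Pn_iff n a).1 hn).2 (h.not_P_of_Q0 hac.1)
    · rw [h.U_inj n m a ((h.Pn_iff n a).1 hn).1 ((h.Pn_iff m a).1 hm).1]
      exact ha.trans Set.subset_union_left
  · intro n a ha hsub
    exact Or.inr ⟨n, ha, fun z hz => hQ n z a ha hz (hsub hz)⟩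

variable {N₁ : Type u} [nlowLanguage.Structure N₁]

theorem relMap_embedding (f : N ↪[nlowLanguage] N₁) {r : nlowLanguage.Relations 1} (x : N) :
    Structure.RelMap r ![f x] ↔ Structure.RelMap r ![x] := by
  rw [← f.map_rel r (![x])]
  refine iff_of_eq (congrArg _ ?_)
  funext i
  fin_cases i
  rfl

theorem relMap_embedding₂ (f : N ↪[nlowLanguage] N₁) {r : nlowLanguage.Relations 2} (x y : N) :
    Structure.RelMap r ![f x, f y] ↔ Structure.RelMap r ![x, y] := by
  rw [← f.map_rel r (![x, y])]
  refine iff_of_eq (congrArg _ ?_)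
  funext i
  fin_cases i <;> rfl

/-- Embeddings carry neighbourhoods onto neighbourhoods: a point of `P_n` is a value of `F_n`, and
its neighbourhood is the range of the generating tuple. This is why the functions are in the
language. -/
theorem isGood_diagonal (f : N ↪[nlowLanguage] N₁) (h₁ : IsNlow N₁) (h : IsNlow N) {D : Set N}
    (hD : #D < μ) (hDc : IsClosedSet D) : IsGood μ ((fun d => (f d, d)) '' D) := by
  have hQ0 : ∀ n (d : N), Qn n false (f d) ↔ Qn n false d := fun n d => relMap_embedding f d
  have hPn : ∀ n (d : N), Pn n (f d) ↔ Pn n d := fun n d => relMap_embedding f d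
  have hR : ∀ (d e : N), R (f d) (f e) ↔ R d e := fun d e => relMap_embedding₂ f d e
  have hnb : ∀ n (d : N), Pn n d → nb n (f d) = f '' nb n d := by
    intro n d hd
    obtain ⟨b, hb, hb', rfl⟩ := h.gen n d hd
    have e : f (F n b) = F n (f ∘ b) := f.map_fun (NlowFun.F n) b
    rw [e, (h₁.F_good n (f ∘ b) (f.injective.comp hb) fun i => (hQ0 n _).2 (hb' i)).2,
      (h.F_good n b hb hb').2, Set.range_comp]
  refine ⟨mk_image_le.trans_lt hD, ?_, ?_, ?_, ?_, ?_, ?_, ?_, ?_⟩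
  · rintro _ ⟨d, _, rfl⟩ _ ⟨e, _, rfl⟩
    exact f.injective.eq_iff
  · rintro _ ⟨d, _, rfl⟩
    exact relMap_embedding f d
  · rintro n _ ⟨d, _, rfl⟩
    exact relMap_embedding f d
  · rintro n _ ⟨d, _, rfl⟩
    exact hQ0 n d
  · rintro _ ⟨d, _, rfl⟩ _ ⟨e, _, rfl⟩
    exact relMap_embedding₂ f d e
  · rintro _ ⟨d, _, rfl⟩ _ ⟨e, _, rfl⟩
    exact hR d e
  · rintro n _ ⟨d, hd, rfl⟩ hdn
    have hdn' : Pn n d := (hPn n d).1 hdn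
    constructor
    · intro z hz
      simp only [hnb n d hdn'] at hz
      obtain ⟨w, hw, rfl⟩ := hz
      exact ⟨w, hw, w, hDc.nb_sub n d hd hdn' hw, rfl⟩
    · intro w hw
      exact ⟨f w, ⟨(hQ0 n w).2 hw.1, (hR d w).2 hw.2⟩, w, hDc.nb_sub n d hd hdn' hw, rfl⟩
  · intro n a a' ha ha' hcorr
    have ha'D : a' ∈ D := by
      refine hDc.mem n a' ha' fun z hz => ?_
      obtain ⟨w, -, d, hd, hdz⟩ := hcorr.2 z hz
      obtain ⟨rfl, rfl⟩ := Prod.mk.inj hdz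
      exact hd
    refine ⟨a', ha'D, Prod.ext ?_ rfl⟩
    refine h₁.nb_inj n _ _ ((hPn n a').2 ha') ha ?_
    rw [hnb n a' ha']
    ext z
    constructor
    · rintro ⟨w, hw, rfl⟩
      obtain ⟨z, hz, d, hd, hdz⟩ := hcorr.2 w hw
      obtain ⟨rfl, rfl⟩ := Prod.mk.inj hdz
      exact hz
    · intro hz
      obtain ⟨w, hw, d, hd, hdz⟩ := hcorr.1 z hz
      obtain ⟨rfl, rfl⟩ := Prod.mk.inj hdz
      exact ⟨_, hw, rfl⟩

/-- Elementary maps are embeddings. -/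
theorem exists_embedding {L : FirstOrder.Language.{0, 0}} {N N₁ : Type u} [L.Structure N]
    [L.Structure N₁] (j : N → N₁) (hj : ∀ θ : L.Formula N, θ.Realize j ↔ θ.Realize id) :
    ∃ f : N ↪[L] N₁, ∀ x, f x = j x := by
  refine ⟨⟨⟨j, fun a b hab => ?_⟩, fun {n} F x => ?_, fun {n} r x => ?_⟩, fun x => rfl⟩
  · have := (hj (L.paramEq a b)).1 (by simpa [paramEq] using hab)
    simpa [paramEq] using this
  · have := (hj (BVStructure.funEq F x (Structure.funMap F x))).2 (by
      simp only [BVStructure.funEq, Formula.realize_equal, Term.realize_func, Term.realize_var]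
      rfl)
    simp only [BVStructure.funEq, Formula.realize_equal, Term.realize_func, Term.realize_var] at this
    exact this.symm
  · have := hj (BVStructure.relAt r x)
    simp only [BVStructure.relAt, Formula.realize_rel, Term.realize_var] at this
    exact this

end Closed

end NlowStr


/-! ### Concrete models of the base theory of `T_nlow` -/

namespace NlowStr

open Cardinal

/-- The free choices in a concrete model. -/
structure StdData (X : Type) where
  r1 : ℕ+ → Finset X → X → Prop
  r2 : X → X → X → Prop

/-- A concrete model with free choices `D`. Its elements are the members of `Q_n^0`, of `Q_n^1` and
of `P_n`, and the members of `P` and `Q` in the further classes. -/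
inductive StdModel {X : Type} (D : StdData X) : Type
  | q0 (n : ℕ+) (x : X)
  | q1 (n : ℕ+) (x : X)
  | p (n : ℕ+) (s : Finset X) (h : s.card = n)
  | gp (c x : X)
  | gq (c x : X)

namespace StdModel

variable {X : Type} {D : StdData X}

def cls : StdModel D → ℕ+ ⊕ X
  | q0 n _ => Sum.inl n
  | q1 n _ => Sum.inl n
  | p n _ _ => Sum.inl n
  | gp c _ => Sum.inr c
  | gq c _ => Sum.inr c

def isP : StdModel D → Prop
  | p _ _ _ => True
  | gp _ _ => True
  | _ => False

def rel : StdModel D → StdModel D → Prop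
  | p n s _, q0 m x => m = n ∧ x ∈ s
  | p n s _, q1 m x => m = n ∧ D.r1 n s x
  | gp c a, gq c' b => c = c' ∧ D.r2 c a b
  | _, _ => False

def isQn (n : ℕ+) : Bool → StdModel D → Prop
  | false, q0 m _ => m = n
  | true, q1 m _ => m = n
  | _, _ => False

open Classical in
noncomputable def fn (n : ℕ+) (b : Fin n → StdModel D) : StdModel D :=
  if h : ∃ s : Finset X, s.card = n ∧ ∀ z, z ∈ Set.range b ↔ ∃ x ∈ s, z = q0 n x then
    p n h.choose h.choose_spec.1 else b ⟨0, n.pos⟩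

noncomputable instance : nlowLanguage.Structure (StdModel D) where
  funMap f x := match f with
    | NlowFun.F n => fn n x
  RelMap r x := match r with
    | NlowRel.P => isP (x 0)
    | NlowRel.Q => ¬ isP (x 0)
    | NlowRel.U n => cls (x 0) = Sum.inl n
    | NlowRel.Pn n => cls (x 0) = Sum.inl n ∧ isP (x 0)
    | NlowRel.Qn n i => isQn n i (x 0)
    | NlowRel.R => rel (x 0) (x 1)
    | NlowRel.E => cls (x 0) = cls (x 1)

theorem P_iff {x : StdModel D} : P x ↔ isP x := Iff.rfl
theorem U_iff {n : ℕ+} {x : StdModel D} : U n x ↔ cls x = Sum.inl n := Iff.rfl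
theorem Pn_iff {n : ℕ+} {x : StdModel D} : Pn n x ↔ cls x = Sum.inl n ∧ isP x := Iff.rfl
theorem Qn_iff {n : ℕ+} {i : Bool} {x : StdModel D} : Qn n i x ↔ isQn n i x := Iff.rfl
theorem R_iff {x y : StdModel D} : R x y ↔ rel x y := Iff.rfl
theorem E_iff {x y : StdModel D} : E x y ↔ cls x = cls y := Iff.rfl

theorem R_sub {a b : StdModel D} (h : R a b) : P a ∧ Q b ∧ E a b := by
  change rel a b at h
  rcases a with ⟨m, x⟩ | ⟨m, x⟩ | ⟨m, s, hs⟩ | ⟨c, x⟩ | ⟨c, x⟩ <;>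
    rcases b with ⟨m', x'⟩ | ⟨m', x'⟩ | ⟨m', s', hs'⟩ | ⟨c', x'⟩ | ⟨c', x'⟩ <;>
    first
      | exact h.elim
      | exact ⟨trivial, fun h => h, by rw [h.1]; rfl⟩

theorem Pn_iff_exists {n : ℕ+} {a : StdModel D} :
    Pn n a ↔ ∃ (s : Finset X) (h : s.card = n), a = p n s h := by
  rw [Pn_iff]
  constructor
  · rintro ⟨h1, h2⟩
    rcases a with ⟨m, x⟩ | ⟨m, x⟩ | ⟨m, s, hs⟩ | ⟨c, x⟩ | ⟨c, x⟩
    · exact h2.elim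
    · exact h2.elim
    · obtain rfl : m = n := Sum.inl.inj h1
      exact ⟨s, hs, rfl⟩
    · simp [cls] at h1
    · exact h2.elim
  · rintro ⟨s, hs, rfl⟩
    exact ⟨rfl, trivial⟩

theorem Q0_iff_exists {n : ℕ+} {a : StdModel D} : Qn n false a ↔ ∃ x, a = q0 n x := by
  rw [Qn_iff]
  constructor
  · intro h
    rcases a with ⟨m, x⟩ | ⟨m, x⟩ | ⟨m, s, hs⟩ | ⟨c, x⟩ | ⟨c, x⟩
    · obtain rfl : m = n := h
      exact ⟨x, rfl⟩
    all_goals exact h.elim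
  · rintro ⟨x, rfl⟩
    exact rfl

theorem Q1_iff_exists {n : ℕ+} {a : StdModel D} : Qn n true a ↔ ∃ x, a = q1 n x := by
  rw [Qn_iff]
  constructor
  · intro h
    rcases a with ⟨m, x⟩ | ⟨m, x⟩ | ⟨m, s, hs⟩ | ⟨c, x⟩ | ⟨c, x⟩
    · exact h.elim
    · obtain rfl : m = n := h
      exact ⟨x, rfl⟩
    all_goals exact h.elim
  · rintro ⟨x, rfl⟩
    exact rfl

theorem nb_p {n : ℕ+} {s : Finset X} {h : s.card = n} :
    nb n (p n s h : StdModel D) = q0 n '' (s : Set X) := by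
  ext z
  constructor
  · rintro ⟨h1, h2⟩
    obtain ⟨x, rfl⟩ := Q0_iff_exists.1 h1
    exact ⟨x, h2.2, rfl⟩
  · rintro ⟨x, hx, rfl⟩
    exact ⟨rfl, rfl, hx⟩

theorem q0_injective (n : ℕ+) : Function.Injective (q0 n : X → StdModel D) := fun a b h => by
  injection h

theorem F_eq_p {n : ℕ+} {b : Fin n → StdModel D} {s : Finset X} (hs : s.card = n)
    (h : ∀ z, z ∈ Set.range b ↔ ∃ x ∈ s, z = q0 n x) : F n b = p n s hs := by
  have hex : ∃ s : Finset X, s.card = n ∧ ∀ z, z ∈ Set.range b ↔ ∃ x ∈ s, z = q0 n x := ⟨s, hs, h⟩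
  have e0 : F n b = p n hex.choose hex.choose_spec.1 := dif_pos hex
  rw [e0]
  have e : hex.choose = s := by
    ext x
    have h1 := (hex.choose_spec.2 (q0 n x)).symm.trans (h (q0 n x))
    simpa [q0_injective n |>.eq_iff] using h1
  congr 1

theorem range_iff {n : ℕ+} {b : Fin n → StdModel D} :
    (Function.Injective b ∧ ∀ i, Qn n false (b i)) ↔
      ∃ s : Finset X, s.card = n ∧ ∀ z, z ∈ Set.range b ↔ ∃ x ∈ s, z = q0 n x := by
  classical
  constructor
  · rintro ⟨h1, h2⟩
    choose x hx using fun i => Q0_iff_exists.1 (h2 i)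
    have hxi : Function.Injective x := fun i j hij => h1 (by rw [hx, hx, hij])
    refine ⟨Finset.univ.image x, ?_, fun z => ?_⟩
    · rw [Finset.card_image_of_injective _ hxi]
      simp
    · constructor
      · rintro ⟨i, rfl⟩
        exact ⟨x i, by simp, hx i⟩
      · rintro ⟨w, hw, rfl⟩
        obtain ⟨i, -, rfl⟩ := Finset.mem_image.1 hw
        exact ⟨i, hx i⟩
  · rintro ⟨s, hs, h⟩
    refine ⟨?_, fun i => ?_⟩
    · have hr : Set.range b = q0 n '' (s : Set X) := by
        ext z
        rw [h]
        exact ⟨fun ⟨x, hx, e⟩ => ⟨x, hx, e.symm⟩, fun ⟨x, hx, e⟩ => ⟨x, hx, e.symm⟩⟩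
      have hcard : (Finset.univ.image b).card = (Finset.univ : Finset (Fin n)).card := by
        have e : ((Finset.univ.image b : Finset (StdModel D)) : Set (StdModel D)) = Set.range b := by
          simp
        rw [← Set.ncard_coe_finset, e, hr, Set.ncard_image_of_injective _ (q0_injective n),
          Set.ncard_coe_finset, hs]
        simp
      simpa using Finset.card_image_iff.1 hcard
    · obtain ⟨x, -, hx⟩ := (h (b i)).1 ⟨i, rfl⟩
      exact Q0_iff_exists.2 ⟨x, hx⟩

theorem isBaseModel [Infinite X] : Nlow.IsBaseModel (StdModel D) where
  P_or_Q x := by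
    by_cases h : isP x
    · exact Or.inl ⟨h, fun h' => h' h⟩
    · exact Or.inr ⟨h, h⟩
  infinite_P := by
    obtain ⟨c⟩ : Nonempty X := inferInstance
    refine (Set.infinite_range_of_injective (f := fun x : X => (gp c x : StdModel D))
      fun a b h => ?_).mono ?_
    · injection h
    · rintro _ ⟨x, rfl⟩
      exact trivial
  infinite_Q := by
    obtain ⟨c⟩ : Nonempty X := inferInstance
    refine (Set.infinite_range_of_injective (f := fun x : X => (gq c x : StdModel D))
      fun a b h => ?_).mono ?_
    · injection h
    · rintro _ ⟨x, rfl⟩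
      exact fun h => h
  equivalence_E := ⟨fun x => rfl, fun h => Eq.symm h, fun h h' => Eq.trans h h'⟩
  R_sub _ _ := R_sub
  U_class n := by
    obtain ⟨c⟩ : Nonempty X := inferInstance
    exact ⟨(q0 n c : StdModel D), fun x => eq_comm⟩
  U_distinct m n hmn x h := hmn (Sum.inl.inj (h.1.symm.trans h.2))
  Pn_iff n x := Iff.rfl
  Qn_iff n x := by
    change cls x = Sum.inl n ∧ ¬ isP x ↔ isQn n false x ∨ isQn n true x
    rcases x with ⟨m, x⟩ | ⟨m, x⟩ | ⟨m, s, hs⟩ | ⟨c, x⟩ | ⟨c, x⟩ <;> simp [cls, isP, isQn]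
  Qn_disjoint n x := by
    change ¬ (isQn n false x ∧ isQn n true x)
    rcases x with ⟨m, x⟩ | ⟨m, x⟩ | ⟨m, s, hs⟩ | ⟨c, x⟩ | ⟨c, x⟩ <;> simp [isQn]
  nbrs_bij n := by
    classical
    refine ⟨fun a ha => ?_, fun a ha b hb hab => ?_, fun s hs => ?_⟩
    · obtain ⟨s, hs, rfl⟩ := Pn_iff_exists.1 (show Pn n a from ha)
      refine ⟨?_, fun b hb => hb.1⟩
      change (nb n (p n s hs : StdModel D)).encard = _
      rw [nb_p, (q0_injective n).encard_image, Set.encard_coe_eq_coe_finsetCard, hs]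
    · obtain ⟨s, hs, rfl⟩ := Pn_iff_exists.1 (show Pn n a from ha)
      obtain ⟨t, ht, rfl⟩ := Pn_iff_exists.1 (show Pn n b from hb)
      change nb n (p n s hs : StdModel D) = nb n (p n t ht : StdModel D) at hab
      rw [nb_p, nb_p, (q0_injective n).image_injective.eq_iff, Finset.coe_inj] at hab
      subst hab
      rfl
    · have hfin : s.Finite := Set.finite_of_encard_eq_coe hs.1
      have himg : q0 n '' (q0 n ⁻¹' s) = s := Set.image_preimage_eq_of_subset fun z hz => by
        obtain ⟨x, rfl⟩ := Q0_iff_exists.1 (hs.2 z hz)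
        exact ⟨x, rfl⟩
      have hfin' : (q0 n ⁻¹' s : Set X).Finite := hfin.preimage (q0_injective n).injOn
      have hcard : hfin'.toFinset.card = n := by
        have h1 := hs.1
        rw [← himg, (q0_injective n).encard_image, hfin'.encard_eq_coe_toFinset_card] at h1
        exact_mod_cast h1
      refine ⟨(p n hfin'.toFinset hcard : StdModel D), Pn_iff_exists.2 ⟨_, hcard, rfl⟩, ?_⟩
      change nb n (p n _ hcard : StdModel D) = s
      rw [nb_p, hfin'.coe_toFinset, himg]
  F_good n b h1 h2 := by
    obtain ⟨s, hs, h⟩ := range_iff.1 ⟨h1, h2⟩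
    change Pn n (F n b) ∧ nb n (F n b) = Set.range b
    rw [F_eq_p hs h, nb_p]
    refine ⟨Pn_iff_exists.2 ⟨s, hs, rfl⟩, ?_⟩
    ext z
    rw [h]
    exact ⟨fun ⟨x, hx, e⟩ => ⟨x, hx, e.symm⟩, fun ⟨x, hx, e⟩ => ⟨x, hx, e.symm⟩⟩
  F_bad n b h := by
    change F n b = _
    exact dif_neg fun h' => h (range_iff.2 h')

end StdModel

/-- Base models satisfy the axioms for partial isomorphisms. -/
theorem _root_.Nlow.IsBaseModel.isNlow {M : Type} [nlowLanguage.Structure M]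
    (h : Nlow.IsBaseModel M) : IsNlow M where
  Q_iff x := by
    rcases h.P_or_Q x with ⟨h1, h2⟩ | ⟨h1, h2⟩
    · exact ⟨fun h => absurd h h2, fun h => absurd h1 h⟩
    · exact ⟨fun _ => h2, fun _ => h1⟩
  E_equiv := h.equivalence_E
  R_sub := h.R_sub
  U_nonempty n := by
    obtain ⟨c, hc⟩ := h.U_class n
    exact ⟨c, (hc c).2 (h.equivalence_E.refl c)⟩
  U_iff n x y hx := by
    obtain ⟨c, hc⟩ := h.U_class n
    have hx' := (hc x).1 hx
    refine (hc y).trans ⟨fun hy => ?_, fun hy => ?_⟩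
    · exact h.equivalence_E.trans (h.equivalence_E.symm hx') hy
    · exact h.equivalence_E.trans hx' hy
  U_inj m n x hm hn := by
    by_contra hne
    exact h.U_distinct m n hne x ⟨hm, hn⟩
  Pn_iff := h.Pn_iff
  Q0_sub n x hx := (h.Qn_iff n x).2 (Or.inl hx)
  Q1_iff n x := by
    constructor
    · intro hx
      have := (h.Qn_iff n x).2 (Or.inr hx)
      exact ⟨this.1, this.2, fun hx0 => h.Qn_disjoint n x ⟨hx0, hx⟩⟩
    · rintro ⟨h1, h2, h3⟩
      exact ((h.Qn_iff n x).1 ⟨h1, h2⟩).resolve_left h3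
  gen n a ha := by
    have hs := (h.nbrs_bij n).mapsTo ha
    have hfin : (Nlow.nbrs n a).Finite := Set.finite_of_encard_eq_coe hs.1
    have hcard : Nat.card (Nlow.nbrs n a) = n := by
      have h1 := hs.1
      rw [← hfin.cast_ncard_eq] at h1
      exact_mod_cast h1
    have := hfin.to_subtype
    let e : Fin n ≃ Nlow.nbrs n a := (Finite.equivFinOfCardEq hcard).symm
    have hinj : Function.Injective fun i => (e i : M) := Subtype.val_injective.comp e.injective
    have hQ : ∀ i, Nlow.Qn n false (e i : M) := fun i => (e i).2.1
    refine ⟨fun i => e i, hinj, hQ, ?_⟩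
    obtain ⟨h1, h2⟩ := h.F_good n _ hinj hQ
    refine (h.nbrs_bij n).injOn h1 ha (h2.trans ?_)
    ext z
    constructor
    · rintro ⟨i, rfl⟩
      exact (e i).2
    · intro hz
      exact ⟨e.symm ⟨z, hz⟩, by simp⟩
  nb_inj n a a' ha ha' hnb := (h.nbrs_bij n).injOn ha ha' hnb
  F_good := h.F_good
  F_bad := h.F_bad

/-! ### A countable rich base model -/

section Rich

open StdModel

theorem exists_infinite_fibers (Y : Type) [Countable Y] [Nonempty Y] :
    ∃ c : ℕ → Y, ∀ y, {n | c n = y}.Infinite := by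
  obtain ⟨f, hf⟩ := exists_surjective_nat (Y × ℕ)
  refine ⟨fun n => (f n).1, fun y => ?_⟩
  have : (fun k => (y, k)) ⁻¹' (f '' {n | (f n).1 = y}) = Set.univ := by
    ext k
    obtain ⟨n, hn⟩ := hf (y, k)
    simp only [Set.mem_preimage, Set.mem_univ, iff_true]
    exact ⟨n, by simp [hn], hn⟩
  intro hfin
  have h2 := (hfin.image f).preimage (f := fun k => (y, k)) fun a _ b _ h => (Prod.mk.inj h).2
  rw [this] at h2
  exact Set.infinite_univ h2

/-- The data of a countable rich model. -/
def richData (c : ℕ → Finset (Finset ℕ × ℕ)) (c' : ℕ → Finset (Finset ℕ)) (d : ℕ → Finset ℕ) :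
    StdData ℕ where
  r1 _ t m := (∃ y ∈ t, (∀ z ∈ t, z ≤ y) ∧ (t.erase y, m) ∈ c y) ∨ t ∈ c' m
  r2 _ a b := b ∈ d a ∨ a ∈ d b

/-- Each number codes the answers demanded of a future point: `c` for points of `Q_n^0`, `c'` for
points of `Q_n^1`, `d` for the classes outside the `U_n`. Every code occurs infinitely often, so the
new point can avoid `A` and all codes which would impose unwanted relations. -/
theorem isRich_richData {c : ℕ → Finset (Finset ℕ × ℕ)} {c' : ℕ → Finset (Finset ℕ)}
    {d : ℕ → Finset ℕ} (hc : ∀ y, {n | c n = y}.Infinite) (hc' : ∀ y, {n | c' n = y}.Infinite)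
    (hd : ∀ y, {n | d n = y}.Infinite) : IsRich (StdModel (richData c c' d)) ℵ₀ := by
  classical
  have hB : IsNlow (StdModel (richData c c' d)) := (isBaseModel (D := richData c c' d)).isNlow
  have hfin : ∀ {A : Set (StdModel (richData c c' d))} {g : ℕ → StdModel (richData c c' d)},
      A.Finite → Function.Injective g → (g ⁻¹' A).Finite := fun h hg => h.preimage hg.injOn
  refine ⟨fun A ε m₀ hA => ?_, fun A ε m₀ hA hm₀ => ?_, fun A hA => ?_, fun n A ε hA => ?_⟩
  · have hA := lt_aleph0_iff_set_finite.1 hA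
    rcases hm : cls m₀ with n | k
    · have hT : {t : Finset ℕ | ∃ h : t.card = n, (p n t h : StdModel (richData c c' d)) ∈ A}.Finite := by
        refine (hA.preimage (f := fun t : {t : Finset ℕ // t.card = n} =>
          (p n t.1 t.2 : StdModel (richData c c' d))) fun a _ b _ h => ?_).image Subtype.val |>.subset ?_
        · injection h with _ h
          exact Subtype.ext h
        · rintro t ⟨h, ht⟩
          exact ⟨⟨t, h⟩, ht, rfl⟩
      have hA1 := hfin hA (g := fun m => (q1 n m : StdModel (richData c c' d))) fun a b h => by injection h
      -- The code lists the wanted neighbours among the points of `P_n` in `A`; the excluded values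
      -- of `m` are those which these points already demand through `c`.
      obtain ⟨m, hm', hmn⟩ := (hc' (hT.toFinset.filter fun t =>
        ∃ h : t.card = n, ε (p n t h : StdModel (richData c c' d)))).exists_notMem_finset
        (hA1.toFinset ∪ hT.toFinset.biUnion fun t => t.biUnion fun y => (c y).image Prod.snd)
      simp only [Finset.mem_union, Set.Finite.mem_toFinset, Set.mem_preimage, Finset.mem_biUnion,
        Finset.mem_image, not_or, not_exists, not_and] at hmn
      have hm' : c' m = _ := hm'
      refine ⟨(q1 n m : StdModel (richData c c' d)), fun h => h, hm, fun k h => h, hmn.1, ?_⟩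
      intro x hx hxP hxE
      obtain ⟨t, ht, rfl⟩ := Pn_iff_exists.1 (show Pn n x from ⟨hxE.symm.trans hm, hxP⟩)
      have h1 : t ∈ hT.toFinset := hT.mem_toFinset.2 ⟨ht, hx⟩
      change n = n ∧ (_ ∨ t ∈ c' m) ↔ _
      rw [hm', Finset.mem_filter]
      constructor
      · rintro ⟨-, ⟨y, hy, -, hyc⟩ | ⟨-, _, h⟩⟩
        · exact absurd rfl (hmn.2 t ⟨ht, hx⟩ y hy _ hyc)
        · exact h
      · intro h
        exact ⟨rfl, Or.inr ⟨h1, ht, h⟩⟩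
    · have hA1 := hfin hA (g := fun b => (gq k b : StdModel (richData c c' d))) fun a b h => by injection h
      have hA2 := hfin hA (g := fun b => (gp k b : StdModel (richData c c' d))) fun a b h => by injection h
      obtain ⟨b, hb, hbn⟩ := (hd (hA2.toFinset.filter fun a => ε (gp k a : StdModel (richData c c' d)))).exists_notMem_finset
        (hA1.toFinset ∪ hA2.toFinset.biUnion d)
      simp only [Finset.mem_union, Set.Finite.mem_toFinset, Set.mem_preimage, Finset.mem_biUnion,
        not_or, not_exists, not_and] at hbn
      have hb : d b = _ := hb
      refine ⟨(gq k b : StdModel (richData c c' d)), fun h => h, hm, fun k h => h, hbn.1, ?_⟩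
      intro x hx hxP hxE
      have hxE : cls x = Sum.inr k := hxE.symm.trans hm
      rcases x with ⟨m, x⟩ | ⟨m, x⟩ | ⟨m, s, hs⟩ | ⟨k', a⟩ | ⟨k', x⟩
      · exact absurd hxE (by simp [cls])
      · exact absurd hxE (by simp [cls])
      · exact absurd hxE (by simp [cls])
      · obtain rfl : k' = k := Sum.inr.inj hxE
        change k' = k' ∧ (b ∈ d a ∨ a ∈ d b) ↔ _
        rw [hb, Finset.mem_filter]
        constructor
        · rintro ⟨-, h | ⟨-, h⟩⟩
          · exact absurd h (hbn.2 a hx)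
          · exact h
        · intro h
          exact ⟨rfl, Or.inr ⟨hA2.mem_toFinset.2 hx, h⟩⟩
      · exact hxP.elim
  · have hA := lt_aleph0_iff_set_finite.1 hA
    rcases hm : cls m₀ with n | k
    · exact absurd hm (hm₀ n)
    · have hA1 := hfin hA (g := fun b => (gp k b : StdModel (richData c c' d))) fun a b h => by injection h
      have hA2 := hfin hA (g := fun b => (gq k b : StdModel (richData c c' d))) fun a b h => by injection h
      obtain ⟨b, hb, hbn⟩ := (hd (hA2.toFinset.filter fun a => ε (gq k a : StdModel (richData c c' d)))).exists_notMem_finset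
        (hA1.toFinset ∪ hA2.toFinset.biUnion d)
      simp only [Finset.mem_union, Set.Finite.mem_toFinset, Set.mem_preimage, Finset.mem_biUnion,
        not_or, not_exists, not_and] at hbn
      have hb : d b = _ := hb
      refine ⟨(gp k b : StdModel (richData c c' d)), trivial, hm, hbn.1, ?_⟩
      intro x hx hxP hxE
      have hxE : cls x = Sum.inr k := hxE.symm.trans hm
      rcases x with ⟨m, x⟩ | ⟨m, x⟩ | ⟨m, s, hs⟩ | ⟨k', x⟩ | ⟨k', a⟩
      · exact absurd hxE (by simp [cls])
      · exact absurd hxE (by simp [cls])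
      · exact absurd hxE (by simp [cls])
      · exact absurd trivial hxP
      · obtain rfl : k' = k := Sum.inr.inj hxE
        change k' = k' ∧ (a ∈ d b ∨ b ∈ d a) ↔ _
        rw [hb, Finset.mem_filter]
        constructor
        · rintro ⟨-, ⟨-, h⟩ | h⟩
          · exact h
          · exact absurd h (hbn.2 a hx)
        · intro h
          exact ⟨rfl, Or.inl ⟨hA2.mem_toFinset.2 hx, h⟩⟩
  · have hA := lt_aleph0_iff_set_finite.1 hA
    obtain ⟨k, hk⟩ := (hA.image cls).preimage (f := (Sum.inr : ℕ → ℕ+ ⊕ ℕ))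
      Sum.inr_injective.injOn |>.exists_notMem
    refine ⟨(gp k 0 : StdModel (richData c c' d)), fun n h => Sum.inr_ne_inl (U_iff.1 h), fun a ha h => hk ⟨a, ha, ?_⟩⟩
    exact h.symm
  · have hA := lt_aleph0_iff_set_finite.1 hA
    have hA0 := hfin hA (g := fun m => (q0 n m : StdModel (richData c c' d))) fun a b h => by injection h
    have hA1 := hfin hA (g := fun m => (q1 n m : StdModel (richData c c' d))) fun a b h => by injection h
    -- Taking `y` above all points of `A` in `Q_n^0` makes it the maximum of every neighbourhood it
    -- completes, so that `c y` is the code which is consulted.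
    obtain ⟨y, hy, hyn⟩ := (hc ((hA0.toFinset.powerset ×ˢ hA1.toFinset).filter fun q =>
      ε (q0 n '' (q.1 : Set ℕ)) (q1 n q.2 : StdModel (richData c c' d)))).exists_notMem_finset
      (Finset.range (hA0.toFinset.sup id + 1) ∪ hA1.toFinset.biUnion fun m => (c' m).biUnion id)
    simp only [Finset.mem_union, Set.Finite.mem_toFinset, Set.mem_preimage, Finset.mem_biUnion,
      not_or, not_exists, not_and, Finset.mem_range, not_lt, id] at hyn
    have hy : c y = _ := hy
    have hlt : ∀ z, (q0 n z : StdModel (richData c c' d)) ∈ A → z < y := fun z hz => lt_of_lt_of_le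
      (Nat.lt_succ_of_le (Finset.le_sup (f := id) (hA0.mem_toFinset.2 hz))) hyn.1
    refine ⟨(q0 n y : StdModel (richData c c' d)), rfl, fun h => lt_irrefl _ (hlt y h), ?_⟩
    intro a ha hya hsub x hx hxQ
    obtain ⟨t, ht, rfl⟩ := Pn_iff_exists.1 ha
    obtain ⟨m, rfl⟩ := Q1_iff_exists.1 hxQ
    rw [nb_p] at hya hsub ⊢
    have hyt : y ∈ t := by
      obtain ⟨z, hz, hzy⟩ := hya
      rwa [← q0_injective n hzy]
    have hmem : ∀ z ∈ t, z ≠ y → (q0 n z : StdModel (richData c c' d)) ∈ A := fun z hz hzy =>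
      (hsub ⟨z, hz, rfl⟩).resolve_left fun h => hzy (q0_injective n h)
    have hmax : ∀ z ∈ t, z ≤ y := fun z hz => by
      by_cases h : z = y
      · exact h.le
      · exact (hlt z (hmem z hz h)).le
    have hset : (q0 n '' (t : Set ℕ) \ {(q0 n y : StdModel (richData c c' d))} : Set (StdModel (richData c c' d))) =
        q0 n '' (t.erase y : Finset ℕ) := by
      rw [Finset.coe_erase, Set.image_sdiff (q0_injective n), Set.image_singleton]
    change n = n ∧ ((∃ y ∈ t, (∀ z ∈ t, z ≤ y) ∧ (t.erase y, m) ∈ c y) ∨ t ∈ c' m) ↔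
      ε ((q0 n '' (t : Set ℕ) \ {(q0 n y : StdModel (richData c c' d))} : Set (StdModel (richData c c' d)))) _
    rw [hset]
    have key : (t.erase y, m) ∈ c y ↔ ε (q0 n '' (t.erase y : Finset ℕ)) (q1 n m : StdModel (richData c c' d)) := by
      rw [hy, Finset.mem_filter, Finset.mem_product, Finset.mem_powerset]
      refine ⟨fun h => h.2, fun h => ⟨⟨fun z hz => ?_, hA1.mem_toFinset.2 hx⟩, h⟩⟩
      obtain ⟨h1, h2⟩ := Finset.mem_erase.1 hz
      exact hA0.mem_toFinset.2 (hmem z h2 h1)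
    constructor
    · rintro ⟨-, ⟨y', hy't, hy'max, h⟩ | h⟩
      · have : y' = y := le_antisymm (hmax y' hy't) (hy'max y hyt)
        subst this
        exact key.1 h
      · exact absurd hyt (hyn.2 m hx t h)
    · intro h
      exact ⟨rfl, Or.inl ⟨y, hyt, hmax, key.2 h⟩⟩

theorem exists_rich_baseModel : ∃ (M : Type) (_ : nlowLanguage.Structure M),
    Nlow.IsBaseModel M ∧ IsRich M ℵ₀ := by
  obtain ⟨c, hc⟩ := exists_infinite_fibers (Finset (Finset ℕ × ℕ))
  obtain ⟨c', hc'⟩ := exists_infinite_fibers (Finset (Finset ℕ))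
  obtain ⟨d, hd⟩ := exists_infinite_fibers (Finset ℕ)
  exact ⟨StdModel (richData c c' d), inferInstance, isBaseModel, isRich_richData hc hc' hd⟩

end Rich

/-- Rich base models are existentially closed. -/
theorem isExistentiallyClosedIn_of_isRich {M : Type} [nlowLanguage.Structure M]
    (hM : Nlow.IsBaseModel M) (hr : IsRich M ℵ₀) :
    IsExistentiallyClosedIn nlowLanguage (fun M _ => Nlow.IsBaseModel M) M := by
  classical
  refine ⟨hM, fun N _ hN f n φ hφ ⟨y, hy⟩ => ?_⟩
  obtain ⟨a₀, -⟩ := hM.infinite_P.nonempty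
  obtain ⟨s, hs⟩ := exists_finset_realize_congr φ.toFormula
  obtain ⟨D, hAD, hD, hDc⟩ := hM.isNlow.exists_isClosedSet le_rfl
    (insert a₀ (s.toLeft : Set M)) (lt_aleph0_iff_set_finite.2 (s.toLeft.finite_toSet.insert _))
  have hG := isGood_diagonal f hN.isNlow hM.isNlow hD hDc
  obtain ⟨G, hG', hGG', hG''⟩ := hG.exists_extend_finite hN.isNlow hM.isNlow le_rfl hr y
  choose x hx using hG''
  -- Parameters outside `D` do not occur in `φ`; sending them to `a₀` puts the whole assignment into
  -- the domain of the partial isomorphism.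
  let w : M → M := fun m => if m ∈ D then m else a₀
  have hw : ∀ m, w m ∈ D := fun m => by
    by_cases h : m ∈ D
    · simp [w, h]
    · simpa [w, h] using hAD (Set.mem_insert _ _)
  have hcongr : ∀ {K : Type} [nlowLanguage.Structure K] (g : M → K) (z : Fin n → K),
      φ.Realize (fun m => g (w m)) z ↔ φ.Realize g z := by
    intro K _ g z
    have e : ∀ v : M → K, φ.Realize v z ↔ φ.toFormula.Realize (Sum.elim v z) := fun v => by
      rw [BoundedFormula.realize_toFormula]
      rfl
    rw [e, e]
    refine hs _ _ ?_
    rintro (m | i) hmi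
    · have : m ∈ D := hAD (Set.mem_insert_of_mem _ (Finset.mem_coe.2 (Finset.mem_toLeft.2 hmi)))
      simp [w, this]
    · rfl
  have := hG'.realize_iff_of_isQF hN.isNlow hM.isNlow hφ (fun m => (f (w m), w m))
    (fun i => (y i, x i)) (fun m => hGG' ⟨w m, hw m, rfl⟩) hx
  refine ⟨x, (hcongr id x).1 (this.1 ((hcongr f y).2 hy))⟩

end NlowStr


/-! ### Models of the theory of the existentially closed structures -/

section ModelCompletion

variable {L : FirstOrder.Language.{0, 0}} {K : ∀ (M : Type) [L.Structure M], Prop}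

theorem realize_of_modelCompletionOf {N : Type*} [L.Structure N] [Nonempty N]
    (hN : N ⊨ modelCompletionOf L K) {X : Type*} (θ : L.Formula X)
    (hne : ∀ (M : Type) [L.Structure M], K M → Nonempty M)
    (h : ∀ (M : Type) [L.Structure M], IsExistentiallyClosedIn L K M → ∀ v : X → M, θ.Realize v)
    (v : X → N) : θ.Realize v := by
  refine (Formula.realize_allClosure θ).1 (hN.realize_of_mem _ ?_) v
  intro M _ hM
  have := hne M hM.1
  exact (Formula.realize_allClosure θ).2 (h M hM)

open Classical in
/-- The conjunction of the formulas in `Ψ`, each negated unless it satisfies `p`. -/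
noncomputable def Finset.signedInf {X : Type*} (Ψ : Finset (L.Formula X)) (p : L.Formula X → Prop) :
    L.Formula X :=
  Formula.iInf fun ψ : Ψ => if p ψ then (ψ : L.Formula X) else (ψ : L.Formula X).not

theorem Finset.realize_signedInf {X : Type*} (Ψ : Finset (L.Formula X)) (p : L.Formula X → Prop)
    {N : Type*} [L.Structure N] (v : X → N) :
    (Ψ.signedInf p).Realize v ↔ ∀ ψ ∈ Ψ, (ψ.Realize v ↔ p ψ) := by
  rw [Finset.signedInf, Formula.realize_iInf, Subtype.forall]
  refine forall₂_congr fun ψ hψ => ?_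
  dsimp only
  split_ifs with h <;> simp [h, Formula.realize_not]

theorem FirstOrder.Language.BoundedFormula.isQF_iInf {X ι : Type*} [Finite ι] {n : ℕ}
    {f : ι → L.BoundedFormula X n} (h : ∀ i, (f i).IsQF) : (BoundedFormula.iInf f).IsQF := by
  have := Fintype.ofFinite ι
  suffices H : ∀ l : List ι, ((l.map f).foldr (· ⊓ ·) ⊤).IsQF from H _
  intro l
  induction l with
  | nil => exact BoundedFormula.IsQF.top
  | cons a l ih => exact (h a).inf ih

theorem Finset.isQF_signedInf {X : Type*} {Ψ : Finset (L.Formula X)} (p : L.Formula X → Prop)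
    (h : ∀ ψ ∈ Ψ, BoundedFormula.IsQF ψ) : BoundedFormula.IsQF (Ψ.signedInf p) := by
  refine BoundedFormula.isQF_iInf fun ψ => ?_
  split_ifs
  · exact h ψ ψ.2
  · exact (h ψ ψ.2).not

/-- Finitely many formulas are reflected in an existentially closed structure. -/
theorem exists_isExistentiallyClosedIn_realize_iff {N : Type*} [L.Structure N] [Nonempty N]
    (hN : N ⊨ modelCompletionOf L K) (hne : ∀ (M : Type) [L.Structure M], K M → Nonempty M)
    {X : Type*} (Ψ : Finset (L.Formula X)) (v : X → N) :
    ∃ (M : Type) (_ : L.Structure M) (w : X → M), IsExistentiallyClosedIn L K M ∧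
      ∀ ψ ∈ Ψ, ψ.Realize w ↔ ψ.Realize v := by
  by_contra hcon
  push Not at hcon
  have := realize_of_modelCompletionOf hN (Ψ.signedInf fun ψ => ψ.Realize v).not hne
    (fun M _ hM w => by
      rw [Formula.realize_not, Finset.realize_signedInf]
      intro h
      obtain ⟨ψ, hψ, hψ'⟩ := hcon M _ w hM
      have := h ψ hψ
      tauto) v
  rw [Formula.realize_not, Finset.realize_signedInf] at this
  exact this fun ψ _ => Iff.rfl

/-- Quantifier-free types of tuples over extensions of existentially closed structures are
realized. -/
theorem IsExistentiallyClosedIn.exists_realize_iff {M N : Type} [L.Structure M] [L.Structure N]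
    (hM : IsExistentiallyClosedIn L K M) (hN : K N) (f : M ↪[L] N) {X : Type*} {Y : Type} [Finite Y]
    (Φ : Finset (L.Formula (X ⊕ Y))) (hΦ : ∀ φ ∈ Φ, BoundedFormula.IsQF φ) (w : X → M)
    (y : Y → N) : ∃ x : Y → M, ∀ φ ∈ Φ, (φ.Realize (Sum.elim w x) ↔
      φ.Realize (Sum.elim (fun i => f (w i)) y)) := by
  obtain ⟨n, ⟨e⟩⟩ := Finite.exists_equiv_fin Y
  let θ := Φ.signedInf fun φ => φ.Realize (Sum.elim (fun i => f (w i)) y)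
  let χ : L.BoundedFormula M n := BoundedFormula.relabel (n := n) (k := 0) (Sum.map w e) θ
  have hχ : ∀ {A : Type} [L.Structure A] (g : M → A) (z : Fin n → A),
      χ.Realize g z ↔ θ.Realize (Sum.elim (fun i => g (w i)) fun i => z (e i)) := by
    intro A _ g z
    refine (BoundedFormula.realize_relabel (φ := θ) (g := Sum.map w e)).trans ?_
    rw [Formula.Realize]
    refine iff_of_eq (congrArg₂ _ ?_ (Subsingleton.elim _ _))
    funext x
    rcases x with x | x <;> rfl
  obtain ⟨x, hx⟩ := hM.2 N hN f n χ ((Finset.isQF_signedInf _ hΦ).relabel _)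
    ⟨fun i => y (e.symm i), by
      rw [hχ, Finset.realize_signedInf]
      simp⟩
  refine ⟨fun i => x (e i), ?_⟩
  rw [hχ, Finset.realize_signedInf] at hx
  exact hx

/-- Models of `modelCompletionOf L K` are approximated by members of `K`: finitely many formulas are
reflected, and then finite tuples in extensions in `K` have copies in the model. -/
theorem exists_extension_realize_iff {N : Type*} [L.Structure N] [Nonempty N]
    (hN : N ⊨ modelCompletionOf L K) (hne : ∀ (M : Type) [L.Structure M], K M → Nonempty M)
    {X : Type*} {Y : Type} [Finite Y] (Ψ : Finset (L.Formula X)) (Φ : Finset (L.Formula (X ⊕ Y)))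
    (hΦ : ∀ φ ∈ Φ, BoundedFormula.IsQF φ) (v : X → N) :
    ∃ (M : Type) (_ : L.Structure M) (w : X → M), K M ∧ (∀ ψ ∈ Ψ, ψ.Realize w ↔ ψ.Realize v) ∧
      ∀ (M' : Type) [L.Structure M'] (f : M ↪[L] M'), K M' → ∀ y : Y → M', ∃ x : Y → N,
        ∀ φ ∈ Φ, (φ.Realize (Sum.elim v x) ↔ φ.Realize (Sum.elim (fun i => f (w i)) y)) := by
  classical
  -- For each pattern `S` of truth values, the formula `ex S` asserts that some tuple has this
  -- pattern. Reflecting these as well lets tuples found in `M` be copied to `N`.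
  let ex : Finset (L.Formula (X ⊕ Y)) → L.Formula X := fun S =>
    Formula.iExs Y (Φ.signedInf fun φ => φ ∈ S)
  obtain ⟨M, i, w, hM, hw⟩ := exists_isExistentiallyClosedIn_realize_iff hN hne
    (Ψ ∪ Φ.powerset.image ex) v
  refine ⟨M, i, w, hM.1, fun ψ hψ => hw ψ (Finset.mem_union_left _ hψ), fun M' _ f hM' y => ?_⟩
  obtain ⟨z, hz⟩ := hM.exists_realize_iff hM' f Φ hΦ w y
  let S := Φ.filter fun φ => φ.Realize (Sum.elim w z)
  have h1 := (hw (ex S) (Finset.mem_union_right _ (Finset.mem_image_of_mem _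
    (Finset.mem_powerset.2 (Finset.filter_subset _ _))))).1 (by
      rw [Formula.realize_iExs]
      refine ⟨z, ?_⟩
      rw [Finset.realize_signedInf]
      intro φ hφ
      simp [S, hφ])
  rw [Formula.realize_iExs] at h1
  obtain ⟨x, hx⟩ := h1
  rw [Finset.realize_signedInf] at hx
  refine ⟨x, fun φ hφ => (hx φ hφ).trans (Iff.trans ?_ (hz φ hφ))⟩
  simp [S, hφ]

end ModelCompletion

/-! ### Atomic formulas in the language of `T_nlow` -/

namespace NlowStr

section Atoms

variable {X : Type*}

/-- The level of a unary relation symbol. -/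
def _root_.NlowRel.level : NlowRel 1 → ℕ+
  | NlowRel.P => 1
  | NlowRel.Q => 1
  | NlowRel.U n => n
  | NlowRel.Pn n => n
  | NlowRel.Qn n _ => n

/-- The language is infinite; bounding the level leaves finitely many atomic formulas in finitely
many variables, as reflection requires. -/
theorem finite_level_le (k : ℕ+) : {r : NlowRel 1 | r.level ≤ k}.Finite := by
  have h : {r : NlowRel 1 | r.level ≤ k} ⊆ {NlowRel.P, NlowRel.Q} ∪ (NlowRel.U '' Set.Iic k ∪
      (NlowRel.Pn '' Set.Iic k ∪ ((fun n => NlowRel.Qn n false) '' Set.Iic k ∪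
        (fun n => NlowRel.Qn n true) '' Set.Iic k))) := by
    rintro (_ | _ | n | n | ⟨n, _ | _⟩) hr
    · simp
    · simp
    all_goals
      have hr : n ≤ k := hr
      simp [hr]
  refine Set.Finite.subset ?_ h
  have := Set.finite_Iic k
  exact (Set.toFinite _).union ((this.image _).union ((this.image _).union
    ((this.image _).union (this.image _))))

def relFormula {n : ℕ} (r : NlowRel n) (x : Fin n → X) : nlowLanguage.Formula X :=
  Relations.formula (L := nlowLanguage) r fun i => Term.var (x i)

def eqFormula (a b : X) : nlowLanguage.Formula X := Term.equal (Term.var a) (Term.var b)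

/-- The formula `F_n(s) = a`. -/
def funFormula (n : ℕ+) (s : Fin n → X) (a : X) : nlowLanguage.Formula X :=
  Term.equal (Term.func (L := nlowLanguage) (NlowFun.F n) fun i => Term.var (s i)) (Term.var a)

/-- The formula `R(F_n(s), a)`. -/
def relFunFormula (n : ℕ+) (s : Fin n → X) (a : X) : nlowLanguage.Formula X :=
  Relations.formula (L := nlowLanguage) NlowRel.R
    ![Term.func (L := nlowLanguage) (NlowFun.F n) fun i => Term.var (s i), Term.var a]

variable {N : Type*} [nlowLanguage.Structure N] {v : X → N}

theorem realize_relFormula {n : ℕ} {r : NlowRel n} {x : Fin n → X} :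
    (relFormula r x).Realize v ↔ Structure.RelMap (L := nlowLanguage) r fun i => v (x i) := by
  exact Formula.realize_rel (L := nlowLanguage) (R := r)

theorem realize_eqFormula {a b : X} : (eqFormula a b).Realize v ↔ v a = v b := by
  simp [eqFormula]

theorem realize_funFormula {n : ℕ+} {s : Fin n → X} {a : X} :
    (funFormula n s a).Realize v ↔ F n (fun i => v (s i)) = v a := by
  exact Formula.realize_equal

theorem realize_relFunFormula {n : ℕ+} {s : Fin n → X} {a : X} :
    (relFunFormula n s a).Realize v ↔ R (F n fun i => v (s i)) (v a) := by
  refine (Formula.realize_rel (L := nlowLanguage) (R := NlowRel.R)).trans ?_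
  refine iff_of_eq (congrArg _ ?_)
  funext i
  fin_cases i <;> rfl

theorem relMap_unary {r : NlowRel 1} {x : Fin 1 → N} :
    Structure.RelMap (L := nlowLanguage) r x ↔ Structure.RelMap (L := nlowLanguage) r ![x 0] := by
  refine iff_of_eq (congrArg _ ?_)
  funext i
  fin_cases i; rfl

theorem relMap_binary {r : NlowRel 2} {x : Fin 2 → N} :
    Structure.RelMap (L := nlowLanguage) r x ↔
      Structure.RelMap (L := nlowLanguage) r ![x 0, x 1] := by
  refine iff_of_eq (congrArg _ ?_)
  funext i
  fin_cases i <;> rfl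

/-- Atomic formulas with variables in `A` and level at most `k`. -/
inductive IsAtom (A : Set X) (k : ℕ+) : nlowLanguage.Formula X → Prop
  | rel_unary (r : NlowRel 1) (hr : r.level ≤ k) (x : Fin 1 → X) (hx : ∀ i, x i ∈ A) :
      IsAtom A k (relFormula r x)
  | rel_binary (r : NlowRel 2) (x : Fin 2 → X) (hx : ∀ i, x i ∈ A) : IsAtom A k (relFormula r x)
  | eq (a b : X) (ha : a ∈ A) (hb : b ∈ A) : IsAtom A k (eqFormula a b)
  | func (n : ℕ+) (hn : n ≤ k) (s : Fin n → X) (hs : ∀ i, s i ∈ A) (a : X) (ha : a ∈ A) :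
      IsAtom A k (funFormula n s a)
  | rel_func (n : ℕ+) (hn : n ≤ k) (s : Fin n → X) (hs : ∀ i, s i ∈ A) (a : X) (ha : a ∈ A) :
      IsAtom A k (relFunFormula n s a)

theorem IsAtom.isQF {A : Set X} {k : ℕ+} {φ : nlowLanguage.Formula X} (h : IsAtom A k φ) :
    BoundedFormula.IsQF φ := by
  rcases h
  · exact (BoundedFormula.IsAtomic.rel _ _).isQF
  · exact (BoundedFormula.IsAtomic.rel _ _).isQF
  · exact (BoundedFormula.IsAtomic.equal _ _).isQF
  · exact (BoundedFormula.IsAtomic.equal _ _).isQF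
  · exact (BoundedFormula.IsAtomic.rel _ _).isQF

theorem finite_isAtom {A : Set X} (hA : A.Finite) (k : ℕ+) : {φ | IsAtom A k φ}.Finite := by
  have ht : ∀ n, {s : Fin n → X | ∀ i, s i ∈ A}.Finite := fun n => by
    simpa [Set.pi] using Set.Finite.pi' fun _ : Fin n => hA
  have h2 : (Set.univ : Set (NlowRel 2)).Finite := by
    refine Set.Finite.subset (s := {NlowRel.R, NlowRel.E}) (Set.toFinite _) ?_
    rintro (_ | _) <;> simp
  have hk := Set.finite_Iic k
  refine Set.Finite.subset (((finite_level_le k).image2 relFormula (ht 1)).union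
    ((h2.image2 relFormula (ht 2)).union ((hA.image2 eqFormula hA).union
      ((hk.biUnion fun n _ => (ht n).image2 (funFormula n) hA).union
        (hk.biUnion fun n _ => (ht n).image2 (relFunFormula n) hA))))) ?_
  rintro _ (⟨r, hr, x, hx⟩ | ⟨r, x, hx⟩ | ⟨a, b, ha, hb⟩ | ⟨n, hn, s, hs, a, ha⟩ |
    ⟨n, hn, s, hs, a, ha⟩)
  · exact Or.inl ⟨r, hr, x, hx, rfl⟩
  · exact Or.inr (Or.inl ⟨r, trivial, x, hx, rfl⟩)
  · exact Or.inr (Or.inr (Or.inl ⟨a, ha, b, hb, rfl⟩))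
  · exact Or.inr (Or.inr (Or.inr (Or.inl (Set.mem_biUnion hn ⟨s, hs, a, ha, rfl⟩))))
  · exact Or.inr (Or.inr (Or.inr (Or.inr (Set.mem_biUnion hn ⟨s, hs, a, ha, rfl⟩))))

/-- Two assignments agree on the atomic formulas in `A` up to level `k`. -/
def Agree {N' : Type*} [nlowLanguage.Structure N'] (A : Set X) (k : ℕ+) (v : X → N)
    (w : X → N') : Prop :=
  ∀ φ, IsAtom A k φ → (φ.Realize v ↔ φ.Realize w)

namespace Agree

variable {N' : Type*} [nlowLanguage.Structure N'] {A : Set X} {k : ℕ+} {w : X → N'}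
  (h : Agree A k v w)

include h

theorem rel_unary {r : NlowRel 1} (hr : r.level ≤ k) {a : X} (ha : a ∈ A) :
    Structure.RelMap (L := nlowLanguage) r ![v a] ↔
      Structure.RelMap (L := nlowLanguage) r ![w a] := by
  have := h _ (IsAtom.rel_unary r hr (fun _ => a) fun _ => ha)
  rwa [realize_relFormula, realize_relFormula, relMap_unary, relMap_unary (N := N')] at this

theorem rel_binary {r : NlowRel 2} {a b : X} (ha : a ∈ A) (hb : b ∈ A) :
    Structure.RelMap (L := nlowLanguage) r ![v a, v b] ↔
      Structure.RelMap (L := nlowLanguage) r ![w a, w b] := by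
  have := h _ (IsAtom.rel_binary r ![a, b] fun i => by fin_cases i <;> simp [ha, hb])
  rwa [realize_relFormula, realize_relFormula, relMap_binary, relMap_binary (N := N')] at this

theorem P_iff {a : X} (ha : a ∈ A) : P (v a) ↔ P (w a) := h.rel_unary (r := NlowRel.P) (one_le (a := k)) ha
theorem Q_iff {a : X} (ha : a ∈ A) : Q (v a) ↔ Q (w a) := h.rel_unary (r := NlowRel.Q) (one_le (a := k)) ha
theorem U_iff {n : ℕ+} (hn : n ≤ k) {a : X} (ha : a ∈ A) : U n (v a) ↔ U n (w a) :=
  h.rel_unary (r := NlowRel.U n) hn ha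
theorem Pn_iff {n : ℕ+} (hn : n ≤ k) {a : X} (ha : a ∈ A) : Pn n (v a) ↔ Pn n (w a) :=
  h.rel_unary (r := NlowRel.Pn n) hn ha
theorem Qn_iff {n : ℕ+} (hn : n ≤ k) {i : Bool} {a : X} (ha : a ∈ A) :
    Qn n i (v a) ↔ Qn n i (w a) := h.rel_unary (r := NlowRel.Qn n i) hn ha
theorem R_iff {a b : X} (ha : a ∈ A) (hb : b ∈ A) : R (v a) (v b) ↔ R (w a) (w b) :=
  h.rel_binary ha hb
theorem E_iff {a b : X} (ha : a ∈ A) (hb : b ∈ A) : E (v a) (v b) ↔ E (w a) (w b) :=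
  h.rel_binary ha hb

theorem eq_iff {a b : X} (ha : a ∈ A) (hb : b ∈ A) : v a = v b ↔ w a = w b := by
  simpa only [realize_eqFormula] using h _ (IsAtom.eq a b ha hb)

theorem F_eq_iff {n : ℕ+} (hn : n ≤ k) {s : Fin n → X} (hs : ∀ i, s i ∈ A) {a : X} (ha : a ∈ A) :
    F n (fun i => v (s i)) = v a ↔ F n (fun i => w (s i)) = w a := by
  simpa only [realize_funFormula] using h _ (IsAtom.func n hn s hs a ha)

theorem R_F_iff {n : ℕ+} (hn : n ≤ k) {s : Fin n → X} (hs : ∀ i, s i ∈ A) {a : X} (ha : a ∈ A) :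
    R (F n fun i => v (s i)) (v a) ↔ R (F n fun i => w (s i)) (w a) := by
  simpa only [realize_relFunFormula] using h _ (IsAtom.rel_func n hn s hs a ha)

end Agree

theorem nonempty_of_isBaseModel (M : Type) [nlowLanguage.Structure M] (h : Nlow.IsBaseModel M) :
    Nonempty M := ⟨h.infinite_P.nonempty.some⟩

/-- Models of `T_nlow` are approximated by base models. -/
theorem exists_agree [Nonempty N] (hN : N ⊨ nlowTheory) {Y : Type} [Finite Y] {A : Set X}
    (hA : A.Finite) (k : ℕ+) (v : X → N) :
    ∃ (M : Type) (_ : nlowLanguage.Structure M) (w : X → M), Nlow.IsBaseModel M ∧ Agree A k v w ∧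
      ∀ (M' : Type) [nlowLanguage.Structure M'] (f : M ↪[nlowLanguage] M'), Nlow.IsBaseModel M' →
        ∀ y : Y → M', ∃ x : Y → N, Agree (Sum.inl '' A ∪ Set.range Sum.inr) k (Sum.elim v x)
          (Sum.elim (fun i => f (w i)) y) := by
  have hA' : (Sum.inl '' A ∪ Set.range Sum.inr : Set (X ⊕ Y)).Finite :=
    (hA.image _).union (Set.finite_range _)
  obtain ⟨M, i, w, hM, h1, h2⟩ := exists_extension_realize_iff (K := fun M _ => Nlow.IsBaseModel M)
    hN nonempty_of_isBaseModel (finite_isAtom hA k).toFinset (finite_isAtom hA' k).toFinset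
    (fun φ hφ => IsAtom.isQF ((Set.Finite.mem_toFinset _).1 hφ)) v
  refine ⟨M, i, w, hM, fun φ hφ => (h1 φ ((Set.Finite.mem_toFinset _).2 hφ)).symm,
    fun M' _ f hM' y => ?_⟩
  obtain ⟨x, hx⟩ := h2 M' f hM' y
  exact ⟨x, fun φ hφ => hx φ ((Set.Finite.mem_toFinset _).2 hφ)⟩

end Atoms

end NlowStr


/-! ### Models of `T_nlow` -/

namespace NlowStr

section Models

variable {N : Type*} [nlowLanguage.Structure N] [Nonempty N]

theorem exists_agree_of_finite (hN : N ⊨ nlowTheory) {A : Set N} (hA : A.Finite) (k : ℕ+) :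
    ∃ (M : Type) (_ : nlowLanguage.Structure M) (w : N → M), IsNlow M ∧ Agree A k id w := by
  obtain ⟨M, i, w, hM, h, -⟩ := exists_agree hN (Y := Empty) hA k (id : N → N)
  exact ⟨M, i, w, hM.isNlow, h⟩

/-- Each instance concerns finitely many elements and one level, so it can be checked in a base
model agreeing on the relevant atoms. The neighbourhood is tested one element `z` at a time. -/
theorem F_good_of_model (hN : N ⊨ nlowTheory) (n : ℕ+) (b : Fin n → N) (hb : Function.Injective b)
    (hb' : ∀ i, Qn n false (b i)) : Pn n (F n b) ∧ nb n (F n b) = Set.range b := by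
  have key : ∀ z, Pn n (F n b) ∧ (z ∈ nb n (F n b) ↔ z ∈ Set.range b) := by
    intro z
    obtain ⟨M, _, w, hM, h⟩ := exists_agree_of_finite hN
      (((Set.finite_range b).insert z).insert (F n b)) n
    have hbm : ∀ i, b i ∈ insert (F n b) (insert z (Set.range b)) := fun i =>
      Or.inr (Or.inr ⟨i, rfl⟩)
    have hz : z ∈ insert (F n b) (insert z (Set.range b)) := Or.inr (Or.inl rfl)
    have hF : F n b ∈ insert (F n b) (insert z (Set.range b)) := Or.inl rfl
    have hw := hM.F_good n (fun i => w (b i))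
      (fun i j hij => hb ((h.eq_iff (hbm i) (hbm j)).2 hij))
      (fun i => (h.Qn_iff le_rfl (hbm i)).1 (hb' i))
    rw [(h.F_eq_iff le_rfl hbm hF).1 rfl] at hw
    refine ⟨(h.Pn_iff le_rfl hF).2 hw.1, ?_⟩
    have h1 : z ∈ nb n (F n b) ↔ w z ∈ nb n (w (F n b)) :=
      and_congr (h.Qn_iff le_rfl hz) (h.R_iff hF hz)
    rw [h1, hw.2]
    exact exists_congr fun i => (h.eq_iff (hbm i) hz).symm
  exact ⟨(key (b ⟨0, n.pos⟩)).1, Set.ext fun z => (key z).2⟩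

/-- The generators exist in the approximating base model and are copied back by its existential
closedness, applied to the identity embedding. -/
theorem gen_of_model (hN : N ⊨ nlowTheory) (n : ℕ+) (a : N) (ha : Pn n a) :
    ∃ b : Fin n → N, Function.Injective b ∧ (∀ i, Qn n false (b i)) ∧ F n b = a := by
  obtain ⟨M, _, w, hM, h, hex⟩ := exists_agree hN (Y := Fin n) (Set.finite_singleton a) n
    (id : N → N)
  obtain ⟨b, hb, hb', hab⟩ := hM.isNlow.gen n (w a) ((h.Pn_iff le_rfl rfl).1 ha)
  obtain ⟨x, hx⟩ := hex M (Embedding.refl _ M) hM b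
  have hi : ∀ i : Fin n, (Sum.inr i : N ⊕ Fin n) ∈
      (Sum.inl '' {a} ∪ Set.range Sum.inr : Set (N ⊕ Fin n)) := fun i => Or.inr ⟨i, rfl⟩
  have ha' : (Sum.inl a : N ⊕ Fin n) ∈
      (Sum.inl '' {a} ∪ Set.range Sum.inr : Set (N ⊕ Fin n)) := Or.inl ⟨a, rfl, rfl⟩
  exact ⟨x, fun i j hij => hb ((hx.eq_iff (hi i) (hi j)).1 hij),
    fun i => (hx.Qn_iff le_rfl (hi i)).2 (hb' i), (hx.F_eq_iff le_rfl hi ha').2 hab⟩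

/-- Models of `T_nlow` satisfy the base axioms. -/
theorem isNlow_of_model (hN : N ⊨ nlowTheory) : IsNlow N where
  Q_iff x := by
    obtain ⟨M, _, w, hM, h⟩ := exists_agree_of_finite hN (Set.finite_singleton x) 1
    exact (h.Q_iff rfl).trans ((hM.Q_iff _).trans (not_congr (h.P_iff rfl)).symm)
  E_equiv := by
    refine ⟨fun x => ?_, fun {x y} hxy => ?_, fun {x y z} hxy hyz => ?_⟩
    · obtain ⟨M, _, w, hM, h⟩ := exists_agree_of_finite hN (Set.finite_singleton x) 1
      exact (h.E_iff rfl rfl).2 (hM.E_equiv.refl _)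
    · obtain ⟨M, _, w, hM, h⟩ := exists_agree_of_finite hN (Set.toFinite {x, y}) 1
      have hx : x ∈ ({x, y} : Set N) := by simp
      have hy : y ∈ ({x, y} : Set N) := by simp
      exact (h.E_iff hy hx).2 (hM.E_equiv.symm ((h.E_iff hx hy).1 hxy))
    · obtain ⟨M, _, w, hM, h⟩ := exists_agree_of_finite hN (Set.toFinite {x, y, z}) 1
      have hx : x ∈ ({x, y, z} : Set N) := by simp
      have hy : y ∈ ({x, y, z} : Set N) := by simp
      have hz : z ∈ ({x, y, z} : Set N) := by simp
      exact (h.E_iff hx hz).2 (hM.E_equiv.trans ((h.E_iff hx hy).1 hxy) ((h.E_iff hy hz).1 hyz))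
  R_sub x y hxy := by
    obtain ⟨M, _, w, hM, h⟩ := exists_agree_of_finite hN (Set.toFinite {x, y}) 1
    have hx : x ∈ ({x, y} : Set N) := by simp
    have hy : y ∈ ({x, y} : Set N) := by simp
    obtain ⟨h1, h2, h3⟩ := hM.R_sub _ _ ((h.R_iff hx hy).1 hxy)
    exact ⟨(h.P_iff hx).2 h1, (h.Q_iff hy).2 h2, (h.E_iff hx hy).2 h3⟩
  U_nonempty n := by
    obtain ⟨M, _, w, hM, -, hex⟩ := exists_agree hN (Y := Unit) Set.finite_empty n (id : N → N)
    obtain ⟨b, hb⟩ := hM.isNlow.U_nonempty n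
    obtain ⟨x, hx⟩ := hex M (Embedding.refl _ M) hM fun _ => b
    exact ⟨x (), (hx.U_iff le_rfl (a := Sum.inr ()) (Or.inr ⟨_, rfl⟩)).2 hb⟩
  U_iff n x y hU := by
    obtain ⟨M, _, w, hM, h⟩ := exists_agree_of_finite hN (Set.toFinite {x, y}) n
    have hx : x ∈ ({x, y} : Set N) := by simp
    have hy : y ∈ ({x, y} : Set N) := by simp
    exact (h.U_iff le_rfl hy).trans ((hM.U_iff n _ _ ((h.U_iff le_rfl hx).1 hU)).trans
      (h.E_iff hx hy).symm)
  U_inj m n x hm hn := by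
    obtain ⟨M, _, w, hM, h⟩ := exists_agree_of_finite hN (Set.finite_singleton x) (max m n)
    exact hM.U_inj m n (w x) ((h.U_iff (le_max_left _ _) rfl).1 hm)
      ((h.U_iff (le_max_right _ _) rfl).1 hn)
  Pn_iff n x := by
    obtain ⟨M, _, w, hM, h⟩ := exists_agree_of_finite hN (Set.finite_singleton x) n
    exact (h.Pn_iff le_rfl rfl).trans ((hM.Pn_iff n _).trans
      (and_congr (h.U_iff le_rfl rfl) (h.P_iff rfl)).symm)
  Q0_sub n x hx := by
    obtain ⟨M, _, w, hM, h⟩ := exists_agree_of_finite hN (Set.finite_singleton x) n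
    exact (and_congr (h.U_iff le_rfl rfl) (h.Q_iff rfl)).2
      (hM.Q0_sub n _ ((h.Qn_iff le_rfl rfl).1 hx))
  Q1_iff n x := by
    obtain ⟨M, _, w, hM, h⟩ := exists_agree_of_finite hN (Set.finite_singleton x) n
    exact (h.Qn_iff le_rfl rfl).trans ((hM.Q1_iff n _).trans
      (and_congr (h.U_iff le_rfl rfl) (and_congr (h.Q_iff rfl)
        (not_congr (h.Qn_iff le_rfl rfl)))).symm)
  gen := gen_of_model hN
  nb_inj n a a' ha ha' haa' := by
    obtain ⟨b, hb, hb', rfl⟩ := gen_of_model hN n a ha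
    obtain ⟨c, hc, hc', rfl⟩ := gen_of_model hN n a' ha'
    rw [(F_good_of_model hN n b hb hb').2, (F_good_of_model hN n c hc hc').2] at haa'
    obtain ⟨M, _, w, hM, h⟩ := exists_agree_of_finite hN
      (((Set.finite_range b).insert (F n c)).insert (F n b)) n
    have hbm : ∀ i, b i ∈ insert (F n b) (insert (F n c) (Set.range b)) := fun i =>
      Or.inr (Or.inr ⟨i, rfl⟩)
    have hcm : ∀ i, c i ∈ insert (F n b) (insert (F n c) (Set.range b)) := fun i =>
      Or.inr (Or.inr (haa' ▸ ⟨i, rfl⟩))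
    have hFb : F n b ∈ insert (F n b) (insert (F n c) (Set.range b)) := Or.inl rfl
    have hFc : F n c ∈ insert (F n b) (insert (F n c) (Set.range b)) := Or.inr (Or.inl rfl)
    have hwb := hM.F_good n (fun i => w (b i))
      (fun i j hij => hb ((h.eq_iff (hbm i) (hbm j)).2 hij))
      (fun i => (h.Qn_iff le_rfl (hbm i)).1 (hb' i))
    have hwc := hM.F_good n (fun i => w (c i))
      (fun i j hij => hc ((h.eq_iff (hcm i) (hcm j)).2 hij))
      (fun i => (h.Qn_iff le_rfl (hcm i)).1 (hc' i))
    rw [(h.F_eq_iff le_rfl hbm hFb).1 rfl] at hwb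
    rw [(h.F_eq_iff le_rfl hcm hFc).1 rfl] at hwc
    refine (h.eq_iff hFb hFc).2 (hM.nb_inj n _ _ hwb.1 hwc.1 ?_)
    rw [hwb.2, hwc.2]
    change Set.range (w ∘ b) = Set.range (w ∘ c)
    rw [Set.range_comp, Set.range_comp, haa']
  F_good := F_good_of_model hN
  F_bad n b hb := by
    obtain ⟨M, _, w, hM, h⟩ := exists_agree_of_finite hN (Set.finite_range b) n
    have hbm : ∀ i, b i ∈ Set.range b := fun i => ⟨i, rfl⟩
    refine (h.F_eq_iff le_rfl hbm (hbm ⟨0, n.pos⟩)).2 (hM.F_bad n _ fun hbad => hb ?_)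
    exact ⟨fun i j hij => hbad.1 ((h.eq_iff (hbm i) (hbm j)).1 hij),
      fun i => (h.Qn_iff le_rfl (hbm i)).2 (hbad.2 i)⟩

end Models

theorem exists_model_nlowTheory : ∃ (N : Type u) (_ : nlowLanguage.Structure N)
    (_ : Nonempty N), N ⊨ nlowTheory := by
  obtain ⟨M, _, hM, hr⟩ := exists_rich_baseModel
  have hne := nonempty_of_isBaseModel M hM
  obtain ⟨N, i1, i2, h⟩ := exists_model_of_type_zero.{u} (L := nlowLanguage) M
  exact ⟨N, i1, i2, h _ ⟨fun σ hσ => hσ M (isExistentiallyClosedIn_of_isRich hM hr)⟩⟩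

theorem card_nlowLanguage_le : nlowLanguage.card ≤ Cardinal.aleph0 := by
  have h1 : Countable (Σ n, NlowFun n) := by
    refine ⟨⟨fun x => x.1, ?_⟩⟩
    rintro ⟨_, ⟨m⟩⟩ ⟨_, ⟨n⟩⟩ h
    obtain rfl : m = n := PNat.eq h
    rfl
  have h2 : Countable (Σ n, NlowRel n) := by
    let f : (Σ n, NlowRel n) → ℕ × ℕ+ := fun x => match x with
      | ⟨_, NlowRel.P⟩ => (0, 1)
      | ⟨_, NlowRel.Q⟩ => (1, 1)
      | ⟨_, NlowRel.U n⟩ => (2, n)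
      | ⟨_, NlowRel.Pn n⟩ => (3, n)
      | ⟨_, NlowRel.Qn n false⟩ => (4, n)
      | ⟨_, NlowRel.Qn n true⟩ => (5, n)
      | ⟨_, NlowRel.R⟩ => (6, 1)
      | ⟨_, NlowRel.E⟩ => (7, 1)
    refine Function.Injective.countable (f := f) ?_
    rintro ⟨_, _ | _ | n | n | ⟨n, _ | _⟩ | _ | _⟩ ⟨_, _ | _ | m | m | ⟨m, _ | _⟩ | _ | _⟩ h <;>
      simp_all [f]
  have h3 : Countable nlowLanguage.Symbols :=
    inferInstanceAs (Countable ((Σ n, NlowFun n) ⊕ (Σ n, NlowRel n)))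
  exact Cardinal.mk_le_aleph0

end NlowStr


/-! ### Extending base models by one element -/

namespace NlowStr

open StdModel

section OnePoint

variable {M : Type} [nlowLanguage.Structure M]

/-- A representative of the class of an element. -/
noncomputable def classRep (h : IsNlow M) (x : M) : M :=
  Quotient.out (Quotient.mk (⟨E, h.E_equiv⟩ : Setoid M) x)

theorem classRep_eq_iff (h : IsNlow M) {x y : M} : classRep h x = classRep h y ↔ E x y := by
  let S : Setoid M := ⟨E, h.E_equiv⟩
  exact Quotient.out_inj.trans (Quotient.eq (r := S))

/-- The free choices on a base model with one additional point `none`, extending the relation `R`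
of the base model. -/
def onePointData (M : Type) [nlowLanguage.Structure M]
    (ρ₁ : ℕ+ → Finset (Option M) → Option M → Prop) (ρ₂ : Option M → Option M → Prop) :
    StdData (Option M) where
  r1 n s m := ρ₁ n s m ∧ (none ∈ s ∨ m = none) ∨
    ∃ a b, Pn n a ∧ (∀ z, z ∈ s ↔ ∃ c ∈ nb n a, z = some c) ∧ m = some b ∧ R a b
  r2 _ a b := ρ₂ a b ∧ (a = none ∨ b = none) ∨ ∃ a' b', a = some a' ∧ b = some b' ∧ R a' b'

variable {ρ₁ : ℕ+ → Finset (Option M) → Option M → Prop} {ρ₂ : Option M → Option M → Prop}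

theorem onePointData_r1_none {n : ℕ+} {s : Finset (Option M)} :
    (onePointData M ρ₁ ρ₂).r1 n s none ↔ ρ₁ n s none := by
  simp [onePointData]

theorem onePointData_r1_of_mem {n : ℕ+} {s : Finset (Option M)} (hs : none ∈ s) {m : Option M} :
    (onePointData M ρ₁ ρ₂).r1 n s m ↔ ρ₁ n s m := by
  simp only [onePointData, hs, true_or, and_true, or_iff_left_iff_imp]
  rintro ⟨a, b, -, h, -⟩
  obtain ⟨c, -, hc⟩ := (h none).1 hs
  cases hc

theorem onePointData_r1_some (h : IsNlow M) {n : ℕ+} {s : Finset (Option M)} {a b : M}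
    (ha : Pn n a) (hs : ∀ z, z ∈ s ↔ ∃ c ∈ nb n a, z = some c) :
    (onePointData M ρ₁ ρ₂).r1 n s (some b) ↔ R a b := by
  constructor
  · rintro (⟨-, hn | hn⟩ | ⟨a', b', ha', hs', hb, hR⟩)
    · obtain ⟨c, -, hc⟩ := (hs none).1 hn
      cases hc
    · cases hn
    · obtain rfl := Option.some_injective _ hb
      have : nb n a = nb n a' := by
        ext c
        have := (hs (some c)).symm.trans (hs' (some c))
        simpa using this
      rwa [h.nb_inj n a a' ha ha' this]
  · exact fun hR => Or.inr ⟨a, b, ha, hs, rfl, hR⟩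

theorem onePointData_r2_some {c : Option M} {a b : M} :
    (onePointData M ρ₁ ρ₂).r2 c (some a) (some b) ↔ R a b := by
  constructor
  · rintro (⟨-, hn | hn⟩ | ⟨a', b', ha, hb, hR⟩)
    · cases hn
    · cases hn
    · obtain rfl := Option.some_injective _ ha
      obtain rfl := Option.some_injective _ hb
      exact hR
  · exact fun hR => Or.inr ⟨a, b, rfl, rfl, hR⟩

theorem onePointData_r2_none {c : Option M} {a b : Option M} (h : a = none ∨ b = none) :
    (onePointData M ρ₁ ρ₂).r2 c a b ↔ ρ₂ a b := by
  simp only [onePointData, h, and_true, or_iff_left_iff_imp]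
  rintro ⟨a', b', rfl, rfl, -⟩
  simp at h

/-- The graph of the embedding of a base model into its extension. -/
inductive OnePointRel (h : IsNlow M) (D : StdData (Option M)) : M → StdModel D → Prop
  | q0 (n : ℕ+) (x : M) (hx : Qn n false x) : OnePointRel h D x (StdModel.q0 n (some x))
  | q1 (n : ℕ+) (x : M) (hx : Qn n true x) : OnePointRel h D x (StdModel.q1 n (some x))
  | p (n : ℕ+) (x : M) (hx : Pn n x) (s : Finset (Option M)) (hs : s.card = n)
      (hs' : ∀ z, z ∈ s ↔ ∃ c ∈ nb n x, z = some c) : OnePointRel h D x (StdModel.p n s hs)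
  | gp (x : M) (hx : P x) (hU : ∀ n, ¬ U n x) :
      OnePointRel h D x (StdModel.gp (some (classRep h x)) (some x))
  | gq (x : M) (hx : Q x) (hU : ∀ n, ¬ U n x) :
      OnePointRel h D x (StdModel.gq (some (classRep h x)) (some x))

theorem exists_onePointRel (h : IsNlow M) (D : StdData (Option M)) (x : M) :
    ∃ y, OnePointRel h D x y := by
  classical
  by_cases hU : ∃ n, U n x
  · obtain ⟨n, hn⟩ := hU
    by_cases hP : P x
    · have hx : Pn n x := (h.Pn_iff n x).2 ⟨hn, hP⟩
      have hfin := (h.finite_nb hx).1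
      refine ⟨_, OnePointRel.p n x hx (hfin.toFinset.image some) ?_ fun z => ?_⟩
      · rw [Finset.card_image_of_injective _ (Option.some_injective _),
          ← Set.ncard_eq_toFinset_card _ hfin, (h.finite_nb hx).2]
      · simp [eq_comm]
    · by_cases hx : Qn n false x
      · exact ⟨_, OnePointRel.q0 n x hx⟩
      · exact ⟨_, OnePointRel.q1 n x ((h.Q1_iff n x).2 ⟨hn, (h.Q_iff x).2 hP, hx⟩)⟩
  · push Not at hU
    by_cases hP : P x
    · exact ⟨_, OnePointRel.gp x hP hU⟩
    · exact ⟨_, OnePointRel.gq x ((h.Q_iff x).2 hP) hU⟩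

namespace OnePointRel

variable {h : IsNlow M} {D : StdData (Option M)} {x x' : M} {y y' : StdModel D}

theorem cls_eq (hxy : OnePointRel h D x y) : (∃ n, U n x ∧ cls y = Sum.inl n) ∨
    ((∀ n, ¬ U n x) ∧ cls y = Sum.inr (some (classRep h x))) := by
  rcases hxy with ⟨n, x, hx⟩ | ⟨n, x, hx⟩ | ⟨n, x, hx, s, hs, hs'⟩ | ⟨x, hx, hU⟩ | ⟨x, hx, hU⟩
  · exact Or.inl ⟨n, (h.Q0_sub n x hx).1, rfl⟩
  · exact Or.inl ⟨n, ((h.Q1_iff n x).1 hx).1, rfl⟩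
  · exact Or.inl ⟨n, ((h.Pn_iff n x).1 hx).1, rfl⟩
  · exact Or.inr ⟨hU, rfl⟩
  · exact Or.inr ⟨hU, rfl⟩

theorem U_iff (hxy : OnePointRel h D x y) (n : ℕ+) : U n x ↔ U n y := by
  rw [StdModel.U_iff]
  rcases hxy.cls_eq with ⟨m, hm, hy⟩ | ⟨hU, hy⟩ <;> rw [hy]
  · rw [Sum.inl.injEq]
    exact ⟨fun hn => h.U_inj m n x hm hn, fun hn => hn ▸ hm⟩
  · exact ⟨fun hn => absurd hn (hU n), fun h => by cases h⟩

theorem P_iff (hxy : OnePointRel h D x y) : P x ↔ P y := by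
  rw [StdModel.P_iff]
  rcases hxy with ⟨n, x, hx⟩ | ⟨n, x, hx⟩ | ⟨n, x, hx, s, hs, hs'⟩ | ⟨x, hx, hU⟩ | ⟨x, hx, hU⟩
  · exact iff_of_false (h.not_P_of_Q0 hx) id
  · exact iff_of_false ((h.Q_iff x).1 ((h.Q1_iff n x).1 hx).2.1) id
  · exact iff_of_true ((h.Pn_iff n x).1 hx).2 trivial
  · exact iff_of_true hx trivial
  · exact iff_of_false ((h.Q_iff x).1 hx) id

theorem E_iff (hxy : OnePointRel h D x y) (hxy' : OnePointRel h D x' y') :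
    E x x' ↔ E y y' := by
  rw [StdModel.E_iff]
  rcases hxy.cls_eq with ⟨m, hm, hy⟩ | ⟨hU, hy⟩
  · rw [← h.U_iff m x x' hm, hxy'.U_iff, StdModel.U_iff, hy, eq_comm]
  · rcases hxy'.cls_eq with ⟨m', hm', hy'⟩ | ⟨hU', hy'⟩ <;> rw [hy, hy']
    · refine iff_of_false (fun hE => hU m' ((h.U_of_E hE m').2 hm')) (fun h => by cases h)
    · rw [Sum.inr.injEq, Option.some_inj, classRep_eq_iff]

theorem Q0_iff (hxy : OnePointRel h D x y) (n : ℕ+) : Qn n false x ↔ Qn n false y := by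
  rw [StdModel.Qn_iff]
  rcases hxy with ⟨m, x, hx⟩ | ⟨m, x, hx⟩ | ⟨m, x, hx, s, hs, hs'⟩ | ⟨x, hx, hU⟩ | ⟨x, hx, hU⟩
  · exact ⟨fun hn => h.U_inj m n x (h.Q0_sub m x hx).1 (h.Q0_sub n x hn).1,
      fun (hn : m = n) => hn ▸ hx⟩
  · refine iff_of_false (fun hn => ?_) id
    obtain ⟨h1, -, h2⟩ := (h.Q1_iff m x).1 hx
    exact h2 (h.U_inj n m x (h.Q0_sub n x hn).1 h1 ▸ hn)
  · exact iff_of_false (fun hn => h.not_P_of_Q0 hn ((h.Pn_iff m x).1 hx).2) id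
  · exact iff_of_false (fun hn => h.not_P_of_Q0 hn hx) id
  · exact iff_of_false (fun hn => hU n (h.Q0_sub n x hn).1) id

theorem eq_of_eq (hxy : OnePointRel h D x y) (hxy' : OnePointRel h D x' y) : x = x' := by
  rcases hxy with ⟨n, x, hx⟩ | ⟨n, x, hx⟩ | ⟨n, x, hx, s, hs, hs'⟩ | ⟨x, hx, hU⟩ | ⟨x, hx, hU⟩
  · cases hxy'; rfl
  · cases hxy'; rfl
  · rcases hxy' with _ | _ | ⟨_, x', hx', _, _, hs''⟩
    refine h.nb_inj n x x' hx hx' (Set.ext fun c => ?_)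
    simpa using (hs' (some c)).symm.trans (hs'' (some c))
  · generalize hy : (StdModel.gp (some (classRep h x)) (some x) : StdModel D) = y at hxy'
    rcases hxy' with _ | _ | _ | _ | _
    · cases hy
    · cases hy
    · cases hy
    · injection hy with _ h2
      exact Option.some_injective _ h2
    · cases hy
  · generalize hy : (StdModel.gq (some (classRep h x)) (some x) : StdModel D) = y at hxy'
    rcases hxy' with _ | _ | _ | _ | _
    · cases hy
    · cases hy
    · cases hy
    · cases hy
    · injection hy with _ h2
      exact Option.some_injective _ h2

end OnePointRel

/-- Once classes and sorts match, only a point of `P` and a point of `Q` in one class remain. There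
`onePointData` copies the old relation. -/
theorem OnePointRel.R_iff {h : IsNlow M} {x x' : M} {y y' : StdModel (onePointData M ρ₁ ρ₂)}
    (hxy : OnePointRel h _ x y) (hxy' : OnePointRel h _ x' y') : R x x' ↔ R y y' := by
  by_cases hE : E x x'
  swap
  · exact iff_of_false (fun hR => hE (h.R_sub _ _ hR).2.2) fun hR =>
      hE ((hxy.E_iff hxy').2 (StdModel.R_sub hR).2.2)
  by_cases hP : P x
  swap
  · exact iff_of_false (fun hR => hP (h.R_sub _ _ hR).1) fun hR =>
      hP (hxy.P_iff.2 (StdModel.R_sub hR).1)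
  by_cases hP' : P x'
  · exact iff_of_false (fun hR => (h.Q_iff _).1 (h.R_sub _ _ hR).2.1 hP') fun hR =>
      (StdModel.R_sub hR).2.1 (hxy'.P_iff.1 hP')
  rcases hxy with ⟨n, x, hx⟩ | ⟨n, x, hx⟩ | ⟨n, x, hx, s, hs, hs'⟩ | ⟨x, hx, hU⟩ | ⟨x, hx, hU⟩
  · exact absurd hP (h.not_P_of_Q0 hx)
  · exact absurd hP ((h.Q_iff x).1 ((h.Q1_iff n x).1 hx).2.1)
  · have hUx := ((h.Pn_iff n x).1 hx).1
    rcases hxy' with ⟨m, _, hb⟩ | ⟨m, _, hb⟩ | ⟨m, _, hb, t, ht, ht'⟩ | ⟨_, hb, hU⟩ | ⟨_, hb, hU⟩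
    · obtain rfl := h.U_inj n m x' ((h.U_iff n x x' hUx).2 hE) (h.Q0_sub m x' hb).1
      change R x x' ↔ n = n ∧ some x' ∈ s
      rw [hs']
      constructor
      · exact fun hR => ⟨rfl, x', ⟨hb, hR⟩, rfl⟩
      · rintro ⟨-, c, hc, hbc⟩
        obtain rfl := Option.some_injective _ hbc
        exact hc.2
    · obtain rfl := h.U_inj n m x' ((h.U_iff n x x' hUx).2 hE) ((h.Q1_iff m x').1 hb).1
      change R x x' ↔ n = n ∧ (onePointData M ρ₁ ρ₂).r1 n s (some x')
      rw [onePointData_r1_some h hx hs']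
      exact ⟨fun h => ⟨rfl, h⟩, fun h => h.2⟩
    · exact absurd ((h.Pn_iff m x').1 hb).2 hP'
    · exact absurd hb hP'
    · exact absurd ((h.U_iff n x x' hUx).2 hE) (hU n)
  · rcases hxy' with ⟨m, _, hb⟩ | ⟨m, _, hb⟩ | ⟨m, _, hb, t, ht, ht'⟩ | ⟨_, hb, hU'⟩ | ⟨_, hb, hU'⟩
    · exact absurd ((h.U_of_E hE m).2 (h.Q0_sub m x' hb).1) (hU m)
    · exact absurd ((h.U_of_E hE m).2 ((h.Q1_iff m x').1 hb).1) (hU m)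
    · exact absurd ((h.Pn_iff m x').1 hb).2 hP'
    · exact absurd hb hP'
    · change R x x' ↔ some (classRep h x) = some (classRep h x') ∧
        (onePointData M ρ₁ ρ₂).r2 (some (classRep h x)) (some x) (some x')
      rw [onePointData_r2_some, Option.some_inj, classRep_eq_iff]
      exact ⟨fun h => ⟨hE, h⟩, fun h => h.2⟩
  · exact absurd hP ((h.Q_iff x).1 hx)

theorem OnePointRel.q0_eq {h : IsNlow M} {D : StdData (Option M)} {x : M} {y : StdModel D}
    (hxy : OnePointRel h D x y) {n : ℕ+} (hx : Qn n false x) : y = StdModel.q0 n (some x) := by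
  have hy := (hxy.Q0_iff n).1 hx
  rcases hxy with ⟨m, _, hx'⟩ | ⟨m, _, hx'⟩ | ⟨m, _, hx', s, hs, hs'⟩ | ⟨_, hx', hU⟩ | ⟨_, hx', hU⟩
  · obtain rfl : m = n := hy
    rfl
  all_goals exact hy.elim

theorem OnePointRel.nb_eq {h : IsNlow M} {D : StdData (Option M)} {x : M} {y : StdModel D}
    (hxy : OnePointRel h D x y) {n : ℕ+} (hx : Pn n x) {g : M → StdModel D}
    (hg : ∀ x, OnePointRel h D x (g x)) : nb n y = g '' nb n x := by
  obtain ⟨hx1, hx2⟩ := (h.Pn_iff n x).1 hx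
  rcases hxy with ⟨m, _, hx'⟩ | ⟨m, _, hx'⟩ | ⟨m, _, hx', s, hs, hs'⟩ | ⟨_, hx', hU⟩ | ⟨_, hx', hU⟩
  · exact absurd hx2 (h.not_P_of_Q0 hx')
  · exact absurd hx2 ((h.Q_iff x).1 ((h.Q1_iff m x).1 hx').2.1)
  · obtain rfl := h.U_inj m n x ((h.Pn_iff m x).1 hx').1 hx1
    rw [nb_p]
    ext z
    constructor
    · rintro ⟨w, hw, rfl⟩
      obtain ⟨c, hc, rfl⟩ := (hs' w).1 hw
      exact ⟨c, hc, (hg c).q0_eq hc.1⟩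
    · rintro ⟨c, hc, rfl⟩
      exact ⟨some c, (hs' _).2 ⟨c, hc, rfl⟩, ((hg c).q0_eq hc.1).symm⟩
  · exact absurd hx1 (hU n)
  · exact absurd hx1 (hU n)

/-- Base models embed into their extensions by one point. -/
theorem exists_onePoint_embedding (hM : Nlow.IsBaseModel M)
    (ρ₁ : ℕ+ → Finset (Option M) → Option M → Prop) (ρ₂ : Option M → Option M → Prop) :
    Nlow.IsBaseModel (StdModel (onePointData M ρ₁ ρ₂)) ∧
      ∃ f : M ↪[nlowLanguage] StdModel (onePointData M ρ₁ ρ₂),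
        ∀ x, OnePointRel hM.isNlow _ x (f x) := by
  have : Infinite M := Set.infinite_univ_iff.1 (hM.infinite_P.mono (Set.subset_univ _))
  have hB := isBaseModel (D := onePointData M ρ₁ ρ₂)
  have h := hM.isNlow
  choose g hg using exists_onePointRel h (onePointData M ρ₁ ρ₂)
  have hginj : Function.Injective g := fun x x' hxx' => (hg x).eq_of_eq (hxx' ▸ hg x')
  -- The graph of `g` is a good partial isomorphism, with a cardinal bound chosen only to fit the
  -- definition; hence `g` preserves functions and relations.
  have hgood : IsGood (Order.succ (Cardinal.mk (Set.range fun x => (x, g x))))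
      (Set.range fun x => (x, g x)) := by
    refine ⟨Order.lt_succ _, ?_, ?_, ?_, ?_, ?_, ?_, ?_, ?_⟩
    · rintro _ ⟨x, rfl⟩ _ ⟨y, rfl⟩
      exact hginj.eq_iff.symm
    · rintro _ ⟨x, rfl⟩
      exact (hg x).P_iff
    · rintro n _ ⟨x, rfl⟩
      exact (hg x).U_iff n
    · rintro n _ ⟨x, rfl⟩
      exact (hg x).Q0_iff n
    · rintro _ ⟨x, rfl⟩ _ ⟨y, rfl⟩
      exact (hg x).E_iff (hg y)
    · rintro _ ⟨x, rfl⟩ _ ⟨y, rfl⟩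
      exact (hg x).R_iff (hg y)
    · rintro n _ ⟨x, rfl⟩ hx
      rw [Corr, (hg x).nb_eq hx hg]
      refine ⟨fun z hz => ⟨g z, ⟨z, hz, rfl⟩, z, rfl⟩, ?_⟩
      rintro _ ⟨z, hz, rfl⟩
      exact ⟨z, hz, z, rfl⟩
    · rintro n a a' ha ha' hc
      refine ⟨a, Prod.ext rfl (hB.isNlow.nb_inj n _ _ ?_ ha' ?_)⟩
      · rw [h.Pn_iff, (hg a).U_iff, (hg a).P_iff, ← hB.isNlow.Pn_iff] at ha
        exact ha
      · change nb n (g a) = nb n a'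
        rw [(hg a).nb_eq ha hg]
        ext z
        constructor
        · rintro ⟨c, hcn, rfl⟩
          obtain ⟨z', hz', w, hw⟩ := hc.1 c hcn
          obtain ⟨rfl, rfl⟩ := Prod.mk.inj hw
          exact hz'
        · intro hz
          obtain ⟨c, hcn, w, hw⟩ := hc.2 z hz
          obtain ⟨rfl, rfl⟩ := Prod.mk.inj hw
          exact ⟨_, hcn, rfl⟩
  refine ⟨hB, ⟨⟨g, hginj⟩, fun {n} F x => ?_, fun {n} r x => ?_⟩, hg⟩
  · obtain ⟨w, hw⟩ := hgood.funMap_mem h hB.isNlow F (fun i => (x i, g (x i))) fun i => ⟨_, rfl⟩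
    obtain ⟨rfl, h2⟩ := Prod.mk.inj hw
    exact h2
  · exact (hgood.relMap_iff h hB.isNlow r (fun i => (x i, g (x i))) fun i => ⟨_, rfl⟩).symm

end OnePoint

end NlowStr


/-! ### Finite extension properties of models of `T_nlow` -/

namespace NlowStr

open StdModel

section OnePointExtensions

variable {M : Type} [nlowLanguage.Structure M]

theorem OnePointRel.ne_gp_none {h : IsNlow M} {D : StdData (Option M)} {x : M} {c : Option M} :
    ¬ OnePointRel h D x (StdModel.gp c none) := fun h => by cases h

theorem OnePointRel.ne_gq_none {h : IsNlow M} {D : StdData (Option M)} {x : M} {c : Option M} :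
    ¬ OnePointRel h D x (StdModel.gq c none) := fun h => by cases h

/-- The point `none` of `Q` is placed in the class of `m₀`, in `Q_n^1` if that class is `U_n`, since
there its relation to `P` is unrestricted. -/
theorem exists_extension_Q (hM : Nlow.IsBaseModel M) (m₀ : M) (ε : M → Prop) :
    ∃ (M' : Type) (_ : nlowLanguage.Structure M') (f : M ↪[nlowLanguage] M') (y : M'),
      Nlow.IsBaseModel M' ∧ Q y ∧ E (f m₀) y ∧ (∀ n, ¬ Qn n false y) ∧ (∀ a, f a ≠ y) ∧
        ∀ p, P p → E m₀ p → (R (f p) y ↔ ε p) := by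
  have h := hM.isNlow
  obtain ⟨hB, f, hf⟩ := exists_onePoint_embedding hM
    (fun n s _ => ∃ p, Pn n p ∧ (∀ z, z ∈ s ↔ ∃ c ∈ nb n p, z = some c) ∧ ε p)
    (fun a _ => ∃ p, a = some p ∧ ε p)
  rcases (hf m₀).cls_eq with ⟨n, hn, hc⟩ | ⟨hU, hc⟩
  · refine ⟨_, inferInstance, f, q1 n none, hB, fun h => h, hc, fun n h => h, fun a ha => ?_,
      fun p hp hE => ?_⟩
    · have := hf a
      rw [ha] at this
      cases this
    · have hpn : U n p := (h.U_of_E hE n).1 hn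
      have hfp := hf p
      generalize f p = z at hfp
      rcases hfp with ⟨m, _, hx⟩ | ⟨m, _, hx⟩ | ⟨m, _, hx, s, hs, hs'⟩ | ⟨_, hx, hU⟩ | ⟨_, hx, hU⟩
      · exact absurd hp (h.not_P_of_Q0 hx)
      · exact absurd hp ((h.Q_iff p).1 ((h.Q1_iff m p).1 hx).2.1)
      · obtain rfl := h.U_inj m n p ((h.Pn_iff m p).1 hx).1 hpn
        rw [R_iff]
        change m = m ∧ (onePointData M _ _).r1 m s none ↔ _
        rw [onePointData_r1_none]
        constructor
        · rintro ⟨-, p', hp', hs'', hε⟩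
          have : nb m p = nb m p' := by
            ext c
            simpa using (hs' (some c)).symm.trans (hs'' (some c))
          rwa [h.nb_inj m p p' hx hp' this]
        · exact fun hε => ⟨rfl, p, hx, hs', hε⟩
      · exact absurd hpn (hU n)
      · exact absurd hpn (hU n)
  · refine ⟨_, inferInstance, f, gq (some (classRep h m₀)) none, hB, fun h => h, hc, fun n h => h,
      fun a ha => OnePointRel.ne_gq_none (ha ▸ hf a), fun p hp hE => ?_⟩
    · have hfp := hf p
      have hUp : ∀ n, ¬ U n p := fun n hn => hU n ((h.U_of_E hE n).2 hn)
      generalize f p = z at hfp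
      rcases hfp with ⟨m, _, hx⟩ | ⟨m, _, hx⟩ | ⟨m, _, hx, s, hs, hs'⟩ | ⟨_, hx, hU⟩ | ⟨_, hx, hU⟩
      · exact absurd (h.Q0_sub m p hx).1 (hUp m)
      · exact absurd ((h.Q1_iff m p).1 hx).1 (hUp m)
      · exact absurd ((h.Pn_iff m p).1 hx).1 (hUp m)
      · rw [R_iff]
        change some (classRep h p) = some (classRep h m₀) ∧ (onePointData M _ _).r2 _ (some p) none ↔ _
        rw [onePointData_r2_none (Or.inr rfl), (classRep_eq_iff h).2 hE]
        simp
      · exact absurd hp ((h.Q_iff p).1 hx)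

/-- If the class is `U_n`, a point of `P` needs exactly `n` neighbours in `Q_n^0`. The set `T` is
filled up by elements outside `A` and by the new element `none`, which also makes the point new; the
strict inequality in `hcard` leaves room for it. -/
theorem exists_extension_P (hM : Nlow.IsBaseModel M) (m₀ : M) (A : Finset M) (T : Finset M)
    (hT : T ⊆ A) (hcard : ∀ n, U n m₀ → T.card < n) :
    ∃ (M' : Type) (_ : nlowLanguage.Structure M') (f : M ↪[nlowLanguage] M') (y : M'),
      Nlow.IsBaseModel M' ∧ P y ∧ E (f m₀) y ∧ (∀ a, f a ≠ y) ∧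
        ∀ q ∈ A, Q q → E m₀ q → (R y (f q) ↔ q ∈ T) := by
  classical
  have h := hM.isNlow
  have : Infinite M := Set.infinite_univ_iff.1 (hM.infinite_P.mono (Set.subset_univ _))
  obtain ⟨hB, f, hf⟩ := exists_onePoint_embedding hM
    (fun n s m => ∃ b, m = some b ∧ b ∈ T) (fun _ m => ∃ b, m = some b ∧ b ∈ T)
  rcases (hf m₀).cls_eq with ⟨n, hn, hc⟩ | ⟨hU, hc⟩
  · obtain ⟨T', hT', hT'A⟩ : ∃ T' : Finset M, T'.card = n - 1 - T.card ∧ Disjoint T' A := by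
      obtain ⟨T', hT', hc⟩ := (Finset.finite_toSet A).infinite_compl.exists_subset_card_eq
        (n - 1 - T.card)
      exact ⟨T', hc, Finset.disjoint_left.2 fun x hx => hT' hx⟩
    have hsc : (insert none ((T ∪ T').image some)).card = n := by
      rw [Finset.card_insert_of_notMem (by simp),
        Finset.card_image_of_injective _ (Option.some_injective _),
        Finset.card_union_of_disjoint (hT'A.symm.mono_left hT), hT']
      have := hcard n hn
      omega
    refine ⟨_, inferInstance, f, p n _ hsc, hB, trivial, hc, fun a ha => ?_, fun q hqA hq hE => ?_⟩
    · have := hf a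
      rw [ha] at this
      rcases this with _ | _ | ⟨_, _, hx, _, _, hs'⟩
      obtain ⟨c, -, hc⟩ := (hs' none).1 (by simp)
      cases hc
    · have hqn : U n q := (h.U_of_E hE n).1 hn
      have hfq := hf q
      generalize f q = z at hfq
      rcases hfq with ⟨m, _, hx⟩ | ⟨m, _, hx⟩ | ⟨m, _, hx, s, hs, hs'⟩ | ⟨_, hx, hU⟩ | ⟨_, hx, hU⟩
      · obtain rfl := h.U_inj m n q (h.Q0_sub m q hx).1 hqn
        rw [R_iff]
        change m = m ∧ some q ∈ insert none ((T ∪ T').image some) ↔ _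
        have : q ∉ T' := fun hq => Finset.disjoint_left.1 hT'A hq hqA
        simp [this]
      · obtain rfl := h.U_inj m n q ((h.Q1_iff m q).1 hx).1 hqn
        rw [R_iff]
        change m = m ∧ (onePointData M _ _).r1 m _ (some q) ↔ _
        rw [onePointData_r1_of_mem (by simp)]
        simp
      · exact absurd ((h.Pn_iff m q).1 hx).2 ((h.Q_iff q).1 hq)
      · exact absurd hqn (hU n)
      · exact absurd hqn (hU n)
  · refine ⟨_, inferInstance, f, gp (some (classRep h m₀)) none, hB, trivial, hc,
      fun a ha => OnePointRel.ne_gp_none (ha ▸ hf a), fun q hqA hq hE => ?_⟩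
    · have hfq := hf q
      have hUq : ∀ n, ¬ U n q := fun n hn => hU n ((h.U_of_E hE n).2 hn)
      generalize f q = z at hfq
      rcases hfq with ⟨m, _, hx⟩ | ⟨m, _, hx⟩ | ⟨m, _, hx, s, hs, hs'⟩ | ⟨_, hx, hU⟩ | ⟨_, hx, hU⟩
      · exact absurd (h.Q0_sub m q hx).1 (hUq m)
      · exact absurd ((h.Q1_iff m q).1 hx).1 (hUq m)
      · exact absurd ((h.Pn_iff m q).1 hx).1 (hUq m)
      · exact absurd hx ((h.Q_iff q).1 hq)
      · rw [R_iff]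
        change some (classRep h m₀) = some (classRep h q) ∧ (onePointData M _ _).r2 _ none (some q) ↔ _
        rw [onePointData_r2_none (Or.inl rfl), (classRep_eq_iff h).2 hE]
        simp

/-- All points of `P_n` having the new element as a neighbour are new, so their relations to the old
`Q_n^1` can be prescribed at once. -/
theorem exists_extension_Q0 (hM : Nlow.IsBaseModel M) (n : ℕ+) (ε : Set M → M → Prop) :
    ∃ (M' : Type) (_ : nlowLanguage.Structure M') (f : M ↪[nlowLanguage] M') (y : M'),
      Nlow.IsBaseModel M' ∧ Qn n false y ∧ (∀ a, f a ≠ y) ∧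
        ∀ a, Pn n a → y ∈ nb n a → ∀ b, Qn n true b → (R a (f b) ↔ ε {c | f c ∈ nb n a} b) := by
  have h := hM.isNlow
  obtain ⟨hB, f, hf⟩ := exists_onePoint_embedding hM
    (fun n s m => ∃ b, m = some b ∧ ε {c | Qn n false c ∧ some c ∈ s} b) (fun _ _ => True)
  refine ⟨_, inferInstance, f, q0 n none, hB, rfl, fun a ha => ?_, fun a ha hy b hb => ?_⟩
  · have := hf a
    rw [ha] at this
    cases this
  · obtain ⟨s, hs, rfl⟩ := Pn_iff_exists.1 ha
    rw [nb_p] at hy ⊢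
    have hns : none ∈ s := by
      obtain ⟨z, hz, hzy⟩ := hy
      rwa [← q0_injective n hzy]
    have hset : {c | f c ∈ q0 n '' (s : Set (Option M))} = {c | Qn n false c ∧ some c ∈ s} := by
      ext c
      constructor
      · rintro ⟨z, hz, hzc⟩
        have hcn : Qn n false c := ((hf c).Q0_iff n).2 (hzc ▸ rfl)
        rw [(hf c).q0_eq hcn] at hzc
        obtain rfl := q0_injective n hzc
        exact ⟨hcn, hz⟩
      · rintro ⟨hcn, hc⟩
        exact ⟨some c, hc, ((hf c).q0_eq hcn).symm⟩
    rw [hset]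
    have hbn := ((h.Q1_iff n b).1 hb).1
    have hfb := hf b
    generalize f b = z at hfb
    rcases hfb with ⟨m, _, hx⟩ | ⟨m, _, hx⟩ | ⟨m, _, hx, s, hs, hs'⟩ | ⟨_, hx, hU⟩ | ⟨_, hx, hU⟩
    · obtain rfl := h.U_inj m n b (h.Q0_sub m b hx).1 hbn
      exact absurd hx ((h.Q1_iff m b).1 hb).2.2
    · obtain rfl := h.U_inj m n b ((h.Q1_iff m b).1 hx).1 hbn
      rw [R_iff]
      change m = m ∧ (onePointData M _ _).r1 m s (some b) ↔ _
      rw [onePointData_r1_of_mem hns]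
      simp
    · exact absurd ((h.Pn_iff m b).1 hx).2 ((h.Q_iff b).1 ((h.Q1_iff n b).1 hb).2.1)
    · exact absurd hbn (hU n)
    · exact absurd hbn (hU n)

end OnePointExtensions

/-- The extension properties for finite sets, in which finitely many levels are controlled. -/
structure IsFinRich (N : Type*) [nlowLanguage.Structure N] : Prop where
  exists_Q : ∀ (A : Finset N) (ε : N → Prop) (m₀ : N) (k : ℕ+),
    ∃ y, Q y ∧ E m₀ y ∧ (∀ n ≤ k, ¬ Qn n false y) ∧ y ∉ A ∧
      ∀ p ∈ A, P p → E m₀ p → (R p y ↔ ε p)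
  exists_P : ∀ (A T : Finset N) (m₀ : N) (k : ℕ), T ⊆ A → T.card ≤ k →
    (∀ n : ℕ+, (n : ℕ) ≤ k → ¬ U n m₀) →
    ∃ y, P y ∧ E m₀ y ∧ y ∉ A ∧ ∀ q ∈ A, Q q → E m₀ q → (R y q ↔ q ∈ T)
  exists_class : ∀ (A : Finset N) (k : ℕ+), ∃ m₀, (∀ n ≤ k, ¬ U n m₀) ∧ ∀ a ∈ A, ¬ E m₀ a
  exists_Q0 : ∀ (n : ℕ+) (A : Finset N) (ε : Set N → N → Prop),
    ∃ y, Qn n false y ∧ y ∉ A ∧ ∀ a, Pn n a → y ∈ nb n a → nb n a ⊆ insert y ↑A →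
      ∀ m ∈ A, Qn n true m → (R a m ↔ ε (nb n a \ {y}) m)

/-! ### Finite richness of the models of the theory -/

section FinRich

variable {N : Type*} [nlowLanguage.Structure N] [Nonempty N]

/-- Each property asks for a point satisfying finitely many atomic conditions over finitely many
parameters. An approximating base model has a one-point extension with such a point, and
`exists_agree` copies it into the given model. -/
theorem isFinRich_of_model (hN : N ⊨ nlowTheory) : IsFinRich N where
  exists_Q A ε m₀ k := by
    classical
    have hA := (insert m₀ A).finite_toSet
    obtain ⟨M, _, w, hM, h, hex⟩ := exists_agree hN (Y := Unit) hA k (id : N → N)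
    obtain ⟨M', _, f, y, hM', hyQ, hyE, hy0, hyf, hyR⟩ := exists_extension_Q hM (w m₀)
      fun x => ∃ p ∈ A, w p = x ∧ ε p
    obtain ⟨x, hx⟩ := hex M' f hM' fun _ => y
    have hm : ∀ {a}, a ∈ A → a ∈ ((insert m₀ A : Finset N) : Set N) := fun ha => by simp [ha]
    have hm₀ : m₀ ∈ ((insert m₀ A : Finset N) : Set N) := by simp
    have hl : ∀ {a}, a ∈ ((insert m₀ A : Finset N) : Set N) → (Sum.inl a : N ⊕ Unit) ∈
      (Sum.inl '' ((insert m₀ A : Finset N) : Set N) ∪ Set.range Sum.inr : Set (N ⊕ Unit)) :=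
      fun ha => Or.inl ⟨_, ha, rfl⟩
    have hr : (Sum.inr () : N ⊕ Unit) ∈
      (Sum.inl '' ((insert m₀ A : Finset N) : Set N) ∪ Set.range Sum.inr : Set (N ⊕ Unit)) :=
      Or.inr ⟨_, rfl⟩
    refine ⟨x (), (hx.Q_iff hr).2 hyQ, (hx.E_iff (hl hm₀) hr).2 hyE,
      fun n hn hxn => hy0 n ((hx.Qn_iff hn hr).1 hxn),
      fun hxA => hyf _ ((hx.eq_iff (hl (hm hxA)) hr).1 rfl), fun p hp hpP hpE => ?_⟩
    refine (hx.R_iff (hl (hm hp)) hr).trans ((hyR (w p) ((h.P_iff (hm hp)).1 hpP)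
      ((h.E_iff hm₀ (hm hp)).1 hpE)).trans ?_)
    constructor
    · rintro ⟨q, hq, hqp, hε⟩
      rwa [← show q = p from (h.eq_iff (hm hq) (hm hp)).2 hqp]
    · exact fun hε => ⟨p, hp, rfl, hε⟩
  exists_P A T m₀ k hT hcard hU := by
    classical
    have hA := (insert m₀ A).finite_toSet
    obtain ⟨M, _, w, hM, h, hex⟩ := exists_agree hN (Y := Unit) hA k.succPNat (id : N → N)
    have hm : ∀ {a}, a ∈ A → a ∈ ((insert m₀ A : Finset N) : Set N) := fun ha => by simp [ha]
    have hm₀ : m₀ ∈ ((insert m₀ A : Finset N) : Set N) := by simp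
    obtain ⟨M', _, f, y, hM', hyP, hyE, hyf, hyR⟩ := exists_extension_P hM (w m₀) (A.image w)
      (T.image w) (Finset.image_subset_image hT) fun n hn => by
        by_contra hlt
        have hnk : (n : ℕ) ≤ k := (not_lt.1 hlt).trans (Finset.card_image_le.trans hcard)
        refine hU n hnk ((h.U_iff ?_ hm₀).2 hn)
        exact (PNat.coe_le_coe _ _).1 (hnk.trans (Nat.le_succ k))
    obtain ⟨x, hx⟩ := hex M' f hM' fun _ => y
    have hl : ∀ {a}, a ∈ ((insert m₀ A : Finset N) : Set N) → (Sum.inl a : N ⊕ Unit) ∈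
      (Sum.inl '' ((insert m₀ A : Finset N) : Set N) ∪ Set.range Sum.inr : Set (N ⊕ Unit)) :=
      fun ha => Or.inl ⟨_, ha, rfl⟩
    have hr : (Sum.inr () : N ⊕ Unit) ∈
      (Sum.inl '' ((insert m₀ A : Finset N) : Set N) ∪ Set.range Sum.inr : Set (N ⊕ Unit)) :=
      Or.inr ⟨_, rfl⟩
    refine ⟨x (), (hx.P_iff hr).2 hyP, (hx.E_iff (hl hm₀) hr).2 hyE,
      fun hxA => hyf _ ((hx.eq_iff (hl (hm hxA)) hr).1 rfl), fun q hq hqQ hqE => ?_⟩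
    refine (hx.R_iff hr (hl (hm hq))).trans ((hyR (w q) (Finset.mem_image_of_mem w hq)
      ((h.Q_iff (hm hq)).1 hqQ) ((h.E_iff hm₀ (hm hq)).1 hqE)).trans ?_)
    rw [Finset.mem_image]
    constructor
    · rintro ⟨p, hp, hpq⟩
      rwa [← show p = q from (h.eq_iff (hm (hT hp)) (hm hq)).2 hpq]
    · exact fun hq => ⟨q, hq, rfl⟩
  exists_class A k := by
    classical
    obtain ⟨M, _, w, hM, h, hex⟩ := exists_agree hN (Y := Unit) A.finite_toSet k (id : N → N)
    -- A class `U_n` with `n > k` which contains none of the given elements is good enough, since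
    -- only levels up to `k` are controlled.
    obtain ⟨n, hn⟩ := ((Set.finite_Iic k).union
      (Set.Finite.biUnion A.finite_toSet fun a _ => (Set.Subsingleton.finite
        (s := {n | U n (w a)}) fun m hm n hn => hM.isNlow.U_inj m n _ hm hn))).exists_notMem
    simp only [Set.mem_union, Set.mem_Iic, Set.mem_iUnion, not_or, not_exists] at hn
    obtain ⟨y, hy⟩ := hM.isNlow.U_nonempty n
    obtain ⟨x, hx⟩ := hex M (Embedding.refl _ M) hM fun _ => y
    have hr : (Sum.inr () : N ⊕ Unit) ∈
      (Sum.inl '' (A : Set N) ∪ Set.range Sum.inr : Set (N ⊕ Unit)) := Or.inr ⟨_, rfl⟩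
    refine ⟨x (), fun m hm hxm => ?_, fun a ha hxa => ?_⟩
    · exact hn.1 (hM.isNlow.U_inj m n y ((hx.U_iff hm hr).1 hxm) hy ▸ hm)
    · exact hn.2 a ha ((hM.isNlow.U_iff n _ _ hy).2
        ((hx.E_iff (b := Sum.inl a) hr (Or.inl ⟨a, ha, rfl⟩)).1 hxa))
  exists_Q0 n A ε := by
    classical
    have hb := isNlow_of_model hN
    obtain ⟨M, _, w, hM, h, hex⟩ := exists_agree hN (Y := Unit) A.finite_toSet n (id : N → N)
    obtain ⟨M', _, f, y, hM', hy0, hyf, hyR⟩ := exists_extension_Q0 hM n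
      fun C x => ∃ m ∈ A, w m = x ∧ ε {c | c ∈ A ∧ w c ∈ C} m
    obtain ⟨x, hx⟩ := hex M' f hM' fun _ => y
    have hl : ∀ {a}, a ∈ A → (Sum.inl a : N ⊕ Unit) ∈
      (Sum.inl '' (A : Set N) ∪ Set.range Sum.inr : Set (N ⊕ Unit)) :=
      fun ha => Or.inl ⟨_, ha, rfl⟩
    have hr : (Sum.inr () : N ⊕ Unit) ∈
      (Sum.inl '' (A : Set N) ∪ Set.range Sum.inr : Set (N ⊕ Unit)) :=
      Or.inr ⟨_, rfl⟩
    have hxA : x () ∉ A := fun hxA => hyf _ ((hx.eq_iff (hl hxA) hr).1 rfl)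
    refine ⟨x (), (hx.Qn_iff le_rfl hr).2 hy0, hxA, fun a ha hya hsub m hm hm1 => ?_⟩
    obtain ⟨b, hbi, hbQ, rfl⟩ := hb.gen n a ha
    rw [(hb.F_good n b hbi hbQ).2] at hya hsub ⊢
    -- The tuple is rewritten in variables, old ones and the new one, so that `R(F_n(b), m)` becomes
    -- one of the controlled atomic formulas.
    have hlift : ∀ i, ∃ z : N ⊕ Unit, z ∈ (Sum.inl '' (A : Set N) ∪ Set.range Sum.inr :
        Set (N ⊕ Unit)) ∧ Sum.elim id x z = b i := fun i => by
      rcases hsub ⟨i, rfl⟩ with h | h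
      · exact ⟨Sum.inr (), hr, h.symm⟩
      · exact ⟨Sum.inl (b i), hl h, rfl⟩
    choose s hs hsb using hlift
    obtain rfl : (fun i => Sum.elim id x (s i)) = b := funext hsb
    have hg := hM'.isNlow.F_good n (fun i => Sum.elim (fun i => f (w i)) (fun _ => y) (s i))
      (fun i j hij => hbi ((hx.eq_iff (hs i) (hs j)).2 hij))
      (fun i => (hx.Qn_iff le_rfl (hs i)).1 (hbQ i))
    have hys : y ∈ Set.range fun i => Sum.elim (fun i => f (w i)) (fun _ => y) (s i) := by
      obtain ⟨i, hi⟩ := hya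
      exact ⟨i, (hx.eq_iff (hs i) hr).1 hi⟩
    refine (hx.R_F_iff (a := Sum.inl m) le_rfl hs (hl hm)).trans ((hyR _ hg.1 (hg.2 ▸ hys) (w m)
      ((h.Qn_iff le_rfl hm).1 hm1)).trans ?_)
    have hset : {c | c ∈ A ∧ w c ∈ {c | f c ∈ nb n (F n fun i =>
        Sum.elim (fun i => f (w i)) (fun _ => y) (s i))}} =
        (Set.range fun i => Sum.elim id x (s i)) \ {x ()} := by
      rw [hg.2]
      ext c
      constructor
      · rintro ⟨hc, i, hi⟩
        exact ⟨⟨i, (hx.eq_iff (hs i) (hl hc)).2 hi⟩, fun h => hxA (h ▸ hc)⟩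
      · rintro ⟨⟨i, hi⟩, hcx⟩
        have hc : c ∈ A := (hsub ⟨i, hi⟩).resolve_left hcx
        exact ⟨hc, i, (hx.eq_iff (hs i) (hl hc)).1 hi⟩
    rw [hset]
    constructor
    · rintro ⟨m', hm', hmm, hε⟩
      rwa [← show m' = m from (h.eq_iff hm' hm).2 hmm]
    · exact fun hε => ⟨m, hm, rfl, hε⟩

end FinRich

end NlowStr


/-! ### Richness of specializations -/

section Tools

open Cardinal

variable {B : Type u} [CompleteBooleanAlgebra B] {U : Order.PFilter B} {κ : Cardinal.{u}}
  {L : FirstOrder.Language.{0, 0}} {M : Type u}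

/-- Realizing small sets of formulas in a specialization. -/
theorem BVStructure.exists_realize_specModel (hU : IsUltrafilterOn U) (S : BVStructure L B M)
    (hS : S.IsFull) (hL : L.card ≤ ℵ₀) (hκ : ℵ₀ ≤ κ) (hsat : S.IsSuccSaturated κ) {K : Type u}
    (hK : #K ≤ κ) (φ : K → L.Formula (M ⊕ PUnit.{u + 1})) (d : K → B) (hd : ∀ k, d k ∈ U)
    (h : ∀ W : Order.PFilter B, IsUltrafilterOn W → ∀ s : Finset K, (∀ k ∈ s, d k ∈ W) →
      ∃ y, ∀ k ∈ s, (φ k).Realize (Sum.elim (SpecModel.mk S hS W) fun _ => y)) :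
    ∃ y, ∀ k, (φ k).Realize (Sum.elim (SpecModel.mk S hS U) fun _ => y) := by
  have := hU.nontrivial
  obtain ⟨b, hb⟩ := S.exists_realization hS hL hκ hsat (J := PUnit.{u + 1})
    (by simpa using one_le_aleph0.trans hκ) hK φ d fun W hW s hs =>
      (h W hW s hs).imp' (fun y _ => y) fun y hy => hy
  refine ⟨SpecModel.mk S hS U (b PUnit.unit), fun k => ?_⟩
  have h1 := (SpecModel.realize_iff (hS := hS) hU _).2 (U.mem_of_le (hb k) (hd k))
  rw [Formula.realize_relabel] at h1
  convert h1 using 1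
  funext x
  rcases x with x | x <;> rfl

/-- Separation of colourings of definable equivalence relations. -/
theorem SeparatesColourings.exists_coherent (hsep : SeparatesColourings U κ)
    (hU : IsUltrafilterOn U) (S : BVStructure L B M) (hS : S.IsFull) {I : Type u} (hI : #I ≤ κ)
    (θ : I → I → L.Formula M) (ε : I → Prop)
    (hθ : ∀ (N : Type u) [L.Structure N] [Nonempty N] (v : M → N),
      Equivalence fun i j => (θ i j).Realize v)
    (hε : ∀ i j, (θ i j).Realize (SpecModel.mk S hS U) → ε i → ε j) :
    ∃ d : I → B, (∀ i, d i ∈ U) ∧ ∀ W : Order.PFilter B, IsUltrafilterOn W → ∀ i j, d i ∈ W →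
      d j ∈ W → (θ i j).Realize (SpecModel.mk S hS W) → (ε i ↔ ε j) := by
  obtain ⟨d, hd, hd'⟩ := hsep I hI (fun i j => S.val (θ i j)) ε
    (S.toPreVal.isBoolEquiv _ hθ) fun i j hi hj => hU.compl_mem_iff.2 fun h =>
      hj (hε i j ((SpecModel.realize_iff hU _).2 h) hi)
  have key : ∀ W : Order.PFilter B, IsUltrafilterOn W → ∀ i j, d i ∈ W →
      d j ∈ W → (θ i j).Realize (SpecModel.mk S hS W) → ε i → ε j := by
    intro W hW i j hi hj hij hεi
    by_contra hεj
    refine hW.1 ?_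
    rw [← hd' i j hεi hεj]
    exact Order.PFilter.inf_mem (Order.PFilter.inf_mem hi hj) ((SpecModel.realize_iff hW _).1 hij)
  refine ⟨d, hd, fun W hW i j hi hj hij => ⟨key W hW i j hi hj hij, key W hW j i hj hi ?_⟩⟩
  have := hS.nonempty
  exact (hθ _ _).symm hij

/-- Families from `OKFor` are indexed by arbitrary types which are not larger. -/
theorem OKFor.of_card_le {J J' : Type u} (h : OKFor U J) (hJ : #J' ≤ #J) : OKFor U J' := by
  classical
  obtain ⟨f⟩ := Cardinal.le_def _ _ |>.1 hJ
  intro a ha haU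
  obtain ⟨d, hd, hd'⟩ := h a ha haU
  refine ⟨fun i => d (f i), fun i => hd _, fun s hs => ?_⟩
  have := hd' (s.map f) (hs.map)
  rw [Finset.card_map] at this
  refine le_trans (le_iInf₂ fun i hi => ?_) this
  obtain ⟨j, hj, rfl⟩ := Finset.mem_map.1 hi
  exact iInf₂_le j hj

open Classical in
/-- The formula `φ` or its negation, according to `p`. -/
noncomputable def FirstOrder.Language.Formula.signed {X : Type*} (φ : L.Formula X) (p : Prop) :
    L.Formula X := if p then φ else φ.not

theorem FirstOrder.Language.Formula.realize_signed {X : Type*} {φ : L.Formula X} {p : Prop}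
    {N : Type*} [L.Structure N] {v : X → N} : (φ.signed p).Realize v ↔ (φ.Realize v ↔ p) := by
  rw [Formula.signed]
  split_ifs with h <;> simp [h, Formula.realize_not]

end Tools

namespace NlowStr

open Cardinal

section Formulas

variable {X N : Type*} [nlowLanguage.Structure N] {v : X → N}

theorem realize_unary {r : NlowRel 1} {a : X} :
    (relFormula r ![a]).Realize v ↔ Structure.RelMap (L := nlowLanguage) r ![v a] :=
  realize_relFormula.trans relMap_unary

theorem realize_binary {r : NlowRel 2} {a b : X} :
    (relFormula r ![a, b]).Realize v ↔ Structure.RelMap (L := nlowLanguage) r ![v a, v b] :=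
  realize_relFormula.trans relMap_binary

theorem realize_P {a : X} : (relFormula NlowRel.P ![a]).Realize v ↔ P (v a) := realize_unary
theorem realize_Q {a : X} : (relFormula NlowRel.Q ![a]).Realize v ↔ Q (v a) := realize_unary
theorem realize_U {n : ℕ+} {a : X} : (relFormula (NlowRel.U n) ![a]).Realize v ↔ U n (v a) :=
  realize_unary
theorem realize_Qn {n : ℕ+} {i : Bool} {a : X} :
    (relFormula (NlowRel.Qn n i) ![a]).Realize v ↔ Qn n i (v a) := realize_unary
theorem realize_R {a b : X} : (relFormula NlowRel.R ![a, b]).Realize v ↔ R (v a) (v b) :=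
  realize_binary
theorem realize_E {a b : X} : (relFormula NlowRel.E ![a, b]).Realize v ↔ E (v a) (v b) :=
  realize_binary

end Formulas

/-! ### Richness of specializations of saturated models -/

section Rich

variable {B : Type u} [CompleteBooleanAlgebra B] {F : Order.PFilter B} {κ : Cardinal.{u}}
  {M : Type u} (S : BVStructure nlowLanguage B M) (hS : S.IsFull)

-- Elements distinct at `F` may coincide at another `W`. The family `d` ensures that indices visible
-- at `W` whose elements coincide there carry the same demand.
include hS in
theorem exists_coherent_eq (hF : IsUltrafilterOn F) (hsep : SeparatesColourings F κ) {I : Type u}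
    (hI : #I ≤ κ) (b : I → M) (ε : SpecModel S hS F → Prop) :
    ∃ d : I → B, (∀ i, d i ∈ F) ∧ ∀ W : Order.PFilter B, IsUltrafilterOn W → ∀ i j, d i ∈ W →
      d j ∈ W → SpecModel.mk S hS W (b i) = SpecModel.mk S hS W (b j) →
        (ε (SpecModel.mk S hS F (b i)) ↔ ε (SpecModel.mk S hS F (b j))) := by
  obtain ⟨d, hd, hd'⟩ := hsep.exists_coherent hF S hS hI (fun i j => eqFormula (b i) (b j))
    (fun i => ε (SpecModel.mk S hS F (b i))) (fun N _ _ v => by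
      simp only [realize_eqFormula]
      exact eq_equivalence.comap fun i => v (b i)) (fun i j hij hi => by
      rwa [← realize_eqFormula.1 hij])
  exact ⟨d, hd, fun W hW i j hi hj hij => hd' W hW i j hi hj (realize_eqFormula.2 hij)⟩

variable (hF : IsUltrafilterOn F) (hκ : ℵ₀ ≤ κ) (hT : S.IsModelOf nlowTheory)
  (hsat : S.IsSuccSaturated κ) (hsep : SeparatesColourings F κ)

include hF hκ hT hsat hsep

theorem exists_Q_specModel (A : Set (SpecModel S hS F)) (ε : SpecModel S hS F → Prop)
    (m₀ : SpecModel S hS F) (hA : #A ≤ κ) :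
    ∃ y, Q y ∧ E m₀ y ∧ (∀ n, ¬ Qn n false y) ∧ y ∉ A ∧ ∀ p ∈ A, P p → E m₀ p → (R p y ↔ ε p) := by
  classical
  have hmod := fun W (hW : IsUltrafilterOn W) => SpecModel.model_of_isModelOf (hS := hS) hW hT
  obtain ⟨m, rfl⟩ := SpecModel.mk_surjective m₀
  choose b hb using fun a : A => SpecModel.mk_surjective (a : SpecModel S hS F)
  -- Positive demands are restricted to points of `P` in the right class; elsewhere `R` is false and
  -- the negative demand is harmless.
  let ε' : SpecModel S hS F → Prop := fun p => ε p ∧ P p ∧ E (SpecModel.mk S hS F m) p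
  obtain ⟨d, hd, hd'⟩ := exists_coherent_eq S hS hF hsep hA b ε'
  let y : M ⊕ PUnit.{u + 1} := Sum.inr PUnit.unit
  let γ : A → nlowLanguage.Formula M := fun a =>
    relFormula NlowRel.P ![b a] ⊓ relFormula NlowRel.E ![m, b a]
  let φ : A ⊕ ULift.{u} ℕ+ → nlowLanguage.Formula (M ⊕ PUnit.{u + 1}) := Sum.elim
    (fun a => (eqFormula y (Sum.inl (b a))).not ⊓
      (relFormula NlowRel.R ![Sum.inl (b a), y]).signed (ε' a))
    (fun n => relFormula NlowRel.Q ![y] ⊓ relFormula NlowRel.E ![Sum.inl m, y] ⊓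
      (relFormula (NlowRel.Qn n.down false) ![y]).not)
  have hφl : ∀ {W : Order.PFilter B} (a : A) (z : SpecModel S hS W),
      (φ (Sum.inl a)).Realize (Sum.elim (SpecModel.mk S hS W) fun _ => z) ↔
      z ≠ SpecModel.mk S hS W (b a) ∧ (R (SpecModel.mk S hS W (b a)) z ↔ ε' a) := by
    intro W a z
    simp only [φ, Sum.elim_inl, Formula.realize_inf, Formula.realize_not, realize_eqFormula,
      Formula.realize_signed, realize_R, y, Sum.elim_inr, ne_eq]
  have hφr : ∀ {W : Order.PFilter B} (n : ULift.{u} ℕ+) (z : SpecModel S hS W),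
      (φ (Sum.inr n)).Realize (Sum.elim (SpecModel.mk S hS W) fun _ => z) ↔
      (Q z ∧ E (SpecModel.mk S hS W m) z) ∧ ¬ Qn n.down false z := by
    intro W n z
    simp only [φ, Sum.elim_inr, Formula.realize_inf, Formula.realize_not, realize_Q, realize_E,
      realize_Qn, y, Sum.elim_inl]
  obtain ⟨z, hz⟩ := S.exists_realize_specModel hF hS card_nlowLanguage_le hκ hsat
    (K := A ⊕ ULift.{u} ℕ+) (by
      rw [mk_sum, lift_id, lift_id]
      exact add_le_of_le hκ hA ((mk_le_aleph0 (α := ULift.{u} ℕ+)).trans hκ)) φ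
    -- A positive demand is made only where its parameter still lies in `P` and in the class of `m`.
    (Sum.elim (fun a => d a ⊓ if ε' a then S.val (γ a) else ⊤) fun _ => ⊤) (by
      rintro (a | n)
      · refine Order.PFilter.inf_mem (hd a) ?_
        split_ifs with h
        · refine (SpecModel.realize_iff (hS := hS) hF _).1 ?_
          rw [Formula.realize_inf, realize_P, realize_E, hb]
          exact h.2
        · exact F.top_mem
      · exact F.top_mem) (by
      intro W hW s hs
      have hfin := isFinRich_of_model (hmod W hW)
      have hbase := isNlow_of_model (hmod W hW)
      have hdW : ∀ a, Sum.inl a ∈ s → d a ∈ W := fun a ha =>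
        W.mem_of_le inf_le_left (hs _ ha)
      obtain ⟨k, hk⟩ : ∃ k : ℕ+, ∀ n, Sum.inr n ∈ s → n.down ≤ k := by
        obtain ⟨k, hk⟩ := (s.toRight.image ULift.down).bddAbove
        exact ⟨k, fun n hn => hk (Finset.mem_coe.2
          (Finset.mem_image_of_mem _ (Finset.mem_toRight.2 hn)))⟩
      obtain ⟨z, hzQ, hzE, hz0, hzA, hzR⟩ := hfin.exists_Q
        (s.toLeft.image fun a => SpecModel.mk S hS W (b a))
        (fun p => ∃ a ∈ s.toLeft, SpecModel.mk S hS W (b a) = p ∧ ε' a) (SpecModel.mk S hS W m) k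
      refine ⟨z, ?_⟩
      rintro (a | n) hks
      · rw [hφl]
        have ha := Finset.mem_image_of_mem (fun a => SpecModel.mk S hS W (b a))
          (Finset.mem_toLeft.2 hks)
        refine ⟨fun h => hzA (h ▸ ha), ?_⟩
        by_cases hPE : P (SpecModel.mk S hS W (b a)) ∧
            E (SpecModel.mk S hS W m) (SpecModel.mk S hS W (b a))
        · rw [hzR _ ha hPE.1 hPE.2]
          constructor
          · rintro ⟨a', ha', haa', hε⟩
            have := hd' W hW a' a (hdW _ (Finset.mem_toLeft.1 ha')) (hdW _ hks) haa'
            rw [hb, hb] at this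
            exact this.1 hε
          · exact fun hε => ⟨a, Finset.mem_toLeft.2 hks, rfl, hε⟩
        · refine iff_of_false (fun h => hPE ?_) fun hε => hPE ?_
          · obtain ⟨h1, -, h2⟩ := hbase.R_sub _ _ h
            exact ⟨h1, hbase.E_equiv.trans hzE (hbase.E_equiv.symm h2)⟩
          · have h1 := W.mem_of_le inf_le_right (hs _ hks)
            rw [if_pos hε] at h1
            have h2 := (SpecModel.realize_iff (hS := hS) hW _).2 h1
            rwa [Formula.realize_inf, realize_P, realize_E] at h2
      · rw [hφr]
        exact ⟨⟨hzQ, hzE⟩, hz0 _ (hk n hks)⟩)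
  have hr := fun n => (hφr n z).1 (hz _)
  have hl := fun a => (hφl a z).1 (hz _)
  refine ⟨z, (hr ⟨1⟩).1.1, (hr ⟨1⟩).1.2, fun n => (hr ⟨n⟩).2, fun hzA => ?_, fun p hp hpP hpE => ?_⟩
  · exact (hl ⟨z, hzA⟩).1 (hb ⟨z, hzA⟩).symm
  · have := (hl ⟨p, hp⟩).2
    rw [hb] at this
    rw [this]
    exact ⟨fun h => h.1, fun h => ⟨h, hpP, hpE⟩⟩

omit hsep in
theorem exists_class_specModel (A : Set (SpecModel S hS F)) (hA : #A ≤ κ) :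
    ∃ m₀ : SpecModel S hS F, (∀ n, ¬ U n m₀) ∧ ∀ a ∈ A, ¬ E m₀ a := by
  classical
  have hmod := fun W (hW : IsUltrafilterOn W) => SpecModel.model_of_isModelOf (hS := hS) hW hT
  choose b hb using fun a : A => SpecModel.mk_surjective (a : SpecModel S hS F)
  let y : M ⊕ PUnit.{u + 1} := Sum.inr PUnit.unit
  obtain ⟨z, hz⟩ := S.exists_realize_specModel hF hS card_nlowLanguage_le hκ hsat
    (K := A ⊕ ULift.{u} ℕ+) (by
      rw [mk_sum, lift_id, lift_id]
      exact add_le_of_le hκ hA ((mk_le_aleph0 (α := ULift.{u} ℕ+)).trans hκ))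
    (Sum.elim (fun a => (relFormula NlowRel.E ![y, Sum.inl (b a)]).not)
      fun n => (relFormula (NlowRel.U n.down) ![y]).not) (fun _ => ⊤) (fun _ => F.top_mem) (by
      intro W hW s hs
      obtain ⟨k, hk⟩ : ∃ k : ℕ+, ∀ n, Sum.inr n ∈ s → n.down ≤ k := by
        obtain ⟨k, hk⟩ := (s.toRight.image ULift.down).bddAbove
        exact ⟨k, fun n hn => hk (Finset.mem_coe.2
          (Finset.mem_image_of_mem _ (Finset.mem_toRight.2 hn)))⟩
      obtain ⟨z, hzU, hzA⟩ := (isFinRich_of_model (hmod W hW)).exists_class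
        (s.toLeft.image fun a => SpecModel.mk S hS W (b a)) k
      refine ⟨z, ?_⟩
      rintro (a | n) hks
      · simp only [Sum.elim_inl, Formula.realize_not, realize_E]
        exact hzA _ (Finset.mem_image_of_mem (fun a => SpecModel.mk S hS W (b a))
          (Finset.mem_toLeft.2 hks))
      · simp only [Sum.elim_inr, Formula.realize_not, realize_U]
        exact hzU _ (hk n hks))
  refine ⟨z, fun n => ?_, fun a ha => ?_⟩
  · have := hz (Sum.inr ⟨n⟩)
    simpa only [Sum.elim_inr, Formula.realize_not, realize_U, y] using this
  · have := hz (Sum.inl ⟨a, ha⟩)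
    simp only [Sum.elim_inl, Formula.realize_not, realize_E, hb, y, Sum.elim_inr] at this
    exact this

/-- The formula saying that `a` is not in `U_n` for `n ≤ k`. -/
noncomputable def notUFormula {X : Type*} (a : X) (k : ℕ) : nlowLanguage.Formula X :=
  have : Finite {n : ℕ+ // (n : ℕ) ≤ k} :=
    Finite.of_injective (β := Fin (k + 1)) (fun n => ⟨n.1, Nat.lt_succ_of_le n.2⟩)
      fun _ _ h => Subtype.ext (PNat.eq (Fin.mk.inj h))
  Formula.iInf fun n : {n : ℕ+ // (n : ℕ) ≤ k} => (relFormula (NlowRel.U n) ![a]).not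

omit hF hκ hT hsat hsep in
theorem realize_notUFormula {X N : Type*} [nlowLanguage.Structure N] {v : X → N} {a : X} {k : ℕ} :
    (notUFormula a k).Realize v ↔ ∀ n : ℕ+, (n : ℕ) ≤ k → ¬ U n (v a) := by
  have : Finite {n : ℕ+ // (n : ℕ) ≤ k} :=
    Finite.of_injective (β := Fin (k + 1)) (fun n => ⟨n.1, Nat.lt_succ_of_le n.2⟩)
      fun _ _ h => Subtype.ext (PNat.eq (Fin.mk.inj h))
  rw [notUFormula, Formula.realize_iInf, Subtype.forall]
  simp only [Formula.realize_not, realize_U]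

/-- This is where OK is needed. The class of `m₀` avoids every `U_n` at `F` but may be `U_n` at `W`,
where at most `n` neighbours in `Q_n^0` are possible. OK, applied to the values of "`m` is in no
`U_n` with `n ≤ k`", bounds the number of positive demands active at `W` below that level. -/
theorem exists_P_specModel (hOK : OKFor F κ.out) (A : Set (SpecModel S hS F))
    (ε : SpecModel S hS F → Prop) (m₀ : SpecModel S hS F) (hA : #A ≤ κ) (hm₀ : ∀ n, ¬ U n m₀) :
    ∃ y, P y ∧ E m₀ y ∧ y ∉ A ∧ ∀ q ∈ A, Q q → E m₀ q → (R y q ↔ ε q) := by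
  classical
  have hmod := fun W (hW : IsUltrafilterOn W) => SpecModel.model_of_isModelOf (hS := hS) hW hT
  obtain ⟨m, rfl⟩ := SpecModel.mk_surjective m₀
  choose b hb using fun a : A => SpecModel.mk_surjective (a : SpecModel S hS F)
  let ε' : SpecModel S hS F → Prop := fun p => ε p ∧ Q p ∧ E (SpecModel.mk S hS F m) p
  obtain ⟨d, hd, hd'⟩ := exists_coherent_eq S hS hF hsep hA b ε'
  obtain ⟨c, hc, hc'⟩ := hOK.of_card_le (J' := A) (by simpa using hA)
    (fun k => S.val (notUFormula m k))
    (antitone_nat_of_succ_le fun k => S.toPreVal.mono fun N _ _ v h => by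
      rw [realize_notUFormula] at h ⊢
      exact fun n hn => h n (hn.trans (Nat.le_succ k)))
    (fun k => (SpecModel.realize_iff (hS := hS) hF _).1 (realize_notUFormula.2 fun n _ => hm₀ n))
  let y : M ⊕ PUnit.{u + 1} := Sum.inr PUnit.unit
  let γ : A → nlowLanguage.Formula M := fun a =>
    relFormula NlowRel.Q ![b a] ⊓ relFormula NlowRel.E ![m, b a]
  let φ : Option A → nlowLanguage.Formula (M ⊕ PUnit.{u + 1}) := fun o => match o with
    | some a => (eqFormula y (Sum.inl (b a))).not ⊓
      (relFormula NlowRel.R ![y, Sum.inl (b a)]).signed (ε' a)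
    | none => relFormula NlowRel.P ![y] ⊓ relFormula NlowRel.E ![Sum.inl m, y]
  have hφl : ∀ {W : Order.PFilter B} (a : A) (z : SpecModel S hS W),
      (φ (some a)).Realize (Sum.elim (SpecModel.mk S hS W) fun _ => z) ↔
      z ≠ SpecModel.mk S hS W (b a) ∧ (R z (SpecModel.mk S hS W (b a)) ↔ ε' a) := by
    intro W a z
    simp only [φ, Sum.elim_inl, Formula.realize_inf, Formula.realize_not, realize_eqFormula,
      Formula.realize_signed, realize_R, y, Sum.elim_inr, ne_eq]
  have hφr : ∀ {W : Order.PFilter B} (z : SpecModel S hS W),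
      (φ none).Realize (Sum.elim (SpecModel.mk S hS W) fun _ => z) ↔
      P z ∧ E (SpecModel.mk S hS W m) z := by
    intro W z
    simp only [φ, Sum.elim_inr, Formula.realize_inf, realize_P, realize_E, y, Sum.elim_inl]
  obtain ⟨z, hz⟩ := S.exists_realize_specModel hF hS card_nlowLanguage_le hκ hsat
    (K := Option A) (by
      rw [mk_option]
      exact add_le_of_le hκ hA (one_le_aleph0.trans hκ)) φ
    (fun o => match o with
      | some a => d a ⊓ if ε' a then S.val (γ a) ⊓ c a else ⊤
      | none => ⊤) (by
      rintro (_ | a)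
      · exact F.top_mem
      · refine Order.PFilter.inf_mem (hd a) ?_
        split_ifs with h
        · refine Order.PFilter.inf_mem ((SpecModel.realize_iff (hS := hS) hF _).1 ?_) (hc a)
          rw [Formula.realize_inf, realize_Q, realize_E, hb]
          exact h.2
        · exact F.top_mem) (by
      intro W hW s hs
      have hfin := isFinRich_of_model (hmod W hW)
      have hbase := isNlow_of_model (hmod W hW)
      let l : Finset A := s.eraseNone
      have hl : ∀ {a}, a ∈ l ↔ some a ∈ s := Finset.mem_eraseNone
      have hdW : ∀ a ∈ l, d a ∈ W := fun a ha => W.mem_of_le inf_le_left (hs _ (hl.1 ha))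
      have hεW : ∀ a ∈ l, ε' a → S.val (γ a) ⊓ c a ∈ W := fun a ha h => by
        have := W.mem_of_le inf_le_right (hs _ (hl.1 ha))
        rwa [if_pos h] at this
      let l' : Finset A := l.filter fun a : A => ε' a
      -- The meet of the `c a` over the positive demands `l'` excludes the levels up to their
      -- number; without positive demands there is no level to exclude.
      have hU : ∀ n : ℕ+, (n : ℕ) ≤ l'.card → ¬ U n (SpecModel.mk S hS W m) := by
        rcases l'.eq_empty_or_nonempty with h | h
        · intro n hn
          rw [h, Finset.card_empty] at hn
          exact absurd n.pos (not_lt.2 hn)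
        · refine realize_notUFormula.1 ((SpecModel.realize_iff (hS := hS) hW _).2
            (W.mem_of_le (hc' l' h) (Order.PFilter.finset_iInf_mem fun a ha => ?_)))
          obtain ⟨h1, h2⟩ := Finset.mem_filter.1 ha
          exact W.mem_of_le inf_le_right (hεW a h1 h2)
      obtain ⟨z, hzP, hzE, hzA, hzR⟩ := hfin.exists_P
        (l.image fun a => SpecModel.mk S hS W (b a)) (l'.image fun a => SpecModel.mk S hS W (b a))
        (SpecModel.mk S hS W m) l'.card (Finset.image_subset_image (Finset.filter_subset _ _))
        Finset.card_image_le hU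
      refine ⟨z, ?_⟩
      rintro (_ | a) hks
      · exact (hφr z).2 ⟨hzP, hzE⟩
      · rw [hφl]
        have ha := Finset.mem_image_of_mem (fun a => SpecModel.mk S hS W (b a)) (hl.2 hks)
        refine ⟨fun h => hzA (h ▸ ha), ?_⟩
        by_cases hPE : Q (SpecModel.mk S hS W (b a)) ∧
            E (SpecModel.mk S hS W m) (SpecModel.mk S hS W (b a))
        · rw [hzR _ ha hPE.1 hPE.2, Finset.mem_image]
          constructor
          · rintro ⟨a', ha', haa'⟩
            obtain ⟨ha', hε⟩ := Finset.mem_filter.1 ha'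
            have := hd' W hW a' a (hdW _ ha') (hdW _ (hl.2 hks)) haa'
            rw [hb, hb] at this
            exact this.1 hε
          · exact fun hε => ⟨a, Finset.mem_filter.2 ⟨hl.2 hks, hε⟩, rfl⟩
        · refine iff_of_false (fun h => hPE ?_) fun hε => hPE ?_
          · obtain ⟨-, h1, h2⟩ := hbase.R_sub _ _ h
            exact ⟨h1, hbase.E_equiv.trans hzE h2⟩
          · have h2 := (SpecModel.realize_iff (hS := hS) hW _).2
              (W.mem_of_le inf_le_left (hεW a (hl.2 hks) hε))
            rwa [Formula.realize_inf, realize_Q, realize_E] at h2)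
  have hr := (hφr z).1 (hz none)
  have hl := fun a => (hφl a z).1 (hz (some a))
  refine ⟨z, hr.1, hr.2, fun hzA => ?_, fun p hp hpP hpE => ?_⟩
  · exact (hl ⟨z, hzA⟩).1 (hb ⟨z, hzA⟩).symm
  · have := (hl ⟨p, hp⟩).2
    rw [hb] at this
    rw [this]
    exact ⟨fun h => h.1, fun h => ⟨h, hpP, hpE⟩⟩

/-- The formula saying that `s` and `t` have the same values outside of `0`. -/
noncomputable def sameRangeFormula {X : Type*} {n : ℕ+} (s t : Fin n → X) :
    nlowLanguage.Formula X :=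
  (Formula.iInf fun i : {i : Fin n // i ≠ ⟨0, n.pos⟩} =>
    Formula.iSup fun j : {j : Fin n // j ≠ ⟨0, n.pos⟩} => eqFormula (s i) (t j)) ⊓
  Formula.iInf fun i : {i : Fin n // i ≠ ⟨0, n.pos⟩} =>
    Formula.iSup fun j : {j : Fin n // j ≠ ⟨0, n.pos⟩} => eqFormula (t i) (s j)

omit hF hκ hT hsat hsep in
theorem realize_sameRangeFormula {X N : Type*} [nlowLanguage.Structure N] {v : X → N} {n : ℕ+}
    {s t : Fin n → X} : (sameRangeFormula s t).Realize v ↔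
      (fun i => v (s i)) '' {i | i ≠ ⟨0, n.pos⟩} = (fun i => v (t i)) '' {i | i ≠ ⟨0, n.pos⟩} := by
  simp only [sameRangeFormula, Formula.realize_inf, Formula.realize_iInf, Formula.realize_iSup,
    realize_eqFormula, Subtype.forall, Subtype.exists, exists_prop]
  rw [Set.Subset.antisymm_iff, Set.image_subset_iff, Set.image_subset_iff]
  refine and_congr ?_ ?_ <;>
  · refine forall₂_congr fun i _ => ?_
    simp only [Set.mem_preimage, Set.mem_image, Set.mem_ofPred_eq, eq_comm]

/-- The formula saying that `s` is injective with values in `Q_n^0`, outside of `0`, and that `a` is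
in `Q_n^1`. -/
noncomputable def goodTupleFormula {X : Type*} {n : ℕ+} (s : Fin n → X) (a : X) :
    nlowLanguage.Formula X :=
  (Formula.iInf fun p : {p : Fin n × Fin n // p.1 ≠ ⟨0, n.pos⟩ ∧ p.2 ≠ ⟨0, n.pos⟩ ∧ p.1 ≠ p.2} =>
    (eqFormula (s p.1.1) (s p.1.2)).not) ⊓
  (Formula.iInf fun i : {i : Fin n // i ≠ ⟨0, n.pos⟩} =>
    relFormula (NlowRel.Qn n false) ![s i]) ⊓ relFormula (NlowRel.Qn n true) ![a]

omit hF hκ hT hsat hsep in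
theorem realize_goodTupleFormula {X N : Type*} [nlowLanguage.Structure N] {v : X → N} {n : ℕ+}
    {s : Fin n → X} {a : X} : (goodTupleFormula s a).Realize v ↔
      Set.InjOn (fun i => v (s i)) {i | i ≠ ⟨0, n.pos⟩} ∧
      (∀ i, i ≠ ⟨0, n.pos⟩ → Qn n false (v (s i))) ∧ Qn n true (v a) := by
  simp only [goodTupleFormula, Formula.realize_inf, Formula.realize_iInf, Formula.realize_not,
    realize_eqFormula, realize_Qn, Subtype.forall, and_assoc, Prod.forall]
  refine and_congr ⟨fun h i hi j hj hij => ?_, fun h i j hij hv => ?_⟩ Iff.rfl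
  · by_contra hne
    exact h i j ⟨hi, hj, hne⟩ hij
  · exact hij.2.2 (h hij.1 hij.2.1 hv)

omit hF hκ hT hsat hsep in
/-- The tuple obtained from a good one by adding a new element. -/
theorem IsNlow.F_update {N : Type*} [nlowLanguage.Structure N] (h : IsNlow N) {n : ℕ+}
    {s : Fin n → N} (hs : Set.InjOn s {i | i ≠ ⟨0, n.pos⟩})
    (hsQ : ∀ i, i ≠ ⟨0, n.pos⟩ → Qn n false (s i)) {y : N} (hy : Qn n false y)
    (hys : ∀ i, i ≠ ⟨0, n.pos⟩ → s i ≠ y) :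
    Pn n (NlowStr.F n (Function.update s ⟨0, n.pos⟩ y)) ∧
      nb n (NlowStr.F n (Function.update s ⟨0, n.pos⟩ y)) = insert y (s '' {i | i ≠ ⟨0, n.pos⟩}) := by
  have hg := h.F_good n (Function.update s ⟨0, n.pos⟩ y) (fun i j hij => ?_) fun i => ?_
  · refine ⟨hg.1, ?_⟩
    rw [hg.2]
    ext z
    constructor
    · rintro ⟨i, rfl⟩
      by_cases hi : i = ⟨0, n.pos⟩
      · subst hi
        exact Or.inl (Function.update_self _ _ _)
      · exact Or.inr ⟨i, hi, (Function.update_of_ne hi _ _).symm⟩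
    · rintro (rfl | ⟨i, hi, rfl⟩)
      · exact ⟨_, Function.update_self _ _ _⟩
      · exact ⟨i, Function.update_of_ne hi _ _⟩
  · by_cases hi : i = ⟨0, n.pos⟩ <;> by_cases hj : j = ⟨0, n.pos⟩
    · rw [hi, hj]
    · subst hi
      rw [Function.update_self, Function.update_of_ne hj] at hij
      exact absurd hij.symm (hys j hj)
    · subst hj
      rw [Function.update_self, Function.update_of_ne hi] at hij
      exact absurd hij (hys i hi)
    · rw [Function.update_of_ne hi, Function.update_of_ne hj] at hij
      exact hs hi hj hij
  · by_cases hi : i = ⟨0, n.pos⟩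
    · subst hi
      rwa [Function.update_self]
    · rw [Function.update_of_ne hi]
      exact hsQ i hi

omit hF hκ hT hsat hsep in
/-- Every element of `P_n` is generated by a tuple starting with a given neighbour. -/
theorem IsNlow.exists_update {N : Type*} [nlowLanguage.Structure N] (h : IsNlow N) {n : ℕ+}
    {a y : N} (ha : Pn n a) (hy : y ∈ nb n a) (m : N) : ∃ s : Fin n → N, s ⟨0, n.pos⟩ = m ∧
      (∀ i, i ≠ ⟨0, n.pos⟩ → s i ∈ nb n a \ {y}) ∧ Set.InjOn s {i | i ≠ ⟨0, n.pos⟩} ∧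
      NlowStr.F n (Function.update s ⟨0, n.pos⟩ y) = a := by
  obtain ⟨b, hb, hbQ, rfl⟩ := h.gen n a ha
  have hnb := (h.F_good n b hb hbQ).2
  rw [hnb] at hy ⊢
  obtain ⟨i₀, rfl⟩ := hy
  let σ := Equiv.swap (⟨0, n.pos⟩ : Fin n) i₀
  have hσ : σ ⟨0, n.pos⟩ = i₀ := Equiv.swap_apply_left _ _
  have hu : Function.update (Function.update (b ∘ σ) ⟨0, n.pos⟩ m) ⟨0, n.pos⟩ (b i₀) = b ∘ σ := by
    rw [Function.update_idem, ← hσ]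
    exact Function.update_eq_self _ _
  have hbσ : Function.Injective (b ∘ σ) := hb.comp σ.injective
  refine ⟨Function.update (b ∘ σ) ⟨0, n.pos⟩ m, Function.update_self _ _ _, fun i hi => ?_,
    fun i hi j hj hij => ?_, ?_⟩
  · rw [Function.update_of_ne hi]
    refine ⟨⟨_, rfl⟩, fun h => hi (σ.injective ?_)⟩
    rw [hσ]
    exact hb h
  · rw [Function.update_of_ne hi, Function.update_of_ne hj] at hij
    exact hbσ hij
  · rw [hu]
    have hg := h.F_good n (b ∘ σ) hbσ fun i => hbQ _
    refine h.nb_inj n _ _ hg.1 ha ?_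
    rw [hg.2, hnb, σ.surjective.range_comp]

/-- The demands concern pairs of a neighbourhood, without the new point, and an element of `Q_n^1`.
Neighbourhoods are coded by tuples whose position `0` is reserved for the new point, and the
colouring to be separated lives on such pairs modulo having the same range. -/
theorem exists_Q0_specModel (n : ℕ+) (A : Set (SpecModel S hS F))
    (ε : Set (SpecModel S hS F) → SpecModel S hS F → Prop) (hA : #A ≤ κ) :
    ∃ y, Qn n false y ∧ y ∉ A ∧ ∀ a, Pn n a → y ∈ nb n a → nb n a ⊆ insert y A →
      ∀ m ∈ A, Qn n true m → (R a m ↔ ε (nb n a \ {y}) m) := by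
  classical
  have hmod := fun W (hW : IsUltrafilterOn W) => SpecModel.model_of_isModelOf (hS := hS) hW hT
  choose b hb using fun a : A => SpecModel.mk_surjective (a : SpecModel S hS F)
  let o : Fin n := ⟨0, n.pos⟩
  let γ : (Fin n → A) × A → nlowLanguage.Formula M := fun p =>
    goodTupleFormula (fun i => b (p.1 i)) (b p.2)
  -- Only tuples which are good at `F` carry demands; the value of their goodness is part of the
  -- bound, so they remain good at every `W` where they are active.
  let I := {p : (Fin n → A) × A // (γ p).Realize (SpecModel.mk S hS F)}
  let ε' : I → Prop := fun p => ε ((fun i => (p.1.1 i : SpecModel S hS F)) '' {i | i ≠ o}) p.1.2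
  have hI : #I ≤ κ := by
    refine (mk_subtype_le _).trans ?_
    rw [mk_prod, lift_id, lift_id]
    refine mul_le_of_le hκ ?_ hA
    rw [mk_arrow, lift_uzero, mk_fin, lift_natCast, power_natCast]
    exact (pow_le_pow_left₀ zero_le hA _).trans (power_nat_le hκ)
  obtain ⟨d, hd, hd'⟩ := hsep.exists_coherent hF S hS hI
    (fun p q => sameRangeFormula (fun i => b (p.1.1 i)) (fun i => b (q.1.1 i)) ⊓
      eqFormula (b p.1.2) (b q.1.2)) ε' (fun N _ _ v => by
      simp only [Formula.realize_inf, realize_sameRangeFormula, realize_eqFormula]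
      exact ⟨fun p => ⟨rfl, rfl⟩, fun h => ⟨h.1.symm, h.2.symm⟩,
        fun h h' => ⟨h.1.trans h'.1, h.2.trans h'.2⟩⟩) (fun p q hpq hp => by
      rw [Formula.realize_inf, realize_sameRangeFormula, realize_eqFormula] at hpq
      simp only [hb] at hpq
      change ε _ _
      rw [← hpq.1, ← hpq.2]
      exact hp)
  let y : M ⊕ PUnit.{u + 1} := Sum.inr PUnit.unit
  let φ : Option A ⊕ I → nlowLanguage.Formula (M ⊕ PUnit.{u + 1}) := Sum.elim
    (fun x => match x with
      | some a => (eqFormula y (Sum.inl (b a))).not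
      | none => relFormula (NlowRel.Qn n false) ![y])
    fun p => (relFunFormula n (Function.update (fun i => Sum.inl (b (p.1.1 i))) o y)
      (Sum.inl (b p.1.2))).signed (ε' p)
  have hφA : ∀ {W : Order.PFilter B} (a : A) (z : SpecModel S hS W),
      (φ (Sum.inl (some a))).Realize (Sum.elim (SpecModel.mk S hS W) fun _ => z) ↔
      z ≠ SpecModel.mk S hS W (b a) := by
    intro W a z
    simp only [φ, Sum.elim_inl, Formula.realize_not, realize_eqFormula, y, Sum.elim_inr, ne_eq]
  have hφ0 : ∀ {W : Order.PFilter B} (z : SpecModel S hS W),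
      (φ (Sum.inl none)).Realize (Sum.elim (SpecModel.mk S hS W) fun _ => z) ↔ Qn n false z := by
    intro W z
    simp only [φ, Sum.elim_inl, realize_Qn, y, Sum.elim_inr]
  have hφI : ∀ {W : Order.PFilter B} (p : I) (z : SpecModel S hS W),
      (φ (Sum.inr p)).Realize (Sum.elim (SpecModel.mk S hS W) fun _ => z) ↔
      (R (NlowStr.F n (Function.update (fun i => SpecModel.mk S hS W (b (p.1.1 i))) o z))
        (SpecModel.mk S hS W (b p.1.2)) ↔ ε' p) := by
    intro W p z
    simp only [φ, Sum.elim_inr, Formula.realize_signed, realize_relFunFormula, Sum.elim_inl]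
    have : (fun i => Sum.elim (SpecModel.mk S hS W) (fun _ => z)
        (Function.update (fun i => Sum.inl (b (p.1.1 i))) o y i)) =
        Function.update (fun i => SpecModel.mk S hS W (b (p.1.1 i))) o z := by
      funext i
      by_cases hi : i = o
      · subst hi
        simp [y]
      · simp [Function.update_of_ne hi]
    rw [this]
  obtain ⟨z, hz⟩ := S.exists_realize_specModel hF hS card_nlowLanguage_le hκ hsat
    (K := Option A ⊕ I) (by
      rw [mk_sum, lift_id, lift_id, mk_option]
      exact add_le_of_le hκ (add_le_of_le hκ hA (one_le_aleph0.trans hκ)) hI) φ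
    (Sum.elim (fun _ => ⊤) fun p => d p ⊓ S.val (γ p)) (by
      rintro (_ | p)
      · exact F.top_mem
      · exact Order.PFilter.inf_mem (hd p) ((SpecModel.realize_iff (hS := hS) hF _).1 p.2)) (by
      intro W hW s hs
      have hfin := isFinRich_of_model (hmod W hW)
      have hbase := isNlow_of_model (hmod W hW)
      let f : A → SpecModel S hS W := fun a => SpecModel.mk S hS W (b a)
      have hγ : ∀ p, Sum.inr p ∈ s → Set.InjOn (fun i => f (p.1.1 i)) {i | i ≠ o} ∧
          (∀ i, i ≠ o → Qn n false (f (p.1.1 i))) ∧ Qn n true (f p.1.2) := fun p hp =>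
        (realize_goodTupleFormula (v := SpecModel.mk S hS W)).1 ((SpecModel.realize_iff (hS := hS) hW _).2
          (W.mem_of_le inf_le_right (hs _ hp)))
      let l : Finset A := s.toLeft.eraseNone ∪ s.toRight.biUnion fun p =>
        insert p.1.2 (Finset.univ.image p.1.1)
      have hl : ∀ p, Sum.inr p ∈ s → p.1.2 ∈ l ∧ ∀ i, p.1.1 i ∈ l := fun p hp =>
        ⟨Finset.mem_union_right _ (Finset.mem_biUnion.2 ⟨p, Finset.mem_toRight.2 hp, by simp⟩),
          fun i => Finset.mem_union_right _ (Finset.mem_biUnion.2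
            ⟨p, Finset.mem_toRight.2 hp, by simp⟩)⟩
      obtain ⟨z, hzQ, hzA, hzR⟩ := hfin.exists_Q0 n (l.image f)
        fun T x => ∃ p : I, Sum.inr p ∈ s ∧ T = (fun i => f (p.1.1 i)) '' {i | i ≠ o} ∧
          x = f p.1.2 ∧ ε' p
      have hzf : ∀ a ∈ l, f a ≠ z := fun a ha h => hzA (h ▸ Finset.mem_image_of_mem f ha)
      refine ⟨z, ?_⟩
      rintro ((_ | a) | p) hks
      · exact (hφ0 z).2 hzQ
      · refine (hφA a z).2 (hzf a (Finset.mem_union_left _ ?_)).symm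
        exact Finset.mem_eraseNone.2 (Finset.mem_toLeft.2 hks)
      · rw [hφI]
        obtain ⟨h1, h2, h3⟩ := hγ p hks
        have hpl := hl p hks
        obtain ⟨h4, h5⟩ := hbase.F_update h1 h2 hzQ fun i _ => hzf _ (hpl.2 i)
        have hnz : z ∉ (fun i => f (p.1.1 i)) '' {i | i ≠ o} := by
          rintro ⟨i, -, hi⟩
          exact hzf _ (hpl.2 i) hi
        have := hzR _ h4 (by rw [h5]; exact Or.inl rfl) (by
          rw [h5]
          refine Set.insert_subset_insert ?_
          rintro _ ⟨i, -, rfl⟩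
          exact Finset.mem_coe.2 (Finset.mem_image_of_mem f (hpl.2 i)))
          (f p.1.2) (Finset.mem_image_of_mem f hpl.1) h3
        rw [h5, Set.insert_sdiff_self_of_notMem hnz] at this
        refine this.trans ⟨?_, fun h => ⟨p, hks, rfl, rfl, h⟩⟩
        rintro ⟨q, hq, hset, hx, hε⟩
        refine (hd' W hW q p (W.mem_of_le inf_le_left (hs _ hq))
          (W.mem_of_le inf_le_left (hs _ hks)) ?_).1 hε
        rw [Formula.realize_inf, realize_sameRangeFormula, realize_eqFormula]
        exact ⟨hset.symm, hx.symm⟩)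
  have hz0 := (hφ0 z).1 (hz (Sum.inl none))
  have hbase := isNlow_of_model (hmod F hF)
  have hzA : z ∉ A := fun hzA =>
    (hφA ⟨z, hzA⟩ z).1 (hz (Sum.inl (some ⟨z, hzA⟩))) (hb ⟨z, hzA⟩).symm
  refine ⟨z, hz0, hzA, fun a ha hza hsub m hm hmQ => ?_⟩
  -- The reserved position is filled by `m`, an arbitrary element of `A`, so that the tuple has
  -- values in `A`.
  obtain ⟨s, hs0, hs, hsi, hsa⟩ := hbase.exists_update ha hza m
  have hsA : ∀ i, s i ∈ A := fun i => by
    by_cases hi : i = o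
    · rw [hi, hs0]
      exact hm
    · exact (hsub (hs i hi).1).resolve_left (hs i hi).2
  let p : I := ⟨(fun i => ⟨s i, hsA i⟩, ⟨m, hm⟩), by
    rw [realize_goodTupleFormula]
    simp only [hb]
    exact ⟨hsi, fun i hi => (hs i hi).1.1, hmQ⟩⟩
  have hp := (hφI p z).1 (hz (Sum.inr p))
  simp only [hb, p] at hp
  rw [hsa] at hp
  rw [hp]
  have hset : s '' {i | i ≠ o} = nb n a \ {z} := by
    have := (hbase.F_update hsi (fun i hi => (hs i hi).1.1) hz0 fun i hi => (hs i hi).2).2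
    rw [hsa] at this
    rw [this, Set.insert_sdiff_self_of_notMem]
    rintro ⟨i, hi, hiz⟩
    exact (hs i hi).2 hiz
  rw [← hset]

/-- Specializations of saturated Boolean-valued models of `T_nlow` are rich. -/
theorem isRich_specModel (hOK : OKFor F κ.out) : IsRich (SpecModel S hS F) (Order.succ κ) where
  exists_Q A ε m₀ hA := exists_Q_specModel S hS hF hκ hT hsat hsep A ε m₀ (Order.lt_succ_iff.1 hA)
  exists_P A ε m₀ hA hm₀ :=
    exists_P_specModel S hS hF hκ hT hsat hsep hOK A ε m₀ (Order.lt_succ_iff.1 hA) hm₀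
  exists_class A hA := exists_class_specModel S hS hF hκ hT hsat A (Order.lt_succ_iff.1 hA)
  exists_Q0 n A ε hA := exists_Q0_specModel S hS hF hκ hT hsat hsep n A ε (Order.lt_succ_iff.1 hA)

omit hT hsat in
theorem succSaturates_nlowTheory (hOK : OKFor F κ.out) : SuccSaturates F κ nlowTheory := by
  have hnt := hF.nontrivial
  obtain ⟨N, i1, i2, hN⟩ := exists_model_nlowTheory.{u}
  obtain ⟨M, S, hS, hsat, hT, -⟩ := exists_specModel_extension (L := nlowLanguage) hF hκ N ∅ (by
    intro s hs
    obtain rfl : s = ∅ := by simpa using hs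
    exact ⟨Classical.arbitrary N, by simp⟩)
  refine ⟨M, S, hS, hT _ hN, hsat, ?_⟩
  refine isCardSaturated_of_backForth hF S hS hκ fun M' S' hS' hsat' hT' j hj A hA x => ?_
  have hμ : ℵ₀ ≤ Order.succ κ := hκ.trans (Order.le_succ κ)
  have hmod := SpecModel.model_of_isModelOf (hS := hS) hF (hT _ hN)
  have h₂ := isNlow_of_model hmod
  have h₁ := isNlow_of_model (SpecModel.model_of_isModelOf (hS := hS') hF (hT' _ hmod))
  have hr₂ := isRich_specModel S hS hF hκ (hT _ hN) hsat hsep hOK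
  have hr₁ := isRich_specModel S' hS' hF hκ (hT' _ hmod) hsat' hsep hOK
  obtain ⟨f, hf⟩ := exists_embedding j hj
  obtain ⟨D, hAD, hD, hDc⟩ := h₂.exists_isClosedSet hμ A (Order.lt_succ_iff.2 hA)
  have hG := isGood_diagonal f h₁ h₂ hD hDc
  obtain ⟨G, hG', hGG', y, hy⟩ := hG.exists_extend h₁ h₂ hμ hr₂ x
  refine ⟨y, fun θ => ?_⟩
  have := hG'.realize_iff h₁ h₂ hμ hr₁ hr₂ θ
    (Sum.elim (fun a : A => (j a, (a : SpecModel S hS F))) fun _ => (x, y)) (by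
      rintro (a | _)
      · exact hGG' ⟨a, hAD a.2, Prod.ext (hf a) rfl⟩
      · exact hy)
  convert this using 2
  · funext y; rcases y with y | y <;> rfl
  · funext y; rcases y with y | y <;> rfl

end Rich

end NlowStr


/-! ### Saturation of `T_nlow` -/

namespace NlowStr

open Cardinal

section Models

variable {N : Type u} [nlowLanguage.Structure N] [Nonempty N]

theorem infinite_of_exists_notMem {α : Type*} {s : Set α}
    (h : ∀ A : Finset α, ∃ y ∈ s, y ∉ A) : s.Infinite := fun hs => by
  obtain ⟨y, hy, hy'⟩ := h hs.toFinset
  exact hy' (hs.mem_toFinset.2 hy)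

theorem infinite_Q0 (hN : N ⊨ nlowTheory) (n : ℕ+) : {x : N | Qn n false x}.Infinite :=
  infinite_of_exists_notMem fun A => by
    obtain ⟨y, hy, hyA, -⟩ := (isFinRich_of_model hN).exists_Q0 n A fun _ _ => True
    exact ⟨y, hy, hyA⟩

theorem infinite_Q_class (hN : N ⊨ nlowTheory) (m₀ : N) (k : ℕ+) :
    {x : N | Q x ∧ E m₀ x ∧ ∀ n ≤ k, ¬ Qn n false x}.Infinite :=
  infinite_of_exists_notMem fun A => by
    obtain ⟨y, hy, hyE, hyQ, hyA, -⟩ := (isFinRich_of_model hN).exists_Q A (fun _ => True) m₀ k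
    exact ⟨y, ⟨hy, hyE, hyQ⟩, hyA⟩

theorem infinite_Q1 (hN : N ⊨ nlowTheory) (n : ℕ+) : {x : N | Qn n true x}.Infinite := by
  have hb := isNlow_of_model hN
  obtain ⟨m₀, hm₀⟩ := hb.U_nonempty n
  refine (infinite_Q_class hN m₀ n).mono ?_
  rintro x ⟨hxQ, hxE, hx⟩
  exact (hb.Q1_iff n x).2 ⟨(hb.U_iff n _ _ hm₀).2 hxE, hxQ, hx n le_rfl⟩

/-- At level `1` points of `P_1` correspond to points of `Q_1^0`, and their relation to `Q_1^1` is
arbitrary: a random bipartite graph in which colourings can be encoded. -/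
theorem exists_R_iff_mem (hN : N ⊨ nlowTheory) {A : Finset N} (X : Set N)
    (hA : ∀ x ∈ A, Qn 1 true x) : ∃ z, ∀ x ∈ A, R z x ↔ x ∈ X := by
  have hb := isNlow_of_model hN
  obtain ⟨y, hy, hyA, hyR⟩ := (isFinRich_of_model hN).exists_Q0 1 A fun _ x => x ∈ X
  obtain ⟨h1, h2⟩ := hb.F_good 1 (fun _ => y) (fun i j _ => Subsingleton.elim (α := Fin 1) i j)
    fun _ => hy
  have h3 : nb 1 (F 1 fun _ => y) = {y} := by
    rw [h2]
    have : Nonempty (Fin (1 : ℕ+)) := ⟨⟨0, one_pos⟩⟩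
    exact Set.range_const
  refine ⟨_, fun x hx => hyR _ h1 (by rw [h3]; rfl) (by rw [h3]; simp) x hx (hA x hx)⟩

/-- Outside all `U_n` the number of neighbours is not bounded. -/
theorem exists_forall_R (hN : N ⊨ nlowTheory) (A : Finset N) (m₀ : N) (hm₀ : ∀ n, ¬ U n m₀)
    (hA : ∀ q ∈ A, Q q ∧ E m₀ q) : ∃ z, ∀ q ∈ A, R z q := by
  obtain ⟨z, -, -, -, hz⟩ := (isFinRich_of_model hN).exists_P A A m₀ A.card subset_rfl le_rfl
    fun n _ => hm₀ n
  exact ⟨z, fun q hq => (hz q hq (hA q hq).1 (hA q hq).2).2 hq⟩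

end Models

/-! ### Separation of colourings and OK from saturation -/

section Saturation

variable {B : Type u} [CompleteBooleanAlgebra B] {F : Order.PFilter B} {κ : Cardinal.{u}}

theorem separatesColourings_of_succSaturates (hF : IsUltrafilterOn F) (hκ : ℵ₀ ≤ κ)
    (h : SuccSaturates F κ nlowTheory) : SeparatesColourings F κ := by
  classical
  obtain ⟨M, S, hS, hT, hsat, hcard⟩ := h
  have := hF.nontrivial
  have hmod := fun W (hW : IsUltrafilterOn W) => SpecModel.model_of_isModelOf (hS := hS) hW hT
  refine separatesColourings_of_saturated hF S hS card_nlowLanguage_le hκ hsat hcard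
    (relFormula (NlowRel.Qn 1 true) ![()]) (fun W hW => ?_)
    (relFormula NlowRel.R ![Sum.inr (), Sum.inl ()]) fun X Y hX hY hXY => ?_
  · simp only [realize_Qn]
    exact infinite_Q1 (hmod W hW) 1
  · simp only [realize_Qn] at hX hY
    obtain ⟨z, hz⟩ := exists_R_iff_mem (hmod F hF) (A := X ∪ Y) X fun x hx =>
      (Finset.mem_union.1 hx).elim (hX x) (hY x)
    simp only [realize_R, Sum.elim_inl, Sum.elim_inr]
    exact ⟨z, fun x hx => (hz x (Finset.mem_union_left _ hx)).2 hx, fun x hx hR =>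
      Finset.disjoint_left.1 hXY ((hz x (Finset.mem_union_right _ hx)).1 hR) hx⟩

/-- Here `j` is the last index whose value is in `W`; it is positive because `a 1 = ⊤`. -/
theorem exists_level {a : ℕ → B} (h1 : a 1 = ⊤) (ha : Antitone a) {W : Order.PFilter B} {k : ℕ}
    (hk : a k ∉ W) : ∃ j : ℕ+, (j : ℕ) < k ∧ a j ∈ W ∧ a (j + 1) ∉ W := by
  classical
  have hex : ∃ n, a n ∉ W := ⟨k, hk⟩
  have h2 : 2 ≤ Nat.find hex := by
    by_contra hlt
    refine Nat.find_spec hex (W.mem_of_le (ha (show Nat.find hex ≤ 1 by omega)) ?_)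
    rw [h1]
    exact W.top_mem
  refine ⟨⟨Nat.find hex - 1, by omega⟩, ?_, ?_, ?_⟩
  · have := Nat.find_min' hex hk
    simp only [PNat.mk_coe]
    omega
  · exact not_not.1 (Nat.find_min hex (show Nat.find hex - 1 < _ by omega))
  · simp only [PNat.mk_coe]
    rw [show Nat.find hex - 1 + 1 = Nat.find hex by omega]
    exact Nat.find_spec hex

/-- Elements whose levels are determined by a decreasing sequence. -/
theorem exists_levelled (hF : IsUltrafilterOn F) (hκ : ℵ₀ ≤ κ) {M : Type u}
    (S : BVStructure nlowLanguage B M) (hS : S.IsFull) (hT : S.IsModelOf nlowTheory)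
    (hsat : S.IsSuccSaturated κ) {J : Type u} (hJ : #J ≤ κ) {a : ℕ → B} (h1 : a 1 = ⊤)
    (ha : Antitone a) : ∃ b : J → M, ∀ W : Order.PFilter B, IsUltrafilterOn W →
      (∀ i, Q (SpecModel.mk S hS W (b i))) ∧
      (∀ i j, i ≠ j → SpecModel.mk S hS W (b i) ≠ SpecModel.mk S hS W (b j) ∧
        E (SpecModel.mk S hS W (b i)) (SpecModel.mk S hS W (b j))) ∧
      (∀ i (n : ℕ+), a n ∈ W → a (n + 1) ∉ W → Qn n false (SpecModel.mk S hS W (b i))) ∧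
      ∀ i (n : ℕ+), a (n + 1) ∈ W → ¬ U n (SpecModel.mk S hS W (b i)) := by
  classical
  have := hF.nontrivial
  have hmod := fun W (hW : IsUltrafilterOn W) => SpecModel.model_of_isModelOf (hS := hS) hW hT
  -- The set in which the values in the specialization at `W` are chosen.
  have hset : ∀ W : Order.PFilter B, IsUltrafilterOn W → ∀ k : ℕ+, ∃ Z : Set (SpecModel S hS W),
      Z.Infinite ∧ ∀ z ∈ Z, Q z ∧ (∀ z' ∈ Z, E z z') ∧
        (∀ n : ℕ+, a n ∈ W → a (n + 1) ∉ W → Qn n false z) ∧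
        ∀ n : ℕ+, n ≤ k → a (n + 1) ∈ W → ¬ U n z := by
    intro W hW k
    have hb := isNlow_of_model (hmod W hW)
    -- If the sequence leaves `W`, its level `j` is determined and `Q_j^0` serves. If it stays in
    -- `W`, finitely many conditions only exclude levels up to `k`, and a class avoiding them
    -- serves.
    by_cases h : ∃ n, a n ∉ W
    · obtain ⟨n, hn⟩ := h
      obtain ⟨j, -, hj, hj'⟩ := exists_level h1 ha hn
      refine ⟨_, infinite_Q0 (hmod W hW) j, fun z hz => ?_⟩
      have hzU := (hb.Q0_sub j z hz).1
      refine ⟨(hb.Q0_sub j z hz).2, fun z' hz' => hb.E_of_U hzU (hb.Q0_sub j z' hz').1,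
        fun n hn hn' => ?_, fun n _ hn hU => ?_⟩
      · have h2 : ¬ (n : ℕ) + 1 ≤ j := fun h => hn' (W.mem_of_le (ha h) hj)
        have h3 : ¬ (j : ℕ) + 1 ≤ n := fun h => hj' (W.mem_of_le (ha h) hn)
        obtain rfl : n = j := PNat.eq (by omega)
        exact hz
      · obtain rfl := hb.U_inj n j z hU hzU
        exact hj' hn
    · push Not at h
      obtain ⟨m₀, hm₀, -⟩ := (isFinRich_of_model (hmod W hW)).exists_class ∅ k
      refine ⟨_, infinite_Q_class (hmod W hW) m₀ k, fun z hz => ?_⟩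
      exact ⟨hz.1, fun z' hz' => hb.E_equiv.trans (hb.E_equiv.symm hz.2.1) hz'.2.1,
        fun n _ hn => absurd (h _) hn, fun n hn _ hU => hm₀ n hn ((hb.U_of_E hz.2.1 n).2 hU)⟩
  let K := {p : J × J // p.1 ≠ p.2} ⊕ (J × ULift.{u} ℕ+ ⊕ (J × ULift.{u} ℕ+ ⊕ J))
  let φ : K → nlowLanguage.Formula (M ⊕ J) :=
    Sum.elim (fun p => (eqFormula (Sum.inr p.1.1) (Sum.inr p.1.2)).not ⊓
      relFormula NlowRel.E ![Sum.inr p.1.1, Sum.inr p.1.2])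
      (Sum.elim (fun p => relFormula (NlowRel.Qn p.2.down false) ![Sum.inr p.1])
        (Sum.elim (fun p => (relFormula (NlowRel.U p.2.down) ![Sum.inr p.1]).not)
          fun i => relFormula NlowRel.Q ![Sum.inr i]))
  let d : K → B :=
    Sum.elim (fun _ => ⊤) (Sum.elim (fun p => a p.2.down ⊓ (a (p.2.down + 1))ᶜ)
      (Sum.elim (fun p => a (p.2.down + 1)) fun _ => ⊤))
  have hK : #K ≤ κ := by
    have h2 : #(J × ULift.{u} ℕ+) ≤ κ := by
      rw [mk_prod, lift_id, lift_id]
      exact mul_le_of_le hκ hJ ((mk_le_aleph0 (α := ULift.{u} ℕ+)).trans hκ)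
    have h3 : #{p : J × J // p.1 ≠ p.2} ≤ κ := by
      refine (mk_subtype_le _).trans ?_
      rw [mk_prod, lift_id]
      exact mul_le_of_le hκ hJ hJ
    simp only [K, mk_sum, lift_id]
    exact add_le_of_le hκ h3 (add_le_of_le hκ h2 (add_le_of_le hκ h2 hJ))
  obtain ⟨b, hb⟩ := S.exists_realization hS card_nlowLanguage_le hκ hsat hJ hK φ d (by
    intro W hW s hs
    let t : Finset J := s.biUnion (Sum.elim (fun p => {p.1.1, p.1.2}) (Sum.elim (fun p => {p.1})
      (Sum.elim (fun p => {p.1}) fun i => {i})))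
    obtain ⟨k, hk⟩ : ∃ k : ℕ+, ∀ p : J × ULift.{u} ℕ+, Sum.inr (Sum.inr (Sum.inl p)) ∈ s →
        p.2.down ≤ k := by
      obtain ⟨k, hk⟩ := (s.toRight.toRight.toLeft.image fun p => p.2.down).bddAbove
      refine ⟨k, fun p hp => hk (Finset.mem_coe.2 (Finset.mem_image_of_mem
        (fun p : J × ULift.{u} ℕ+ => p.2.down) ?_))⟩
      exact Finset.mem_toLeft.2 (Finset.mem_toRight.2 (Finset.mem_toRight.2 hp))
    obtain ⟨Z, hZ, hZ'⟩ := hset W hW k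
    obtain ⟨f, hf, hfZ⟩ := exists_injOn_of_infinite t hZ
    refine ⟨f, ?_⟩
    rintro (p | p | p | i) hks
    · simp only [φ, Sum.elim_inl, Formula.realize_inf, Formula.realize_not, realize_eqFormula,
        realize_E, Sum.elim_inr]
      refine ⟨fun h => p.2 (hf ?_ ?_ h), (hZ' _ (hfZ _)).2.1 _ (hfZ _)⟩
      · exact Finset.mem_coe.2 (Finset.mem_biUnion.2 ⟨_, hks, by simp⟩)
      · exact Finset.mem_coe.2 (Finset.mem_biUnion.2 ⟨_, hks, by simp⟩)
    · simp only [φ, Sum.elim_inl, realize_Qn, Sum.elim_inr]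
      have := hs _ hks
      exact (hZ' _ (hfZ _)).2.2.1 _ (W.mem_of_le inf_le_left this)
        (hW.compl_mem_iff.1 (W.mem_of_le inf_le_right this))
    · simp only [φ, Sum.elim_inl, Formula.realize_not, realize_U, Sum.elim_inr]
      exact (hZ' _ (hfZ _)).2.2.2 _ (hk p hks) (hs _ hks)
    · simp only [φ, realize_Q, Sum.elim_inr]
      exact (hZ' _ (hfZ _)).1)
  refine ⟨b, fun W hW => ?_⟩
  have key : ∀ k, d k ∈ W → (φ k).Realize (Sum.elim (SpecModel.mk S hS W) fun i =>
      SpecModel.mk S hS W (b i)) := fun k hk => by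
    have h2 := (SpecModel.realize_iff (hS := hS) hW _).2 (W.mem_of_le (hb k) hk)
    rw [Formula.realize_relabel] at h2
    convert h2 using 1
    funext x
    rcases x with x | x <;> rfl
  refine ⟨fun i => ?_, fun i j hij => ?_, fun i n hn hn' => ?_, fun i n hn => ?_⟩
  · have := key (Sum.inr (Sum.inr (Sum.inr i))) W.top_mem
    simpa only [φ, realize_Q, Sum.elim_inr] using this
  · have := key (Sum.inl ⟨(i, j), hij⟩) W.top_mem
    simpa only [φ, Sum.elim_inl, Formula.realize_inf, Formula.realize_not, realize_eqFormula,
        realize_E, Sum.elim_inr] using this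
  · have := key (Sum.inr (Sum.inl (i, ⟨n⟩)))
      (Order.PFilter.inf_mem hn (hW.compl_mem_iff.2 hn'))
    simpa only [φ, Sum.elim_inl, realize_Qn, Sum.elim_inr] using this
  · have := key (Sum.inr (Sum.inr (Sum.inl (i, ⟨n⟩)))) hn
    simpa only [φ, Sum.elim_inl, Formula.realize_not, realize_U, Sum.elim_inr] using this

/-- At `F` the levelled elements `b i` lie in one class outside all `U_n`, so any finitely many have
a common neighbour, and saturation gives a common neighbour `m` of all. At `W` of level `j` the
point `m` has only `j` neighbours in `Q_j^0`; hence `‖R(m, b i)‖` for `i ∈ s` can hold together only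
where `|s| ≤ j`, that is, where the sequence has not yet dropped at `|s|`. -/
theorem okFor_of_succSaturates (hF : IsUltrafilterOn F) (hκ : ℵ₀ ≤ κ)
    (h : SuccSaturates F κ nlowTheory) : OKFor F κ.out := by
  classical
  obtain ⟨M, S, hS, hT, hsat, hcard⟩ := h
  have := hF.nontrivial
  have hmod := fun W (hW : IsUltrafilterOn W) => SpecModel.model_of_isModelOf (hS := hS) hW hT
  intro a₀ ha₀ ha₀F
  -- Levels start at `1`, so the first values are raised to `⊤`; the factor `a₀ 1` of the family
  -- takes care of singletons.
  let a : ℕ → B := fun k => if k ≤ 1 then ⊤ else a₀ k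
  have h1 : a 1 = ⊤ := if_pos le_rfl
  have ha : Antitone a := by
    intro k l hkl
    by_cases hk : k ≤ 1
    · exact le_top.trans_eq (if_pos hk).symm
    · exact (if_neg (show ¬ l ≤ 1 by omega)).trans_le ((ha₀ hkl).trans_eq (if_neg hk).symm)
  have haF : ∀ k, a k ∈ F := by
    intro k
    simp only [a]
    split_ifs
    · exact F.top_mem
    · exact ha₀F k
  have hJ : #κ.out ≤ κ := (mk_out κ).le
  obtain ⟨b, hb⟩ := exists_levelled hF hκ S hS hT hsat hJ h1 ha
  obtain ⟨hQ, hE, -, hU⟩ := hb F hF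
  have hcard' : IsCardSaturated nlowLanguage (SpecModel S hS F) (Order.succ κ) := hcard
  obtain ⟨x, hx⟩ := hcard'.exists_realize hJ (fun i => SpecModel.mk S hS F (b i))
    (fun i : κ.out => relFormula NlowRel.R ![Sum.inr (), Sum.inl i]) (by
      intro s
      rcases s.eq_empty_or_nonempty with rfl | ⟨i₀, hi₀⟩
      · exact ⟨Classical.arbitrary _, by simp⟩
      · obtain ⟨z, hz⟩ := exists_forall_R (hmod F hF)
          (s.image fun i => SpecModel.mk S hS F (b i)) (SpecModel.mk S hS F (b i₀))
          (fun n => hU i₀ n (haF _)) (by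
            simp only [Finset.mem_image]
            rintro _ ⟨i, -, rfl⟩
            refine ⟨hQ i, ?_⟩
            by_cases hi : i₀ = i
            · subst hi
              exact (isNlow_of_model (hmod F hF)).E_equiv.refl _
            · exact (hE _ _ hi).2)
        refine ⟨z, fun i hi => ?_⟩
        rw [realize_R]
        exact hz _ (Finset.mem_image_of_mem (fun i => SpecModel.mk S hS F (b i)) hi))
  obtain ⟨m, rfl⟩ := SpecModel.mk_surjective x
  simp only [realize_R, Sum.elim_inl, Sum.elim_inr] at hx
  refine ⟨fun i => S.val (relFormula NlowRel.R ![m, b i]) ⊓ a₀ 1, fun i => ?_, fun s hs => ?_⟩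
  · exact Order.PFilter.inf_mem ((SpecModel.realize_iff (hS := hS) hF _).1 (realize_R.2 (hx i)))
      (ha₀F 1)
  · by_contra hle
    obtain ⟨W, hW, hcW⟩ := exists_isUltrafilterOn_mem (fun h => hle (disjoint_compl_right_iff.1
      (disjoint_iff.2 h)))
    have hsW := W.mem_of_le inf_le_left hcW
    have hsW' : a₀ s.card ∉ W := hW.compl_mem_iff.1 (W.mem_of_le inf_le_right hcW)
    have hd : ∀ i ∈ s, R (SpecModel.mk S hS W m) (SpecModel.mk S hS W (b i)) ∧ a₀ 1 ∈ W := by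
      intro i hi
      have h2 := Order.PFilter.finset_iInf_mem_iff.1 hsW i hi
      exact ⟨realize_R.1 ((SpecModel.realize_iff (hS := hS) hW _).2 (W.mem_of_le inf_le_left h2)),
        W.mem_of_le inf_le_right h2⟩
    have hcard : 2 ≤ s.card := by
      by_contra hlt
      have h2 : s.card = 1 := le_antisymm (by omega) hs.card_pos
      obtain ⟨i, hi⟩ := hs
      rw [h2] at hsW'
      exact hsW' (hd i hi).2
    have hbase := isNlow_of_model (hmod W hW)
    obtain ⟨-, hE, hQ, -⟩ := hb W hW
    obtain ⟨j, hj, hj1, hj2⟩ := exists_level (W := W) (k := s.card) h1 ha (by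
      rwa [show a s.card = a₀ s.card from if_neg (by omega)])
    have hmem : ∀ i ∈ s, Pn j (SpecModel.mk S hS W m) ∧
        SpecModel.mk S hS W (b i) ∈ nb j (SpecModel.mk S hS W m) := fun i hi =>
      hbase.nb_of_R (hQ i j hj1 hj2) (hd i hi).1
    obtain ⟨i, hi⟩ := hs
    obtain ⟨hfin, hncard⟩ := hbase.finite_nb (hmem i hi).1
    have h3 : (s.image fun i => SpecModel.mk S hS W (b i)).card = s.card := by
      refine Finset.card_image_of_injective _ fun i j hij => ?_
      by_contra hne
      exact (hE i j hne).1 hij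
    -- The distinct elements `b i` with `i ∈ s` all lie in a neighbourhood of size `j < |s|`.
    have h4 := Set.ncard_le_ncard (s := ((s.image fun i => SpecModel.mk S hS W (b i) : Finset _) :
      Set (SpecModel S hS W))) (fun z hz => by
        obtain ⟨i, hi, rfl⟩ := Finset.mem_image.1 (Finset.mem_coe.1 hz)
        exact (hmem i hi).2) hfin
    rw [Set.ncard_coe_finset, h3, hncard] at h4
    omega

end Saturation

end NlowStr

theorem theorem7p13 {B : Type u} [CompleteBooleanAlgebra B] (U : Order.PFilter B)
    (hU : IsUltrafilterOn U) :
    -- the invariant of the finite dividing property and OK ultrafilters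
    patternInvariant U patternFDP = leastCardinal (fun κ : Cardinal.{u} => ¬ IsOK U κ) ∧
    -- the invariant of the finite dividing property and flexible ultrafilters
    (IsAleph1Incomplete U →
      patternInvariant U patternFDP = leastCardinal (fun κ : Cardinal.{u} => ¬ IsFlexible U κ)) ∧
    -- the two descriptions of the distributions witnessing flexibility
    (∀ (κ : Cardinal.{u}) (n : BooleanUltrapower B ℕ) (D : BADistribution B κ.out),
      n.IsNonstandard U → D.IsIn U → D.IsMultiplicative →
      List.TFAE [
        ∀ s, D s ≤ n.geValue s.card,
        IsRegularFamily (fun i => D {i}) ∧ ∀ c : B, c ≠ ⊥ → (∀ s, BADecides c (D s)) →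
          ∀ s : Finset κ.out, (∀ i, i ∈ s ↔ c ≤ D {i}) → c ≤ n.geValue s.card,
        IsRegularFamily (fun i => D {i}) ∧ ∀ c : B, c ≠ ⊥ → (∀ i, BADecides c (D {i})) →
          ∀ s : Finset κ.out, (∀ i, i ∈ s ↔ c ≤ D {i}) → c ≤ n.geValue s.card]) ∧
    -- flexible ultrafilters are regular
    (∀ κ : Cardinal.{u}, IsFlexible U κ → IsRegularFilter U κ) ∧
    -- saturation of the minimal nonlow theory
    (∀ κ : Cardinal.{u}, Cardinal.aleph0 ≤ κ →
      (SuccSaturates U κ nlowTheory ↔ SuccSaturates U κ randomGraphTheory ∧ IsOK U κ)) := by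
  refine ⟨patternInvariant_eq_leastCardinal_not_isOK hU,
    patternInvariant_eq_leastCardinal_not_isFlexible hU,
    fun κ n D _ _ hmult => regular_tfae n D hmult, fun κ h => h.isRegularFilter hU, fun κ hκ => ?_⟩
  -- Saturation of the random graph is replaced by the combinatorial condition, which `T_nlow`
  -- implies and uses together with OK.
  have hrg : SuccSaturates U κ randomGraphTheory ↔ SeparatesColourings U κ :=
    ⟨separatesColourings_of_succSaturates hU hκ, succSaturates_of_separatesColourings hU hκ⟩
  rw [hrg, isOK_iff_okFor hU]
  exact ⟨fun h => ⟨NlowStr.separatesColourings_of_succSaturates hU hκ h,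
    NlowStr.okFor_of_succSaturates hU hκ h⟩,
    fun h => NlowStr.succSaturates_nlowTheory hU hκ h.1 h.2⟩
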